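/- Let $U_s\in C^2([0,\infty);\mathbb R)$ satisfy $U_s(0)=0$, $U_s(Y)>0$ for $Y>0$, $\lim_{Y\to\infty}U_s(Y)=U_E$ for some $U_E>0$, $U_s'(0)>0$, and $\sup_{Y\ge 0}(1+Y)^3|U_s^{(k)}(Y)|<\infty$ for $k=1,2$. Write $\|\cdot\|$ for the norm of $L^2(0,\infty)$ (complex-valued functions) and let $H^2_0(0,\infty)$ be the space of $\phi\in H^2(0,\infty)$ with $\phi(0)=\partial_Y\phi(0)=0$. Then there are positive numbers $\delta_0$, $\varepsilon_0$ and $C$, depending only on $U_s$, such that the following holds. Let $0<\varepsilon\le\varepsilon_0$ and $\alpha>0$ with $\varepsilon^{1/3}\alpha\le\delta_0$. For every $f\in L^2(0,\infty)$ with $(1+Y)^2f\in L^2(0,\infty)$ there is a unique $\phi\in H^4(0,\infty)\cap H^2_0(0,\infty)$ solving the Orr–Sommerfeld equation $$U_s(\partial_Y^2-\alpha^2)\phi-U_s''\phi+i\varepsilon(\partial_Y^2-\alpha^2)^2\phi=f\quad\text{for } Y>0,\qquad \phi|_{Y=0}=\partial_Y\phi|_{Y=0}=0,$$ and it satisfies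 the following estimates. (i) If $\alpha\ge 1$: $$\|\partial_Y\phi\|+\alpha\|\phi\|\le C\|(1+Y)f\|,\qquad \|(\partial_Y^2-\alpha^2)\phi\|\le\frac{C}{\varepsilon^{1/3}}\|(1+Y)f\|.$$ (ii) If $0<\alpha\le 1$, with $N(f)=\|(1+Y)^2f\|+\frac1\alpha\left|\int_0^\infty f\,dY\right|$: $$\|\partial_Y\phi\|+\alpha\|\phi\|\le C\,\frac{\alpha+\varepsilon^{1/6}}{\alpha+\varepsilon^{1/3}}\,N(f),\qquad \|\partial_Y\phi\|_{L^\infty}\le\frac{C}{\varepsilon^{1/6}}\,N(f),\qquad \|(\partial_Y^2-\alpha^2)\phi\|\le\frac{C}{\varepsilon^{1/3}}\,N(f).$$ -/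

import Mathlib

open MeasureTheory Set Filter Topology
open scoped ContDiff ENNReal

namespace OrrSommerfeld

/-- Lebesgue measure on the open half-line `(0, ∞)`. -/
noncomputable abbrev halfLine : Measure ℝ := volume.restrict (Ioi (0 : ℝ))

/-- The complex Hilbert space `L²(0, ∞)`. -/
abbrev L2 : Type := Lp ℂ 2 halfLine

/-- The `L²(0, ∞)` norm `(∫₀^∞ |g|²)^{1/2}` of a function. -/
noncomputable def l2norm (g : ℝ → ℂ) : ℝ := Real.sqrt (∫ Y in Ioi (0 : ℝ), ‖g Y‖ ^ 2)

/-- `v` is the weak derivative of `u` on `(0, ∞)`: integration by parts holds against all test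
functions in `C_c^∞((0, ∞))`. -/
def IsWeakDeriv (u v : L2) : Prop :=
  ∀ η : ℝ → ℝ, ContDiff ℝ ∞ η → HasCompactSupport η → tsupport η ⊆ Ioi (0 : ℝ) →
    ∫ Y in Ioi (0 : ℝ), deriv η Y • u Y = -∫ Y in Ioi (0 : ℝ), η Y • v Y

/-- Weak derivatives are unique. -/
theorem IsWeakDeriv.unique {u v w : L2} (hv : IsWeakDeriv u v) (hw : IsWeakDeriv u w) :
    v = w := by
  have hloc : ∀ z : L2, LocallyIntegrableOn (fun Y => z Y) (Ioi (0 : ℝ)) volume := by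
    intro z
    apply locallyIntegrableOn_of_locallyIntegrable_restrict
    exact (Lp.memLp z).locallyIntegrable (by norm_num)
  have hint : ∀ (z : L2) (η : ℝ → ℝ), ContDiff ℝ ∞ η → HasCompactSupport η →
      Integrable (fun Y => η Y • z Y) halfLine := by
    intro z η h1 h2
    exact ((Lp.memLp z).locallyIntegrable (by norm_num)).integrable_smul_left_of_hasCompactSupport
      h1.continuous h2
  have key := isOpen_Ioi.ae_eq_zero_of_integral_contDiff_smul_eq_zero
    (μ := volume) (f := fun Y => v Y - w Y) ((hloc v).sub (hloc w)) (by
      intro η h1 h2 h3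
      have hset : ∫ Y, η Y • (v Y - w Y) = ∫ Y in Ioi (0 : ℝ), η Y • (v Y - w Y) := by
        refine (setIntegral_eq_integral_of_forall_compl_eq_zero ?_).symm
        intro Y hY
        rw [image_eq_zero_of_notMem_tsupport (fun h => hY (h3 h)), zero_smul]
      rw [hset]
      simp only [smul_sub]
      rw [integral_sub (hint v η h1 h2) (hint w η h1 h2), sub_eq_zero]
      exact neg_injective ((hv η h1 h2 h3).symm.trans (hw η h1 h2 h3)))
  apply Lp.ext
  refine (ae_restrict_iff' measurableSet_Ioi).2 ?_
  filter_upwards [key] with Y hY hmem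
  exact sub_eq_zero.1 (hY hmem)

open Classical in
/-- The weak derivative in `L²(0, ∞)` (`0` if there is none; it is only used for functions that
have one). -/
noncomputable def weakDeriv (u : L2) : L2 :=
  if h : ∃ v, IsWeakDeriv u v then h.choose else 0

theorem IsWeakDeriv.weakDeriv_eq {u v : L2} (h : IsWeakDeriv u v) : weakDeriv u = v := by
  have hex : ∃ v, IsWeakDeriv u v := ⟨v, h⟩
  rw [weakDeriv, dif_pos hex]
  exact hex.choose_spec.unique h

/-- The Sobolev space `H^k(0, ∞)`: weak derivatives up to order `k` exist in `L²(0, ∞)`. -/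
def MemSobolev : ℕ → L2 → Prop
  | 0, _ => True
  | k + 1, u => ∃ v : L2, IsWeakDeriv u v ∧ MemSobolev k v

/-- The boundary trace of `u` at `0` vanishes: `u` has a representative that is continuous on
`[0, ∞)` and takes the value `0` at `0`. -/
def HasZeroTrace (u : L2) : Prop :=
  ∃ w : ℝ → ℂ, ContinuousOn w (Ici (0 : ℝ)) ∧ (⇑u =ᵐ[halfLine] w) ∧ w 0 = 0

/-- `H²₀(0, ∞)`: functions in `H²(0, ∞)` with zero Dirichlet and Neumann trace at `0`. -/
def MemH20 (u : L2) : Prop :=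
  MemSobolev 2 u ∧ HasZeroTrace u ∧ HasZeroTrace (weakDeriv u)

/-- The operator `∂_Y² - α²`. -/
noncomputable def helmholtz (α : ℝ) (u : L2) : L2 :=
  weakDeriv (weakDeriv u) - (α ^ 2 : ℝ) • u

/-- The standing assumptions on the shear profile `U`. All derivatives are derivatives on the
closed half-line `[0, ∞)`, one-sided at `0`; the values of `U` on `(-∞, 0)` are irrelevant. -/
structure IsShearProfile (U : ℝ → ℝ) : Prop where
  contDiffOn : ContDiffOn ℝ 2 U (Ici (0 : ℝ))
  zero : U 0 = 0
  pos : ∀ Y : ℝ, 0 < Y → 0 < U Y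
  lim : ∃ UE : ℝ, 0 < UE ∧ Tendsto U atTop (𝓝 UE)
  deriv_pos : 0 < iteratedDerivWithin 1 U (Ici (0 : ℝ)) 0
  decay : ∀ k : ℕ, k = 1 ∨ k = 2 →
    ∃ M : ℝ, ∀ Y : ℝ, 0 ≤ Y → (1 + Y) ^ 3 * |iteratedDerivWithin k U (Ici (0 : ℝ)) Y| ≤ M

/-- `φ ∈ H⁴ ∩ H²₀` solves the Orr–Sommerfeld equation
`U (∂² - α²) φ - U'' φ + i ε (∂² - α²)² φ = f` on `(0, ∞)` with `φ = ∂φ = 0` at `Y = 0`. -/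
def IsOSSolution (U : ℝ → ℝ) (ε α : ℝ) (f : ℝ → ℂ) (φ : L2) : Prop :=
  MemSobolev 4 φ ∧ MemH20 φ ∧
    ∀ᵐ Y ∂halfLine,
      (U Y : ℂ) * helmholtz α φ Y
        - ((iteratedDerivWithin 2 U (Ici (0 : ℝ)) Y : ℝ) : ℂ) * φ Y
        + Complex.I * (ε : ℂ) * helmholtz α (helmholtz α φ) Y = f Y

end OrrSommerfeld

open OrrSommerfeld

/-! ### Integration by parts and Cauchy–Schwarz on the half-line -/

namespace OrrSommerfeld

/-! Write ε = k³ with k = σ² the width of the viscous sublayer, p = φ, q = φ', w = (∂² - α²)φ, ψ =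
φ/U (`psi`) and g = Uψ' (`gee`). The inviscid operator has divergence form, Uw - U''φ = (Ug)' -
α²Uφ, so pairing with ψ yields ‖g‖² + α²‖φ‖² up to sign. This is the inviscid coercivity on which
everything rests; no monotonicity or concavity of U is needed.

The difficulty is the viscous term, which becomes ε⟨iw, ψ''⟩ and contains g/U², too singular at the
wall. Below a scale L = J²k, with J a large constant, ψ is therefore exchanged for a regular
quantity: the test function is (1 - b')ψ + (b'q - bw)/U'(0) with b = L²y/(L² + y²). It is arranged
so that its derivative involves the vorticity only through bw', which disappears because ⟨iw', w'⟩ =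
0 as a real pairing; and it produces the additional good term ∫ bU|w|². This is `energy_identity`,
with coercivity in `energyDensity_lower`. The errors are small relative to ‖g‖², α²‖φ‖², k²‖w‖² and
k|ψ(k)|². The last two are recovered from the first two, from ∫ bU|w|² and from ‖f‖² by
`vorticity_bound`: testing with iφ times a cutoff sees the vorticity inside the layer, testing with
ρ(1 - i)w, ρ vanishing at the wall, sees it outside, and no-slip bounds ψ(k) by the vorticity in the
layer. Absorption gives `energy_bound`: all energies are bounded by |∫⟨f, ψ⟩| + ‖f‖².

It remains to bound the pairing of f with ψ. For α ≥ 1, ‖ψ‖ is bounded by the energies. For α ≤ 1, ψ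
is split into the constant ψ(1), which sees only ∫f and satisfies α|ψ(1)| ≲ √energy, and ψ - ψ(1),
which is controlled by g with the weight (1 + y)⁻². This explains N(f). The velocity is q = g + U'ψ,
whose L² norm needs |ψ(1)| itself. The layer gives |ψ(1)| ≲ √energy/σ. Testing with e^{-αy}, which
is annihilated by ∂² - α², gives α|ψ(1)| ≲ (α + σ)(√energy + N) in `Sol.mul_norm_psi_one_le`.
Together they yield the factor (α + σ)/(α + σ²). The sup bound is Agmon's inequality for g outside
the layer and integration of w inside.

Uniqueness is the case f = 0. Existence (`Flow.exists_solution`) is a Fredholm argument with unknown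
x = (∂² - α²)²φ. With G the Dirichlet inverse of ∂² - α² and P the projection orthogonal to e^{-αy},
the function φ = GPGx satisfies both boundary conditions, and the equation for x is iε + U_E·PG plus
a compact operator, since U - U_E and U'' are square integrable. The main part is invertible because
PGP is self-adjoint, and injectivity is the uniqueness already proved. -/

theorem inner_complex (z w : ℂ) : inner ℝ z w = z.re * w.re + z.im * w.im := by
  rw [Complex.inner]; simp; ring

/-- If the increments of `f` on `(0, ∞)` are integrals of `h`, with `f` and `h` integrable and `f`
continuous at `0`, then `∫ h = - f 0`. -/
theorem integral_Ioi_eq_neg_of_increments {f h : ℝ → ℝ}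
    (hc : ContinuousWithinAt f (Ioi 0) 0)
    (hinc : ∀ a b : ℝ, 0 < a → a ≤ b → ∫ x in a..b, h x = f b - f a)
    (hf : IntegrableOn f (Ioi 0)) (hh : IntegrableOn h (Ioi 0)) :
    ∫ x in Ioi (0 : ℝ), h x = - f 0 := by
  have key : ∀ a : ℝ, 0 < a → ∫ x in Ioi a, h x = - f a := by
    intro a ha
    have hha : IntegrableOn h (Ioi a) := hh.mono_set (Ioi_subset_Ioi ha.le)
    have h1 := intervalIntegral_tendsto_integral_Ioi a hha tendsto_id
    -- The increments force `f` to converge at infinity, and integrability then forces the limit to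
    -- be zero.
    have h2 : Tendsto f atTop (𝓝 ((∫ x in Ioi a, h x) + f a)) := by
      refine (h1.add_const (f a)).congr' ?_
      filter_upwards [eventually_ge_atTop a] with b hb
      rw [id, hinc a b ha hb]; ring
    have h3 : IntegrableAtFilter f atTop := ⟨Ioi 0, Ioi_mem_atTop _, hf⟩
    have h4 := IntegrableAtFilter.eq_zero_of_tendsto h3 (by
      intro s hs
      rcases mem_atTop_sets.1 hs with ⟨b, hb⟩
      rw [← top_le_iff, ← Real.volume_Ici (a := b)]
      exact measure_mono hb) h2
    linarith
  have h5 : Tendsto (fun a => ∫ x in Ioi a, h x) (𝓝[>] 0) (𝓝 (∫ x in Ioi (0 : ℝ), h x)) := by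
    have h6 : Tendsto (fun a : ℝ => ∫ x in (0 : ℝ)..a, h x) (𝓝[>] 0) (𝓝 0) := by
      have h7 : ContinuousWithinAt (fun a : ℝ => ∫ x in (0 : ℝ)..a, h x) (Icc 0 1) 0 := by
        refine intervalIntegral.continuousOn_primitive_interval' (a := 0) (b₁ := 0) (b₂ := 1) ?_ ?_ 0 ?_ |>.mono ?_
        · rw [intervalIntegrable_iff_integrableOn_Ioc_of_le zero_le_one]
          exact hh.mono_set Ioc_subset_Ioi_self
        · simp
        · simp
        · rw [uIcc_of_le zero_le_one]
      have h8 := h7.tendsto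
      simp only [intervalIntegral.integral_same] at h8
      refine h8.mono_left ?_
      rw [← nhdsWithin_Ioo_eq_nhdsGT zero_lt_one]
      exact nhdsWithin_mono _ Ioo_subset_Icc_self
    have h9 : Tendsto (fun a : ℝ => (∫ x in Ioi (0 : ℝ), h x) - ∫ x in (0 : ℝ)..a, h x) (𝓝[>] 0)
        (𝓝 ((∫ x in Ioi (0 : ℝ), h x) - 0)) := tendsto_const_nhds.sub h6
    rw [sub_zero] at h9
    refine h9.congr' ?_
    filter_upwards [self_mem_nhdsWithin] with a ha
    have ha' : (0 : ℝ) < a := ha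
    have := intervalIntegral.integral_interval_add_Ioi hh (hh.mono_set (Ioi_subset_Ioi ha'.le))
    linarith
  have h10 : Tendsto (fun a => - f a) (𝓝[>] 0) (𝓝 (- f 0)) := hc.tendsto.neg
  refine tendsto_nhds_unique h5 (h10.congr' ?_)
  filter_upwards [self_mem_nhdsWithin] with a ha
  exact (key a ha).symm

theorem integral_Ioi_deriv_eq_neg {f h : ℝ → ℝ}
    (hc : ContinuousWithinAt f (Ioi 0) 0) (hd : ∀ y, 0 < y → HasDerivAt f (h y) y)
    (hf : IntegrableOn f (Ioi 0)) (hh : IntegrableOn h (Ioi 0)) :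
    ∫ x in Ioi (0 : ℝ), h x = - f 0 := by
  refine integral_Ioi_eq_neg_of_increments hc ?_ hf hh
  intro a b ha hab
  refine intervalIntegral.integral_eq_sub_of_hasDerivAt ?_ ?_
  · intro x hx
    rw [uIcc_of_le hab] at hx
    exact hd x (ha.trans_le hx.1)
  · rw [intervalIntegrable_iff_integrableOn_Ioc_of_le hab]
    exact hh.mono_set (fun x hx => ha.trans hx.1)

theorem integrable_inner_of_memLp {μ : Measure ℝ} {f g : ℝ → ℂ} (hf : MemLp f 2 μ)
    (hg : MemLp g 2 μ) : Integrable (fun y => inner ℝ (f y) (g y)) μ := by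
  have h : Integrable (fun y => ‖f y‖ * ‖g y‖) μ := hf.norm.integrable_mul hg.norm
  refine h.mono (hf.1.inner hg.1) ?_
  filter_upwards with y
  rw [Real.norm_eq_abs, norm_mul, norm_norm, norm_norm]
  exact abs_real_inner_le_norm _ _

theorem integrable_norm_sq_of_memLp {μ : Measure ℝ} {f : ℝ → ℂ} (hf : MemLp f 2 μ) :
    Integrable (fun y => ‖f y‖ ^ 2) μ :=
  hf.norm.integrable_sq

theorem sq_integral_mul_le {μ : Measure ℝ} {f g : ℝ → ℝ} (hf : MemLp f 2 μ) (hg : MemLp g 2 μ) :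
    (∫ y, f y * g y ∂μ) ^ 2 ≤ (∫ y, f y ^ 2 ∂μ) * ∫ y, g y ^ 2 ∂μ := by
  have hfg : Integrable (fun y => f y * g y) μ := hf.integrable_mul hg
  have h : ∀ t : ℝ, 0 ≤ (∫ y, f y ^ 2 ∂μ) * (t * t) + (2 * ∫ y, f y * g y ∂μ) * t
      + ∫ y, g y ^ 2 ∂μ := by
    intro t
    have h1 : ∫ y, (f y * t + g y) ^ 2 ∂μ = (∫ y, f y ^ 2 ∂μ) * (t * t)
        + (2 * ∫ y, f y * g y ∂μ) * t + ∫ y, g y ^ 2 ∂μ := by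
      rw [← integral_mul_const, ← integral_const_mul, ← integral_mul_const, ← integral_add,
        ← integral_add]
      · congr 1; ext y; ring
      · exact (hf.integrable_sq.mul_const _).add ((hfg.const_mul _).mul_const _)
      · exact hg.integrable_sq
      · exact hf.integrable_sq.mul_const _
      · exact (hfg.const_mul _).mul_const _
    rw [← h1]
    exact integral_nonneg fun y => sq_nonneg _
  have := discrim_le_zero h
  rw [discrim] at this
  nlinarith

theorem sq_integral_norm_mul_le {μ : Measure ℝ} {f g : ℝ → ℂ} (hf : MemLp f 2 μ)
    (hg : MemLp g 2 μ) :
    (∫ y, ‖f y‖ * ‖g y‖ ∂μ) ^ 2 ≤ (∫ y, ‖f y‖ ^ 2 ∂μ) * ∫ y, ‖g y‖ ^ 2 ∂μ :=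
  sq_integral_mul_le hf.norm hg.norm

theorem intervalIntegrable_of_memLp_halfLine {h : ℝ → ℂ} (hh : MemLp h 2 halfLine) {a b : ℝ}
    (ha : 0 ≤ a) (hb : 0 ≤ b) : IntervalIntegrable h volume a b := by
  rw [intervalIntegrable_iff]
  have h1 : MemLp h 2 (volume.restrict (uIoc a b)) := by
    refine hh.mono_measure (Measure.restrict_mono ?_ le_rfl)
    intro x hx
    rw [uIoc, mem_Ioc] at hx
    exact lt_of_le_of_lt (le_min ha hb) hx.1
  have : IsFiniteMeasure (volume.restrict (uIoc a b)) :=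
    ⟨by rw [Measure.restrict_apply_univ, uIoc, Real.volume_Ioc]; exact ENNReal.ofReal_lt_top⟩
  exact h1.integrable (by norm_num)

/-- Integration by parts for an absolutely continuous function against a `C¹` function. -/
theorem integral_inner_parts {q h V V' : ℝ → ℂ}
    (hq : ∀ y, 0 ≤ y → q y = q 0 + ∫ t in (0 : ℝ)..y, h t)
    (hV0 : ContinuousWithinAt V (Ioi 0) 0) (hVd : ∀ y, 0 < y → HasDerivAt V (V' y) y)
    (hV'c : ContinuousOn V' (Ioi 0))
    (mq : MemLp q 2 halfLine) (mh : MemLp h 2 halfLine) (mV : MemLp V 2 halfLine)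
    (mV' : MemLp V' 2 halfLine) :
    ∫ y in Ioi (0 : ℝ), inner ℝ (h y) (V y) =
      - inner ℝ (q 0) (V 0) - ∫ y in Ioi (0 : ℝ), inner ℝ (q y) (V' y) := by
  have i1 : IntegrableOn (fun y => inner ℝ (h y) (V y)) (Ioi 0) := integrable_inner_of_memLp mh mV
  have i2 : IntegrableOn (fun y => inner ℝ (q y) (V' y)) (Ioi 0) :=
    integrable_inner_of_memLp mq mV'
  have i3 : IntegrableOn (fun y => inner ℝ (q y) (V y)) (Ioi 0) := integrable_inner_of_memLp mq mV
  have hqc : ContinuousWithinAt q (Ioi 0) 0 := by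
    have h7 : ContinuousWithinAt (fun a : ℝ => ∫ x in (0 : ℝ)..a, h x) (Icc 0 1) 0 := by
      refine intervalIntegral.continuousOn_primitive_interval' (a := 0) (b₁ := 0) (b₂ := 1)
        (intervalIntegrable_of_memLp_halfLine mh le_rfl zero_le_one) (by simp) 0 (by simp) |>.mono ?_
      rw [uIcc_of_le zero_le_one]
    have h8 : ContinuousWithinAt (fun a : ℝ => q 0 + ∫ x in (0 : ℝ)..a, h x) (Ioo 0 1) 0 :=
      (continuousWithinAt_const.add h7).mono Ioo_subset_Icc_self
    have h9 : ContinuousWithinAt (fun a : ℝ => q 0 + ∫ x in (0 : ℝ)..a, h x) (Ioi 0) 0 := by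
      rw [ContinuousWithinAt, ← nhdsWithin_Ioo_eq_nhdsGT zero_lt_one]; exact h8
    exact h9.congr (fun y hy => hq y (le_of_lt hy)) (hq 0 le_rfl)
  have key := integral_Ioi_eq_neg_of_increments
    (f := fun y => inner ℝ (q y) (V y))
    (h := fun y => inner ℝ (h y) (V y) + inner ℝ (q y) (V' y))
    (hqc.inner hV0) ?_ i3 (i1.add i2)
  · rw [integral_add i1 i2] at key
    linarith
  intro a b ha hab
  have hh : IntervalIntegrable h volume a b :=
    intervalIntegrable_of_memLp_halfLine mh ha.le (ha.le.trans hab)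
  have hsub : uIcc a b ⊆ Ioi 0 := by
    rw [uIcc_of_le hab]; intro x hx; exact ha.trans_le hx.1
  have hre : IntervalIntegrable (fun t => (h t).re) volume a b := ⟨hh.1.re, hh.2.re⟩
  have him : IntervalIntegrable (fun t => (h t).im) volume a b := ⟨hh.1.im, hh.2.im⟩
  -- Since `h` is only square integrable, `q` is merely absolutely continuous. The fundamental
  -- theorem is applied to the real function Re q·Re V + Im q·Im V, whose derivative is computed
  -- almost everywhere.
  let q1 : ℝ → ℝ := fun y => (q a).re + ∫ t in a..y, (h t).re
  let q2 : ℝ → ℝ := fun y => (q a).im + ∫ t in a..y, (h t).im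
  have ac0 : ∀ c : ℝ, AbsolutelyContinuousOnInterval (fun _ : ℝ => c) a b := fun c =>
    contDiffOn_const.absolutelyContinuousOnInterval
  have ac1 : AbsolutelyContinuousOnInterval q1 a b :=
    (ac0 _).add (hre.absolutelyContinuousOnInterval_intervalIntegral (by simp))
  have ac2 : AbsolutelyContinuousOnInterval q2 a b :=
    (ac0 _).add (him.absolutelyContinuousOnInterval_intervalIntegral (by simp))
  have hVre : ∀ y, 0 < y → HasDerivAt (fun t => (V t).re) (V' y).re y := fun y hy =>
    Complex.reCLM.hasFDerivAt.comp_hasDerivAt y (hVd y hy)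
  have hVim : ∀ y, 0 < y → HasDerivAt (fun t => (V t).im) (V' y).im y := fun y hy =>
    Complex.imCLM.hasFDerivAt.comp_hasDerivAt y (hVd y hy)
  have cd : ∀ (v v' : ℝ → ℝ), (∀ y, 0 < y → HasDerivAt v (v' y) y) → ContinuousOn v' (Ioi 0) →
      AbsolutelyContinuousOnInterval v a b := by
    intro v v' h1 h2
    apply ContDiffOn.absolutelyContinuousOnInterval
    have : ContDiffOn ℝ 1 v (Ioi 0) := by
      rw [show (1 : WithTop ℕ∞) = 0 + 1 from rfl, contDiffOn_succ_iff_deriv_of_isOpen isOpen_Ioi]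
      refine ⟨fun y hy => (h1 y hy).differentiableAt.differentiableWithinAt, by simp, ?_⟩
      rw [contDiffOn_zero]
      exact h2.congr fun y hy => (h1 y hy).deriv
    exact this.mono hsub
  have ac3 := cd _ _ hVre (Complex.continuous_re.comp_continuousOn hV'c)
  have ac4 := cd _ _ hVim (Complex.continuous_im.comp_continuousOn hV'c)
  have ac := (ac1.mul ac3).add (ac2.mul ac4)
  have hqeq : ∀ y ∈ uIcc a b, (q y).re = q1 y ∧ (q y).im = q2 y := by
    intro y hy
    have hy0 : 0 < y := hsub hy
    have e1 : q y = q a + ∫ t in a..y, h t := by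
      rw [hq y hy0.le, hq a ha.le, add_assoc, intervalIntegral.integral_add_adjacent_intervals
        (intervalIntegrable_of_memLp_halfLine mh le_rfl ha.le)
        (intervalIntegrable_of_memLp_halfLine mh ha.le hy0.le)]
    have hi : IntervalIntegrable h volume a y :=
      intervalIntegrable_of_memLp_halfLine mh ha.le hy0.le
    constructor
    · rw [e1, Complex.add_re]
      congr 1
      exact (Complex.reCLM.intervalIntegral_comp_comm hi).symm
    · rw [e1, Complex.add_im]
      congr 1
      exact (Complex.imCLM.intervalIntegral_comp_comm hi).symm
  have hfin := ac.integral_deriv_eq_sub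
  have e2 : ∀ y ∈ uIcc a b, inner ℝ (q y) (V y) = (q1 * (fun t => (V t).re) + q2 * fun t => (V t).im) y := by
    intro y hy
    rw [inner_complex, (hqeq y hy).1, (hqeq y hy).2]; rfl
  rw [e2 b right_mem_uIcc, e2 a left_mem_uIcc, ← hfin]
  apply intervalIntegral.integral_congr_ae
  filter_upwards [hre.ae_hasDerivAt_integral, him.ae_hasDerivAt_integral] with y h1 h2 hy
  have hy' : y ∈ uIcc a b := uIoc_subset_uIcc hy
  have d1 : HasDerivAt q1 (h y).re y := (h1 hy' a left_mem_uIcc).const_add _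
  have d2 : HasDerivAt q2 (h y).im y := (h2 hy' a left_mem_uIcc).const_add _
  have d := (d1.mul (hVre y (hsub hy'))).add (d2.mul (hVim y (hsub hy')))
  rw [d.deriv, inner_complex, inner_complex, (hqeq y hy').1, (hqeq y hy').2]
  ring

theorem integrableOn_inv_add_pow {L : ℝ} (hL : 0 < L) {n : ℕ} (hn : 1 ≤ n) :
    IntegrableOn (fun y : ℝ => 1 / (L + y) ^ (n + 1)) (Ioi 0) ∧
      ∫ y in Ioi (0 : ℝ), 1 / (L + y) ^ (n + 1) = 1 / (n * L ^ n) := by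
  have hn0 : (n : ℝ) ≠ 0 := by positivity
  have hd : ∀ y ∈ Ioi (0 : ℝ), HasDerivAt (fun y : ℝ => - (1 / (n * (L + y) ^ n)))
      (1 / (L + y) ^ (n + 1)) y := by
    intro y hy
    have hy' : (0 : ℝ) < L + y := by have : 0 < y := hy; linarith
    obtain ⟨m, rfl⟩ : ∃ m, n = m + 1 := ⟨n - 1, by omega⟩
    have h1 : HasDerivAt (fun y : ℝ => ((m + 1 : ℕ) : ℝ) * (L + y) ^ (m + 1))
        (((m + 1 : ℕ) : ℝ) * (((m + 1 : ℕ) : ℝ) * (L + y) ^ m * 1)) y := by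
      have := (((hasDerivAt_id y).const_add L).pow (m + 1)).const_mul ((m + 1 : ℕ) : ℝ)
      simpa using this
    have h2 := ((h1.inv (by positivity)).neg)
    refine (h2.congr_deriv ?_).congr_of_eventuallyEq (Eventually.of_forall fun y => ?_)
    · push_cast; field_simp; ring
    · simp
  have hc : ContinuousWithinAt (fun y : ℝ => - (1 / (n * (L + y) ^ n))) (Ici 0) 0 := by
    apply ContinuousAt.continuousWithinAt
    apply ContinuousAt.neg
    apply ContinuousAt.div continuousAt_const (by fun_prop)
    positivity
  have ht : Tendsto (fun y : ℝ => - (1 / (n * (L + y) ^ n))) atTop (𝓝 0) := by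
    rw [← neg_zero]
    apply Tendsto.neg
    simp only [one_div]
    apply Tendsto.inv_tendsto_atTop
    apply Tendsto.const_mul_atTop (by positivity)
    exact (tendsto_pow_atTop (by omega)).comp (tendsto_atTop_add_const_left _ _ tendsto_id)
  have hnn : ∀ y ∈ Ioi (0 : ℝ), 0 ≤ 1 / (L + y) ^ (n + 1) := by
    intro y hy
    have hy' : (0 : ℝ) < L + y := by have : 0 < y := hy; linarith
    positivity
  refine ⟨integrableOn_Ioi_deriv_of_nonneg hc hd hnn ht, ?_⟩
  rw [integral_Ioi_of_hasDerivAt_of_nonneg hc hd hnn ht]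
  simp

end OrrSommerfeld

/-! ### The quotient ψ = p/U and its regularity up to the wall -/

namespace OrrSommerfeld

/-- A shear flow `U` on `ℝ` with derivatives `U1`, `U2`, wall slope `u`, and all the quantitative
bounds on `[0, ∞)` expressed by a single constant `M`. -/
structure Flow (U U1 U2 : ℝ → ℝ) (u M : ℝ) : Prop where
  d0 : ∀ y, HasDerivAt U (U1 y) y
  d1 : ∀ y, HasDerivAt U1 (U2 y) y
  c2 : Continuous U2
  zero : U 0 = 0
  one_le : 1 ≤ M
  slope : 1 ≤ M * u
  le_mul : ∀ y, 0 ≤ y → U y ≤ M * y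
  le : ∀ y, 0 ≤ y → U y ≤ M
  ge : ∀ y, 0 ≤ y → y ≤ M * (1 + y) * U y
  b1 : ∀ y, 0 ≤ y → |U1 y| * (1 + y) ^ 3 ≤ M
  b2 : ∀ y, 0 ≤ y → |U2 y| * (1 + y) ^ 3 ≤ M
  bu : ∀ y, 0 ≤ y → |U1 y - u| ≤ M * y

/-- A stream function `p` with `p' = q`, `(∂² - α²) p = w`, `w' = w1`, `w'' = w2`, all of them square
integrable on the half-line, and with the no-slip boundary conditions. -/
structure Wave (α : ℝ) (p q w w1 w2 : ℝ → ℂ) : Prop where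
  d0 : ∀ y, HasDerivAt p (q y) y
  d1 : ∀ y, HasDerivAt q (w y + (α ^ 2) • p y) y
  d2 : ∀ y, HasDerivAt w (w1 y) y
  c3 : Continuous w1
  i3 : ∀ y, 0 ≤ y → w1 y = w1 0 + ∫ t in (0 : ℝ)..y, w2 t
  z0 : p 0 = 0
  z1 : q 0 = 0
  m0 : MemLp p 2 halfLine
  m1 : MemLp q 2 halfLine
  m2 : MemLp w 2 halfLine
  m3 : MemLp w1 2 halfLine
  m4 : MemLp w2 2 halfLine

/-- The quotient `p / U`. -/
noncomputable def psi (U : ℝ → ℝ) (p : ℝ → ℂ) (y : ℝ) : ℂ := (U y)⁻¹ • p y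

/-- The function `U (p / U)'`. -/
noncomputable def gee (U U1 : ℝ → ℝ) (p q : ℝ → ℂ) (y : ℝ) : ℂ := q y - U1 y • psi U p y

/-- The derivative of `gee`. -/
noncomputable def dgee (α : ℝ) (U U1 U2 : ℝ → ℝ) (p q w : ℝ → ℂ) (y : ℝ) : ℂ :=
  w y + (α ^ 2) • p y - U2 y • psi U p y - (U1 y * (U y)⁻¹) • gee U U1 p q y

theorem memLp_smul_of_bound {c : ℝ → ℝ} {f : ℝ → ℂ} {B : ℝ} (hc : ContinuousOn c (Ioi 0))
    (hB : ∀ y, 0 < y → |c y| ≤ B) (hf : MemLp f 2 halfLine) :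
    MemLp (fun y => c y • f y) 2 halfLine := by
  refine MemLp.of_le_mul (c := B) hf
    ((hc.aestronglyMeasurable measurableSet_Ioi).smul hf.1) ?_
  refine (ae_restrict_iff' measurableSet_Ioi).2 (Eventually.of_forall fun y hy => ?_)
  rw [norm_smul]
  exact mul_le_mul_of_nonneg_right (hB y hy) (norm_nonneg _)

theorem memLp_inv_one_add : MemLp (fun y : ℝ => 1 / (1 + y)) 2 halfLine := by
  have hm : AEStronglyMeasurable (fun y : ℝ => 1 / (1 + y)) halfLine :=
    (ContinuousOn.div continuousOn_const (by fun_prop) (fun y hy => by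
      have : (0 : ℝ) < y := hy
      positivity)).aestronglyMeasurable measurableSet_Ioi
  rw [memLp_two_iff_integrable_sq hm]
  have := (integrableOn_inv_add_pow (L := 1) one_pos (n := 1) le_rfl).1
  simpa [IntegrableOn] using this

/-- Meant for quotients by U: boundedness near the wall comes from no-slip, while away from the wall
1/U is bounded. Since 2/(1 + y) ≥ 1 on (0, 1], one square-integrable majorant serves both regimes.
-/
theorem memLp_of_bound {f : ℝ → ℂ} {h : ℝ → ℝ} {C : ℝ} (hf : ContinuousOn f (Ioi 0))
    (h0 : ∀ y, 0 < y → y ≤ 1 → ‖f y‖ ≤ C) (h1 : ∀ y, 1 < y → ‖f y‖ ≤ h y)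
    (mh : MemLp h 2 halfLine) : MemLp f 2 halfLine := by
  have hC : 0 ≤ C := (norm_nonneg _).trans (h0 1 one_pos le_rfl)
  have hm : MemLp (fun y => (2 * C) * (1 / (1 + y)) + |h y|) 2 halfLine :=
    (memLp_inv_one_add.const_mul _).add mh.abs
  refine hm.mono (hf.aestronglyMeasurable measurableSet_Ioi) ?_
  refine (ae_restrict_iff' measurableSet_Ioi).2 (Eventually.of_forall fun y hy => ?_)
  have hy' : (0 : ℝ) < y := hy
  have hnn : 0 ≤ (2 * C) * (1 / (1 + y)) := by positivity
  rw [Real.norm_of_nonneg (add_nonneg hnn (abs_nonneg _))]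
  rcases le_or_gt y 1 with hy1 | hy1
  · have h2 : C ≤ (2 * C) * (1 / (1 + y)) := by
      rw [mul_one_div, le_div_iff₀ (by linarith)]; nlinarith
    linarith [h0 y hy' hy1, abs_nonneg (h y)]
  · linarith [h1 y hy1, le_abs_self (h y)]

section basic

variable {U U1 U2 : ℝ → ℝ} {u M α : ℝ} {p q w w1 w2 : ℝ → ℂ}

theorem Flow.M_pos (F : Flow U U1 U2 u M) : 0 < M := one_pos.trans_le F.one_le

theorem Flow.pos (F : Flow U U1 U2 u M) {y : ℝ} (hy : 0 < y) : 0 < U y := by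
  have h := F.ge y hy.le
  have := F.M_pos
  by_contra hc
  have : M * (1 + y) * U y ≤ 0 := mul_nonpos_of_nonneg_of_nonpos (by positivity) (not_lt.1 hc)
  linarith

theorem Flow.inv_le (F : Flow U U1 U2 u M) {y : ℝ} (hy : 0 < y) : (U y)⁻¹ ≤ M * (1 + y) / y := by
  rw [inv_le_iff_one_le_mul₀ (F.pos hy), div_mul_eq_mul_div, le_div_iff₀ hy, one_mul]
  exact F.ge y hy.le

theorem Flow.contU (F : Flow U U1 U2 u M) : Continuous U :=
  continuous_iff_continuousAt.2 fun y => (F.d0 y).continuousAt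

theorem Flow.contU1 (F : Flow U U1 U2 u M) : Continuous U1 :=
  continuous_iff_continuousAt.2 fun y => (F.d1 y).continuousAt

theorem Flow.contInv (F : Flow U U1 U2 u M) : ContinuousOn (fun y => (U y)⁻¹) (Ioi 0) :=
  F.contU.continuousOn.inv₀ fun _ hy => (F.pos hy).ne'

theorem Flow.b1' (F : Flow U U1 U2 u M) {y : ℝ} (hy : 0 ≤ y) : |U1 y| ≤ M := by
  have h := F.b1 y hy
  have h2 : (1 : ℝ) ≤ (1 + y) ^ 3 := one_le_pow₀ (by linarith)
  nlinarith [abs_nonneg (U1 y)]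

theorem Flow.b2' (F : Flow U U1 U2 u M) {y : ℝ} (hy : 0 ≤ y) : |U2 y| ≤ M := by
  have h := F.b2 y hy
  have h2 : (1 : ℝ) ≤ (1 + y) ^ 3 := one_le_pow₀ (by linarith)
  nlinarith [abs_nonneg (U2 y)]

theorem Flow.u_pos (F : Flow U U1 U2 u M) : 0 < u := by
  have := F.slope; have := F.M_pos
  by_contra hc
  have : M * u ≤ 0 := mul_nonpos_of_nonneg_of_nonpos (by positivity) (not_lt.1 hc)
  linarith

theorem Flow.inv_u_le (F : Flow U U1 U2 u M) : u⁻¹ ≤ M := by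
  rw [inv_le_iff_one_le_mul₀ F.u_pos]; exact F.slope

theorem Flow.U1_zero (F : Flow U U1 U2 u M) : U1 0 = u := by
  have := F.bu 0 le_rfl
  rw [mul_zero] at this
  exact sub_eq_zero.1 (abs_nonpos_iff.1 this)

theorem Flow.u_le (F : Flow U U1 U2 u M) : u ≤ M := by
  have := F.b1' le_rfl
  rw [F.U1_zero] at this
  exact (le_abs_self _).trans this

theorem Wave.c0 (W : Wave α p q w w1 w2) : Continuous p :=
  continuous_iff_continuousAt.2 fun y => (W.d0 y).continuousAt

theorem Wave.c1 (W : Wave α p q w w1 w2) : Continuous q :=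
  continuous_iff_continuousAt.2 fun y => (W.d1 y).continuousAt

theorem Wave.c2 (W : Wave α p q w w1 w2) : Continuous w :=
  continuous_iff_continuousAt.2 fun y => (W.d2 y).continuousAt

theorem smul_psi (F : Flow U U1 U2 u M) (p : ℝ → ℂ) {y : ℝ} (hy : 0 < y) :
    U y • psi U p y = p y := by
  rw [psi, smul_smul, mul_inv_cancel₀ (F.pos hy).ne', one_smul]

theorem norm_le_of_hasDerivAt {f f' : ℝ → ℂ} (hf : ∀ y, HasDerivAt f (f' y) y) (h0 : f 0 = 0)
    {C y : ℝ} (hy : 0 ≤ y) (hC : ∀ t, 0 ≤ t → t ≤ y → ‖f' t‖ ≤ C) : ‖f y‖ ≤ C * y := by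
  have := (convex_Icc 0 y).norm_image_sub_le_of_norm_hasDerivWithin_le (f := f) (f' := f') (C := C)
    (fun x _ => (hf x).hasDerivWithinAt) (fun x hx => hC x hx.1 hx.2)
    (left_mem_Icc.2 hy) (right_mem_Icc.2 hy)
  rw [h0, sub_zero, sub_zero, Real.norm_of_nonneg hy] at this
  exact this

/-- The bounded function w + α²p is integrated twice from the no-slip conditions. The resulting p =
O(y²), q = O(y) against U ≳ y make ψ and g of size O(y) and ψ' = g/U bounded, so that dividing by U
stays within L². -/
theorem Wave.near_zero (W : Wave α p q w w1 w2) :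
    ∃ C, 0 ≤ C ∧ ∀ y, 0 ≤ y → y ≤ 1 → ‖p y‖ ≤ C * y ^ 2 ∧ ‖q y‖ ≤ C * y := by
  have hcont : Continuous (fun y => w y + (α ^ 2) • p y) := W.c2.add (W.c0.const_smul (α ^ 2))
  obtain ⟨C, hC⟩ := isCompact_Icc.exists_bound_of_continuousOn (s := Icc (0 : ℝ) 1)
    hcont.continuousOn
  have hC0 : 0 ≤ C := (norm_nonneg _).trans (hC 0 (by simp))
  refine ⟨C, hC0, fun y hy hy1 => ?_⟩
  have h1 : ∀ t, 0 ≤ t → t ≤ 1 → ‖q t‖ ≤ C * t := fun t ht ht1 =>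
    norm_le_of_hasDerivAt W.d1 W.z1 ht (fun s hs hs1 => hC s ⟨hs, hs1.trans ht1⟩)
  refine ⟨?_, h1 y hy hy1⟩
  have := norm_le_of_hasDerivAt (C := C * y) W.d0 W.z0 hy (fun s hs hs1 =>
    (h1 s hs (hs1.trans hy1)).trans (mul_le_mul_of_nonneg_left hs1 hC0))
  nlinarith

theorem hasDerivAt_psi (F : Flow U U1 U2 u M) (W : Wave α p q w w1 w2) {y : ℝ} (hy : 0 < y) :
    HasDerivAt (psi U p) ((U y)⁻¹ • gee U U1 p q y) y := by
  have h := ((F.d0 y).inv (F.pos hy).ne').smul (W.d0 y)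
  refine h.congr_deriv ?_
  rw [gee, psi, smul_sub, smul_smul, smul_smul, sub_eq_add_neg, ← neg_smul]
  have := (F.pos hy).ne'
  congr 2
  field_simp

theorem hasDerivAt_gee (F : Flow U U1 U2 u M) (W : Wave α p q w w1 w2) {y : ℝ} (hy : 0 < y) :
    HasDerivAt (gee U U1 p q) (dgee α U U1 U2 p q w y) y := by
  have h := (W.d1 y).sub ((F.d1 y).smul (hasDerivAt_psi F W hy))
  refine h.congr_deriv ?_
  rw [dgee, smul_smul]
  module

theorem continuousOn_psi (F : Flow U U1 U2 u M) (W : Wave α p q w w1 w2) :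
    ContinuousOn (psi U p) (Ioi 0) := fun _ hy =>
  (hasDerivAt_psi F W hy).continuousAt.continuousWithinAt

theorem continuousOn_gee (F : Flow U U1 U2 u M) (W : Wave α p q w w1 w2) :
    ContinuousOn (gee U U1 p q) (Ioi 0) := fun _ hy =>
  (hasDerivAt_gee F W hy).continuousAt.continuousWithinAt

theorem norm_psi_le (F : Flow U U1 U2 u M) (p : ℝ → ℂ) {y : ℝ} (hy : 0 < y) :
    ‖psi U p y‖ ≤ M * (1 + y) / y * ‖p y‖ := by
  rw [psi, norm_smul, Real.norm_of_nonneg (inv_nonneg.2 (F.pos hy).le)]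
  exact mul_le_mul_of_nonneg_right (F.inv_le hy) (norm_nonneg _)

theorem psi_near_zero (F : Flow U U1 U2 u M) (W : Wave α p q w w1 w2) :
    ∃ C, 0 ≤ C ∧ ∀ y, 0 < y → y ≤ 1 → ‖psi U p y‖ ≤ C * y ∧ ‖gee U U1 p q y‖ ≤ C * y ∧
      ‖(U y)⁻¹ • gee U U1 p q y‖ ≤ C := by
  obtain ⟨C, hC0, hC⟩ := W.near_zero
  have hM := F.one_le
  have hM0 := F.M_pos
  have key : ∀ y, 0 < y → y ≤ 1 → ‖psi U p y‖ ≤ 2 * M * C * y ∧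
      ‖gee U U1 p q y‖ ≤ (C + 2 * M ^ 2 * C) * y := by
    intro y hy hy1
    have h1 : ‖psi U p y‖ ≤ 2 * M * C * y := by
      refine (norm_psi_le F p hy).trans ?_
      calc M * (1 + y) / y * ‖p y‖ ≤ M * (1 + 1) / y * (C * y ^ 2) := by
            gcongr
            exact (hC y hy.le hy1).1
        _ = 2 * M * C * y := by field_simp; ring
    refine ⟨h1, ?_⟩
    rw [gee]
    refine (norm_sub_le _ _).trans ?_
    rw [norm_smul, Real.norm_eq_abs]
    have h2 := (hC y hy.le hy1).2
    have h3 := mul_le_mul (F.b1' hy.le) h1 (norm_nonneg _) hM0.le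
    nlinarith
  refine ⟨2 * M * (C + 2 * M ^ 2 * C) , by positivity, fun y hy hy1 => ?_⟩
  obtain ⟨k1, k2⟩ := key y hy hy1
  refine ⟨k1.trans ?_, k2.trans ?_, ?_⟩
  · have : C ≤ C + 2 * M ^ 2 * C := by have : 0 ≤ 2 * M ^ 2 * C := by positivity
                                       linarith
    gcongr
  · have h5 : 0 ≤ (C + 2 * M ^ 2 * C) * y := by positivity
    nlinarith
  · rw [norm_smul, Real.norm_of_nonneg (inv_nonneg.2 (F.pos hy).le)]
    calc (U y)⁻¹ * ‖gee U U1 p q y‖ ≤ (M * (1 + 1) / y) * ((C + 2 * M ^ 2 * C) * y) := by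
          gcongr
          exact (F.inv_le hy).trans (by gcongr)
      _ = _ := by field_simp; ring

theorem memLp_psi (F : Flow U U1 U2 u M) (W : Wave α p q w w1 w2) : MemLp (psi U p) 2 halfLine := by
  obtain ⟨C, hC0, hC⟩ := psi_near_zero F W
  have hM0 := F.M_pos
  refine memLp_of_bound (h := fun y => (2 * M) * ‖p y‖) (C := C) (continuousOn_psi F W)
    (fun y hy hy1 => (hC y hy hy1).1.trans (by nlinarith)) (fun y hy => ?_)
    (W.m0.norm.const_mul _)
  refine (norm_psi_le F p (by linarith)).trans ?_
  refine mul_le_mul_of_nonneg_right ?_ (norm_nonneg _)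
  rw [div_le_iff₀ (by linarith)]; nlinarith

theorem memLp_gee (F : Flow U U1 U2 u M) (W : Wave α p q w w1 w2) :
    MemLp (gee U U1 p q) 2 halfLine :=
  W.m1.sub (memLp_smul_of_bound F.contU1.continuousOn (fun _ hy => F.b1' (le_of_lt hy))
    (memLp_psi F W))

theorem memLp_dpsi (F : Flow U U1 U2 u M) (W : Wave α p q w w1 w2) :
    MemLp (fun y => (U y)⁻¹ • gee U U1 p q y) 2 halfLine := by
  obtain ⟨C, hC0, hC⟩ := psi_near_zero F W
  have hM0 := F.M_pos
  refine memLp_of_bound (h := fun y => (2 * M) * ‖gee U U1 p q y‖) (C := C)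
    (F.contInv.smul (continuousOn_gee F W))
    (fun y hy hy1 => (hC y hy hy1).2.2) (fun y hy => ?_)
    ((memLp_gee F W).norm.const_mul _)
  have hy0 : 0 < y := by linarith
  rw [norm_smul, Real.norm_of_nonneg (inv_nonneg.2 (F.pos hy0).le)]
  refine mul_le_mul_of_nonneg_right ((F.inv_le hy0).trans ?_) (norm_nonneg _)
  rw [div_le_iff₀ (by linarith)]; nlinarith

theorem memLp_dgee (F : Flow U U1 U2 u M) (W : Wave α p q w w1 w2) :
    MemLp (dgee α U U1 U2 p q w) 2 halfLine := by
  have h := ((W.m2.add (W.m0.const_smul (α ^ 2))).sub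
    (memLp_smul_of_bound F.c2.continuousOn (fun _ hy => F.b2' (le_of_lt hy)) (memLp_psi F W))).sub
    (memLp_smul_of_bound F.contU1.continuousOn (fun _ hy => F.b1' (le_of_lt hy)) (memLp_dpsi F W))
  refine h.ae_eq (Eventually.of_forall fun y => ?_)
  simp only [dgee, Pi.sub_apply, Pi.add_apply, Pi.smul_apply, smul_smul]

theorem tendsto_psi_zero (F : Flow U U1 U2 u M) (W : Wave α p q w w1 w2) :
    ContinuousWithinAt (psi U p) (Ioi 0) 0 := by
  obtain ⟨C, hC0, hC⟩ := psi_near_zero F W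
  -- At the wall `psi` takes the junk value 0⁻¹ • 0 = 0, which is also its limit.
  rw [ContinuousWithinAt, show psi U p 0 = 0 by rw [psi, W.z0, smul_zero],
    ← nhdsWithin_Ioo_eq_nhdsGT zero_lt_one]
  refine squeeze_zero_norm' (a := fun y => C * y) ?_ ?_
  · filter_upwards [self_mem_nhdsWithin] with y hy using (hC y hy.1 hy.2.le).1
  · refine Tendsto.mono_left ?_ nhdsWithin_le_nhds
    exact (continuous_const.mul continuous_id).tendsto' _ _ (by simp)

theorem tendsto_gee_zero (F : Flow U U1 U2 u M) (W : Wave α p q w w1 w2) :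
    ContinuousWithinAt (gee U U1 p q) (Ioi 0) 0 :=
  W.c1.continuousWithinAt.sub (F.contU1.continuousWithinAt.smul (tendsto_psi_zero F W))

end basic

end OrrSommerfeld

/-! ### Hardy-type inequalities for ψ in terms of g -/

namespace OrrSommerfeld

variable {U U1 U2 : ℝ → ℝ} {u M α : ℝ} {p q w w1 w2 : ℝ → ℂ}

theorem halfLine_mono {f : ℝ → ℂ} (hf : MemLp f 2 halfLine) {s : Set ℝ} (hs : s ⊆ Ioi 0) :
    MemLp f 2 (volume.restrict s) :=
  hf.mono_measure (Measure.restrict_mono hs le_rfl)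

theorem setIntegral_norm_sq_le {f : ℝ → ℂ} (hf : MemLp f 2 halfLine) {s : Set ℝ}
    (hs : s ⊆ Ioi 0) : ∫ y in s, ‖f y‖ ^ 2 ≤ ∫ y in Ioi (0 : ℝ), ‖f y‖ ^ 2 :=
  setIntegral_mono_set (integrable_norm_sq_of_memLp hf)
    (Eventually.of_forall fun _ => by positivity) hs.eventuallyLE

theorem Flow.inv_sq_le (F : Flow U U1 U2 u M) {y : ℝ} (hy : 0 < y) :
    ((U y)⁻¹) ^ 2 ≤ 2 * M ^ 2 * (1 + 1 / y ^ 2) := by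
  have h := F.inv_le hy
  have h0 : 0 ≤ (U y)⁻¹ := inv_nonneg.2 (F.pos hy).le
  calc ((U y)⁻¹) ^ 2 ≤ (M * (1 + y) / y) ^ 2 := pow_le_pow_left₀ h0 h 2
    _ = M ^ 2 * ((1 + y) ^ 2 / y ^ 2) := by rw [div_pow]; ring
    _ ≤ M ^ 2 * (2 * (1 + 1 / y ^ 2)) := by
        gcongr
        rw [div_le_iff₀ (by positivity)]
        field_simp
        nlinarith [sq_nonneg (y - 1)]
    _ = _ := by ring

/-- The oscillation of `p / U` between `a` and `b` is controlled by the `L²` norm of `gee`. -/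
theorem sq_norm_psi_sub_le (F : Flow U U1 U2 u M) (W : Wave α p q w w1 w2) {a b : ℝ} (ha : 0 < a)
    (hab : a ≤ b) :
    ‖psi U p b - psi U p a‖ ^ 2 ≤
      2 * M ^ 2 * (b + 1 / a) * ∫ y in Ioi (0 : ℝ), ‖gee U U1 p q y‖ ^ 2 := by
  have hsub : Ioc a b ⊆ Ioi 0 := fun x hx => ha.trans hx.1
  have hsubI : Icc a b ⊆ Ioi 0 := fun x hx => ha.trans_le hx.1
  have hcont : ContinuousOn (fun y => (U y)⁻¹ • gee U U1 p q y) (Icc a b) :=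
    (F.contInv.smul (continuousOn_gee F W)).mono hsubI
  have e : psi U p b - psi U p a = ∫ y in a..b, (U y)⁻¹ • gee U U1 p q y := by
    refine (intervalIntegral.integral_eq_sub_of_hasDerivAt (fun x hx => ?_) ?_).symm
    · rw [uIcc_of_le hab] at hx
      exact hasDerivAt_psi F W (hsubI hx)
    · exact ContinuousOn.intervalIntegrable (by rwa [uIcc_of_le hab])
  have hinv : MemLp (fun y => (U y)⁻¹) 2 (volume.restrict (Ioc a b)) := by
    have hm : AEStronglyMeasurable (fun y => (U y)⁻¹) (volume.restrict (Ioc a b)) :=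
      (F.contInv.mono hsub).aestronglyMeasurable measurableSet_Ioc
    rw [memLp_two_iff_integrable_sq hm]
    exact (((F.contInv.mono hsubI).pow 2).integrableOn_Icc).mono_set Ioc_subset_Icc_self
  have hg : MemLp (fun y => ‖gee U U1 p q y‖) 2 (volume.restrict (Ioc a b)) :=
    (halfLine_mono (memLp_gee F W) hsub).norm
  have h1 : ‖psi U p b - psi U p a‖ ≤ ∫ y in Ioc a b, (U y)⁻¹ * ‖gee U U1 p q y‖ := by
    rw [e, intervalIntegral.integral_of_le hab]
    refine (norm_integral_le_integral_norm _).trans (le_of_eq ?_)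
    refine setIntegral_congr_fun measurableSet_Ioc fun y hy => ?_
    simp only [norm_smul, Real.norm_of_nonneg (inv_nonneg.2 (F.pos (hsub hy)).le)]
  have h2 := sq_integral_mul_le hinv hg
  -- Since ψ' = g/U, Cauchy–Schwarz leaves ∫ U⁻². The bound U⁻² ≤ 2M²(1 + y⁻²) gives b from the
  -- growth at infinity and 1/a from the degeneracy at the wall.
  have h3 : ∫ y in Ioc a b, ((U y)⁻¹) ^ 2 ≤ 2 * M ^ 2 * (b + 1 / a) := by
    have hd : ∀ t ∈ uIcc a b, HasDerivAt (fun t : ℝ => 2 * M ^ 2 * (t - 1 / t))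
        (2 * M ^ 2 * (1 + 1 / t ^ 2)) t := by
      intro t ht
      rw [uIcc_of_le hab] at ht
      have ht0 : t ≠ 0 := (ha.trans_le ht.1).ne'
      have h := ((hasDerivAt_id t).sub ((hasDerivAt_const t (1 : ℝ)).div (hasDerivAt_id t) ht0)).const_mul (2 * M ^ 2)
      refine h.congr_deriv ?_
      simp only [id_eq]; ring
    have hi : IntervalIntegrable (fun t : ℝ => 2 * M ^ 2 * (1 + 1 / t ^ 2)) volume a b := by
      apply ContinuousOn.intervalIntegrable
      rw [uIcc_of_le hab]
      refine continuousOn_const.mul (continuousOn_const.add (continuousOn_const.div (by fun_prop) ?_))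
      intro t ht
      have : 0 < t := hsubI ht
      positivity
    have h4 := intervalIntegral.integral_eq_sub_of_hasDerivAt hd hi
    rw [intervalIntegral.integral_of_le hab] at h4
    have hb : 0 < b := ha.trans_le hab
    calc ∫ y in Ioc a b, ((U y)⁻¹) ^ 2 ≤ ∫ t in Ioc a b, 2 * M ^ 2 * (1 + 1 / t ^ 2) :=
          setIntegral_mono_on hinv.integrable_sq
            ((intervalIntegrable_iff_integrableOn_Ioc_of_le hab).1 hi) measurableSet_Ioc
            (fun t ht => F.inv_sq_le (hsub ht))
      _ = 2 * M ^ 2 * (b - 1 / b) - 2 * M ^ 2 * (a - 1 / a) := h4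
      _ = 2 * M ^ 2 * (b + 1 / a - (1 / b + a)) := by ring
      _ ≤ 2 * M ^ 2 * (b + 1 / a) := by
          have : 0 < 1 / b + a := by positivity
          gcongr
          linarith
  calc ‖psi U p b - psi U p a‖ ^ 2
      ≤ (∫ y in Ioc a b, (U y)⁻¹ * ‖gee U U1 p q y‖) ^ 2 :=
        pow_le_pow_left₀ (norm_nonneg _) h1 2
    _ ≤ (∫ y in Ioc a b, ((U y)⁻¹) ^ 2) * ∫ y in Ioc a b, ‖gee U U1 p q y‖ ^ 2 := h2
    _ ≤ _ := by
        have hb : 0 < b := ha.trans_le hab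
        refine mul_le_mul h3 (setIntegral_norm_sq_le (memLp_gee F W) hsub)
          (integral_nonneg fun _ => by positivity) (by positivity)

/-- Hardy's inequality for `p / U - c` near the wall. -/
theorem hardy_psi (F : Flow U U1 U2 u M) (W : Wave α p q w w1 w2) (c : ℂ) {k : ℝ} (hk : 0 < k)
    (hk1 : k ≤ 1) :
    ∫ y in Ioc 0 k, ‖psi U p y - c‖ ^ 2 ≤
      2 * k * ‖psi U p k - c‖ ^ 2 +
        16 * M ^ 2 * ∫ y in Ioi (0 : ℝ), ‖gee U U1 p q y‖ ^ 2 := by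
  have hsub : Ioc 0 k ⊆ Ioi 0 := fun x hx => hx.1
  have hM := F.M_pos
  let d : ℝ → ℂ := fun y => psi U p y - c
  let e : ℝ → ℂ := fun y => y • ((U y)⁻¹ • gee U U1 p q y)
  have : IsFiniteMeasure (volume.restrict (Ioc 0 k)) :=
    ⟨by rw [Measure.restrict_apply_univ, Real.volume_Ioc]; exact ENNReal.ofReal_lt_top⟩
  have md : MemLp d 2 (volume.restrict (Ioc 0 k)) :=
    (halfLine_mono (memLp_psi F W) hsub).sub (memLp_const c)
  have he : ∀ y ∈ Ioc 0 k, ‖e y‖ ≤ 2 * M * ‖gee U U1 p q y‖ := by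
    intro y hy
    simp only [e, norm_smul, Real.norm_of_nonneg (inv_nonneg.2 (F.pos hy.1).le),
      Real.norm_of_nonneg hy.1.le]
    rw [← mul_assoc]
    refine mul_le_mul_of_nonneg_right ?_ (norm_nonneg _)
    calc y * (U y)⁻¹ ≤ y * (M * (1 + y) / y) :=
          mul_le_mul_of_nonneg_left (F.inv_le hy.1) hy.1.le
      _ = M * (1 + y) := by have := hy.1.ne'; field_simp
      _ ≤ 2 * M := by nlinarith [hy.2]
  have me : MemLp e 2 (volume.restrict (Ioc 0 k)) := by
    refine MemLp.of_le_mul (c := 2 * M) (halfLine_mono (memLp_gee F W) hsub)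
      ((continuousOn_id.smul (F.contInv.smul (continuousOn_gee F W))).mono hsub
        |>.aestronglyMeasurable measurableSet_Ioc) ?_
    exact (ae_restrict_iff' measurableSet_Ioc).2 (Eventually.of_forall he)
  have hint : IntegrableOn (fun y => ‖d y‖ ^ 2 + 2 * inner ℝ (d y) (e y)) (Ioc 0 k) :=
    (integrable_norm_sq_of_memLp md).add ((integrable_inner_of_memLp md me).const_mul 2)
  -- Hardy by integrating (y|ψ - c|²)'. Here yψ' = (y/U)g is at most 2M|g| for y ≤ 1, and Young's
  -- inequality returns half of |ψ - c|².
  have hd : ∀ y, 0 < y → HasDerivAt (fun y => y * ‖d y‖ ^ 2)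
      (‖d y‖ ^ 2 + 2 * inner ℝ (d y) (e y)) y := by
    intro y hy
    have h1 : HasDerivAt d ((U y)⁻¹ • gee U U1 p q y) y := (hasDerivAt_psi F W hy).sub_const c
    have h2 := (hasDerivAt_id y).mul h1.norm_sq
    refine h2.congr_deriv ?_
    simp only [e, id, inner_smul_right]
    ring
  have hcont : ContinuousOn (fun y => y * ‖d y‖ ^ 2) (Icc 0 k) := by
    intro y hy
    rcases hy.1.eq_or_lt with rfl | hy0
    · have h1 : ContinuousWithinAt d (Ioi 0) 0 := (tendsto_psi_zero F W).sub_const c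
      have h2 : ContinuousWithinAt (fun y => y * ‖d y‖ ^ 2) (Ioi 0) 0 :=
        continuousWithinAt_id.mul (h1.norm.pow 2)
      have h3 := h2.insert
      exact h3.mono (by intro x hx; rcases hx.1.eq_or_lt with h | h
                        · exact Or.inl h.symm
                        · exact Or.inr h)
    · exact (hd y hy0).continuousAt.continuousWithinAt
  have ftc := intervalIntegral.integral_eq_sub_of_hasDerivAt_of_le hk.le hcont
    (fun y hy => hd y hy.1) ((intervalIntegrable_iff_integrableOn_Ioc_of_le hk.le).2 hint)
  rw [intervalIntegral.integral_of_le hk.le, zero_mul, sub_zero] at ftc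
  have hle : ∫ y in Ioc 0 k, ((1 / 2) * ‖d y‖ ^ 2 - 8 * M ^ 2 * ‖gee U U1 p q y‖ ^ 2) ≤
      ∫ y in Ioc 0 k, (‖d y‖ ^ 2 + 2 * inner ℝ (d y) (e y)) := by
    refine setIntegral_mono_on (((integrable_norm_sq_of_memLp md).const_mul _).sub
      ((integrable_norm_sq_of_memLp (halfLine_mono (memLp_gee F W) hsub)).const_mul _)) hint
      measurableSet_Ioc fun y hy => ?_
    have h1 := neg_le_of_abs_le (abs_real_inner_le_norm (d y) (e y))
    have h2 := he y hy
    have h3 : ‖e y‖ ^ 2 ≤ 4 * M ^ 2 * ‖gee U U1 p q y‖ ^ 2 := by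
      calc ‖e y‖ ^ 2 ≤ (2 * M * ‖gee U U1 p q y‖) ^ 2 := pow_le_pow_left₀ (norm_nonneg _) h2 2
        _ = _ := by ring
    nlinarith [sq_nonneg (‖d y‖ - 2 * ‖e y‖)]
  rw [integral_sub ((integrable_norm_sq_of_memLp md).const_mul _)
      ((integrable_norm_sq_of_memLp (halfLine_mono (memLp_gee F W) hsub)).const_mul _),
    integral_const_mul, integral_const_mul, ftc] at hle
  have := setIntegral_norm_sq_le (memLp_gee F W) hsub
  have h8 : 8 * M ^ 2 * ∫ y in Ioc 0 k, ‖gee U U1 p q y‖ ^ 2 ≤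
      8 * M ^ 2 * ∫ y in Ioi (0 : ℝ), ‖gee U U1 p q y‖ ^ 2 := by gcongr
  change ∫ y in Ioc 0 k, ‖d y‖ ^ 2 ≤ 2 * k * ‖d k‖ ^ 2 + _
  linarith

theorem continuousOn_weight {L : ℝ} (hL : 0 < L) :
    ContinuousOn (fun y : ℝ => L ^ 2 / (L + y) ^ 2) (Ioi 0) :=
  continuousOn_const.div (by fun_prop) fun y hy => by
    have : (0 : ℝ) < y := hy
    positivity

theorem weight_le_one {L y : ℝ} (hL : 0 < L) (hy : 0 < y) : L ^ 2 / (L + y) ^ 2 ≤ 1 := by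
  rw [div_le_one (by positivity)]
  exact pow_le_pow_left₀ hL.le (by linarith) 2

theorem memLp_weight_psi (F : Flow U U1 U2 u M) (W : Wave α p q w w1 w2) {L : ℝ} (hL : 0 < L) :
    MemLp (fun y => (L ^ 2 / (L + y) ^ 2) • psi U p y) 2 halfLine :=
  memLp_smul_of_bound (B := 1) (continuousOn_weight hL)
    (fun y hy => by rw [abs_of_nonneg (by positivity)]; exact weight_le_one hL hy) (memLp_psi F W)

/-- Arithmetic for `weighted_psi`: in terms of r = L/k ≥ 1 every term on the left is at most a
multiple of M²r·kA or M²rG. -/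
theorem weighted_psi_aux {k L M A G : ℝ} (hk : 0 < k) (hkL : k ≤ L) (hL : L ≤ 1) (hM : 1 ≤ M)
    (hA0 : 0 ≤ A) (hG0 : 0 ≤ G) :
    2 * k * A + 16 * M ^ 2 * G + ((2 * A + 4 * M ^ 2 * G / k) * (L / 3) + 2 * M ^ 2 * L ^ 2 * G) ≤
      20 * M ^ 2 * (L / k) * (k * A + G) := by
  have hL0 : 0 < L := hk.trans_le hkL
  obtain ⟨r, hr⟩ : ∃ r, r = L / k := ⟨_, rfl⟩
  have hLr : L = r * k := by rw [hr]; field_simp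
  have hr1 : 1 ≤ r := by rw [hr, le_div_iff₀ hk]; linarith
  have hk1 : k ≤ 1 := hkL.trans hL
  have e : (2 * A + 4 * M ^ 2 * G / k) * (L / 3) =
      (2 / 3) * r * (k * A) + (4 / 3) * r * (M ^ 2 * G) := by
    rw [hr]; field_simp
  have hL2 : L ^ 2 ≤ r := by
    have h1 : L * L ≤ L * 1 := mul_le_mul_of_nonneg_left hL hL0.le
    have h2 : r * k ≤ r * 1 := mul_le_mul_of_nonneg_left hk1 (by linarith)
    nlinarith
  obtain ⟨N, hN⟩ : ∃ N, N = M ^ 2 * G := ⟨_, rfl⟩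
  obtain ⟨B, hB⟩ : ∃ B, B = k * A := ⟨_, rfl⟩
  have hN0 : 0 ≤ N := by rw [hN]; positivity
  have hB0 : 0 ≤ B := by rw [hB]; positivity
  have hM2 : 1 ≤ M ^ 2 := one_le_pow₀ hM
  rw [e, ← hr]
  have g1 : L ^ 2 * N ≤ r * N := mul_le_mul_of_nonneg_right hL2 hN0
  have g2 : N ≤ r * N := le_mul_of_one_le_left hN0 hr1
  have g3 : B ≤ r * B := le_mul_of_one_le_left hB0 hr1
  have g4 : r * B ≤ M ^ 2 * (r * B) := le_mul_of_one_le_left (by positivity) hM2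
  have g5 : 0 ≤ r * N := by positivity
  calc _ = 2 * B + 16 * N + (2 / 3 * (r * B) + 4 / 3 * (r * N) + 2 * (L ^ 2 * N)) := by
        rw [hN, hB]; ring
    _ ≤ 20 * (M ^ 2 * (r * B)) + 20 * (r * N) := by linarith
    _ = _ := by rw [hN, hB]; ring

/-- Weighted `L²` bound for `p / U`: with weight at scale `L`, in terms of the value at `k ≤ L`. -/
theorem weighted_psi (F : Flow U U1 U2 u M) (W : Wave α p q w w1 w2) {k L : ℝ} (hk : 0 < k)
    (hkL : k ≤ L) (hL : L ≤ 1) :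
    ∫ y in Ioi (0 : ℝ), ‖(L ^ 2 / (L + y) ^ 2) • psi U p y‖ ^ 2 ≤
      20 * M ^ 2 * (L / k) * (k * ‖psi U p k‖ ^ 2 +
        ∫ y in Ioi (0 : ℝ), ‖gee U U1 p q y‖ ^ 2) := by
  have hL0 : 0 < L := hk.trans_le hkL
  have hM := F.one_le
  have hM0 := F.M_pos
  set G := ∫ y in Ioi (0 : ℝ), ‖gee U U1 p q y‖ ^ 2 with hG
  have hG0 : 0 ≤ G := integral_nonneg fun _ => by positivity
  set A := ‖psi U p k‖ ^ 2 with hA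
  have hA0 : 0 ≤ A := by positivity
  have hi := integrable_norm_sq_of_memLp (memLp_weight_psi F W hL0)
  have hsub1 : Ioc 0 k ⊆ Ioi 0 := fun x hx => hx.1
  have hsub2 : Ioi k ⊆ Ioi 0 := Ioi_subset_Ioi hk.le
  rw [← Ioc_union_Ioi_eq_Ioi hk.le, setIntegral_union Ioc_disjoint_Ioi_same measurableSet_Ioi
    (hi.mono_measure (Measure.restrict_mono hsub1 le_rfl))
    (hi.mono_measure (Measure.restrict_mono hsub2 le_rfl))]
  have e1 : ∫ y in Ioc 0 k, ‖(L ^ 2 / (L + y) ^ 2) • psi U p y‖ ^ 2 ≤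
      2 * k * A + 16 * M ^ 2 * G := by
    have h := hardy_psi F W 0 hk (hkL.trans hL)
    simp only [sub_zero] at h
    refine le_trans ?_ h
    refine setIntegral_mono_on (hi.mono_measure (Measure.restrict_mono hsub1 le_rfl))
      (integrable_norm_sq_of_memLp (halfLine_mono (memLp_psi F W) hsub1)) measurableSet_Ioc
      fun y hy => ?_
    have hy0 : 0 < y := hy.1
    rw [norm_smul, Real.norm_of_nonneg (by positivity)]
    exact pow_le_pow_left₀ (by positivity)
      (mul_le_of_le_one_left (norm_nonneg _) (weight_le_one hL0 hy0)) 2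
  have i4 := integrableOn_inv_add_pow hL0 (n := 3) (by norm_num)
  have i3 := integrableOn_inv_add_pow hL0 (n := 2) (by norm_num)
  -- Beyond k the oscillation bound gives |ψ(y)|² ≤ 2|ψ(k)|² + 4M²(y + 1/k)‖g‖². The squared weight
  -- L⁴/(L + y)⁴ makes this linear growth integrable.
  have e2 : ∫ y in Ioi k, ‖(L ^ 2 / (L + y) ^ 2) • psi U p y‖ ^ 2 ≤
      (2 * A + 4 * M ^ 2 * G / k) * (L / 3) + 2 * M ^ 2 * L ^ 2 * G := by
    have h1 : ∫ y in Ioi k, ‖(L ^ 2 / (L + y) ^ 2) • psi U p y‖ ^ 2 ≤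
        ∫ y in Ioi k, ((2 * A + 4 * M ^ 2 * G / k) * L ^ 4 * (1 / (L + y) ^ (3 + 1)) +
          4 * M ^ 2 * L ^ 4 * G * (1 / (L + y) ^ (2 + 1))) := by
      refine setIntegral_mono_on (hi.mono_measure (Measure.restrict_mono hsub2 le_rfl))
        (((i4.1.mono_set hsub2).const_mul _).add ((i3.1.mono_set hsub2).const_mul _))
        measurableSet_Ioi fun y hy => ?_
      have hky : k ≤ y := le_of_lt hy
      have hy0 : 0 < y := hk.trans hy
      have h2 := sq_norm_psi_sub_le F W hk hky
      rw [← hG] at h2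
      have h3 : ‖psi U p y‖ ^ 2 ≤ 2 * A + 2 * (2 * M ^ 2 * (y + 1 / k) * G) := by
        have h4 : ‖psi U p y‖ ≤ ‖psi U p k‖ + ‖psi U p y - psi U p k‖ := by
          have := norm_add_le (psi U p k) (psi U p y - psi U p k)
          rwa [add_sub_cancel] at this
        have h5 : ‖psi U p y‖ ^ 2 ≤ (‖psi U p k‖ + ‖psi U p y - psi U p k‖) ^ 2 :=
          pow_le_pow_left₀ (norm_nonneg _) h4 2
        nlinarith [sq_nonneg (‖psi U p k‖ - ‖psi U p y - psi U p k‖)]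
      rw [norm_smul, Real.norm_of_nonneg (by positivity), mul_pow]
      calc (L ^ 2 / (L + y) ^ 2) ^ 2 * ‖psi U p y‖ ^ 2
          ≤ (L ^ 2 / (L + y) ^ 2) ^ 2 * (2 * A + 2 * (2 * M ^ 2 * (y + 1 / k) * G)) := by gcongr
        _ ≤ (L ^ 2 / (L + y) ^ 2) ^ 2 * (2 * A + 2 * (2 * M ^ 2 * ((L + y) + 1 / k) * G)) := by
            gcongr; linarith
        _ = _ := by field_simp; ring
    refine h1.trans ?_
    have h6 : ∫ y in Ioi k, ((2 * A + 4 * M ^ 2 * G / k) * L ^ 4 * (1 / (L + y) ^ (3 + 1)) +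
          4 * M ^ 2 * L ^ 4 * G * (1 / (L + y) ^ (2 + 1))) ≤
        ∫ y in Ioi (0 : ℝ), ((2 * A + 4 * M ^ 2 * G / k) * L ^ 4 * (1 / (L + y) ^ (3 + 1)) +
          4 * M ^ 2 * L ^ 4 * G * (1 / (L + y) ^ (2 + 1))) := by
      refine setIntegral_mono_set ((i4.1.const_mul _).add (i3.1.const_mul _)) ?_ hsub2.eventuallyLE
      refine (ae_restrict_iff' measurableSet_Ioi).2 (Eventually.of_forall fun y hy => ?_)
      have hy0 : (0 : ℝ) < y := hy
      simp only [Pi.zero_apply]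
      positivity
    refine h6.trans (le_of_eq ?_)
    rw [integral_add (i4.1.const_mul _) (i3.1.const_mul _), integral_const_mul, integral_const_mul,
      i4.2, i3.2]
    field_simp
    push_cast
    ring
  refine (add_le_add e1 e2).trans ?_
  exact weighted_psi_aux hk hkL hL hM hA0 hG0

end OrrSommerfeld

/-! ### The weak form of the equation and its first test functions -/

namespace OrrSommerfeld

variable {U U1 U2 : ℝ → ℝ} {u M α ε : ℝ} {p q w w1 w2 f : ℝ → ℂ}

/-- The Orr–Sommerfeld equation in terms of the vorticity `w`. -/
def OSEq (U U2 : ℝ → ℝ) (ε α : ℝ) (p w w2 f : ℝ → ℂ) : Prop :=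
  ∀ᵐ y ∂halfLine,
    f y = U y • w y - U2 y • p y + ε • (Complex.I * (w2 y - (α ^ 2) • w y))

/-- The pairing is real, so multiplication by i is skew. This selects which terms survive: a real
multiple of w as test function removes the zeroth-order viscous term, and an imaginary multiple of p
removes U''p. -/
theorem inner_I_mul_self (z : ℂ) : inner ℝ (Complex.I * z) z = 0 := by
  rw [inner_complex]; simp [mul_comm]

theorem inner_self_I_mul (z : ℂ) : inner ℝ z (Complex.I * z) = 0 := by
  rw [real_inner_comm, inner_I_mul_self]

theorem inner_I_mul_I_mul (z v : ℂ) : inner ℝ (Complex.I * z) (Complex.I * v) = inner ℝ z v := by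
  rw [inner_complex, inner_complex]; simp; ring

theorem memLp_I_mul {f : ℝ → ℂ} (hf : MemLp f 2 halfLine) :
    MemLp (fun y => Complex.I * f y) 2 halfLine := hf.const_mul _

theorem memLp_U_smul (F : Flow U U1 U2 u M) {h : ℝ → ℂ} (hh : MemLp h 2 halfLine) :
    MemLp (fun y => U y • h y) 2 halfLine :=
  memLp_smul_of_bound F.contU.continuousOn
    (fun y hy => by rw [abs_of_nonneg (F.pos hy).le]; exact F.le y hy.le) hh

theorem memLp_U2_smul (F : Flow U U1 U2 u M) {h : ℝ → ℂ} (hh : MemLp h 2 halfLine) :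
    MemLp (fun y => U2 y • h y) 2 halfLine :=
  memLp_smul_of_bound F.c2.continuousOn (fun _ hy => F.b2' hy.le) hh

theorem memLp_U1_smul (F : Flow U U1 U2 u M) {h : ℝ → ℂ} (hh : MemLp h 2 halfLine) :
    MemLp (fun y => U1 y • h y) 2 halfLine :=
  memLp_smul_of_bound F.contU1.continuousOn (fun _ hy => F.b1' hy.le) hh

theorem integrableOn_add {s : Set ℝ} {f g : ℝ → ℝ} (hf : IntegrableOn f s) (hg : IntegrableOn g s) :
    IntegrableOn (fun y => f y + g y) s := hf.add hg

theorem integrableOn_sub {s : Set ℝ} {f g : ℝ → ℝ} (hf : IntegrableOn f s) (hg : IntegrableOn g s) :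
    IntegrableOn (fun y => f y - g y) s := hf.sub hg

/-- The weak form of the equation, tested with a `C¹` function vanishing at the wall. -/
theorem test_identity (F : Flow U U1 U2 u M) (W : Wave α p q w w1 w2) (E : OSEq U U2 ε α p w w2 f)
    {V V' : ℝ → ℂ} (hV0 : ContinuousWithinAt V (Ioi 0) 0) (hV : V 0 = 0)
    (hVd : ∀ y, 0 < y → HasDerivAt V (V' y) y) (hV'c : ContinuousOn V' (Ioi 0))
    (mV : MemLp V 2 halfLine) (mV' : MemLp V' 2 halfLine) :
    ∫ y in Ioi (0 : ℝ), inner ℝ (f y) (V y) =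
      (∫ y in Ioi (0 : ℝ), inner ℝ (U y • w y - U2 y • p y) (V y))
        - ε * (∫ y in Ioi (0 : ℝ), inner ℝ (Complex.I * w1 y) (V' y))
        - ε * α ^ 2 * ∫ y in Ioi (0 : ℝ), inner ℝ (Complex.I * w y) (V y) := by
  have mR := (memLp_U_smul F W.m2).sub (memLp_U2_smul F W.m0)
  have i1 : IntegrableOn (fun y => inner ℝ (U y • w y - U2 y • p y) (V y)) (Ioi 0) :=
    integrable_inner_of_memLp mR mV
  have i2 : IntegrableOn (fun y => inner ℝ (Complex.I * w2 y) (V y)) (Ioi 0) :=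
    integrable_inner_of_memLp (memLp_I_mul W.m4) mV
  have i3 : IntegrableOn (fun y => inner ℝ (Complex.I * w y) (V y)) (Ioi 0) :=
    integrable_inner_of_memLp (memLp_I_mul W.m2) mV
  have e1 : ∫ y in Ioi (0 : ℝ), inner ℝ (f y) (V y) = ∫ y in Ioi (0 : ℝ),
      (inner ℝ (U y • w y - U2 y • p y) (V y) + ε * inner ℝ (Complex.I * w2 y) (V y)
        - ε * α ^ 2 * inner ℝ (Complex.I * w y) (V y)) := by
    refine integral_congr_ae ?_
    filter_upwards [E] with y hy
    rw [hy, inner_add_left, real_inner_smul_left _ _ ε, mul_sub, inner_sub_left (Complex.I * _), mul_smul_comm,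
      real_inner_smul_left _ _ (α ^ 2)]
    ring
  have hIw : ∀ y, 0 ≤ y → Complex.I * w1 y = Complex.I * w1 0 +
      ∫ t in (0 : ℝ)..y, Complex.I * w2 t := by
    intro y hy
    rw [intervalIntegral.integral_const_mul, ← mul_add, ← W.i3 y hy]
  have e2 := integral_inner_parts hIw hV0 hVd hV'c (memLp_I_mul W.m3) (memLp_I_mul W.m4) mV mV'
  rw [hV, inner_zero_right, neg_zero, zero_sub] at e2
  rw [e1, integral_sub, integral_add i1 (i2.const_mul _), integral_const_mul, integral_const_mul, e2]
  · ring
  · exact i1.add (i2.const_mul _)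
  · exact i3.const_mul _

theorem le_add_of_sq_le {x a b : ℝ} (ha : 0 ≤ a) (hb : 0 ≤ b) (h : x ^ 2 ≤ 4 * a * b) :
    x ≤ a + b := by
  refine le_of_sq_le_sq ?_ (by positivity)
  nlinarith [sq_nonneg (a - b)]
where
  le_of_sq_le_sq {x y : ℝ} (h : x ^ 2 ≤ y ^ 2) (hy : 0 ≤ y) : x ≤ y := by
    by_contra hc
    nlinarith

/-! ### The layer estimate for the vorticity -/

/-- Cutoff at the layer scale `k`. -/
noncomputable def layerCut (k y : ℝ) : ℝ := k ^ 4 / (k ^ 2 + y ^ 2) ^ 2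

theorem hasDerivAt_layerCut {k : ℝ} (hk : 0 < k) (y : ℝ) :
    HasDerivAt (layerCut k) (-4 * k ^ 4 * y / (k ^ 2 + y ^ 2) ^ 3) y := by
  have h1 : HasDerivAt (fun y : ℝ => (k ^ 2 + y ^ 2) ^ 2) (2 * (k ^ 2 + y ^ 2) * (2 * y)) y := by
    refine ((((hasDerivAt_id y).pow 2).const_add (k ^ 2)).pow 2).congr_deriv ?_
    simp
  have hP : k ^ 2 + y ^ 2 ≠ 0 := by positivity
  have h2 := (hasDerivAt_const y (k ^ 4)).div h1 (by positivity)
  refine h2.congr_deriv ?_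
  field_simp
  ring

theorem hasDerivAt_layerCut' {k : ℝ} (hk : 0 < k) (y : ℝ) :
    HasDerivAt (fun y => -4 * k ^ 4 * y / (k ^ 2 + y ^ 2) ^ 3)
      (-4 * k ^ 4 / (k ^ 2 + y ^ 2) ^ 3 + 24 * k ^ 4 * y ^ 2 / (k ^ 2 + y ^ 2) ^ 4) y := by
  have h1 : HasDerivAt (fun y : ℝ => (k ^ 2 + y ^ 2) ^ 3) (3 * (k ^ 2 + y ^ 2) ^ 2 * (2 * y)) y := by
    refine ((((hasDerivAt_id y).pow 2).const_add (k ^ 2)).pow 3).congr_deriv ?_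
    simp
  have hP : k ^ 2 + y ^ 2 ≠ 0 := by positivity
  have h2 := ((hasDerivAt_id y).const_mul (-4 * k ^ 4)).div h1 (by positivity)
  refine h2.congr_deriv ?_
  simp only [id]
  field_simp
  ring

theorem layerCut_nonneg (k y : ℝ) : 0 ≤ layerCut k y := by rw [layerCut]; positivity

theorem continuous_layerCut {k : ℝ} (hk : 0 < k) : Continuous (layerCut k) :=
  continuous_iff_continuousAt.2 fun y => (hasDerivAt_layerCut hk y).continuousAt

theorem layerCut_le_one {k : ℝ} (hk : 0 < k) (y : ℝ) : layerCut k y ≤ 1 := by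
  rw [layerCut, div_le_one (by positivity)]
  nlinarith [sq_nonneg (k * y), sq_nonneg (y ^ 2)]

theorem abs_layerCut'_le {k : ℝ} (hk : 0 < k) {y : ℝ} (hy : 0 ≤ y) :
    |(-4 * k ^ 4 * y / (k ^ 2 + y ^ 2) ^ 3)| ≤ 4 * k ^ 4 * y / (k ^ 2 + y ^ 2) ^ 3 := by
  rw [show -4 * k ^ 4 * y / (k ^ 2 + y ^ 2) ^ 3 = -(4 * k ^ 4 * y / (k ^ 2 + y ^ 2) ^ 3) by ring,
    abs_neg, abs_of_nonneg (by positivity)]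

theorem abs_layerCut''_le {k : ℝ} (hk : 0 < k) (y : ℝ) :
    |(-4 * k ^ 4 / (k ^ 2 + y ^ 2) ^ 3 + 24 * k ^ 4 * y ^ 2 / (k ^ 2 + y ^ 2) ^ 4)| ≤
      20 * k ^ 4 / (k ^ 2 + y ^ 2) ^ 3 := by
  have hP : 0 < k ^ 2 + y ^ 2 := by positivity
  have e : 24 * k ^ 4 * y ^ 2 / (k ^ 2 + y ^ 2) ^ 4 ≤ 24 * k ^ 4 / (k ^ 2 + y ^ 2) ^ 3 := by
    rw [div_le_div_iff₀ (by positivity) (by positivity)]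
    have : y ^ 2 ≤ k ^ 2 + y ^ 2 := by nlinarith [sq_nonneg k]
    calc 24 * k ^ 4 * y ^ 2 * (k ^ 2 + y ^ 2) ^ 3
        ≤ 24 * k ^ 4 * (k ^ 2 + y ^ 2) * (k ^ 2 + y ^ 2) ^ 3 := by gcongr
      _ = _ := by ring
  have e0 : 0 ≤ 24 * k ^ 4 * y ^ 2 / (k ^ 2 + y ^ 2) ^ 4 := by positivity
  have e1 : 0 ≤ k ^ 4 / (k ^ 2 + y ^ 2) ^ 3 := by positivity
  have r1 : -4 * k ^ 4 / (k ^ 2 + y ^ 2) ^ 3 = -4 * (k ^ 4 / (k ^ 2 + y ^ 2) ^ 3) := by ring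
  have r2 : 24 * k ^ 4 / (k ^ 2 + y ^ 2) ^ 3 = 24 * (k ^ 4 / (k ^ 2 + y ^ 2) ^ 3) := by ring
  have r3 : 20 * k ^ 4 / (k ^ 2 + y ^ 2) ^ 3 = 20 * (k ^ 4 / (k ^ 2 + y ^ 2) ^ 3) := by ring
  rw [r1, r3, abs_le]
  rw [r2] at e
  constructor <;> linarith

/-- The test function is i·m·p. The factor i removes the U''p term and makes the viscous term real;
moving the derivative off w' produces ⟨w, (mp)''⟩, which contains m|w|². No-slip removes the
boundary term, and the two α² contributions cancel. -/
theorem layer_identity (F : Flow U U1 U2 u M) (W : Wave α p q w w1 w2)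
    (E : OSEq U U2 ε α p w w2 f) (mf : MemLp f 2 halfLine) {m m' m'' : ℝ → ℝ} {B : ℝ}
    (hm : ∀ y, HasDerivAt m (m' y) y) (hm' : ∀ y, HasDerivAt m' (m'' y) y)
    (hm'' : Continuous m'') (b0 : ∀ y, 0 < y → |m y| ≤ B) (b1 : ∀ y, 0 < y → |m' y| ≤ B)
    (b2 : ∀ y, 0 < y → |m'' y| ≤ B) :
    ε * ∫ y in Ioi (0 : ℝ), m y * ‖w y‖ ^ 2 = ∫ y in Ioi (0 : ℝ),
      (inner ℝ (f y) (Complex.I * (m y • p y)) - inner ℝ (U y • w y) (Complex.I * (m y • p y))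
        - ε * inner ℝ (w y) (m'' y • p y + (2 * m' y) • q y)) := by
  have cm : Continuous m := continuous_iff_continuousAt.2 fun y => (hm y).continuousAt
  have cm' : Continuous m' := continuous_iff_continuousAt.2 fun y => (hm' y).continuousAt
  have mp : MemLp (fun y => m y • p y) 2 halfLine := memLp_smul_of_bound cm.continuousOn b0 W.m0
  have mq : MemLp (fun y => m y • q y) 2 halfLine := memLp_smul_of_bound cm.continuousOn b0 W.m1
  have mw : MemLp (fun y => m y • w y) 2 halfLine := memLp_smul_of_bound cm.continuousOn b0 W.m2
  have m'p : MemLp (fun y => m' y • p y) 2 halfLine := memLp_smul_of_bound cm'.continuousOn b1 W.m0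
  have m'q : MemLp (fun y => m' y • q y) 2 halfLine := memLp_smul_of_bound cm'.continuousOn b1 W.m1
  have m''p : MemLp (fun y => m'' y • p y) 2 halfLine :=
    memLp_smul_of_bound hm''.continuousOn b2 W.m0
  let Z : ℝ → ℂ := fun y => m' y • p y + m y • q y
  let Z' : ℝ → ℂ := fun y => (m'' y • p y + (2 * m' y) • q y) + m y • (w y + (α ^ 2) • p y)
  have mZ : MemLp Z 2 halfLine := m'p.add mq
  have m2q : MemLp (fun y => (2 * m' y) • q y) 2 halfLine := by
    refine (m'q.const_smul (2 : ℝ)).ae_eq (Eventually.of_forall fun y => ?_)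
    simp [mul_smul]
  have mYp : MemLp (fun y => m'' y • p y + (2 * m' y) • q y) 2 halfLine := m''p.add m2q
  have mZ' : MemLp Z' 2 halfLine := by
    refine (mYp.add (mw.add (mp.const_smul (α ^ 2)))).ae_eq (Eventually.of_forall fun y => ?_)
    simp only [Z', Pi.add_apply, Pi.smul_apply]
    rw [smul_add, smul_comm (m y)]
  have dp : ∀ y, HasDerivAt (fun y => m y • p y) (Z y) y := fun y => by
    refine ((hm y).smul (W.d0 y)).congr_deriv ?_
    simp only [Z]; rw [add_comm]
  have dZ : ∀ y, HasDerivAt Z (Z' y) y := fun y => by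
    refine (((hm' y).smul (W.d0 y)).add ((hm y).smul (W.d1 y))).congr_deriv ?_
    simp only [Z']
    module
  have cZ : Continuous Z := continuous_iff_continuousAt.2 fun y => (dZ y).continuousAt
  have cp : Continuous (fun y => m y • p y) := cm.smul W.c0
  have T := test_identity F W E (V := fun y => Complex.I * (m y • p y))
    (V' := fun y => Complex.I * Z y) (continuous_const.mul cp).continuousWithinAt
    (by simp [W.z0]) (fun y _ => (dp y).const_mul _) (continuous_const.mul cZ).continuousOn
    (memLp_I_mul mp) (memLp_I_mul mZ)
  have hsw : ∫ y in Ioi (0 : ℝ), inner ℝ (Complex.I * w1 y) (Complex.I * Z y) =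
      - ∫ y in Ioi (0 : ℝ), inner ℝ (w y) (Z' y) := by
    have i1 : IntegrableOn (fun y => inner ℝ (w1 y) (Z y)) (Ioi 0) :=
      integrable_inner_of_memLp W.m3 mZ
    have i2 : IntegrableOn (fun y => inner ℝ (w y) (Z' y)) (Ioi 0) :=
      integrable_inner_of_memLp W.m2 mZ'
    have h := integral_Ioi_deriv_eq_neg (f := fun y => inner ℝ (w y) (Z y))
      (h := fun y => inner ℝ (w y) (Z' y) + inner ℝ (w1 y) (Z y))
      ((W.c2.inner cZ).continuousWithinAt) (fun y _ => (W.d2 y).inner ℝ (dZ y))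
      (integrable_inner_of_memLp W.m2 mZ) (i2.add i1)
    rw [integral_add i2 i1, show Z 0 = 0 by simp [Z, W.z0, W.z1], inner_zero_right, neg_zero] at h
    simp only [inner_I_mul_I_mul]
    linarith
  have i3 : IntegrableOn (fun y => inner ℝ (w y) (m'' y • p y + (2 * m' y) • q y)) (Ioi 0) :=
    integrable_inner_of_memLp W.m2 mYp
  have i4 : IntegrableOn (fun y => m y * ‖w y‖ ^ 2) (Ioi 0) := by
    refine (integrable_inner_of_memLp W.m2 mw).congr (Eventually.of_forall fun y => ?_)
    simp only [real_inner_smul_right, real_inner_self_eq_norm_sq]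
  have i5 : IntegrableOn (fun y => inner ℝ (w y) (m y • p y)) (Ioi 0) :=
    integrable_inner_of_memLp W.m2 mp
  have hZ' : ∫ y in Ioi (0 : ℝ), inner ℝ (w y) (Z' y) =
      (∫ y in Ioi (0 : ℝ), inner ℝ (w y) (m'' y • p y + (2 * m' y) • q y)) +
      (∫ y in Ioi (0 : ℝ), m y * ‖w y‖ ^ 2) +
        α ^ 2 * ∫ y in Ioi (0 : ℝ), inner ℝ (w y) (m y • p y) := by
    rw [← integral_const_mul, ← integral_add i3 i4, ← integral_add (integrableOn_add i3 i4) (i5.const_mul _)]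
    refine integral_congr_ae (Eventually.of_forall fun y => ?_)
    simp only [Z']
    rw [inner_add_right (w y) (m'' y • p y + _), smul_add, inner_add_right (w y) (m y • w y),
      real_inner_smul_right (w y) (w y) (m y), real_inner_self_eq_norm_sq, smul_comm (m y),
      real_inner_smul_right _ (m y • p y)]
    ring
  have i6 : IntegrableOn (fun y => inner ℝ (f y) (Complex.I * (m y • p y))) (Ioi 0) :=
    integrable_inner_of_memLp mf (memLp_I_mul mp)
  have i7 : IntegrableOn (fun y => inner ℝ (U y • w y) (Complex.I * (m y • p y))) (Ioi 0) :=
    integrable_inner_of_memLp (memLp_U_smul F W.m2) (memLp_I_mul mp)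
  have hR : ∫ y in Ioi (0 : ℝ), inner ℝ (U y • w y - U2 y • p y) (Complex.I * (m y • p y)) =
      ∫ y in Ioi (0 : ℝ), inner ℝ (U y • w y) (Complex.I * (m y • p y)) := by
    refine integral_congr_ae (Eventually.of_forall fun y => ?_)
    simp only
    rw [inner_sub_left, mul_smul_comm, real_inner_smul_left (p y), real_inner_smul_right (p y),
      inner_self_I_mul]
    ring
  rw [hR, hsw, hZ'] at T
  simp only [inner_I_mul_I_mul] at T
  rw [integral_sub (integrableOn_sub i6 i7) (i3.const_mul _), integral_sub i6 i7, integral_const_mul]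
  linarith

end OrrSommerfeld

/-! ### Vorticity inside the layer and the trace of ψ at its edge -/

namespace OrrSommerfeld

/-- A solution of the Orr–Sommerfeld equation over the flow `U` with `ε = k ^ 3`. -/
structure Sol (U U1 U2 : ℝ → ℝ) (u M k α : ℝ) (p q w w1 w2 f : ℝ → ℂ) : Prop where
  F : Flow U U1 U2 u M
  W : Wave α p q w w1 w2
  E : OSEq U U2 (k ^ 3) α p w w2 f
  mf : MemLp f 2 halfLine
  k0 : 0 < k
  k1 : k ≤ 1
  a0 : 0 < α
  ka : k * α ≤ 1

/-- The square of the `L²` norm. -/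
noncomputable def sqInt (f : ℝ → ℂ) : ℝ := ∫ y in Ioi (0 : ℝ), ‖f y‖ ^ 2

/-- The weighted `L²` norm of the vorticity controlled by the shear. -/
noncomputable def shearInt (L : ℝ) (U : ℝ → ℝ) (w : ℝ → ℂ) : ℝ :=
  ∫ y in Ioi (0 : ℝ), L ^ 2 * y / (L ^ 2 + y ^ 2) * U y * ‖w y‖ ^ 2

theorem sqInt_nonneg (f : ℝ → ℂ) : 0 ≤ sqInt f := integral_nonneg fun _ => by positivity

theorem setIntegral_le_of_le {f g : ℝ → ℝ} (hg : IntegrableOn g (Ioi 0))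
    (g0 : ∀ y, 0 < y → 0 ≤ g y) (h : ∀ y, 0 < y → f y ≤ g y) :
    ∫ y in Ioi (0 : ℝ), f y ≤ ∫ y in Ioi (0 : ℝ), g y := by
  by_cases hf : IntegrableOn f (Ioi 0)
  · exact setIntegral_mono_on hf hg measurableSet_Ioi h
  · rw [integral_undef hf]
    exact setIntegral_nonneg measurableSet_Ioi g0

theorem inner_le_mul {x y : ℂ} {a b : ℝ} (hx : ‖x‖ ≤ a) (hy : ‖y‖ ≤ b) : inner ℝ x y ≤ a * b :=
  (real_inner_le_norm x y).trans (mul_le_mul hx hy (norm_nonneg _) ((norm_nonneg _).trans hx))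

theorem neg_inner_le_mul {x y : ℂ} {a b : ℝ} (hx : ‖x‖ ≤ a) (hy : ‖y‖ ≤ b) :
    -inner ℝ x y ≤ a * b := by
  rw [← inner_neg_left]
  exact inner_le_mul (by rwa [norm_neg]) hy

theorem integrableOn_weight_norm_sq {c : ℝ → ℝ} {f : ℝ → ℂ} {B : ℝ} (hc : ContinuousOn c (Ioi 0))
    (hB : ∀ y, 0 < y → |c y| ≤ B) (hf : MemLp f 2 halfLine) :
    IntegrableOn (fun y => c y * ‖f y‖ ^ 2) (Ioi 0) := by
  refine (integrable_inner_of_memLp hf (memLp_smul_of_bound hc hB hf)).congr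
    (Eventually.of_forall fun y => ?_)
  simp only [real_inner_smul_right, real_inner_self_eq_norm_sq]

theorem shearWeight_le {L : ℝ} (hL : 0 < L) (y : ℝ) : L ^ 2 * y / (L ^ 2 + y ^ 2) ≤ L / 2 := by
  rw [div_le_div_iff₀ (by positivity) two_pos]
  nlinarith [mul_nonneg hL.le (sq_nonneg (L - y))]

theorem continuous_shearWeight {L : ℝ} (hL : 0 < L) :
    Continuous fun y : ℝ => L ^ 2 * y / (L ^ 2 + y ^ 2) :=
  Continuous.div (by fun_prop) (by fun_prop) fun y => by positivity

variable {U U1 U2 : ℝ → ℝ} {u M k α : ℝ} {p q w w1 w2 f : ℝ → ℂ}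

theorem integrableOn_shear (F : Flow U U1 U2 u M) {L : ℝ} (hL : 0 < L) (hw : MemLp w 2 halfLine) :
    IntegrableOn (fun y => L ^ 2 * y / (L ^ 2 + y ^ 2) * U y * ‖w y‖ ^ 2) (Ioi 0) := by
  have hM := F.M_pos
  refine integrableOn_weight_norm_sq (B := L / 2 * M)
    ((continuous_shearWeight hL).mul F.contU).continuousOn (fun y hy => ?_) hw
  have hU := F.pos hy
  rw [abs_of_nonneg (by positivity)]
  exact mul_le_mul (shearWeight_le hL y) (F.le y hy.le) hU.le (by positivity)

theorem norm_eq_U_mul_psi (F : Flow U U1 U2 u M) (p : ℝ → ℂ) {y : ℝ} (hy : 0 < y) :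
    ‖p y‖ = U y * ‖psi U p y‖ := by
  have h := congrArg norm (smul_psi F p hy)
  rw [norm_smul, Real.norm_of_nonneg (F.pos hy).le] at h
  exact h.symm

theorem norm_q_le (F : Flow U U1 U2 u M) (p q : ℝ → ℂ) {y : ℝ} (hy : 0 < y) :
    ‖q y‖ ≤ ‖gee U U1 p q y‖ + M * ‖psi U p y‖ := by
  have h : q y = gee U U1 p q y + U1 y • psi U p y := by rw [gee, sub_add_cancel]
  rw [h]
  refine (norm_add_le _ _).trans (add_le_add le_rfl ?_)
  rw [norm_smul]
  exact mul_le_mul_of_nonneg_right (F.b1' hy.le) (norm_nonneg _)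

theorem shearInt_nonneg (F : Flow U U1 U2 u M) {L : ℝ} (hL : 0 < L) (w : ℝ → ℂ) :
    0 ≤ shearInt L U w :=
  setIntegral_nonneg measurableSet_Ioi fun y hy => by
    have := F.pos hy
    have : (0 : ℝ) < y := hy
    positivity

/-- Five applications of Young's inequality, with a = k²/(k² + y²), so that a² is `layerCut`, and n,
s, g, ph the sizes of w, ψ, `gee`, f. The vorticity is always paid for by a·y·U·n², the integrand of
`shearInt` at scale k. Although that weight degenerates at the wall, each error carries a factor y
or U, and a³y ≲ U, U ≲ y supply what is missing. -/
theorem layer_pointwise {k y U M η n s g ph a : ℝ} (hk : 0 < k) (hk1 : k ≤ 1) (hy : 0 < y)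
    (a0 : 0 < a) (a1 : a ≤ 1) (hay : a * y ≤ k / 2) (hay2 : a * y ^ 2 ≤ k ^ 2) (U0 : 0 < U)
    (hU : U ≤ M * y) (hU' : y ≤ M * (1 + y) * U) (M1 : 1 ≤ M) (hη : 0 < η)
    (hs : 0 ≤ s) (hph : 0 ≤ ph) :
    ph * (a ^ 2 * (U * s) / k) + U * n * (a ^ 2 * (U * s) / k) +
      (20 * a ^ 3 * n * (U * s) + 8 * a ^ 3 * y * n * (g + M * s)) ≤
    150 * M ^ 3 / η * (a * y * U * n ^ 2 + ph ^ 2) + η * (4 * (a * s) ^ 2 + g ^ 2) := by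
  have hM : 0 < M := by linarith
  have key : a ^ 3 * y ≤ 3 / 2 * M * U := by
    have h1 : a * (1 + y) ≤ 3 / 2 := by linarith
    calc a ^ 3 * y ≤ a ^ 3 * (M * (1 + y) * U) := by gcongr
      _ = a ^ 2 * (a * (1 + y)) * (M * U) := by ring
      _ ≤ 1 * (3 / 2) * (M * U) := by
          gcongr
          exact pow_le_one₀ a0.le a1
      _ = _ := by ring
  have T1 : ph * (a ^ 2 * (U * s) / k) ≤ M ^ 2 * ph ^ 2 / η + η * (a * s) ^ 2 := by
    have h1 : ph * (a ^ 2 * (U * s) / k) ≤ ph * (M * (a * s)) := by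
      gcongr
      rw [div_le_iff₀ hk]
      calc a ^ 2 * (U * s) ≤ a ^ 2 * (M * y * s) := by gcongr
        _ = M * (a * s) * (a * y) := by ring
        _ ≤ M * (a * s) * k := by gcongr; linarith
    refine h1.trans (le_add_of_sq_le (by positivity) (by positivity) (le_of_sub_nonneg ?_))
    have : 4 * (M ^ 2 * ph ^ 2 / η) * (η * (a * s) ^ 2) - (ph * (M * (a * s))) ^ 2 =
      3 * (ph * (M * (a * s))) ^ 2 := by field_simp; ring
    rw [this]; positivity
  have T2 : U * n * (a ^ 2 * (U * s) / k) ≤ M ^ 3 * (a * y * U * n ^ 2) / η + η * (a * s) ^ 2 := by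
    refine le_add_of_sq_le (by positivity) (by positivity) ?_
    have h1 : U ^ 3 * a ≤ M ^ 3 * y * k ^ 2 := by
      calc U ^ 3 * a ≤ (M * y) ^ 3 * a := by gcongr
        _ = M ^ 3 * y * (a * y ^ 2) := by ring
        _ ≤ _ := by gcongr
    calc (U * n * (a ^ 2 * (U * s) / k)) ^ 2 = U ^ 3 * a * (U * n ^ 2 * (a * s) ^ 2 * a) / k ^ 2 := by
          field_simp
      _ ≤ M ^ 3 * y * k ^ 2 * (U * n ^ 2 * (a * s) ^ 2 * a) / k ^ 2 := by gcongr
      _ = M ^ 3 * (a * y * U * n ^ 2) / η * (η * (a * s) ^ 2) := by field_simp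
      _ ≤ _ := by
          rw [mul_assoc 4]
          exact le_mul_of_one_le_left (by positivity) (by norm_num)
  have T3 : 8 * a ^ 3 * y * n * g ≤ 24 * M * (a * y * U * n ^ 2) / η + η * g ^ 2 := by
    refine le_add_of_sq_le (by positivity) (by positivity) ?_
    calc (8 * a ^ 3 * y * n * g) ^ 2 = 64 * (a ^ 3 * y) * (n ^ 2 * g ^ 2 * y * a) * a ^ 2 := by ring
      _ ≤ 64 * (3 / 2 * M * U) * (n ^ 2 * g ^ 2 * y * a) * 1 := by
          gcongr
          exact pow_le_one₀ a0.le a1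
      _ = _ := by field_simp; ring
  have T4 : 8 * a ^ 3 * y * n * (M * s) ≤ 24 * M ^ 3 * (a * y * U * n ^ 2) / η + η * (a * s) ^ 2 := by
    refine le_add_of_sq_le (by positivity) (by positivity) ?_
    calc (8 * a ^ 3 * y * n * (M * s)) ^ 2 =
          64 * M ^ 2 * (a ^ 3 * y) * (n ^ 2 * (a * s) ^ 2 * y * a) := by ring
      _ ≤ 64 * M ^ 2 * (3 / 2 * M * U) * (n ^ 2 * (a * s) ^ 2 * y * a) := by gcongr
      _ = _ := by field_simp; ring
  have T5 : 20 * a ^ 3 * n * (U * s) ≤ 100 * M * (a * y * U * n ^ 2) / η + η * (a * s) ^ 2 := by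
    refine le_add_of_sq_le (by positivity) (by positivity) ?_
    calc (20 * a ^ 3 * n * (U * s)) ^ 2 = 400 * U * (n ^ 2 * (a * s) ^ 2 * U * a) * a ^ 3 := by ring
      _ ≤ 400 * (M * y) * (n ^ 2 * (a * s) ^ 2 * U * a) * 1 := by
          gcongr
          exact pow_le_one₀ a0.le a1
      _ = _ := by field_simp; ring
  have hM3 : M ≤ M ^ 3 := le_self_pow₀ M1 (by norm_num)
  have hM2 : M ^ 2 ≤ M ^ 3 := pow_le_pow_right₀ M1 (by norm_num)
  have e1 : M ^ 2 * ph ^ 2 / η ≤ 150 * M ^ 3 / η * ph ^ 2 := by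
    rw [div_mul_eq_mul_div]
    gcongr
    nlinarith [pow_pos hM 3]
  have e2 : M ^ 3 * (a * y * U * n ^ 2) / η + 24 * M * (a * y * U * n ^ 2) / η +
      24 * M ^ 3 * (a * y * U * n ^ 2) / η + 100 * M * (a * y * U * n ^ 2) / η ≤
      150 * M ^ 3 / η * (a * y * U * n ^ 2) := by
    rw [← add_div, ← add_div, ← add_div, ← add_mul, ← add_mul, ← add_mul, div_mul_eq_mul_div]
    gcongr
    linarith
  linarith

/-- `layer_identity` with ε = k³, divided by k. The parameter η is left free because the trace on
the right is in turn bounded by the left-hand side in `Sol.trace_le`, and a small η closes that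
circle. -/
theorem Sol.layer_pre (S : Sol U U1 U2 u M k α p q w w1 w2 f) {η : ℝ} (hη : 0 < η) :
    k ^ 2 * ∫ y in Ioi (0 : ℝ), layerCut k y * ‖w y‖ ^ 2 ≤
      150 * M ^ 3 / η * (shearInt k U w + sqInt f) +
        321 * M ^ 2 * η * (k * ‖psi U p k‖ ^ 2 + sqInt (gee U U1 p q)) := by
  have hk := S.k0
  have hM := S.F.M_pos
  have mg := memLp_gee S.F S.W
  have iH := integrable_norm_sq_of_memLp (memLp_weight_psi S.F S.W hk)
  have ig : IntegrableOn (fun y => ‖gee U U1 p q y‖ ^ 2) (Ioi 0) := integrable_norm_sq_of_memLp mg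
  have iff : IntegrableOn (fun y => ‖f y‖ ^ 2) (Ioi 0) := integrable_norm_sq_of_memLp S.mf
  have ib := integrableOn_shear S.F hk S.W.m2
  have hB1 : ∀ y, 0 < y → 4 * k ^ 4 * y / (k ^ 2 + y ^ 2) ^ 3 ≤ 4 / k := fun y hy => by
    rw [div_le_div_iff₀ (by positivity) hk]
    have h1 : y * k ≤ k ^ 2 + y ^ 2 := by nlinarith [sq_nonneg (y - k)]
    have h2 : (k ^ 2) ^ 2 ≤ (k ^ 2 + y ^ 2) ^ 2 := by gcongr; nlinarith [sq_nonneg y]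
    calc 4 * k ^ 4 * y * k = 4 * ((y * k) * (k ^ 2) ^ 2) := by ring
      _ ≤ 4 * ((k ^ 2 + y ^ 2) * (k ^ 2 + y ^ 2) ^ 2) := by gcongr
      _ = _ := by ring
  have hB2 : ∀ y, 20 * k ^ 4 / (k ^ 2 + y ^ 2) ^ 3 ≤ 20 / k ^ 2 := fun y => by
    rw [div_le_div_iff₀ (by positivity) (by positivity)]
    have h2 : (k ^ 2) ^ 3 ≤ (k ^ 2 + y ^ 2) ^ 3 := by gcongr; nlinarith [sq_nonneg y]
    calc 20 * k ^ 4 * k ^ 2 = 20 * (k ^ 2) ^ 3 := by ring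
      _ ≤ _ := by gcongr
  have hid := layer_identity S.F S.W S.E S.mf (B := 1 + 4 / k + 20 / k ^ 2)
    (hasDerivAt_layerCut hk) (hasDerivAt_layerCut' hk)
    (Continuous.add (Continuous.div (by fun_prop) (by fun_prop) fun y => by positivity)
      (Continuous.div (by fun_prop) (by fun_prop) fun y => by positivity))
    (fun y _ => by
      rw [abs_of_nonneg (layerCut_nonneg k y)]
      have := layerCut_le_one hk y
      have : 0 ≤ 4 / k + 20 / k ^ 2 := by positivity
      linarith)
    (fun y hy => (abs_layerCut'_le hk hy.le).trans ((hB1 y hy).trans (by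
      have : 0 ≤ 20 / k ^ 2 := by positivity
      linarith)))
    (fun y hy => (abs_layerCut''_le hk y).trans ((hB2 y).trans (by
      have : 0 ≤ 4 / k := by positivity
      linarith)))
  have key : k ^ 3 * ∫ y in Ioi (0 : ℝ), layerCut k y * ‖w y‖ ^ 2 ≤
      ∫ y in Ioi (0 : ℝ), (k * (150 * M ^ 3 / η) *
        (k ^ 2 * y / (k ^ 2 + y ^ 2) * U y * ‖w y‖ ^ 2 + ‖f y‖ ^ 2) +
        k * η * (16 * ‖(k ^ 2 / (k + y) ^ 2) • psi U p y‖ ^ 2 + ‖gee U U1 p q y‖ ^ 2)) := by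
    rw [hid]
    refine setIntegral_le_of_le (((ib.add iff).const_mul _).add
      (((iH.const_mul _).add ig).const_mul _)) (fun y hy => ?_) fun y hy => ?_
    · have := S.F.pos hy
      positivity
    have hP : 0 < k ^ 2 + y ^ 2 := by positivity
    obtain ⟨a, ha⟩ : ∃ a, a = k ^ 2 / (k ^ 2 + y ^ 2) := ⟨_, rfl⟩
    have a0 : 0 < a := by rw [ha]; positivity
    have hm : layerCut k y = a ^ 2 := by rw [layerCut, ha]; field_simp
    have hU := S.F.pos hy
    have np := norm_eq_U_mul_psi S.F p hy
    have h1 : inner ℝ (f y) (Complex.I * (layerCut k y • p y)) ≤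
        ‖f y‖ * (a ^ 2 * (U y * ‖psi U p y‖)) := by
      refine inner_le_mul le_rfl ?_
      rw [norm_mul, Complex.norm_I, one_mul, norm_smul, hm, Real.norm_of_nonneg (by positivity), np]
    have h2 : -inner ℝ (U y • w y) (Complex.I * (layerCut k y • p y)) ≤
        U y * ‖w y‖ * (a ^ 2 * (U y * ‖psi U p y‖)) := by
      refine neg_inner_le_mul ?_ ?_
      · rw [norm_smul, Real.norm_of_nonneg hU.le]
      · rw [norm_mul, Complex.norm_I, one_mul, norm_smul, hm, Real.norm_of_nonneg (by positivity), np]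
    have h3 : -inner ℝ (w y) ((-4 * k ^ 4 / (k ^ 2 + y ^ 2) ^ 3 +
          24 * k ^ 4 * y ^ 2 / (k ^ 2 + y ^ 2) ^ 4) • p y +
          (2 * (-4 * k ^ 4 * y / (k ^ 2 + y ^ 2) ^ 3)) • q y) ≤
        ‖w y‖ * (20 * k ^ 4 / (k ^ 2 + y ^ 2) ^ 3 * (U y * ‖psi U p y‖) +
          2 * (4 * k ^ 4 * y / (k ^ 2 + y ^ 2) ^ 3) *
            (‖gee U U1 p q y‖ + M * ‖psi U p y‖)) := by
      refine neg_inner_le_mul le_rfl ((norm_add_le _ _).trans (add_le_add ?_ ?_))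
      · rw [norm_smul, np, Real.norm_eq_abs]
        exact mul_le_mul_of_nonneg_right (abs_layerCut''_le hk y) (by positivity)
      · rw [norm_smul, Real.norm_eq_abs, abs_mul, abs_two]
        exact mul_le_mul (mul_le_mul_of_nonneg_left (abs_layerCut'_le hk (le_of_lt hy)) two_pos.le)
          (norm_q_le S.F p q hy) (norm_nonneg _) (by positivity)
    have h4 := layer_pointwise (k := k) (y := y) (U := U y) (M := M) (η := η) (n := ‖w y‖)
      (s := ‖psi U p y‖) (g := ‖gee U U1 p q y‖) (ph := ‖f y‖) (a := a) hk S.k1 hy a0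
      (by rw [ha, div_le_one hP]; nlinarith [sq_nonneg y])
      (by rw [ha, div_mul_eq_mul_div]; exact shearWeight_le hk y)
      (by rw [ha, div_mul_eq_mul_div, div_le_iff₀ hP]
          exact mul_le_mul_of_nonneg_left (by nlinarith [sq_nonneg k]) (by positivity))
      hU (S.F.le_mul y (le_of_lt hy)) (S.F.ge y (le_of_lt hy)) S.F.one_le hη
      (norm_nonneg _) (norm_nonneg _)
    have h5 : (a * ‖psi U p y‖) ^ 2 ≤ 4 * ‖(k ^ 2 / (k + y) ^ 2) • psi U p y‖ ^ 2 := by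
      rw [norm_smul, Real.norm_of_nonneg (by positivity)]
      have : a ≤ 2 * (k ^ 2 / (k + y) ^ 2) := by
        rw [ha, mul_div_assoc', div_le_div_iff₀ hP (by have : 0 < y := hy; positivity)]
        nlinarith [mul_nonneg (sq_nonneg k) (sq_nonneg (k - y))]
      calc (a * ‖psi U p y‖) ^ 2 ≤ (2 * (k ^ 2 / (k + y) ^ 2) * ‖psi U p y‖) ^ 2 := by gcongr
        _ = _ := by ring
    have e1 : ‖f y‖ * (a ^ 2 * (U y * ‖psi U p y‖)) + U y * ‖w y‖ * (a ^ 2 * (U y * ‖psi U p y‖)) +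
        k ^ 3 * (‖w y‖ * (20 * k ^ 4 / (k ^ 2 + y ^ 2) ^ 3 * (U y * ‖psi U p y‖) +
          2 * (4 * k ^ 4 * y / (k ^ 2 + y ^ 2) ^ 3) *
            (‖gee U U1 p q y‖ + M * ‖psi U p y‖))) =
        k * (‖f y‖ * (a ^ 2 * (U y * ‖psi U p y‖) / k) +
          U y * ‖w y‖ * (a ^ 2 * (U y * ‖psi U p y‖) / k) +
          (20 * a ^ 3 * ‖w y‖ * (U y * ‖psi U p y‖) +
            8 * a ^ 3 * y * ‖w y‖ * (‖gee U U1 p q y‖ + M * ‖psi U p y‖))) := by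
      rw [ha]; field_simp; ring
    have e2 : k ^ 2 * y / (k ^ 2 + y ^ 2) = a * y := by rw [ha]; ring
    have h6 := mul_le_mul_of_nonneg_left h3 (pow_pos hk 3).le
    have h7 := mul_le_mul_of_nonneg_left h4 hk.le
    have h8 := mul_le_mul_of_nonneg_left h5 (mul_pos hk hη).le
    rw [← e1] at h7
    rw [e2]
    linarith
  rw [integral_add ((integrableOn_add ib iff).const_mul _)
    ((integrableOn_add (iH.const_mul _) ig).const_mul _), integral_const_mul, integral_const_mul, integral_add ib iff,
    integral_add (iH.const_mul _) ig, integral_const_mul] at key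
  have hw := weighted_psi S.F S.W hk le_rfl S.k1
  rw [div_self hk.ne', mul_one] at hw
  change k ^ 3 * _ ≤ k * (150 * M ^ 3 / η) * (shearInt k U w + sqInt f) +
    k * η * (16 * _ + sqInt (gee U U1 p q)) at key
  change _ ≤ 20 * M ^ 2 * (k * ‖psi U p k‖ ^ 2 + sqInt (gee U U1 p q)) at hw
  have hG := sqInt_nonneg (gee U U1 p q)
  have hM1 : 1 ≤ M ^ 2 := one_le_pow₀ S.F.one_le
  have ha2 : 0 ≤ k * ‖psi U p k‖ ^ 2 := by positivity
  refine le_of_mul_le_mul_left ?_ hk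
  -- 321 = 16·20 + 1: the constant of `weighted_psi` at L = k, and the explicit g term.
  have h9 : k * η * (16 * (∫ y in Ioi (0 : ℝ), ‖(k ^ 2 / (k + y) ^ 2) • psi U p y‖ ^ 2) +
      sqInt (gee U U1 p q)) ≤ k * η * (321 * M ^ 2 * (k * ‖psi U p k‖ ^ 2 + sqInt (gee U U1 p q))) := by
    gcongr
    nlinarith
  linarith

/-- The trace of `psi` at the edge of the layer is controlled by the vorticity inside the layer. -/
theorem Sol.trace_le (S : Sol U U1 U2 u M k α p q w w1 w2 f) :
    k * ‖psi U p k‖ ^ 2 ≤ 32 * M ^ 2 * (k ^ 2 * ∫ y in Ioi (0 : ℝ), layerCut k y * ‖w y‖ ^ 2) +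
      8 * M ^ 2 * (α ^ 2 * sqInt p) := by
  have hk := S.k0
  have hM := S.F.M_pos
  have hsub : Ioc 0 k ⊆ Ioi 0 := fun x hx => hx.1
  have iw : IntegrableOn (fun y => ‖w y‖ ^ 2) (Ioi 0) := integrable_norm_sq_of_memLp S.W.m2
  have ip : IntegrableOn (fun y => ‖p y‖ ^ 2) (Ioi 0) := integrable_norm_sq_of_memLp S.W.m0
  have mh : MemLp (fun y => w y + (α ^ 2) • p y) 2 halfLine := S.W.m2.add (S.W.m0.const_smul (α ^ 2))
  have ch : Continuous (fun y => w y + (α ^ 2) • p y) := S.W.c2.add (S.W.c0.const_smul (α ^ 2))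
  set N : ℝ := ∫ y in Ioc 0 k, ‖w y + (α ^ 2) • p y‖ ^ 2 with hN
  have hN0 : 0 ≤ N := integral_nonneg fun _ => by positivity
  -- By no-slip, q is the integral of w + α²p from the wall, so |q|² ≤ kN on the layer and |p(k)|² ≤
  -- k³N. Dividing by U(k) ≳ k turns this into k|ψ(k)|² ≲ k²N.
  have hq : ∀ y, 0 ≤ y → y ≤ k → ‖q y‖ ≤ Real.sqrt (k * N) := by
    intro y hy hyk
    refine Real.le_sqrt_of_sq_le ?_
    have e : q y = ∫ t in (0 : ℝ)..y, (w t + (α ^ 2) • p t) := by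
      rw [intervalIntegral.integral_eq_sub_of_hasDerivAt (fun x _ => S.W.d1 x)
        (ch.intervalIntegrable _ _), S.W.z1, sub_zero]
    have h1 : ‖q y‖ ≤ ∫ t in Ioc 0 k, ‖(1 : ℂ)‖ * ‖w t + (α ^ 2) • p t‖ := by
      rw [e]
      refine (intervalIntegral.norm_integral_le_integral_norm hy).trans ?_
      simp only [norm_one, one_mul]
      rw [intervalIntegral.integral_of_le hy]
      refine setIntegral_mono_set ((ch.norm.integrableOn_Icc (a := 0) (b := k)).mono_set
        Ioc_subset_Icc_self) (Eventually.of_forall fun _ => norm_nonneg _)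
        (Ioc_subset_Ioc_right hyk).eventuallyLE
    have h2 := sq_integral_norm_mul_le (μ := volume.restrict (Ioc 0 k)) (f := fun _ => (1 : ℂ))
      (memLp_const _) (halfLine_mono mh hsub)
    have h3 : ∫ _ in Ioc 0 k, ‖(1 : ℂ)‖ ^ 2 = k := by simp [hk.le]
    rw [h3] at h2
    exact (pow_le_pow_left₀ (norm_nonneg _) h1 2).trans h2
  have hp : ‖p k‖ ^ 2 ≤ k ^ 3 * N := by
    have h := norm_le_of_hasDerivAt S.W.d0 S.W.z0 hk.le fun t ht htk => hq t ht htk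
    calc ‖p k‖ ^ 2 ≤ (Real.sqrt (k * N) * k) ^ 2 := pow_le_pow_left₀ (norm_nonneg _) h 2
      _ = k ^ 3 * N := by rw [mul_pow, Real.sq_sqrt (by positivity)]; ring
  have hψ : ‖psi U p k‖ ≤ 2 * M / k * ‖p k‖ := by
    refine (norm_psi_le S.F p hk).trans ?_
    have h : M * (1 + k) ≤ 2 * M := by nlinarith [S.k1]
    exact mul_le_mul_of_nonneg_right (div_le_div_of_nonneg_right h hk.le) (norm_nonneg _)
  have hN2 : N ≤ 2 * (4 * ∫ y in Ioi (0 : ℝ), layerCut k y * ‖w y‖ ^ 2) + 2 * α ^ 4 * sqInt p := by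
    have i1 := integrableOn_weight_norm_sq (B := 1) (continuous_layerCut hk).continuousOn
      (fun y _ => by rw [abs_of_nonneg (layerCut_nonneg k y)]; exact layerCut_le_one hk y) S.W.m2
    have i2 : IntegrableOn (fun y => 8 * (layerCut k y * ‖w y‖ ^ 2) + 2 * α ^ 4 * ‖p y‖ ^ 2)
      (Ioi 0) := (i1.const_mul 8).add (ip.const_mul _)
    have h1 : N ≤ ∫ y in Ioc 0 k, (8 * (layerCut k y * ‖w y‖ ^ 2) + 2 * α ^ 4 * ‖p y‖ ^ 2) := by
      refine setIntegral_mono_on (integrable_norm_sq_of_memLp (halfLine_mono mh hsub))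
        (i2.mono_set hsub) measurableSet_Ioc fun y hy => ?_
      have h4 : 1 / 4 ≤ layerCut k y := by
        rw [layerCut, div_le_div_iff₀ (by norm_num) (by have := hy.1; positivity)]
        have : y ^ 2 ≤ k ^ 2 := pow_le_pow_left₀ hy.1.le hy.2 2
        nlinarith [sq_nonneg y, sq_nonneg k]
      have h5 : ‖w y + (α ^ 2) • p y‖ ≤ ‖w y‖ + α ^ 2 * ‖p y‖ := by
        refine (norm_add_le _ _).trans (le_of_eq ?_)
        rw [norm_smul, Real.norm_of_nonneg (by positivity)]
      have h6 := pow_le_pow_left₀ (norm_nonneg _) h5 2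
      nlinarith [sq_nonneg (‖w y‖ - α ^ 2 * ‖p y‖), sq_nonneg ‖w y‖]
    refine h1.trans ((setIntegral_mono_set i2
      (Eventually.of_forall fun y => ?_) hsub.eventuallyLE).trans (le_of_eq ?_))
    · have := layerCut_nonneg k y
      simp only [Pi.zero_apply]
      positivity
    · rw [integral_add (i1.const_mul 8) (ip.const_mul _), integral_const_mul, integral_const_mul,
        sqInt]
      ring
  have hka : k ^ 2 * α ^ 2 ≤ 1 := by
    rw [← mul_pow]; exact pow_le_one₀ (mul_pos hk S.a0).le S.ka
  have hp0 := sqInt_nonneg p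
  calc k * ‖psi U p k‖ ^ 2 ≤ k * (2 * M / k * ‖p k‖) ^ 2 := by gcongr
    _ = 4 * M ^ 2 / k * ‖p k‖ ^ 2 := by field_simp; ring
    _ ≤ 4 * M ^ 2 / k * (k ^ 3 * N) := by gcongr
    _ = 4 * M ^ 2 * k ^ 2 * N := by field_simp
    _ ≤ 4 * M ^ 2 * k ^ 2 * (2 * (4 * ∫ y in Ioi (0 : ℝ), layerCut k y * ‖w y‖ ^ 2) +
        2 * α ^ 4 * sqInt p) := by gcongr
    _ = 32 * M ^ 2 * (k ^ 2 * ∫ y in Ioi (0 : ℝ), layerCut k y * ‖w y‖ ^ 2) +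
        8 * M ^ 2 * ((k ^ 2 * α ^ 2) * (α ^ 2 * sqInt p)) := by ring
    _ ≤ _ := by
        have := mul_le_of_le_one_left (mul_nonneg (sq_nonneg α) hp0) hka
        gcongr

/-- The layer part of the vorticity and the trace are controlled by the interior energy. -/
theorem layer_bound (hM : 1 ≤ M) : ∃ C, 1 ≤ C ∧ ∀ {U U1 U2 u k α p q w w1 w2 f},
    Sol U U1 U2 u M k α p q w w1 w2 f →
    (k ^ 2 * ∫ y in Ioi (0 : ℝ), layerCut k y * ‖w y‖ ^ 2) + k * ‖psi U p k‖ ^ 2 ≤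
      C * (shearInt k U w + sqInt f + α ^ 2 * sqInt p + sqInt (gee U U1 p q)) := by
  refine ⟨10 ^ 9 * M ^ 9, ?_, fun {U U1 U2 u k α p q w w1 w2 f} S => ?_⟩
  · have : 1 ≤ M ^ 9 := one_le_pow₀ hM
    linarith
  have hM0 : 0 < M := by linarith
  -- With this η the trace returns with coefficient 32M²·321M²·η = 32·321/30000 < 1/2 after
  -- insertion into `Sol.trace_le`, and is absorbed.
  have h1 := S.layer_pre (η := 1 / (30000 * M ^ 4)) (by positivity)
  have h2 := S.trace_le
  have hB := shearInt_nonneg S.F S.k0 w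
  have hD := sqInt_nonneg f
  have hG := sqInt_nonneg (gee U U1 p q)
  have hF := mul_nonneg (sq_nonneg α) (sqInt_nonneg p)
  have ha2 : 0 ≤ k * ‖psi U p k‖ ^ 2 := by have := S.k0; positivity
  set X := k ^ 2 * ∫ y in Ioi (0 : ℝ), layerCut k y * ‖w y‖ ^ 2
  set a2 := k * ‖psi U p k‖ ^ 2
  set G := sqInt (gee U U1 p q)
  set B := shearInt k U w
  set D := sqInt f
  set F2 := α ^ 2 * sqInt p
  have e1 : 150 * M ^ 3 / (1 / (30000 * M ^ 4)) * (B + D) = 4500000 * M ^ 7 * (B + D) := by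
    field_simp; ring
  have e2 : 321 * M ^ 2 * (1 / (30000 * M ^ 4)) * (a2 + G) = 107 / 10000 * ((a2 + G) / M ^ 2) := by
    field_simp; ring
  rw [e1, e2] at h1
  have h3 := mul_le_mul_of_nonneg_left h1 (by positivity : 0 ≤ 32 * M ^ 2)
  have e3 : 32 * M ^ 2 * (4500000 * M ^ 7 * (B + D) + 107 / 10000 * ((a2 + G) / M ^ 2)) =
      144000000 * (M ^ 9 * (B + D)) + 32 * 107 / 10000 * (a2 + G) := by field_simp; ring
  rw [e3] at h3
  have p2 : M ^ 2 ≤ M ^ 9 := pow_le_pow_right₀ hM (by norm_num)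
  have p7 : M ^ 7 ≤ M ^ 9 := pow_le_pow_right₀ hM (by norm_num)
  have p9 : 1 ≤ M ^ 9 := one_le_pow₀ hM
  have h4 : (a2 + G) / M ^ 2 ≤ a2 + G := div_le_self (by positivity) (one_le_pow₀ hM)
  have q1 : M ^ 7 * (B + D) ≤ M ^ 9 * (B + D) := by gcongr
  have q2 : M ^ 2 * F2 ≤ M ^ 9 * F2 := by gcongr
  have q3 : G ≤ M ^ 9 * G := le_mul_of_one_le_left hG p9
  have q4 : 0 ≤ M ^ 9 * (B + D) := by positivity
  have q5 : 0 ≤ M ^ 9 * F2 := by positivity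
  have e4 : 10 ^ 9 * M ^ 9 * (B + D + F2 + G) =
    10 ^ 9 * (M ^ 9 * (B + D)) + 10 ^ 9 * (M ^ 9 * F2) + 10 ^ 9 * (M ^ 9 * G) := by ring
  rw [e4]
  linarith

end OrrSommerfeld

/-! ### Vorticity outside the layer -/

namespace OrrSommerfeld

variable {U U1 U2 : ℝ → ℝ} {u M k α ε : ℝ} {p q w w1 w2 f : ℝ → ℂ}

/-- The integrand of the weak form of the equation. -/
noncomputable def weakForm (U U2 : ℝ → ℝ) (ε α : ℝ) (p w w1 f V V' : ℝ → ℂ) (y : ℝ) : ℝ :=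
  inner ℝ (U y • w y - U2 y • p y) (V y) - ε * inner ℝ (Complex.I * w1 y) (V' y)
    - ε * α ^ 2 * inner ℝ (Complex.I * w y) (V y) - inner ℝ (f y) (V y)

theorem integral_weakForm (F : Flow U U1 U2 u M) (W : Wave α p q w w1 w2)
    (E : OSEq U U2 ε α p w w2 f) (mf : MemLp f 2 halfLine)
    {V V' : ℝ → ℂ} (hV0 : ContinuousWithinAt V (Ioi 0) 0) (hV : V 0 = 0)
    (hVd : ∀ y, 0 < y → HasDerivAt V (V' y) y) (hV'c : ContinuousOn V' (Ioi 0))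
    (mV : MemLp V 2 halfLine) (mV' : MemLp V' 2 halfLine) :
    IntegrableOn (weakForm U U2 ε α p w w1 f V V') (Ioi 0) ∧
      ∫ y in Ioi (0 : ℝ), weakForm U U2 ε α p w w1 f V V' y = 0 := by
  have mR : MemLp (fun y => U y • w y - U2 y • p y) 2 halfLine :=
    (memLp_U_smul F W.m2).sub (memLp_U2_smul F W.m0)
  have i1 : IntegrableOn (fun y => inner ℝ (U y • w y - U2 y • p y) (V y)) (Ioi 0) :=
    integrable_inner_of_memLp mR mV
  have i2 : IntegrableOn (fun y => ε * inner ℝ (Complex.I * w1 y) (V' y)) (Ioi 0) :=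
    (integrable_inner_of_memLp (memLp_I_mul W.m3) mV').const_mul _
  have i3 : IntegrableOn (fun y => ε * α ^ 2 * inner ℝ (Complex.I * w y) (V y)) (Ioi 0) :=
    (integrable_inner_of_memLp (memLp_I_mul W.m2) mV).const_mul _
  have i4 : IntegrableOn (fun y => inner ℝ (f y) (V y)) (Ioi 0) := integrable_inner_of_memLp mf mV
  refine ⟨((i1.sub i2).sub i3).sub i4, ?_⟩
  simp only [weakForm]
  rw [integral_sub (integrableOn_sub (integrableOn_sub i1 i2) i3) i4,
    integral_sub (integrableOn_sub i1 i2) i3, integral_sub i1 i2, integral_const_mul,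
    integral_const_mul, test_identity F W E hV0 hV hVd hV'c mV mV']
  ring

theorem hasDerivAt_growth {k : ℝ} (hk : 0 < k) (y : ℝ) :
    HasDerivAt (fun y => k * y ^ 2 / (k ^ 2 + y ^ 2)) (2 * k ^ 3 * y / (k ^ 2 + y ^ 2) ^ 2) y := by
  have hP : k ^ 2 + y ^ 2 ≠ 0 := by positivity
  have h2 := (((hasDerivAt_id y).pow 2).const_mul k).div (((hasDerivAt_id y).pow 2).const_add (k ^ 2)) hP
  refine h2.congr_deriv ?_
  simp only [id, Pi.pow_apply]
  field_simp
  push_cast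
  ring

/-- The errors of `Sol.growth_bound`, with n, n1, ph, s, t the sizes of w, w', f, ψ, U''. The data
and U'' terms are absorbed by ρU|w|². The commutator with ρ' lives in the layer: ρ'² = ρ·4k⁵/P³ lets
it be split between the dissipation ρ|w'|² and the cut-off vorticity. -/
theorem growth_pointwise {k y ρ ρ' m U M P n n1 ph s t : ℝ} (hk : 0 < k) (hk1 : k ≤ 1) (hy : 0 < y)
    (hP : P = k ^ 2 + y ^ 2) (hρ : ρ = k * y ^ 2 / P) (hρ' : ρ' = 2 * k ^ 3 * y / P ^ 2)
    (hm : m = k ^ 4 / P ^ 2) (U0 : 0 < U) (hUM : U ≤ M) (hU : y ≤ M * (1 + y) * U)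
    (M0 : 0 < M) (hn : 0 ≤ n) (hs : 0 ≤ s)
    (hph : 0 ≤ ph) (ht0 : 0 ≤ t) (ht : t * (1 + y) ^ 3 ≤ M) :
    2 * (ρ * t * (U * s) * n) + 2 * k ^ 3 * (ρ' * n1 * n) + 2 * (ρ * ph * n) ≤
      1 / 2 * (ρ * U * n ^ 2) + k ^ 3 * (ρ * n1 ^ 2) + 8 * M * ph ^ 2 +
        4 * k * M ^ 3 * (1 / (1 + y) ^ 2 * s) ^ 2 + 4 * (k ^ 2 * (m * n ^ 2)) := by
  have hP0 : 0 < P := by rw [hP]; positivity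
  have ρ0 : 0 < ρ := by rw [hρ]; positivity
  have ρk : ρ ≤ k := by
    rw [hρ, div_le_iff₀ hP0, hP]; gcongr; nlinarith [sq_nonneg k]
  have T1 : 2 * (ρ * ph * n) ≤ 1 / 4 * (ρ * U * n ^ 2) + 8 * M * ph ^ 2 := by
    have h1 : ρ ≤ 2 * M * U := by
      rw [hρ, div_le_iff₀ hP0]
      have h2 : k * y * (1 + y) ≤ 2 * P := by
        rw [hP]; nlinarith [sq_nonneg (k - y), mul_nonneg (sub_nonneg.2 hk1) (sq_nonneg y)]
      calc k * y ^ 2 = k * y * y := by ring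
        _ ≤ k * y * (M * (1 + y) * U) := by gcongr
        _ = M * U * (k * y * (1 + y)) := by ring
        _ ≤ M * U * (2 * P) := by gcongr
        _ = _ := by ring
    have h3 : 4 * ρ * ph ^ 2 ≤ 8 * M * U * ph ^ 2 := by nlinarith [sq_nonneg ph]
    refine le_of_mul_le_mul_left ?_ U0
    nlinarith [mul_nonneg ρ0.le (sq_nonneg (U * n - 4 * ph))]
  have T2 : 2 * (ρ * t * (U * s) * n) ≤ 1 / 4 * (ρ * U * n ^ 2) +
      4 * k * M ^ 3 * (1 / (1 + y) ^ 2 * s) ^ 2 := by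
    have h1 : t ≤ M * (1 / (1 + y) ^ 2) := by
      rw [mul_one_div, le_div_iff₀ (by positivity)]
      refine le_trans ?_ ht
      gcongr
      · linarith
      · norm_num
    have h2 : 2 * (ρ * t * (U * s) * n) ≤ 1 / 4 * (ρ * U * n ^ 2) + 4 * (ρ * U) * (t * s) ^ 2 := by
      nlinarith [mul_nonneg (mul_nonneg ρ0.le U0.le) (sq_nonneg (n - 4 * (t * s)))]
    refine h2.trans (add_le_add le_rfl ?_)
    calc 4 * (ρ * U) * (t * s) ^ 2 ≤ 4 * (k * M) * (M * (1 / (1 + y) ^ 2) * s) ^ 2 := by gcongr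
      _ = _ := by ring
  have T3 : 2 * k ^ 3 * (ρ' * n1 * n) ≤ k ^ 3 * (ρ * n1 ^ 2) + 4 * (k ^ 2 * (m * n ^ 2)) := by
    have h1 : 2 * (ρ' * n1 * n) ≤ ρ * n1 ^ 2 + 4 * k ^ 5 / P ^ 3 * n ^ 2 := by
      have : ρ * (4 * k ^ 5 / P ^ 3) = ρ' ^ 2 := by rw [hρ, hρ']; field_simp; norm_num
      refine le_of_mul_le_mul_left ?_ ρ0
      nlinarith [sq_nonneg (ρ * n1 - ρ' * n)]
    have h2 : k ^ 3 * (4 * k ^ 5 / P ^ 3) ≤ 4 * (k ^ 2 * m) := by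
      rw [hm, mul_div_assoc', mul_div_assoc', mul_div_assoc', div_le_div_iff₀ (by positivity) (by positivity)]
      have : k ^ 2 ≤ P := by rw [hP]; nlinarith [sq_nonneg y]
      calc k ^ 3 * (4 * k ^ 5) * P ^ 2 = 4 * (k ^ 2 * k ^ 4) * (k ^ 2 * P ^ 2) := by ring
        _ ≤ 4 * (k ^ 2 * k ^ 4) * (P * P ^ 2) := by gcongr
        _ = _ := by ring
    have h3 := mul_le_mul_of_nonneg_left h1 (pow_pos hk 3).le
    have h4 := mul_le_mul_of_nonneg_right h2 (sq_nonneg n)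
    linarith
  linarith

/-- The vorticity is controlled by its layer part, the data, and the streamfunction. -/
theorem Sol.growth_bound (S : Sol U U1 U2 u M k α p q w w1 w2 f) :
    k ^ 2 * sqInt w ≤ 36 * M * (k ^ 2 * ∫ y in Ioi (0 : ℝ), layerCut k y * ‖w y‖ ^ 2) +
      64 * M ^ 2 * sqInt f + 640 * M ^ 6 * (k * ‖psi U p k‖ ^ 2 + sqInt (gee U U1 p q)) := by
  have hk := S.k0
  have hM := S.F.M_pos
  have hPc : ∀ y : ℝ, k ^ 2 + y ^ 2 ≠ 0 := fun y => by positivity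
  let ρ : ℝ → ℝ := fun y => k * y ^ 2 / (k ^ 2 + y ^ 2)
  let ρ' : ℝ → ℝ := fun y => 2 * k ^ 3 * y / (k ^ 2 + y ^ 2) ^ 2
  have cρ : Continuous ρ := Continuous.div (by fun_prop) (by fun_prop) hPc
  have cρ' : Continuous ρ' := Continuous.div (by fun_prop) (by fun_prop) fun y => pow_ne_zero _ (hPc y)
  have ρ0 : ∀ y, 0 ≤ ρ y := fun y => by simp only [ρ]; positivity
  have ρ0' : ∀ y, 0 < y → 0 ≤ ρ' y := fun y hy => by simp only [ρ']; positivity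
  have bρ : ∀ y, 0 < y → |ρ y| ≤ k := fun y hy => by
    rw [abs_of_nonneg (ρ0 y)]
    simp only [ρ]
    rw [div_le_iff₀ (by positivity)]
    gcongr
    nlinarith [sq_nonneg k]
  have bρ' : ∀ y, 0 < y → |ρ' y| ≤ 1 := fun y hy => by
    rw [abs_of_nonneg (ρ0' y hy)]
    simp only [ρ']
    rw [div_le_one (by positivity)]
    nlinarith [mul_nonneg (sq_nonneg k) (sq_nonneg (k - y)), sq_nonneg (y ^ 2), sq_nonneg (k * y)]
  -- Testing with ρ(1 - i)w: the real part gives ρU|w|², the factor -i gives ε(ρ|w'|² + α²ρ|w|²),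
  -- all with the same sign. Since ρ vanishes at the wall, the unknown wall value of w does not
  -- enter.
  let v : ℝ → ℂ := fun y => w y - Complex.I * w y
  let v1 : ℝ → ℂ := fun y => w1 y - Complex.I * w1 y
  have mv : MemLp v 2 halfLine := S.W.m2.sub (memLp_I_mul S.W.m2)
  have mv1 : MemLp v1 2 halfLine := S.W.m3.sub (memLp_I_mul S.W.m3)
  have cv : Continuous v := S.W.c2.sub (continuous_const.mul S.W.c2)
  have cv1 : Continuous v1 := S.W.c3.sub (continuous_const.mul S.W.c3)
  have dv : ∀ y, HasDerivAt v (v1 y) y := fun y => (S.W.d2 y).sub ((S.W.d2 y).const_mul _)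
  obtain ⟨iT, hT⟩ := integral_weakForm S.F S.W S.E S.mf (V := fun y => ρ y • v y)
    (V' := fun y => ρ y • v1 y + ρ' y • v y) (cρ.smul cv).continuousWithinAt
    (by simp [ρ]) (fun y _ => (hasDerivAt_growth hk y).smul (dv y))
    ((cρ.smul cv1).add (cρ'.smul cv)).continuousOn
    (memLp_smul_of_bound cρ.continuousOn bρ mv)
    ((memLp_smul_of_bound cρ.continuousOn bρ mv1).add (memLp_smul_of_bound cρ'.continuousOn bρ' mv))
  set T := weakForm U U2 (k ^ 3) α p w w1 f (fun y => ρ y • v y) (fun y => ρ y • v1 y + ρ' y • v y)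
  have i1 : IntegrableOn (fun y => layerCut k y * ‖w y‖ ^ 2) (Ioi 0) :=
    integrableOn_weight_norm_sq (B := 1) (continuous_layerCut hk).continuousOn
      (fun y _ => by rw [abs_of_nonneg (layerCut_nonneg k y)]; exact layerCut_le_one hk y) S.W.m2
  have i2 : IntegrableOn (fun y => ρ y * U y * ‖w y‖ ^ 2) (Ioi 0) :=
    integrableOn_weight_norm_sq (B := k * M) (cρ.mul S.F.contU).continuousOn
      (fun y hy => by
        rw [abs_mul, abs_of_nonneg (S.F.pos hy).le]
        exact mul_le_mul (bρ y hy) (S.F.le y hy.le) (S.F.pos hy).le hk.le) S.W.m2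
  have iff : IntegrableOn (fun y => ‖f y‖ ^ 2) (Ioi 0) := integrable_norm_sq_of_memLp S.mf
  have iH : IntegrableOn (fun y => ‖((1 : ℝ) ^ 2 / (1 + y) ^ 2) • psi U p y‖ ^ 2) (Ioi 0) :=
    integrable_norm_sq_of_memLp (memLp_weight_psi S.F S.W one_pos)
  have iw : IntegrableOn (fun y => ‖w y‖ ^ 2) (Ioi 0) := integrable_norm_sq_of_memLp S.W.m2
  have nv : ∀ y, ‖v y‖ ≤ 2 * ‖w y‖ := fun y => by
    refine (norm_sub_le _ _).trans (le_of_eq ?_)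
    rw [norm_mul, Complex.norm_I]; ring
  have hpt : ∀ y, 0 < y → 1 / 2 * (ρ y * U y * ‖w y‖ ^ 2) ≤ T y + (8 * M * ‖f y‖ ^ 2 +
      4 * k * M ^ 3 * ‖((1 : ℝ) ^ 2 / (1 + y) ^ 2) • psi U p y‖ ^ 2 +
      4 * k ^ 2 * (layerCut k y * ‖w y‖ ^ 2)) := by
    intro y hy
    have hU := S.F.pos hy
    have g := growth_pointwise (k := k) (y := y) (ρ := ρ y) (ρ' := ρ' y) (m := layerCut k y)
      (n := ‖w y‖) (n1 := ‖w1 y‖) (ph := ‖f y‖) (s := ‖psi U p y‖) (t := |U2 y|) hk S.k1 hy rfl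
      rfl rfl rfl hU (S.F.le y hy.le) (S.F.ge y hy.le) hM (norm_nonneg _) (norm_nonneg _)
      (norm_nonneg _) (abs_nonneg _) (S.F.b2 y hy.le)
    have e1 : inner ℝ (U y • w y) (ρ y • v y) = ρ y * U y * ‖w y‖ ^ 2 := by
      simp only [v]
      rw [real_inner_smul_left, real_inner_smul_right, inner_sub_right, inner_self_I_mul,
        real_inner_self_eq_norm_sq]
      ring
    have e2 : inner ℝ (Complex.I * w1 y) (ρ y • v1 y) = -(ρ y * ‖w1 y‖ ^ 2) := by
      simp only [v1]
      rw [real_inner_smul_right, inner_sub_right, inner_I_mul_self, inner_I_mul_I_mul,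
        real_inner_self_eq_norm_sq]
      ring
    have e3 : inner ℝ (Complex.I * w y) (ρ y • v y) = -(ρ y * ‖w y‖ ^ 2) := by
      simp only [v]
      rw [real_inner_smul_right, inner_sub_right, inner_I_mul_self, inner_I_mul_I_mul,
        real_inner_self_eq_norm_sq]
      ring
    have b1 : inner ℝ (U2 y • p y) (ρ y • v y) ≤ |U2 y| * (U y * ‖psi U p y‖) * (ρ y * (2 * ‖w y‖)) := by
      refine inner_le_mul ?_ ?_
      · rw [norm_smul, norm_eq_U_mul_psi S.F p hy, Real.norm_eq_abs]
      · rw [norm_smul, Real.norm_of_nonneg (ρ0 y)]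
        exact mul_le_mul_of_nonneg_left (nv y) (ρ0 y)
    have b2 : inner ℝ (Complex.I * w1 y) (ρ' y • v y) ≤ ‖w1 y‖ * (ρ' y * (2 * ‖w y‖)) := by
      refine inner_le_mul ?_ ?_
      · rw [norm_mul, Complex.norm_I, one_mul]
      · rw [norm_smul, Real.norm_of_nonneg (ρ0' y hy)]
        exact mul_le_mul_of_nonneg_left (nv y) (ρ0' y hy)
    have b3 : inner ℝ (f y) (ρ y • v y) ≤ ‖f y‖ * (ρ y * (2 * ‖w y‖)) := by
      refine inner_le_mul le_rfl ?_
      rw [norm_smul, Real.norm_of_nonneg (ρ0 y)]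
      exact mul_le_mul_of_nonneg_left (nv y) (ρ0 y)
    have b4 : 0 ≤ k ^ 3 * α ^ 2 * (ρ y * ‖w y‖ ^ 2) := by have := ρ0 y; positivity
    have hT' : T y = ρ y * U y * ‖w y‖ ^ 2 - inner ℝ (U2 y • p y) (ρ y • v y) +
        k ^ 3 * (ρ y * ‖w1 y‖ ^ 2) - k ^ 3 * inner ℝ (Complex.I * w1 y) (ρ' y • v y) +
        k ^ 3 * α ^ 2 * (ρ y * ‖w y‖ ^ 2) - inner ℝ (f y) (ρ y • v y) := by
      simp only [T, weakForm]
      rw [inner_sub_left, inner_add_right, e1, e2, e3]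
      ring
    have e4 : ‖((1 : ℝ) ^ 2 / (1 + y) ^ 2) • psi U p y‖ ^ 2 =
        (1 / (1 + y) ^ 2 * ‖psi U p y‖) ^ 2 := by
      rw [norm_smul, Real.norm_of_nonneg (by positivity), one_pow]
    rw [hT', e4]
    have b2' := mul_le_mul_of_nonneg_left b2 (pow_pos hk 3).le
    linarith
  have iE : IntegrableOn (fun y => 8 * M * ‖f y‖ ^ 2 +
      4 * k * M ^ 3 * ‖((1 : ℝ) ^ 2 / (1 + y) ^ 2) • psi U p y‖ ^ 2 +
      4 * k ^ 2 * (layerCut k y * ‖w y‖ ^ 2)) (Ioi 0) :=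
    ((iff.const_mul _).add (iH.const_mul _)).add (i1.const_mul _)
  have h1 := setIntegral_mono_on (i2.const_mul (1 / 2)) (iT.add iE) measurableSet_Ioi hpt
  have hw := weighted_psi S.F S.W hk S.k1 le_rfl
  change _ ≤ 20 * M ^ 2 * (1 / k) * (k * ‖psi U p k‖ ^ 2 + sqInt (gee U U1 p q)) at hw
  have h2 : ∫ y in Ioi (0 : ℝ), ρ y * U y * ‖w y‖ ^ 2 ≤ 16 * M * sqInt f +
      160 * M ^ 5 * (k * ‖psi U p k‖ ^ 2 + sqInt (gee U U1 p q)) +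
      8 * (k ^ 2 * ∫ y in Ioi (0 : ℝ), layerCut k y * ‖w y‖ ^ 2) := by
    have e := integral_add iT iE
    simp only [Pi.add_apply] at h1
    rw [e, hT, zero_add, integral_const_mul, integral_add
      (integrableOn_add (iff.const_mul _) (iH.const_mul _)) (i1.const_mul _),
      integral_add (iff.const_mul _) (iH.const_mul _), integral_const_mul, integral_const_mul,
      integral_const_mul] at h1
    have hw' := mul_le_mul_of_nonneg_left hw (by positivity : 0 ≤ 4 * k * M ^ 3)
    have e5 : 4 * k * M ^ 3 * (20 * M ^ 2 * (1 / k) *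
        (k * ‖psi U p k‖ ^ 2 + sqInt (gee U U1 p q))) =
        80 * M ^ 5 * (k * ‖psi U p k‖ ^ 2 + sqInt (gee U U1 p q)) := by field_simp; ring
    rw [e5] at hw'
    simp only [sqInt] at hw' ⊢
    linarith
  have h3 : k ^ 2 * sqInt w ≤ ∫ y in Ioi (0 : ℝ), (4 * k ^ 2 * (layerCut k y * ‖w y‖ ^ 2) +
      4 * M * (ρ y * U y * ‖w y‖ ^ 2)) := by
    rw [sqInt, ← integral_const_mul]
    refine setIntegral_mono_on (iw.const_mul _) ((i1.const_mul _).add (i2.const_mul _))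
      measurableSet_Ioi fun y hy => ?_
    have hy0 : 0 < y := hy
    have hU := S.F.pos hy0
    -- For y ≤ k the cutoff is at least 1/4. For y ≥ k one has ρ ≥ k/2 and 2MU ≥ k.
    have key : k ^ 2 ≤ 4 * k ^ 2 * layerCut k y + 4 * M * (ρ y * U y) := by
      rcases le_total y k with hyk | hyk
      · have h4 : 1 / 4 ≤ layerCut k y := by
          rw [layerCut, div_le_div_iff₀ (by norm_num) (by positivity)]
          have : y ^ 2 ≤ k ^ 2 := pow_le_pow_left₀ hy0.le hyk 2
          nlinarith [sq_nonneg y, sq_nonneg k]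
        have h5 : 0 ≤ 4 * M * (ρ y * U y) := by have := ρ0 y; positivity
        nlinarith [sq_nonneg k]
      · have h4 : k / 2 ≤ ρ y := by
          simp only [ρ]
          rw [div_le_div_iff₀ two_pos (by positivity)]
          have : k ^ 2 ≤ y ^ 2 := pow_le_pow_left₀ hk.le hyk 2
          nlinarith
        have h5 : k ≤ 2 * M * U y := by
          have h6 : k * (1 + y) ≤ 2 * y := by nlinarith [S.k1]
          have h7 := S.F.ge y hy0.le
          refine le_of_mul_le_mul_right ?_ (by positivity : 0 < 1 + y)
          linarith
        have h8 : k / 2 * k ≤ ρ y * (2 * M * U y) := mul_le_mul h4 h5 hk.le (ρ0 y)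
        have h9 := mul_nonneg (sq_nonneg k) (layerCut_nonneg k y)
        nlinarith
    have := mul_le_mul_of_nonneg_right key (sq_nonneg ‖w y‖)
    linarith
  rw [integral_add (i1.const_mul _) (i2.const_mul _), integral_const_mul, integral_const_mul] at h3
  have h4 := mul_le_mul_of_nonneg_left h2 (by positivity : 0 ≤ 4 * M)
  have h5 : 0 ≤ k ^ 2 * ∫ y in Ioi (0 : ℝ), layerCut k y * ‖w y‖ ^ 2 :=
    mul_nonneg (sq_nonneg k) (setIntegral_nonneg measurableSet_Ioi fun y _ =>
      mul_nonneg (layerCut_nonneg k y) (sq_nonneg _))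
  have h6 := mul_le_mul_of_nonneg_right S.F.one_le h5
  linarith

theorem shearInt_mono (F : Flow U U1 U2 u M) {k L : ℝ} (hk : 0 < k) (hkL : k ≤ L)
    (hw : MemLp w 2 halfLine) : shearInt k U w ≤ shearInt L U w := by
  have hL := hk.trans_le hkL
  refine setIntegral_mono_on (integrableOn_shear F hk hw) (integrableOn_shear F hL hw)
    measurableSet_Ioi fun y hy => ?_
  have hy0 : 0 < y := hy
  have hU := F.pos hy0
  gcongr ?_ * _ * _
  rw [div_le_div_iff₀ (by positivity) (by positivity)]
  have : k ^ 2 * y ^ 2 ≤ L ^ 2 * y ^ 2 := by gcongr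
  nlinarith

/-- The vorticity and the trace are controlled by the interior energy, uniformly in the scale
`L ≥ k` of the shear integral. -/
theorem vorticity_bound (hM : 1 ≤ M) : ∃ C, 1 ≤ C ∧ ∀ {U U1 U2 u k α p q w w1 w2 f L},
    Sol U U1 U2 u M k α p q w w1 w2 f → k ≤ L →
    k ^ 2 * sqInt w + k * ‖psi U p k‖ ^ 2 ≤
      C * (shearInt L U w + sqInt f + α ^ 2 * sqInt p + sqInt (gee U U1 p q)) := by
  obtain ⟨C, hC, h⟩ := layer_bound hM
  have hM0 : 0 < M := by linarith
  refine ⟨37 * M * C + 64 * M ^ 2 + 640 * M ^ 6 * (C + 1) + C, ?_,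
    fun {U U1 U2 u k α p q w w1 w2 f L} S hkL => ?_⟩
  · have : 0 ≤ 37 * M * C + 64 * M ^ 2 + 640 * M ^ 6 * (C + 1) := by positivity
    linarith
  have h1 := h S
  have h2 := S.growth_bound
  have h3 := shearInt_mono S.F S.k0 hkL S.W.m2
  have hD := sqInt_nonneg f
  have hG := sqInt_nonneg (gee U U1 p q)
  have hF := mul_nonneg (sq_nonneg α) (sqInt_nonneg p)
  have hB := shearInt_nonneg S.F (S.k0.trans_le hkL) w
  have ha2 : 0 ≤ k * ‖psi U p k‖ ^ 2 := by have := S.k0; positivity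
  have hX : 0 ≤ k ^ 2 * ∫ y in Ioi (0 : ℝ), layerCut k y * ‖w y‖ ^ 2 :=
    mul_nonneg (sq_nonneg k) (setIntegral_nonneg measurableSet_Ioi fun y _ =>
      mul_nonneg (layerCut_nonneg k y) (sq_nonneg _))
  set X := k ^ 2 * ∫ y in Ioi (0 : ℝ), layerCut k y * ‖w y‖ ^ 2
  set a2 := k * ‖psi U p k‖ ^ 2
  set G := sqInt (gee U U1 p q)
  set D := sqInt f
  set F2 := α ^ 2 * sqInt p
  set Q := shearInt L U w + D + F2 + G
  have h4 : X + a2 ≤ C * Q := h1.trans (mul_le_mul_of_nonneg_left (by simp only [Q]; linarith) (by linarith))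
  have hQ : D ≤ Q := by simp only [Q]; linarith
  have hQG : G ≤ Q := by simp only [Q]; linarith
  have h5 : a2 + G ≤ (C + 1) * Q := by linarith
  calc k ^ 2 * sqInt w + a2
      ≤ 36 * M * (C * Q) + 64 * M ^ 2 * Q + 640 * M ^ 6 * ((C + 1) * Q) + C * Q := by
        have e1 : 36 * M * X ≤ 36 * M * (C * Q) := by gcongr; linarith
        have e2 : 64 * M ^ 2 * D ≤ 64 * M ^ 2 * Q := by gcongr
        have e3 : 640 * M ^ 6 * (a2 + G) ≤ 640 * M ^ 6 * ((C + 1) * Q) := by gcongr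
        linarith
    _ ≤ _ := by
        have : 0 ≤ M * (C * Q) := by
          have : 0 ≤ Q := hD.trans hQ
          positivity
        nlinarith

end OrrSommerfeld

/-! ### The energy identity with a wall multiplier -/

namespace OrrSommerfeld

/-- A multiplier `b` with derivatives `β`, `β1`, `β2`, all bounded by `B`, such that `(1 - β) / U` is
bounded as well. -/
structure Multiplier (U b β β1 β2 : ℝ → ℝ) (B : ℝ) : Prop where
  d0 : ∀ y, HasDerivAt b (β y) y
  d1 : ∀ y, HasDerivAt β (β1 y) y
  d2 : ∀ y, HasDerivAt β1 (β2 y) y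
  c2 : Continuous β2
  zero : b 0 = 0
  B0 : ∀ y, 0 < y → |b y| ≤ B
  B1 : ∀ y, 0 < y → |β y| ≤ B
  B2 : ∀ y, 0 < y → |β1 y| ≤ B
  B3 : ∀ y, 0 < y → |β2 y| ≤ B
  BU : ∀ y, 0 < y → |(1 - β y) * (U y)⁻¹| ≤ B

variable {U U1 U2 b β β1 β2 : ℝ → ℝ} {u M k α B l ε : ℝ} {p q w w1 w2 f : ℝ → ℂ}

/-- The test function of the energy estimate. -/
noncomputable def energyTest (l : ℝ) (U b β : ℝ → ℝ) (p q w : ℝ → ℂ) (y : ℝ) : ℂ :=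
  (1 - β y) • psi U p y + l • (β y • q y - b y • w y)

/-- The derivative of `energyTest`, up to the term containing the third derivative. -/
noncomputable def energyZeta (l u α : ℝ) (U U1 β β1 : ℝ → ℝ) (p q : ℝ → ℂ) (y : ℝ) : ℂ :=
  ((1 - β y) * (U y)⁻¹) • gee U U1 p q y + (l * β1 y) • (q y - u • psi U p y)
    + (l * α ^ 2 * β y) • p y

/-- The derivative of `energyZeta`. -/
noncomputable def energyZeta' (l u α : ℝ) (U U1 U2 β β1 β2 : ℝ → ℝ) (p q w : ℝ → ℂ) (y : ℝ) : ℂ :=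
  ((1 - β y) * (U y)⁻¹) • (w y + (α ^ 2) • p y - U2 y • psi U p y)
    - (2 * ((1 - β y) * (U y)⁻¹) * U1 y) • ((U y)⁻¹ • gee U U1 p q y)
    - β1 y • ((U y)⁻¹ • gee U U1 p q y)
    + (l * β2 y) • (q y - u • psi U p y)
    + (l * β1 y) • (w y + (α ^ 2) • p y - u • ((U y)⁻¹ • gee U U1 p q y))
    + (l * α ^ 2) • (β1 y • p y + β y • q y)

/-- The density of the energy identity. -/
noncomputable def energyDensity (l u ε α : ℝ) (U U1 U2 b β β1 β2 : ℝ → ℝ) (p q w f : ℝ → ℂ)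
    (y : ℝ) : ℝ :=
  (1 + l * β y * (U1 y - u) - l / 2 * β y * U1 y + l / 2 * β1 y * U y) * ‖gee U U1 p q y‖ ^ 2
    + (1 + l * β y * (U1 y - u)) * α ^ 2 * ‖p y‖ ^ 2 + l * (b y * U y * ‖w y‖ ^ 2)
    + l * (β1 y * (U1 y - u) + β y * U2 y) * U y * inner ℝ (gee U U1 p q y) (psi U p y)
    + l * α ^ 2 * β y * U y * inner ℝ (p y) (gee U U1 p q y)
    - l * b y * U2 y * inner ℝ (p y) (w y)
    - ε * inner ℝ (Complex.I * w y) (energyZeta' l u α U U1 U2 β β1 β2 p q w y)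
    + ε * α ^ 2 * inner ℝ (Complex.I * w y) ((1 - β y) • psi U p y + l • (β y • q y))
    + inner ℝ (f y) (energyTest l U b β p q w y)

/-- The pointwise form of `energy_identity`, with ψ and g as independent variables, p = Uψ and q = g
+ U'ψ. On the left stands the derivative of the flux, on the right the density plus the integrand of
the weak form. The normalization l·u = 1 turns the inviscid part (1 - β)ψ + lβq of the test function
into (1 + lβ(U' - u))ψ + lβg, a perturbation of ψ plus a multiple of g. -/
theorem energy_algebra {U U1 U2 b β β1 u l ε α fV : ℝ} {ψ g w w1 ζ Z : ℂ} (hU : U ≠ 0)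
    (hl : l * u = 1) :
    l * (β1 * (U1 - u) + β * U2) * (U * inner ℝ g ψ) + (1 + l * β * (U1 - u)) *
        (U1 * inner ℝ g ψ + U * (inner ℝ g (U⁻¹ • g) +
          inner ℝ (w + (α ^ 2) • (U • ψ) - U2 • ψ - (U1 * U⁻¹) • g) ψ))
      + (l / 2 * (β1 * U + β * U1) * inner ℝ g g + l / 2 * (β * U) *
        (inner ℝ g (w + (α ^ 2) • (U • ψ) - U2 • ψ - (U1 * U⁻¹) • g) +
          inner ℝ (w + (α ^ 2) • (U • ψ) - U2 • ψ - (U1 * U⁻¹) • g) g))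
      - ε * (inner ℝ (Complex.I * w) Z + inner ℝ (Complex.I * w1) ζ) =
    ((1 + l * β * (U1 - u) - l / 2 * β * U1 + l / 2 * β1 * U) * inner ℝ g g
    + (1 + l * β * (U1 - u)) * α ^ 2 * inner ℝ (U • ψ) (U • ψ) + l * (b * U * inner ℝ w w)
    + l * (β1 * (U1 - u) + β * U2) * U * inner ℝ g ψ
    + l * α ^ 2 * β * U * inner ℝ (U • ψ) g
    - l * b * U2 * inner ℝ (U • ψ) w
    - ε * inner ℝ (Complex.I * w) Z
    + ε * α ^ 2 * inner ℝ (Complex.I * w) ((1 - β) • ψ + l • (β • (g + U1 • ψ)))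
    + fV) +
    (inner ℝ (U • w - U2 • (U • ψ)) ((1 - β) • ψ + l • (β • (g + U1 • ψ) - b • w))
      - ε * inner ℝ (Complex.I * w1) (ζ - (l * b) • w1)
      - ε * α ^ 2 * inner ℝ (Complex.I * w) ((1 - β) • ψ + l • (β • (g + U1 • ψ) - b • w))
      - fV) := by
  have hu : u ≠ 0 := by rintro rfl; simp at hl
  have hl' : l = u⁻¹ := by field_simp; exact hl
  subst hl'
  simp only [inner_complex, Complex.add_re, Complex.add_im, Complex.sub_re, Complex.sub_im,
    Complex.smul_re, Complex.smul_im, Complex.mul_re, Complex.mul_im, Complex.I_re, Complex.I_im,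
    smul_eq_mul]
  field_simp
  ring

theorem tendsto_bounded_smul_zero {c : ℝ → ℝ} {h : ℝ → ℂ} {B : ℝ} (hc : ∀ y, 0 < y → |c y| ≤ B)
    (h0 : ContinuousWithinAt h (Ioi 0) 0) (hz : h 0 = 0) :
    ContinuousWithinAt (fun y => c y • h y) (Ioi 0) 0 := by
  rw [ContinuousWithinAt, hz, smul_zero]
  rw [ContinuousWithinAt, hz] at h0
  refine squeeze_zero_norm' (a := fun y => B * ‖h y‖) ?_ (by simpa using h0.norm.const_mul B)
  filter_upwards [self_mem_nhdsWithin] with y hy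
  rw [norm_smul]
  exact mul_le_mul_of_nonneg_right (hc y hy) (norm_nonneg _)

/-- The density and the weak-form integrand add up to the derivative of the flux Φ = cU⟨g, ψ⟩ +
(l/2)βU|g|² - ε⟨iw, ζ⟩, where c = 1 + lβ(U' - u) and ζ is `energyZeta`. Φ vanishes at the wall and
the weak form integrates to zero. The form of the test function matters for the viscous term: the βw
contributions of (βq)' and (bw)' cancel, so V' = ζ - lbw', the part bw' pairs to zero with iw', and
the derivative can be moved from w' onto ζ. -/
theorem energy_identity (F : Flow U U1 U2 u M) (W : Wave α p q w w1 w2)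
    (E : OSEq U U2 ε α p w w2 f) (mf : MemLp f 2 halfLine)
    (T : Multiplier U b β β1 β2 B) (hl : l * u = 1) :
    IntegrableOn (energyDensity l u ε α U U1 U2 b β β1 β2 p q w f) (Ioi 0) ∧
      ∫ y in Ioi (0 : ℝ), energyDensity l u ε α U U1 U2 b β β1 β2 p q w f y = 0 := by
  have mψ := memLp_psi F W
  have mg := memLp_gee F W
  have mdψ := memLp_dpsi F W
  have mdg := memLp_dgee F W
  have cb : Continuous b := continuous_iff_continuousAt.2 fun y => (T.d0 y).continuousAt
  have cβ : Continuous β := continuous_iff_continuousAt.2 fun y => (T.d1 y).continuousAt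
  have cβ1 : Continuous β1 := continuous_iff_continuousAt.2 fun y => (T.d2 y).continuousAt
  have cU := F.contU
  have cU1 := F.contU1
  have ca : ContinuousOn (fun y => (1 - β y) * (U y)⁻¹) (Ioi 0) :=
    (continuous_const.sub cβ).continuousOn.mul F.contInv
  have hB : 0 ≤ B := (abs_nonneg _).trans (T.B0 1 one_pos)
  have hM := F.M_pos
  have sm : ∀ {c : ℝ → ℝ} {h : ℝ → ℂ} {B : ℝ}, ContinuousOn c (Ioi 0) →
      (∀ y, 0 < y → |c y| ≤ B) → MemLp h 2 halfLine → MemLp (fun y => c y • h y) 2 halfLine :=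
    fun hc hB hh => memLp_smul_of_bound hc hB hh
  have cm : ∀ (c : ℝ) {h : ℝ → ℂ}, MemLp h 2 halfLine → MemLp (fun y => c • h y) 2 halfLine :=
    fun c h hh => hh.const_smul c
  have mγ : MemLp (fun y => q y - u • psi U p y) 2 halfLine := W.m1.sub (cm u mψ)
  have B1' : ∀ y, 0 < y → |1 - β y| ≤ 1 + B := fun y hy => by
    refine (abs_sub _ _).trans ?_
    rw [abs_one]; linarith [T.B1 y hy]
  have lB : ∀ {c : ℝ → ℝ} (m : ℝ) {B : ℝ}, (∀ y, 0 < y → |c y| ≤ B) →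
      ∀ y, 0 < y → |m * c y| ≤ |m| * B := fun m B h y hy => by
    rw [abs_mul]; exact mul_le_mul_of_nonneg_left (h y hy) (abs_nonneg _)
  -- the test function
  have mψ1 : MemLp (fun y => (1 - β y) • psi U p y) 2 halfLine :=
    sm (continuous_const.sub cβ).continuousOn B1' mψ
  have mβq : MemLp (fun y => β y • q y) 2 halfLine := sm cβ.continuousOn T.B1 W.m1
  have mV : MemLp (energyTest l U b β p q w) 2 halfLine :=
    mψ1.add (cm l (mβq.sub (sm cb.continuousOn T.B0 W.m2)))
  have mζ : MemLp (energyZeta l u α U U1 β β1 p q) 2 halfLine :=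
    ((sm ca T.BU mg).add (sm (continuousOn_const.mul cβ1.continuousOn) (lB l T.B2) mγ)).add
      (sm (continuousOn_const.mul cβ.continuousOn) (lB (l * α ^ 2) T.B1) W.m0)
  have mZ : MemLp (energyZeta' l u α U U1 U2 β β1 β2 p q w) 2 halfLine := by
    have h1 := sm ca T.BU ((W.m2.add (cm (α ^ 2) W.m0)).sub (memLp_U2_smul F mψ))
    have h2 := sm (c := fun y => 2 * ((1 - β y) * (U y)⁻¹) * U1 y) (B := 2 * B * M)
      ((continuousOn_const.mul ca).mul cU1.continuousOn) (fun y hy => by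
        rw [abs_mul, abs_mul, abs_two]
        exact mul_le_mul (mul_le_mul_of_nonneg_left (T.BU y hy) two_pos.le) (F.b1' hy.le)
          (abs_nonneg _) (by positivity)) mdψ
    have h3 := sm cβ1.continuousOn T.B2 mdψ
    have h4 := sm (continuousOn_const.mul T.c2.continuousOn) (lB l T.B3) mγ
    have h5 := sm (continuousOn_const.mul cβ1.continuousOn) (lB l T.B2)
      ((W.m2.add (cm (α ^ 2) W.m0)).sub (cm u mdψ))
    have h6 := cm (l * α ^ 2) ((sm cβ1.continuousOn T.B2 W.m0).add mβq)
    exact ((((h1.sub h2).sub h3).add h4).add h5).add h6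
  have dV : ∀ y, 0 < y → HasDerivAt (energyTest l U b β p q w)
      (energyZeta l u α U U1 β β1 p q y - (l * b y) • w1 y) y := fun y hy => by
    refine ((((T.d1 y).const_sub 1).smul (hasDerivAt_psi F W hy)).add
      ((((T.d1 y).smul (W.d1 y)).sub ((T.d0 y).smul (W.d2 y))).const_smul l)).congr_deriv ?_
    rw [energyZeta]
    have e : (l * β1 y) • (q y - u • psi U p y) = (l * β1 y) • q y - β1 y • psi U p y := by
      rw [smul_sub, smul_smul, mul_right_comm, hl, one_mul]
    rw [e]
    module
  have cψ := continuousOn_psi F W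
  have cg := continuousOn_gee F W
  have cζ : ContinuousOn (energyZeta l u α U U1 β β1 p q) (Ioi 0) :=
    ((ca.smul cg).add ((continuous_const.mul cβ1).continuousOn.smul
      (W.c1.continuousOn.sub (cψ.const_smul u)))).add
      ((continuous_const.mul cβ).smul W.c0).continuousOn
  have ψ0 : psi U p 0 = 0 := by rw [psi, W.z0, smul_zero]
  have g0 : gee U U1 p q 0 = 0 := by rw [gee, W.z1, ψ0, smul_zero, sub_zero]
  have tψ := tendsto_psi_zero F W
  have tg := tendsto_gee_zero F W
  have tζ : ContinuousWithinAt (energyZeta l u α U U1 β β1 p q) (Ioi 0) 0 :=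
    ((tendsto_bounded_smul_zero T.BU tg g0).add
      ((continuous_const.mul cβ1).continuousWithinAt.smul
        (W.c1.continuousWithinAt.sub (tψ.const_smul u)))).add
      ((continuous_const.mul cβ).smul W.c0).continuousWithinAt
  have tV : ContinuousWithinAt (energyTest l U b β p q w) (Ioi 0) 0 :=
    ((continuous_const.sub cβ).continuousWithinAt.smul tψ).add
      (((cβ.smul W.c1).sub (cb.smul W.c2)).const_smul l).continuousWithinAt
  obtain ⟨iT, hT⟩ := integral_weakForm F W E mf tV
    (by simp [energyTest, ψ0, W.z1, T.zero]) dV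
    (cζ.sub ((continuous_const.mul cb).smul W.c3).continuousOn) mV
    (mζ.sub (sm (continuousOn_const.mul cb.continuousOn) (lB l T.B0) W.m3))
  have dζ : ∀ y, 0 < y → HasDerivAt (energyZeta l u α U U1 β β1 p q)
      (energyZeta' l u α U U1 U2 β β1 β2 p q w y) y := fun y hy => by
    have hU := (F.pos hy).ne'
    refine ((((((T.d1 y).const_sub 1).mul ((F.d0 y).inv hU)).smul (hasDerivAt_gee F W hy)).add
      (((T.d2 y).const_mul l).smul ((W.d1 y).sub ((hasDerivAt_psi F W hy).const_smul u)))).add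
      (((T.d1 y).const_mul (l * α ^ 2)).smul (W.d0 y))).congr_deriv ?_
    rw [energyZeta', dgee, show -U1 y / U y ^ 2 = -(U1 y * (U y)⁻¹ * (U y)⁻¹) by field_simp]
    simp only [Pi.mul_apply, Pi.inv_apply, Pi.sub_apply, Pi.smul_apply]
    module
  let c : ℝ → ℝ := fun y => 1 + l * β y * (U1 y - u)
  let c' : ℝ → ℝ := fun y => l * (β1 y * (U1 y - u) + β y * U2 y)
  have dc : ∀ y, HasDerivAt c (c' y) y := fun y => by
    refine ((((T.d1 y).const_mul l).mul ((F.d1 y).sub_const u)).const_add 1).congr_deriv ?_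
    simp only [c']; ring
  have cc : Continuous c := continuous_iff_continuousAt.2 fun y => (dc y).continuousAt
  have cc' : Continuous c' :=
    continuous_const.mul ((cβ1.mul (cU1.sub continuous_const)).add (cβ.mul F.c2))
  have bU : ∀ y, 0 < y → |U y| ≤ M := fun y hy => by
    rw [abs_of_nonneg (F.pos hy).le]; exact F.le y hy.le
  have bU1u : ∀ y, 0 < y → |U1 y - u| ≤ M + |u| := fun y hy =>
    (abs_sub _ _).trans (add_le_add (F.b1' hy.le) le_rfl)
  have bc : ∀ y, 0 < y → |c y| ≤ 1 + |l| * B * (M + |u|) := fun y hy => by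
    refine (abs_add_le _ _).trans ?_
    rw [abs_one, abs_mul]
    exact add_le_add le_rfl (mul_le_mul (lB l T.B1 y hy) (bU1u y hy) (abs_nonneg _)
      (by positivity))
  have bc' : ∀ y, 0 < y → |c' y| ≤ |l| * (B * (M + |u|) + B * M) := fun y hy => by
    simp only [c']
    rw [abs_mul]
    refine mul_le_mul_of_nonneg_left ((abs_add_le _ _).trans ?_) (abs_nonneg _)
    rw [abs_mul, abs_mul]
    exact add_le_add (mul_le_mul (T.B2 y hy) (bU1u y hy) (abs_nonneg _) hB)
      (mul_le_mul (T.B1 y hy) (F.b2' hy.le) (abs_nonneg _) hB)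
  let Φ : ℝ → ℝ := fun y => c y * (U y * inner ℝ (gee U U1 p q y) (psi U p y)) +
    l / 2 * (β y * U y) * inner ℝ (gee U U1 p q y) (gee U U1 p q y) -
    ε * inner ℝ (Complex.I * w y) (energyZeta l u α U U1 β β1 p q y)
  have tΦ : ContinuousWithinAt Φ (Ioi 0) 0 :=
    ((cc.continuousWithinAt.mul (cU.continuousWithinAt.mul (tg.inner tψ))).add
      ((continuous_const.mul (cβ.mul cU)).continuousWithinAt.mul (tg.inner tg))).sub
      (continuousWithinAt_const.mul ((continuous_const.mul W.c2).continuousWithinAt.inner tζ))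
  have bmul : ∀ {c d : ℝ → ℝ} {C D : ℝ}, (∀ y, 0 < y → |c y| ≤ C) → (∀ y, 0 < y → |d y| ≤ D) →
      ∀ y, 0 < y → |c y * d y| ≤ C * D := fun hc hd y hy => by
    rw [abs_mul]
    exact mul_le_mul (hc y hy) (hd y hy) (abs_nonneg _) ((abs_nonneg _).trans (hc y hy))
  have ip : ∀ {c : ℝ → ℝ} {h h' : ℝ → ℂ} {B : ℝ}, Continuous c →
      (∀ y, 0 < y → |c y| ≤ B) → MemLp h 2 halfLine → MemLp h' 2 halfLine →
      IntegrableOn (fun y => c y * inner ℝ (h y) (h' y)) (Ioi 0) := fun hc hB hh hh' => by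
    refine (integrable_inner_of_memLp (sm hc.continuousOn hB hh) hh').congr
      (Eventually.of_forall fun y => ?_)
    simp only [real_inner_smul_left]
  have iΦ : IntegrableOn Φ (Ioi 0) := by
    refine Integrable.sub (Integrable.add ?_ ?_) ?_
    · refine (ip (cc.mul cU) (bmul bc bU) mg mψ).congr (Eventually.of_forall fun y => ?_)
      simp only [Pi.mul_apply]
      ring
    · exact ip (continuous_const.mul (cβ.mul cU)) (lB (l / 2) (bmul T.B1 bU)) mg mg
    · exact (integrable_inner_of_memLp (memLp_I_mul W.m2) mζ).const_mul _
  have iD : IntegrableOn (energyDensity l u ε α U U1 U2 b β β1 β2 p q w f) (Ioi 0) := by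
    have j1 := ip (cc) bc mg mg
    have j2 := ip (continuous_const.mul (cβ.mul cU1)) (lB (l / 2)
      (bmul T.B1 fun y hy => F.b1' hy.le)) mg mg
    have j3 := ip (continuous_const.mul (cβ1.mul cU)) (lB (l / 2) (bmul T.B2 bU)) mg mg
    have j4 := (ip cc bc W.m0 W.m0).const_mul (α ^ 2)
    have j5 := ip (continuous_const.mul (cb.mul cU)) (lB l (bmul T.B0 bU)) W.m2 W.m2
    have j6 := ip (cc'.mul cU) (bmul bc' bU) mg mψ
    have j7 := ip (continuous_const.mul (cβ.mul cU)) (lB (l * α ^ 2) (bmul T.B1 bU)) W.m0 mg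
    have j8 := ip (continuous_const.mul (cb.mul F.c2))
      (lB l (bmul T.B0 fun y hy => F.b2' hy.le)) W.m0 W.m2
    have j9 := (integrable_inner_of_memLp (memLp_I_mul W.m2) mZ).const_mul ε
    have j10 := (integrable_inner_of_memLp (memLp_I_mul W.m2) (mψ1.add (cm l mβq))).const_mul
      (ε * α ^ 2)
    have j11 := integrable_inner_of_memLp mf mV
    refine (((((((((((j1.sub j2).add j3).add j4).add j5).add j6).add j7).sub j8).sub j9).add
      j10).add j11)).congr (Eventually.of_forall fun y => ?_)
    simp only [Pi.add_apply, Pi.sub_apply, Pi.mul_apply, energyDensity, c, c', real_inner_self_eq_norm_sq]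
    ring
  have dΦ : ∀ y, 0 < y → HasDerivAt Φ (energyDensity l u ε α U U1 U2 b β β1 β2 p q w f y +
      weakForm U U2 ε α p w w1 f (energyTest l U b β p q w)
        (fun y => energyZeta l u α U U1 β β1 p q y - (l * b y) • w1 y) y) y := fun y hy => by
    have hU := (F.pos hy).ne'
    have dg := hasDerivAt_gee F W hy
    have dψ := hasDerivAt_psi F W hy
    refine ((((dc y).mul ((F.d0 y).mul (dg.inner ℝ dψ))).add
      ((((T.d1 y).mul (F.d0 y)).const_mul (l / 2)).mul (dg.inner ℝ dg))).sub
      ((((W.d2 y).const_mul Complex.I).inner ℝ (dζ y hy)).const_mul ε)).congr_deriv ?_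
    have A := energy_algebra (U := U y) (U1 := U1 y) (U2 := U2 y) (b := b y) (β := β y)
      (β1 := β1 y) (u := u) (l := l) (ε := ε) (α := α)
      (fV := inner ℝ (f y) (energyTest l U b β p q w y)) (ψ := psi U p y) (g := gee U U1 p q y)
      (w := w y) (w1 := w1 y) (ζ := energyZeta l u α U U1 β β1 p q y)
      (Z := energyZeta' l u α U U1 U2 β β1 β2 p q w y) hU hl
    have ep : U y • psi U p y = p y := smul_psi F p hy
    have eq : gee U U1 p q y + U1 y • psi U p y = q y := by rw [gee, sub_add_cancel]
    rw [ep, eq] at A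
    simp only [Pi.mul_apply]
    simp only [c', c, weakForm, energyDensity, ← real_inner_self_eq_norm_sq]
    rw [← dgee] at A
    simp only [energyTest] at A ⊢
    linarith
  have key := integral_Ioi_deriv_eq_neg tΦ dΦ iΦ (integrableOn_add iD iT)
  rw [integral_add iD iT, hT, add_zero] at key
  refine ⟨iD, key.trans ?_⟩
  simp [Φ, F.zero, g0, ψ0, energyZeta, W.z0, W.z1]

end OrrSommerfeld

/-! ### The explicit multiplier b = L²y/(L² + y²) -/

namespace OrrSommerfeld

/-- The multiplier at scale `L`: `L² y / (L² + y²)`. -/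
noncomputable def mulB (L y : ℝ) : ℝ := L ^ 2 * y / (L ^ 2 + y ^ 2)

/-- First derivative of `mulB`. -/
noncomputable def mulB1 (L y : ℝ) : ℝ := L ^ 2 * (L ^ 2 - y ^ 2) / (L ^ 2 + y ^ 2) ^ 2

/-- Second derivative of `mulB`. -/
noncomputable def mulB2 (L y : ℝ) : ℝ :=
  2 * L ^ 2 * y * (y ^ 2 - 3 * L ^ 2) / (L ^ 2 + y ^ 2) ^ 3

/-- Third derivative of `mulB`. -/
noncomputable def mulB3 (L y : ℝ) : ℝ :=
  -6 * L ^ 2 * (L ^ 4 - 6 * L ^ 2 * y ^ 2 + y ^ 4) / (L ^ 2 + y ^ 2) ^ 4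

theorem hasDerivAt_sq_add_sq_pow (L y : ℝ) (n : ℕ) :
    HasDerivAt (fun y : ℝ => (L ^ 2 + y ^ 2) ^ (n + 1))
      ((n + 1) * (L ^ 2 + y ^ 2) ^ n * (2 * y)) y := by
  refine ((((hasDerivAt_id y).pow 2).const_add (L ^ 2)).pow (n + 1)).congr_deriv ?_
  simp

theorem hasDerivAt_mulB {L : ℝ} (hL : 0 < L) (y : ℝ) : HasDerivAt (mulB L) (mulB1 L y) y := by
  have h1 := hasDerivAt_sq_add_sq_pow L y 0
  simp only [zero_add, pow_one] at h1
  have hP : L ^ 2 + y ^ 2 ≠ 0 := by positivity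
  refine (((hasDerivAt_id y).const_mul (L ^ 2)).div h1 hP).congr_deriv ?_
  simp only [id, mulB1]
  field_simp
  push_cast
  ring

theorem hasDerivAt_mulB1 {L : ℝ} (hL : 0 < L) (y : ℝ) : HasDerivAt (mulB1 L) (mulB2 L y) y := by
  have h1 := hasDerivAt_sq_add_sq_pow L y 1
  have hP : L ^ 2 + y ^ 2 ≠ 0 := by positivity
  refine (((((hasDerivAt_id y).pow 2).const_sub (L ^ 2)).const_mul (L ^ 2)).div h1
    (pow_ne_zero _ hP)).congr_deriv ?_
  simp only [id, mulB2, Pi.pow_apply]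
  field_simp
  push_cast
  ring

theorem hasDerivAt_mulB2 {L : ℝ} (hL : 0 < L) (y : ℝ) : HasDerivAt (mulB2 L) (mulB3 L y) y := by
  have h1 := hasDerivAt_sq_add_sq_pow L y 2
  have hP : L ^ 2 + y ^ 2 ≠ 0 := by positivity
  refine ((((hasDerivAt_id y).const_mul (2 * L ^ 2)).mul
    (((hasDerivAt_id y).pow 2).sub_const (3 * L ^ 2))).div h1 (pow_ne_zero _ hP)).congr_deriv ?_
  simp only [id, mulB3, Pi.pow_apply, Pi.mul_apply]
  field_simp
  push_cast
  ring

section bounds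

variable {L y : ℝ}

theorem mul_le_half_sq_add_sq (L y : ℝ) : L * y ≤ (L ^ 2 + y ^ 2) / 2 := by
  nlinarith [sq_nonneg (L - y)]

theorem abs_mulB1_le (hL : 0 < L) (y : ℝ) : |mulB1 L y| ≤ L ^ 2 / (L ^ 2 + y ^ 2) := by
  have hP : 0 < L ^ 2 + y ^ 2 := by positivity
  rw [mulB1, abs_div, abs_mul, abs_of_pos (pow_pos hL 2), abs_of_pos (pow_pos hP 2),
    div_le_div_iff₀ (by positivity) hP]
  have : |L ^ 2 - y ^ 2| ≤ L ^ 2 + y ^ 2 := abs_le.2 ⟨by nlinarith [sq_nonneg L], by nlinarith [sq_nonneg y]⟩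
  calc L ^ 2 * |L ^ 2 - y ^ 2| * (L ^ 2 + y ^ 2) ≤ L ^ 2 * (L ^ 2 + y ^ 2) * (L ^ 2 + y ^ 2) := by gcongr
    _ = _ := by ring

theorem abs_mulB2_le (hL : 0 < L) (hy : 0 < y) :
    |mulB2 L y| ≤ 6 * L ^ 2 * y / (L ^ 2 + y ^ 2) ^ 2 := by
  have hP : 0 < L ^ 2 + y ^ 2 := by positivity
  rw [mulB2, abs_div, abs_mul, abs_of_pos (by positivity : 0 < 2 * L ^ 2 * y),
    abs_of_pos (pow_pos hP 3), div_le_div_iff₀ (by positivity) (by positivity)]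
  have : |y ^ 2 - 3 * L ^ 2| ≤ 3 * (L ^ 2 + y ^ 2) :=
    abs_le.2 ⟨by nlinarith [sq_nonneg y], by nlinarith [sq_nonneg y, sq_nonneg L]⟩
  calc 2 * L ^ 2 * y * |y ^ 2 - 3 * L ^ 2| * (L ^ 2 + y ^ 2) ^ 2
      ≤ 2 * L ^ 2 * y * (3 * (L ^ 2 + y ^ 2)) * (L ^ 2 + y ^ 2) ^ 2 := by gcongr
    _ = _ := by ring

theorem abs_mulB3_le (hL : 0 < L) (y : ℝ) :
    |mulB3 L y| ≤ 18 * L ^ 2 / (L ^ 2 + y ^ 2) ^ 2 := by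
  have hP : 0 < L ^ 2 + y ^ 2 := by positivity
  rw [mulB3, abs_div, abs_mul, abs_mul, abs_of_pos (pow_pos hP 4), abs_of_pos (pow_pos hL 2),
    div_le_div_iff₀ (by positivity) (by positivity), abs_neg, abs_of_pos (by norm_num : (0:ℝ) < 6)]
  have : |L ^ 4 - 6 * L ^ 2 * y ^ 2 + y ^ 4| ≤ 3 * (L ^ 2 + y ^ 2) ^ 2 :=
    abs_le.2 ⟨by nlinarith [sq_nonneg (L ^ 2), sq_nonneg (y ^ 2), sq_nonneg (L * y)],
      by nlinarith [sq_nonneg (L ^ 2), sq_nonneg (y ^ 2), sq_nonneg (L * y)]⟩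
  calc 6 * L ^ 2 * |L ^ 4 - 6 * L ^ 2 * y ^ 2 + y ^ 4| * (L ^ 2 + y ^ 2) ^ 2
      ≤ 6 * L ^ 2 * (3 * (L ^ 2 + y ^ 2) ^ 2) * (L ^ 2 + y ^ 2) ^ 2 := by gcongr
    _ = _ := by ring

theorem one_sub_mulB1 (hL : 0 < L) (y : ℝ) :
    1 - mulB1 L y = y ^ 2 * (3 * L ^ 2 + y ^ 2) / (L ^ 2 + y ^ 2) ^ 2 := by
  have hP : L ^ 2 + y ^ 2 ≠ 0 := by positivity
  rw [mulB1]
  field_simp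
  ring

theorem one_sub_mulB1_nonneg (hL : 0 < L) (y : ℝ) : 0 ≤ 1 - mulB1 L y := by
  rw [one_sub_mulB1 hL]; positivity

theorem one_sub_mulB1_le (hL : 0 < L) (y : ℝ) :
    1 - mulB1 L y ≤ 3 * y ^ 2 / (L ^ 2 + y ^ 2) := by
  have hP : 0 < L ^ 2 + y ^ 2 := by positivity
  rw [one_sub_mulB1 hL, div_le_div_iff₀ (by positivity) hP]
  have : 3 * L ^ 2 + y ^ 2 ≤ 3 * (L ^ 2 + y ^ 2) := by nlinarith [sq_nonneg y]
  calc y ^ 2 * (3 * L ^ 2 + y ^ 2) * (L ^ 2 + y ^ 2)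
      ≤ y ^ 2 * (3 * (L ^ 2 + y ^ 2)) * (L ^ 2 + y ^ 2) := by gcongr
    _ = _ := by ring

/-- The coefficient of |g|² for the linear profile U = uy. With e = L²/(L² + y²) it equals 1 + 3e/2
- 6e² + 4e³, whose minimum over e ≥ 0 is about 0.396, attained near e = 17/20. This positivity is
what allows the energy method to work through the region where ψ is exchanged. -/
theorem mulB_coefficient (hL : 0 < L) (y : ℝ) :
    3 / 8 ≤ 1 - 1 / 2 * mulB1 L y + 1 / 2 * (mulB2 L y * y) := by
  have hP : 0 < L ^ 2 + y ^ 2 := by positivity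
  obtain ⟨e, he⟩ : ∃ e, e = L ^ 2 / (L ^ 2 + y ^ 2) := ⟨_, rfl⟩
  have e0 : 0 ≤ e := by rw [he]; positivity
  have h1 : 1 - 1 / 2 * mulB1 L y + 1 / 2 * (mulB2 L y * y) = 1 + 3 / 2 * e - 6 * e ^ 2 + 4 * e ^ 3 := by
    rw [he, mulB1, mulB2]; field_simp; ring
  rw [h1]
  nlinarith [mul_nonneg (by linarith : 0 ≤ e + 1 / 5) (sq_nonneg (e - 17 / 20))]

variable {U U1 U2 : ℝ → ℝ} {u M : ℝ}

theorem ratio_half (hL : 0 < L) (y : ℝ) : y / (L ^ 2 + y ^ 2) ≤ 1 / (2 * L) := by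
  rw [div_le_div_iff₀ (by positivity) (by positivity)]
  nlinarith [mul_le_half_sq_add_sq L y]

theorem ratio_one (hL : 0 < L) (y : ℝ) : L ^ 2 / (L ^ 2 + y ^ 2) ≤ 1 := by
  rw [div_le_one (by positivity)]; nlinarith [sq_nonneg y]

theorem ratio_one' (hL : 0 < L) (y : ℝ) : y ^ 2 / (L ^ 2 + y ^ 2) ≤ 1 := by
  rw [div_le_one (by positivity)]; nlinarith [sq_nonneg L]

theorem ratio_weight (hL : 0 < L) (hy : 0 < y) :
    L ^ 2 / (L ^ 2 + y ^ 2) ≤ 2 * (L ^ 2 / (L + y) ^ 2) := by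
  rw [mul_div_assoc', div_le_div_iff₀ (by positivity) (by positivity)]
  nlinarith [mul_nonneg (sq_nonneg L) (sq_nonneg (L - y))]

theorem Flow.abs_U_sub_le (F : Flow U U1 U2 u M) (hy : 0 ≤ y) : |U y - u * y| ≤ M * y ^ 2 := by
  have h := (convex_Icc 0 y).norm_image_sub_le_of_norm_hasDerivWithin_le
    (f := fun x => U x - u * x) (f' := fun x => U1 x - u) (C := M * y)
    (fun x _ => by
      refine (((F.d0 x).sub ((hasDerivAt_id x).const_mul u)).congr_deriv ?_).hasDerivWithinAt
      simp)
    (fun x hx => (F.bu x hx.1).trans (mul_le_mul_of_nonneg_left hx.2 F.M_pos.le))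
    (left_mem_Icc.2 hy) (right_mem_Icc.2 hy)
  simp only [F.zero, mul_zero, sub_zero, Real.norm_eq_abs, abs_of_nonneg hy] at h
  linarith [h, sq y]

theorem Flow.abs_U1_sub_le (F : Flow U U1 U2 u M) (hy : 0 ≤ y) : |U1 y - u| ≤ 2 * M := by
  have h0 := F.b1' le_rfl
  rw [F.U1_zero] at h0
  have := abs_sub (U1 y) u
  linarith [F.b1' hy]

/-- `(1 - β) / U`. -/
theorem quot_le (F : Flow U U1 U2 u M) (hL : 0 < L) (hL1 : L ≤ 1) (hy : 0 < y) :
    (1 - mulB1 L y) * (U y)⁻¹ ≤ 5 * M / L := by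
  have hM := F.M_pos
  calc (1 - mulB1 L y) * (U y)⁻¹ ≤ (3 * y ^ 2 / (L ^ 2 + y ^ 2)) * (M * (1 + y) / y) :=
        mul_le_mul (one_sub_mulB1_le hL y) (F.inv_le hy) (inv_nonneg.2 (F.pos hy).le) (by positivity)
    _ = 3 * M * (y / (L ^ 2 + y ^ 2) + y ^ 2 / (L ^ 2 + y ^ 2)) := by field_simp
    _ ≤ 3 * M * (1 / (2 * L) + 1) := by
        exact mul_le_mul_of_nonneg_left (add_le_add (ratio_half hL y) (ratio_one' hL y))
          (by positivity)
    _ ≤ 3 * M * (1 / (2 * L) + 1 / L) := by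
        gcongr
        rw [le_div_iff₀ hL]; linarith
    _ = 9 / 2 * M / L := by field_simp; ring
    _ ≤ _ := by gcongr; norm_num

theorem quot_nonneg (F : Flow U U1 U2 u M) (hL : 0 < L) (hy : 0 < y) :
    0 ≤ (1 - mulB1 L y) * (U y)⁻¹ :=
  mul_nonneg (one_sub_mulB1_nonneg hL y) (inv_nonneg.2 (F.pos hy).le)

/-- 1 - β vanishes quadratically at the wall and so compensates two factors 1/U at the price L⁻².
This is the worst coefficient in the viscous term, and the reason for taking L a large multiple of
k. -/
theorem quot_quot_le (F : Flow U U1 U2 u M) (hL : 0 < L) (hL1 : L ≤ 1) (hy : 0 < y) :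
    (1 - mulB1 L y) * (U y)⁻¹ * (U y)⁻¹ ≤ 6 * M ^ 2 / L ^ 2 := by
  have hM := F.M_pos
  have hU := inv_nonneg.2 (F.pos hy).le
  have hP : 0 < L ^ 2 + y ^ 2 := by positivity
  calc (1 - mulB1 L y) * (U y)⁻¹ * (U y)⁻¹
      ≤ (3 * y ^ 2 / (L ^ 2 + y ^ 2)) * (M * (1 + y) / y) * (M * (1 + y) / y) := by
        have h1 := one_sub_mulB1_le hL y
        have h2 := F.inv_le hy
        gcongr
    _ = 3 * M ^ 2 * ((1 + y) ^ 2 / (L ^ 2 + y ^ 2)) := by field_simp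
    _ ≤ 3 * M ^ 2 * (2 / L ^ 2) := by
        gcongr ?_ * ?_
        rw [div_le_div_iff₀ hP (by positivity)]
        have h3 : L ^ 2 ≤ 1 := pow_le_one₀ hL.le hL1
        have h4 : L ^ 2 * y ^ 2 ≤ y ^ 2 := mul_le_of_le_one_left (sq_nonneg y) h3
        have h5 : (1 + y) ^ 2 ≤ 2 * (1 + y ^ 2) := by nlinarith [sq_nonneg (1 - y)]
        calc (1 + y) ^ 2 * L ^ 2 ≤ 2 * (1 + y ^ 2) * L ^ 2 := by gcongr
          _ ≤ _ := by linarith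
    _ = _ := by ring

theorem mulB2_quot_le (F : Flow U U1 U2 u M) (hL : 0 < L) (hL1 : L ≤ 1) (hy : 0 < y) :
    |mulB2 L y| * (U y)⁻¹ ≤ 10 * M / L ^ 2 := by
  have hM := F.M_pos
  have hP : 0 < L ^ 2 + y ^ 2 := by positivity
  calc |mulB2 L y| * (U y)⁻¹ ≤ (6 * L ^ 2 * y / (L ^ 2 + y ^ 2) ^ 2) * (M * (1 + y) / y) :=
        mul_le_mul (abs_mulB2_le hL hy) (F.inv_le hy) (inv_nonneg.2 (F.pos hy).le) (by positivity)
    _ = 6 * M / L ^ 2 * ((L ^ 2 / (L ^ 2 + y ^ 2)) * (L ^ 2 / (L ^ 2 + y ^ 2) * (1 + y))) := by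
        field_simp
    _ ≤ 6 * M / L ^ 2 * (1 * (3 / 2)) := by
        gcongr
        · exact ratio_one hL y
        · rw [mul_add, mul_one]
          have h1 := ratio_one hL y
          have h2 : L ^ 2 / (L ^ 2 + y ^ 2) * y ≤ 1 / 2 := by
            rw [div_mul_eq_mul_div]
            exact (shearWeight_le hL y).trans (by linarith)
          linarith
    _ ≤ _ := by
        rw [div_mul_eq_mul_div]
        exact div_le_div_of_nonneg_right (by linarith) (by positivity)

theorem mulB2_le (hL : 0 < L) (hy : 0 < y) : |mulB2 L y| ≤ 3 / L := by
  calc |mulB2 L y| ≤ 6 * L ^ 2 * y / (L ^ 2 + y ^ 2) ^ 2 := abs_mulB2_le hL hy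
    _ = 6 * (L ^ 2 / (L ^ 2 + y ^ 2) * (y / (L ^ 2 + y ^ 2))) := by field_simp
    _ ≤ 6 * (1 * (1 / (2 * L))) := by
        have h1 := ratio_half hL y
        have h2 := ratio_one hL y
        gcongr
    _ = _ := by field_simp; norm_num

theorem mulB3_le (hL : 0 < L) (y : ℝ) : |mulB3 L y| ≤ 18 / L ^ 2 := by
  calc |mulB3 L y| ≤ 18 * L ^ 2 / (L ^ 2 + y ^ 2) ^ 2 := abs_mulB3_le hL y
    _ = 18 / L ^ 2 * (L ^ 2 / (L ^ 2 + y ^ 2)) ^ 2 := by field_simp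
    _ ≤ 18 / L ^ 2 * 1 := by
        gcongr
        exact pow_le_one₀ (by positivity) (ratio_one hL y)
    _ = _ := mul_one _

theorem mulB3_mul_le (F : Flow U U1 U2 u M) (hL : 0 < L) (hy : 0 < y) :
    |mulB3 L y| * |U1 y - u| ≤ 18 * M / L * (L ^ 2 / (L + y) ^ 2) := by
  have hM := F.M_pos
  calc |mulB3 L y| * |U1 y - u| ≤ 18 * L ^ 2 / (L ^ 2 + y ^ 2) ^ 2 * (M * y) :=
        mul_le_mul (abs_mulB3_le hL y) (F.bu y hy.le) (abs_nonneg _) (by positivity)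
    _ = 18 * M * ((y / (L ^ 2 + y ^ 2)) * (L ^ 2 / (L ^ 2 + y ^ 2))) := by field_simp
    _ ≤ 18 * M * (1 / (2 * L) * (2 * (L ^ 2 / (L + y) ^ 2))) := by
        have h1 := ratio_half hL y
        have h2 := ratio_weight hL hy
        gcongr
    _ = _ := by field_simp

theorem mulB1_le_weight (hL : 0 < L) (hy : 0 < y) : |mulB1 L y| ≤ 2 * (L ^ 2 / (L + y) ^ 2) :=
  (abs_mulB1_le hL y).trans (ratio_weight hL hy)

theorem mulB1_le_one (hL : 0 < L) (y : ℝ) : |mulB1 L y| ≤ 1 :=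
  (abs_mulB1_le hL y).trans (ratio_one hL y)

theorem mulB1_mul_le (hL : 0 < L) (hy : 0 < y) :
    |mulB1 L y| * y ≤ L / 2 := by
  refine (mul_le_mul_of_nonneg_right (abs_mulB1_le hL y) hy.le).trans ?_
  rw [div_mul_eq_mul_div]
  exact shearWeight_le hL y

/-- Both terms vanish for a linear profile. The gain of a factor L comes from |U' - u|·U·(1 + y)² ≲
y² in the first term, and from |β|y ≤ L/2 with the cubic decay of U'' in the second. -/
theorem shear_correction_le (F : Flow U U1 U2 u M) (hL : 0 < L) (hy : 0 < y) :
    |mulB2 L y * (U1 y - u) + mulB1 L y * U2 y| * U y ≤ 19 * M ^ 2 * L * (1 / (1 + y) ^ 2) := by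
  have hM := F.M_pos
  have hU := F.pos hy
  have hy1 : 0 < 1 + y := by linarith
  rw [mul_one_div, le_div_iff₀ (by positivity)]
  have h1 : |mulB2 L y| * |U1 y - u| * U y * (1 + y) ^ 2 ≤ 18 * M ^ 2 * L := by
    have h2 : |U1 y - u| * U y * (1 + y) ^ 2 ≤ 6 * M ^ 2 * y ^ 2 := by
      have a1 := F.bu y hy.le
      have a2 := F.abs_U1_sub_le hy.le
      have a3 := F.le_mul y hy.le
      have a4 := F.le y hy.le
      have a5 : |U1 y - u| * U y ≤ M * y * (M * y) := mul_le_mul a1 a3 hU.le (by positivity)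
      have a6 : |U1 y - u| * U y ≤ 2 * M * M := mul_le_mul a2 a4 hU.le (by positivity)
      have a7 : (1 + y) ^ 2 ≤ 2 * (1 + y ^ 2) := by nlinarith [sq_nonneg (1 - y)]
      have a8 := mul_le_mul_of_nonneg_right a6 (sq_nonneg y)
      calc |U1 y - u| * U y * (1 + y) ^ 2 ≤ |U1 y - u| * U y * (2 * (1 + y ^ 2)) := by gcongr
        _ ≤ _ := by nlinarith
    calc |mulB2 L y| * |U1 y - u| * U y * (1 + y) ^ 2
        = |mulB2 L y| * (|U1 y - u| * U y * (1 + y) ^ 2) := by ring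
      _ ≤ (6 * L ^ 2 * y / (L ^ 2 + y ^ 2) ^ 2) * (6 * M ^ 2 * y ^ 2) :=
          mul_le_mul (abs_mulB2_le hL hy) h2 (by positivity) (by positivity)
      _ = 36 * M ^ 2 * ((L ^ 2 * y / (L ^ 2 + y ^ 2)) * (y ^ 2 / (L ^ 2 + y ^ 2))) := by
          field_simp; norm_num
      _ ≤ 36 * M ^ 2 * (L / 2 * 1) := by
          have b1 := shearWeight_le hL y
          have b2 := ratio_one' hL y
          gcongr
      _ = _ := by ring
  have h3 : |mulB1 L y| * |U2 y| * U y * (1 + y) ^ 2 ≤ M ^ 2 * L := by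
    have a1 : |U2 y| * (1 + y) ^ 2 ≤ M := by
      refine le_trans ?_ (F.b2 y hy.le)
      gcongr
      · linarith
      · norm_num
    calc |mulB1 L y| * |U2 y| * U y * (1 + y) ^ 2 =
          |mulB1 L y| * (|U2 y| * (1 + y) ^ 2) * U y := by ring
      _ ≤ |mulB1 L y| * M * (M * y) := by
          have a2 := F.le_mul y hy.le
          gcongr
      _ = M ^ 2 * (|mulB1 L y| * y) := by ring
      _ ≤ M ^ 2 * L := by
          gcongr
          exact (mulB1_mul_le hL hy).trans (by linarith)
  calc |mulB2 L y * (U1 y - u) + mulB1 L y * U2 y| * U y * (1 + y) ^ 2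
      ≤ (|mulB2 L y| * |U1 y - u| + |mulB1 L y| * |U2 y|) * U y * (1 + y) ^ 2 := by
        gcongr
        refine (abs_add_le _ _).trans (le_of_eq ?_)
        rw [abs_mul, abs_mul]
    _ = |mulB2 L y| * |U1 y - u| * U y * (1 + y) ^ 2 + |mulB1 L y| * |U2 y| * U y * (1 + y) ^ 2 := by
        ring
    _ ≤ _ := by linarith

/-- Lets the pairing of f with bw be absorbed by bU|w|². -/
theorem mulB_le (F : Flow U U1 U2 u M) (hL : 0 < L) (hL1 : L ≤ 1) (hy : 0 < y) :
    mulB L y ≤ 2 * M * U y := by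
  have hM := F.M_pos
  have hU := F.pos hy
  have hP : 0 < L ^ 2 + y ^ 2 := by positivity
  rw [mulB, div_le_iff₀ hP]
  have h1 : L ^ 2 * (1 + y) ≤ 2 * (L ^ 2 + y ^ 2) := by nlinarith [mul_le_half_sq_add_sq L y, sq_nonneg y, mul_pos hL hy]
  calc L ^ 2 * y ≤ L ^ 2 * (M * (1 + y) * U y) := by
        have := F.ge y hy.le
        gcongr
    _ = M * U y * (L ^ 2 * (1 + y)) := by ring
    _ ≤ M * U y * (2 * (L ^ 2 + y ^ 2)) := by gcongr
    _ = _ := by ring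

theorem mulB_nonneg (hL : 0 < L) (hy : 0 < y) : 0 ≤ mulB L y := by rw [mulB]; positivity

theorem mulB_mul_U_le (F : Flow U U1 U2 u M) (hL : 0 < L) (hy : 0 < y) :
    mulB L y * U y ≤ M * L ^ 2 := by
  have hM := F.M_pos
  calc mulB L y * U y ≤ mulB L y * (M * y) :=
        mul_le_mul_of_nonneg_left (F.le_mul y hy.le) (mulB_nonneg hL hy)
    _ = M * L ^ 2 * (y ^ 2 / (L ^ 2 + y ^ 2)) := by rw [mulB]; field_simp
    _ ≤ M * L ^ 2 * 1 := by gcongr; exact ratio_one' hL y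
    _ = _ := mul_one _

theorem multiplier_mulB (F : Flow U U1 U2 u M) (hL : 0 < L) (hL1 : L ≤ 1) :
    ∃ B, Multiplier U (mulB L) (mulB1 L) (mulB2 L) (mulB3 L) B := by
  have hM := F.M_pos
  refine ⟨1 + 3 / L + 18 / L ^ 2 + 5 * M / L, hasDerivAt_mulB hL, hasDerivAt_mulB1 hL,
    hasDerivAt_mulB2 hL, ?_, by simp [mulB], fun y hy => ?_, fun y hy => ?_, fun y hy => ?_,
    fun y hy => ?_, fun y hy => ?_⟩
  · unfold mulB3
    exact Continuous.div (by fun_prop) (by fun_prop) fun y => by positivity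
  all_goals
    have p1 : 0 < 3 / L := by positivity
    have p2 : 0 < 18 / L ^ 2 := by positivity
    have p3 : 0 < 5 * M / L := by positivity
  · rw [abs_of_nonneg (mulB_nonneg hL hy), mulB]
    linarith [shearWeight_le hL y]
  · linarith [mulB1_le_one hL y]
  · linarith [mulB2_le hL hy]
  · linarith [mulB3_le hL y]
  · rw [abs_of_nonneg (quot_nonneg F hL hy)]
    linarith [quot_le F hL hL1 hy]

/-- A perturbation of `mulB_coefficient`: replacing U by uy and U' by u costs My² and My, which β'
and β turn into a multiple of M²L. -/
theorem main_coefficient (F : Flow U U1 U2 u M) {l : ℝ} (hl : l * u = 1) (hlM : |l| ≤ M)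
    (hL : 0 < L) (hy : 0 < y) :
    3 / 8 - 3 * M ^ 2 * L ≤ 1 + l * mulB1 L y * (U1 y - u) - l / 2 * mulB1 L y * U1 y
      + l / 2 * mulB2 L y * U y := by
  have hM := F.M_pos
  have h0 := mulB_coefficient hL y
  have h1 : |l / 2 * mulB1 L y * (U1 y - u)| ≤ M ^ 2 * L / 4 := by
    rw [abs_mul, abs_mul, abs_div, abs_two]
    calc |l| / 2 * |mulB1 L y| * |U1 y - u| ≤ M / 2 * |mulB1 L y| * (M * y) := by
          have := F.bu y hy.le
          gcongr
      _ = M ^ 2 / 2 * (|mulB1 L y| * y) := by ring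
      _ ≤ M ^ 2 / 2 * (L / 2) := by gcongr; exact mulB1_mul_le hL hy
      _ = _ := by ring
  have h2 : |l / 2 * mulB2 L y * (U y - u * y)| ≤ 3 / 2 * (M ^ 2 * L) := by
    rw [abs_mul, abs_mul, abs_div, abs_two]
    calc |l| / 2 * |mulB2 L y| * |U y - u * y|
        ≤ M / 2 * (6 * L ^ 2 * y / (L ^ 2 + y ^ 2) ^ 2) * (M * y ^ 2) := by
          have a1 := F.abs_U_sub_le hy.le
          have a2 := abs_mulB2_le hL hy
          gcongr
      _ = 3 * M ^ 2 * ((L ^ 2 * y / (L ^ 2 + y ^ 2)) * (y ^ 2 / (L ^ 2 + y ^ 2))) := by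
          field_simp; norm_num
      _ ≤ 3 * M ^ 2 * (L / 2 * 1) := by
          have b1 := shearWeight_le hL y
          have b2 := ratio_one' hL y
          gcongr
      _ = _ := by ring
  have e : 1 + l * mulB1 L y * (U1 y - u) - l / 2 * mulB1 L y * U1 y + l / 2 * mulB2 L y * U y =
      (1 - 1 / 2 * mulB1 L y + 1 / 2 * (mulB2 L y * y)) + l / 2 * mulB1 L y * (U1 y - u) +
        l / 2 * mulB2 L y * (U y - u * y) := by
    linear_combination (-(1 / 2 * mulB1 L y) + 1 / 2 * mulB2 L y * y) * hl
  rw [e]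
  have := neg_le_of_abs_le h1
  have := neg_le_of_abs_le h2
  have : 0 < M ^ 2 * L := by positivity
  linarith

end bounds

end OrrSommerfeld

/-! ### Coercivity of the energy density -/

namespace OrrSommerfeld

variable {U U1 U2 : ℝ → ℝ} {u M k α l L y : ℝ} {p q w w1 w2 f : ℝ → ℂ}

theorem norm_smul_le_of {c : ℝ} {z : ℂ} {C Z : ℝ} (hc : |c| ≤ C) (hz : ‖z‖ ≤ Z) :
    ‖c • z‖ ≤ C * Z := by
  rw [norm_smul]
  exact mul_le_mul hc hz (norm_nonneg _) ((abs_nonneg _).trans hc)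

theorem psi_decay (U : ℝ → ℝ) (p : ℝ → ℂ) (hy : 0 < y) {t : ℝ}
    (ht : |t| * (1 + y) ^ 3 ≤ M) :
    ‖t • psi U p y‖ ≤ M * (1 / (1 + y) ^ 2 * ‖psi U p y‖) := by
  have h : |t| ≤ M * (1 / (1 + y) ^ 2) := by
    rw [mul_one_div, le_div_iff₀ (by positivity)]
    refine le_trans ?_ ht
    gcongr
    · linarith
    · norm_num
  exact (norm_smul_le_of h le_rfl).trans (le_of_eq (by ring))

/-- The part of `energyZeta'` that is not a real multiple of the vorticity. -/
noncomputable def energyRest (l u α : ℝ) (U U1 U2 β β1 β2 : ℝ → ℝ) (p q : ℝ → ℂ) (y : ℝ) : ℂ :=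
  ((1 - β y) * (U y)⁻¹) • ((α ^ 2) • p y - U2 y • psi U p y)
    - (2 * ((1 - β y) * (U y)⁻¹ * (U y)⁻¹) * U1 y) • gee U U1 p q y
    - (2 * (β1 y * (U y)⁻¹)) • gee U U1 p q y
    + (l * β2 y) • gee U U1 p q y + (l * (β2 y * (U1 y - u))) • psi U p y
    + (l * β1 y) • ((α ^ 2) • p y)
    + (l * α ^ 2) • (β1 y • p y + β y • q y)

/-- The vorticity enters the derivative of ζ only with the real coefficient (1 - β)/U + lβ', hence
contributes nothing against iw, however singular it is. Only `energyRest` has to be estimated. -/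
theorem energyZeta'_eq (hl : l * u = 1) (β β1 β2 : ℝ → ℝ) (p q w : ℝ → ℂ) (y : ℝ) :
    energyZeta' l u α U U1 U2 β β1 β2 p q w y =
      ((1 - β y) * (U y)⁻¹ + l * β1 y) • w y + energyRest l u α U U1 U2 β β1 β2 p q y := by
  have e1 : q y - u • psi U p y = gee U U1 p q y + (U1 y - u) • psi U p y := by
    rw [gee]; module
  have e2 : (l * β1 y) • (w y + (α ^ 2) • p y - u • ((U y)⁻¹ • gee U U1 p q y)) =
      (l * β1 y) • w y + (l * β1 y) • ((α ^ 2) • p y) - (β1 y * (U y)⁻¹) • gee U U1 p q y := by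
    rw [show β1 y * (U y)⁻¹ = (l * u) * (β1 y * (U y)⁻¹) by rw [hl, one_mul]]
    module
  rw [energyZeta', energyRest, e1, e2]
  module

theorem inner_I_energyZeta' (hl : l * u = 1) (β β1 β2 : ℝ → ℝ) (p q w : ℝ → ℂ) (y : ℝ) :
    inner ℝ (Complex.I * w y) (energyZeta' l u α U U1 U2 β β1 β2 p q w y) =
      inner ℝ (Complex.I * w y) (energyRest l u α U U1 U2 β β1 β2 p q y) := by
  rw [energyZeta'_eq hl, inner_add_right, real_inner_smul_right, inner_I_mul_self, mul_zero,
    zero_add]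

/-- What counts is the power of L: g carries L⁻² because of the two factors 1/U, and the remaining
coefficients are at most of order L⁻¹ or α². These sizes dictate the conditions collected in
`Small`. -/
theorem norm_energyRest_le (F : Flow U U1 U2 u M) (hl : |l| ≤ M) (hL : 0 < L) (hL1 : L ≤ 1)
    (p q : ℝ → ℂ) (hy : 0 < y) :
    ‖energyRest l u α U U1 U2 (mulB1 L) (mulB2 L) (mulB3 L) p q y‖ ≤
      11 * M / L * (α ^ 2 * ‖p y‖) + 5 * M ^ 2 / L * (1 / (1 + y) ^ 2 * ‖psi U p y‖) +
      50 * M ^ 3 / L ^ 2 * ‖gee U U1 p q y‖ +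
      18 * M ^ 2 / L * (L ^ 2 / (L + y) ^ 2 * ‖psi U p y‖) + M * α ^ 2 * ‖gee U U1 p q y‖ +
      2 * M ^ 2 * α ^ 2 * (L ^ 2 / (L + y) ^ 2 * ‖psi U p y‖) := by
  have hM := F.M_pos
  have hM1 := F.one_le
  have hU := F.pos hy
  have hUi : 0 < (U y)⁻¹ := inv_pos.2 hU
  set G := ‖gee U U1 p q y‖ with hG
  set s := ‖psi U p y‖ with hs
  have hα : ‖(α ^ 2) • p y‖ = α ^ 2 * ‖p y‖ := by
    rw [norm_smul, Real.norm_of_nonneg (sq_nonneg α)]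
  have t1 : ‖((1 - mulB1 L y) * (U y)⁻¹) • ((α ^ 2) • p y - U2 y • psi U p y)‖ ≤
      5 * M / L * (α ^ 2 * ‖p y‖ + M * (1 / (1 + y) ^ 2 * s)) := by
    refine norm_smul_le_of ?_ ((norm_sub_le _ _).trans
      (add_le_add hα.le (psi_decay U p hy (F.b2 y hy.le))))
    rw [abs_of_nonneg (quot_nonneg F hL hy)]
    exact quot_le F hL hL1 hy
  have t2 : ‖(2 * ((1 - mulB1 L y) * (U y)⁻¹ * (U y)⁻¹) * U1 y) • gee U U1 p q y‖ ≤
      2 * (6 * M ^ 2 / L ^ 2) * M * G := by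
    refine norm_smul_le_of ?_ le_rfl
    have h0 : 0 ≤ (1 - mulB1 L y) * (U y)⁻¹ * (U y)⁻¹ := mul_nonneg (quot_nonneg F hL hy) hUi.le
    rw [abs_mul, abs_mul, abs_two, abs_of_nonneg h0]
    have h1 := quot_quot_le F hL hL1 hy
    have h2 := F.b1' hy.le
    gcongr
  have t3 : ‖(2 * (mulB2 L y * (U y)⁻¹)) • gee U U1 p q y‖ ≤ 2 * (10 * M / L ^ 2) * G := by
    refine norm_smul_le_of ?_ le_rfl
    rw [abs_mul, abs_two, abs_mul, abs_of_pos hUi]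
    have h1 := mulB2_quot_le F hL hL1 hy
    gcongr
  have t4 : ‖(l * mulB3 L y) • gee U U1 p q y‖ ≤ M * (18 / L ^ 2) * G := by
    refine norm_smul_le_of ?_ le_rfl
    rw [abs_mul]
    have h1 := mulB3_le hL y
    gcongr
  have t5 : ‖(l * (mulB3 L y * (U1 y - u))) • psi U p y‖ ≤
      M * (18 * M / L * (L ^ 2 / (L + y) ^ 2)) * s := by
    refine norm_smul_le_of ?_ le_rfl
    rw [abs_mul, abs_mul]
    have h1 := mulB3_mul_le F hL hy
    gcongr
  have t6 : ‖(l * mulB2 L y) • ((α ^ 2) • p y)‖ ≤ M * (3 / L) * (α ^ 2 * ‖p y‖) := by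
    refine norm_smul_le_of ?_ hα.le
    rw [abs_mul]
    have h1 := mulB2_le hL hy
    gcongr
  have hq : ‖mulB1 L y • q y‖ ≤ 1 * G + M * (2 * (L ^ 2 / (L + y) ^ 2) * s) := by
    have e : mulB1 L y • q y = mulB1 L y • gee U U1 p q y + U1 y • (mulB1 L y • psi U p y) := by
      rw [gee]; module
    rw [e]
    exact (norm_add_le _ _).trans (add_le_add (norm_smul_le_of (mulB1_le_one hL y) le_rfl)
      (norm_smul_le_of (F.b1' hy.le) (norm_smul_le_of (mulB1_le_weight hL hy) le_rfl)))
  have t7 : ‖(l * α ^ 2) • (mulB2 L y • p y + mulB1 L y • q y)‖ ≤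
      M * α ^ 2 * (3 / L * ‖p y‖ + (1 * G + M * (2 * (L ^ 2 / (L + y) ^ 2) * s))) := by
    refine norm_smul_le_of ?_ ((norm_add_le _ _).trans (add_le_add
      (norm_smul_le_of (mulB2_le hL hy) le_rfl) hq))
    rw [abs_mul, abs_of_nonneg (sq_nonneg α)]
    gcongr
  rw [energyRest]
  refine (norm_add_le _ _).trans ?_
  have r1 := norm_add_le
    (((1 - mulB1 L y) * (U y)⁻¹) • ((α ^ 2) • p y - U2 y • psi U p y)
    - (2 * ((1 - mulB1 L y) * (U y)⁻¹ * (U y)⁻¹) * U1 y) • gee U U1 p q y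
    - (2 * (mulB2 L y * (U y)⁻¹)) • gee U U1 p q y
    + (l * mulB3 L y) • gee U U1 p q y + (l * (mulB3 L y * (U1 y - u))) • psi U p y)
    ((l * mulB2 L y) • ((α ^ 2) • p y))
  have r2 := norm_add_le
    (((1 - mulB1 L y) * (U y)⁻¹) • ((α ^ 2) • p y - U2 y • psi U p y)
    - (2 * ((1 - mulB1 L y) * (U y)⁻¹ * (U y)⁻¹) * U1 y) • gee U U1 p q y
    - (2 * (mulB2 L y * (U y)⁻¹)) • gee U U1 p q y
    + (l * mulB3 L y) • gee U U1 p q y) ((l * (mulB3 L y * (U1 y - u))) • psi U p y)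
  have r3 := norm_add_le
    (((1 - mulB1 L y) * (U y)⁻¹) • ((α ^ 2) • p y - U2 y • psi U p y)
    - (2 * ((1 - mulB1 L y) * (U y)⁻¹ * (U y)⁻¹) * U1 y) • gee U U1 p q y
    - (2 * (mulB2 L y * (U y)⁻¹)) • gee U U1 p q y) ((l * mulB3 L y) • gee U U1 p q y)
  have r4 := norm_sub_le
    (((1 - mulB1 L y) * (U y)⁻¹) • ((α ^ 2) • p y - U2 y • psi U p y)
    - (2 * ((1 - mulB1 L y) * (U y)⁻¹ * (U y)⁻¹) * U1 y) • gee U U1 p q y)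
    ((2 * (mulB2 L y * (U y)⁻¹)) • gee U U1 p q y)
  have r5 := norm_sub_le
    (((1 - mulB1 L y) * (U y)⁻¹) • ((α ^ 2) • p y - U2 y • psi U p y))
    ((2 * ((1 - mulB1 L y) * (U y)⁻¹ * (U y)⁻¹) * U1 y) • gee U U1 p q y)
  have hG0 : 0 ≤ G / L ^ 2 := by positivity
  have hM3 : M ≤ M ^ 3 := le_self_pow₀ hM1 (by norm_num)
  have c1 : 2 * (6 * M ^ 2 / L ^ 2) * M * G + 2 * (10 * M / L ^ 2) * G + M * (18 / L ^ 2) * G ≤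
      50 * M ^ 3 / L ^ 2 * G := by
    have e1 : 2 * (6 * M ^ 2 / L ^ 2) * M * G + 2 * (10 * M / L ^ 2) * G + M * (18 / L ^ 2) * G =
      (12 * M ^ 3 + 38 * M) * (G / L ^ 2) := by ring
    have e2 : 50 * M ^ 3 / L ^ 2 * G = 50 * M ^ 3 * (G / L ^ 2) := by ring
    rw [e1, e2]
    exact mul_le_mul_of_nonneg_right (by linarith) hG0
  have c2 : 5 * M / L * (α ^ 2 * ‖p y‖ + M * (1 / (1 + y) ^ 2 * s)) +
      M * (18 * M / L * (L ^ 2 / (L + y) ^ 2)) * s + M * (3 / L) * (α ^ 2 * ‖p y‖) +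
      M * α ^ 2 * (3 / L * ‖p y‖ + (1 * G + M * (2 * (L ^ 2 / (L + y) ^ 2) * s))) =
      11 * M / L * (α ^ 2 * ‖p y‖) + 5 * M ^ 2 / L * (1 / (1 + y) ^ 2 * s) +
      18 * M ^ 2 / L * (L ^ 2 / (L + y) ^ 2 * s) + M * α ^ 2 * G +
      2 * M ^ 2 * α ^ 2 * (L ^ 2 / (L + y) ^ 2 * s) := by ring
  linarith

/-- The smallness relations between the layer scale `σ²`, the multiplier scale `J² σ²` and the
tolerance `τ`. -/
structure Small (σ J τ α : ℝ) : Prop where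
  σ0 : 0 < σ
  J1 : 1 ≤ J
  τ0 : 0 < τ
  τ1 : τ ≤ 1
  α0 : 0 < α
  h1 : 1 ≤ τ * J ^ 4
  h2 : J ^ 4 * σ ≤ τ
  h3 : J ^ 2 * (σ ^ 2 * α) ≤ τ

variable {σ J τ : ℝ}

/-- These are the dimensionless ratios left over when L = J²σ² and ε = σ⁶ are inserted in the error
terms and each quantity is measured in its own energy. The ratio 1/J⁴ does not improve with σ; it is
made small by J alone. -/
theorem Small.facts (S : Small σ J τ α) : σ ≤ τ ∧ σ ^ 2 * α / J ^ 2 ≤ τ ∧ σ / J ^ 2 ≤ τ ∧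
    1 / J ^ 4 ≤ τ ∧ σ ^ 2 / J ≤ τ ∧ (σ ^ 2 * α) ^ 2 ≤ τ ∧ (σ ^ 2 * α) ^ 2 * J ≤ τ ∧
    J ^ 2 * σ ≤ τ ∧ J ^ 4 * σ ^ 2 ≤ τ ∧ J ^ 2 * σ ^ 2 ≤ τ := by
  obtain ⟨σ0, J1, τ0, τ1, α0, h1, h2, h3⟩ := S
  have J0 : 0 < J := by linarith
  have J2 : 1 ≤ J ^ 2 := one_le_pow₀ J1
  have J4 : 1 ≤ J ^ 4 := one_le_pow₀ J1
  have a1 : σ ≤ τ := le_trans (le_mul_of_one_le_left σ0.le J4) h2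
  have a0 : σ ≤ 1 := a1.trans τ1
  have a2 : σ ^ 2 * α ≤ τ := le_trans (le_mul_of_one_le_left (by positivity) J2) h3
  have a3 : J ^ 2 * σ ≤ τ := by
    refine le_trans ?_ h2
    gcongr ?_ * _
    exact pow_le_pow_right₀ J1 (by norm_num)
  have a4 : σ ^ 2 ≤ σ := by nlinarith
  have a5 : 0 < σ ^ 2 * α := by positivity
  have a6 : J ≤ J ^ 2 := le_self_pow₀ J1 (by norm_num)
  refine ⟨a1, (div_le_self (by positivity) J2).trans a2, (div_le_self σ0.le J2).trans a1, ?_,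
    (div_le_self (by positivity) J1).trans (a4.trans a1), ?_, ?_, a3, ?_, ?_⟩
  · rwa [div_le_iff₀ (by positivity)]
  · nlinarith
  · have : σ ^ 2 * α * J ≤ τ := by
      refine le_trans ?_ h3
      rw [mul_comm]
      gcongr
    calc (σ ^ 2 * α) ^ 2 * J = (σ ^ 2 * α) * (σ ^ 2 * α * J) := by ring
      _ ≤ 1 * τ := mul_le_mul (a2.trans τ1) this (by positivity) zero_le_one
      _ = τ := one_mul _
  · refine le_trans ?_ h2
    gcongr
  · refine le_trans ?_ a3
    gcongr

/-- One factor σ² of ε = σ⁶ goes to n, since the vorticity energy is (σ²‖w‖)². Each remaining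
coefficient is then one of the ratios of `Small.facts`, hence at most τ up to powers of M. The
constant is 112 = 2(51 + 5), the 2 coming from Young's inequality for a sum of four terms. -/
theorem viscous_aux (S : Small σ J τ α) (M1 : 1 ≤ M) {π h1 hL G n z e : ℝ} (hπ : 0 ≤ π)
    (hh1 : 0 ≤ h1) (hhL : 0 ≤ hL) (hG : 0 ≤ G) (hn : 0 ≤ n)
    (hz : z ≤ 11 * M / (J ^ 2 * σ ^ 2) * (α ^ 2 * π) + 5 * M ^ 2 / (J ^ 2 * σ ^ 2) * h1 +
      50 * M ^ 3 / (J ^ 2 * σ ^ 2) ^ 2 * G + 18 * M ^ 2 / (J ^ 2 * σ ^ 2) * hL + M * α ^ 2 * G +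
      2 * M ^ 2 * α ^ 2 * hL)
    (he : e ≤ 5 * M / (J ^ 2 * σ ^ 2) * π + M * (G + M * (2 * hL))) :
    (σ ^ 2) ^ 3 * (n * z) + (σ ^ 2) ^ 3 * α ^ 2 * (n * e) ≤
      112 * M ^ 3 * τ * ((σ ^ 2 * n) ^ 2 + (α * π) ^ 2 + (σ * h1) ^ 2 + G ^ 2 + (hL / J) ^ 2) := by
  obtain ⟨-, f1, f2, f3, f4, f5, f6, -, -, -⟩ := S.facts
  obtain ⟨σ0, J1, τ0, τ1, α0, -, -, -⟩ := S
  have J0 : 0 < J := by linarith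
  have M0 : 0 < M := by linarith
  have m1 : M ≤ M ^ 3 := le_self_pow₀ M1 (by norm_num)
  have m2 : M ^ 2 ≤ M ^ 3 := pow_le_pow_right₀ M1 (by norm_num)
  have e1 : (σ ^ 2) ^ 3 * (n * z) ≤ (σ ^ 2 * n) * (11 * M * (σ ^ 2 * α / J ^ 2) * (α * π) +
      5 * M ^ 2 * (σ / J ^ 2) * (σ * h1) + 50 * M ^ 3 * (1 / J ^ 4) * G +
      18 * M ^ 2 * (σ ^ 2 / J) * (hL / J) + M * (σ ^ 2 * α) ^ 2 * G +
      2 * M ^ 2 * ((σ ^ 2 * α) ^ 2 * J) * (hL / J)) := by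
    refine (mul_le_mul_of_nonneg_left (mul_le_mul_of_nonneg_left hz hn) (by positivity)).trans
      (le_of_eq ?_)
    field_simp
  have e2 : (σ ^ 2) ^ 3 * α ^ 2 * (n * e) ≤ (σ ^ 2 * n) * (5 * M * (σ ^ 2 * α / J ^ 2) * (α * π) +
      M * (σ ^ 2 * α) ^ 2 * G + 2 * M ^ 2 * ((σ ^ 2 * α) ^ 2 * J) * (hL / J)) := by
    refine (mul_le_mul_of_nonneg_left (mul_le_mul_of_nonneg_left he hn) (by positivity)).trans
      (le_of_eq ?_)
    field_simp
    ring
  set N := σ ^ 2 * n with hN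
  set a := α * π with ha
  set b := σ * h1 with hb
  set c := hL / J with hc
  have N0 : 0 ≤ N := by positivity
  have a0 : 0 ≤ a := by positivity
  have b0 : 0 ≤ b := by positivity
  have c0 : 0 ≤ c := by positivity
  have e3 : 11 * M * (σ ^ 2 * α / J ^ 2) * a +
      5 * M ^ 2 * (σ / J ^ 2) * b + 50 * M ^ 3 * (1 / J ^ 4) * G +
      18 * M ^ 2 * (σ ^ 2 / J) * c + M * (σ ^ 2 * α) ^ 2 * G +
      2 * M ^ 2 * ((σ ^ 2 * α) ^ 2 * J) * c ≤ 51 * M ^ 3 * τ * (a + b + G + c) := by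
    calc _ ≤ 11 * M ^ 3 * τ * a + 5 * M ^ 3 * τ * b + 50 * M ^ 3 * τ * G +
          18 * M ^ 3 * τ * c + M ^ 3 * τ * G + 2 * M ^ 3 * τ * c := by gcongr
      _ ≤ _ := by
          have : 0 ≤ M ^ 3 * τ * a := by positivity
          have : 0 ≤ M ^ 3 * τ * b := by positivity
          have : 0 ≤ M ^ 3 * τ * c := by positivity
          linarith
  have e4 : 5 * M * (σ ^ 2 * α / J ^ 2) * a +
      M * (σ ^ 2 * α) ^ 2 * G + 2 * M ^ 2 * ((σ ^ 2 * α) ^ 2 * J) * c ≤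
      5 * M ^ 3 * τ * (a + b + G + c) := by
    calc _ ≤ 5 * M ^ 3 * τ * a + M ^ 3 * τ * G + 2 * M ^ 3 * τ * c := by gcongr
      _ ≤ _ := by
          have : 0 ≤ M ^ 3 * τ * G := by positivity
          have : 0 ≤ M ^ 3 * τ * b := by positivity
          have : 0 ≤ M ^ 3 * τ * c := by positivity
          linarith
  have e5 := mul_le_mul_of_nonneg_left e3 N0
  have e6 := mul_le_mul_of_nonneg_left e4 N0
  have e7 : N * (a + b + G + c) ≤ 2 * (N ^ 2 + a ^ 2 + b ^ 2 + G ^ 2 + c ^ 2) := by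
    have x1 := two_mul_le_add_sq N a
    have x2 := two_mul_le_add_sq N b
    have x3 := two_mul_le_add_sq N G
    have x4 := two_mul_le_add_sq N c
    have := sq_nonneg a
    have := sq_nonneg b
    have := sq_nonneg G
    have := sq_nonneg c
    linarith
  have e8 := mul_le_mul_of_nonneg_left e7 (by positivity : 0 ≤ 56 * M ^ 3 * τ)
  linarith

/-- Young's inequality with the errors kept of size τ, at the cost of the large factor J²/τ in front
of |f|², which is harmless since f is given. -/
theorem data_aux (S : Small σ J τ α) (M1 : 1 ≤ M) {φ G hL b U n : ℝ} (hb : 0 ≤ b)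
    (hbU : b ≤ 2 * M * U) :
    φ * (M * G + M * (4 * M * hL) + M * (b * n)) ≤
      τ * G ^ 2 + τ * (hL / J) ^ 2 + 1 / (8 * M) * (b * U * n ^ 2) + 9 * M ^ 4 * J ^ 2 / τ * φ ^ 2 := by
  obtain ⟨σ0, J1, τ0, τ1, α0, -, -, -⟩ := S
  have J0 : 0 < J := by linarith
  have M0 : 0 < M := by linarith
  have t1 : φ * (M * G) ≤ τ * G ^ 2 + M ^ 2 / τ * φ ^ 2 := by
    have e : τ * G ^ 2 + M ^ 2 / τ * φ ^ 2 - φ * (M * G) =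
        (τ * G - M * φ / 2) ^ 2 / τ + 3 / 4 * M ^ 2 / τ * φ ^ 2 := by field_simp; ring
    have : 0 ≤ (τ * G - M * φ / 2) ^ 2 / τ + 3 / 4 * M ^ 2 / τ * φ ^ 2 := by positivity
    linarith
  have t2 : φ * (M * (4 * M * hL)) ≤ τ * (hL / J) ^ 2 + 4 * M ^ 4 * J ^ 2 / τ * φ ^ 2 := by
    have e : τ * (hL / J) ^ 2 + 4 * M ^ 4 * J ^ 2 / τ * φ ^ 2 - φ * (M * (4 * M * hL)) =
        (τ * hL / J - 2 * M ^ 2 * J * φ) ^ 2 / τ := by field_simp; ring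
    have : 0 ≤ (τ * hL / J - 2 * M ^ 2 * J * φ) ^ 2 / τ := by positivity
    linarith
  have t3 : φ * (M * (b * n)) ≤ 1 / (8 * M) * (b * U * n ^ 2) + 4 * M ^ 4 * φ ^ 2 := by
    have h1 : b * (b * n ^ 2) ≤ 2 * M * U * (b * n ^ 2) := by gcongr
    have h2 : 1 / (8 * M) * (b * U * n ^ 2) = 1 / (16 * M ^ 2) * (2 * M * U * (b * n ^ 2)) := by
      field_simp; ring
    have h3 := mul_le_mul_of_nonneg_left h1 (by positivity : 0 ≤ 1 / (16 * M ^ 2))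
    have h4 : φ * (M * (b * n)) = 1 / (16 * M ^ 2) * (b * (b * n ^ 2)) + 4 * M ^ 4 * φ ^ 2 -
        (b * n / (4 * M) - 2 * M ^ 2 * φ) ^ 2 := by field_simp; ring
    have := sq_nonneg (b * n / (4 * M) - 2 * M ^ 2 * φ)
    linarith
  have c1 : M ^ 2 / τ ≤ M ^ 4 * J ^ 2 / τ := by
    gcongr
    calc M ^ 2 ≤ M ^ 4 := pow_le_pow_right₀ M1 (by norm_num)
      _ ≤ M ^ 4 * J ^ 2 := le_mul_of_one_le_right (by positivity) (one_le_pow₀ J1)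
  have c2 : 4 * M ^ 4 ≤ 4 * (M ^ 4 * J ^ 2 / τ) := by
    refine mul_le_mul_of_nonneg_left ?_ (by norm_num)
    rw [le_div_iff₀ τ0]
    calc M ^ 4 * τ ≤ M ^ 4 * 1 := by gcongr
      _ ≤ M ^ 4 * J ^ 2 := by gcongr; exact one_le_pow₀ J1
  have c3 := mul_le_mul_of_nonneg_right c1 (sq_nonneg φ)
  have c4 := mul_le_mul_of_nonneg_right c2 (sq_nonneg φ)
  have e : 9 * M ^ 4 * J ^ 2 / τ * φ ^ 2 = 9 * (M ^ 4 * J ^ 2 / τ * φ ^ 2) := by ring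
  have e' : 4 * M ^ 4 * J ^ 2 / τ * φ ^ 2 = 4 * (M ^ 4 * J ^ 2 / τ * φ ^ 2) := by ring
  rw [e]
  rw [e'] at t2
  linarith

/-- The inviscid part. Apart from the U'' pairing, the corrections measure the deviation of U from a
linear profile or carry Lα, and are bounded through L ≤ τ, L ≤ τσ and Lα ≤ τ. The pairing of U''p
with bw costs a quarter of the good term lbU|w|², the rest being of order L² ≤ τσ². -/
theorem density_shear (F : Flow U U1 U2 u M) (S : Small σ J τ α) (hl : l * u = 1)
    (hy : 0 < y) (hL : L = J ^ 2 * σ ^ 2) (p q w : ℝ → ℂ) :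
    (3 / 8 - 3 * M ^ 2 * τ) * ‖gee U U1 p q y‖ ^ 2 + (1 - M ^ 2 * τ) * (α * ‖p y‖) ^ 2 +
      3 / 4 * (l * (mulB L y * U y * ‖w y‖ ^ 2)) -
      19 * M ^ 3 * τ * (‖gee U U1 p q y‖ * (σ * (1 / (1 + y) ^ 2 * ‖psi U p y‖))) -
      M ^ 2 * τ * (α * ‖p y‖ * ‖gee U U1 p q y‖) -
      M ^ 4 * τ * (σ * (1 / (1 + y) ^ 2 * ‖psi U p y‖)) ^ 2 ≤
    (1 + l * mulB1 L y * (U1 y - u) - l / 2 * mulB1 L y * U1 y + l / 2 * mulB2 L y * U y) *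
      ‖gee U U1 p q y‖ ^ 2 + (1 + l * mulB1 L y * (U1 y - u)) * α ^ 2 * ‖p y‖ ^ 2 +
      l * (mulB L y * U y * ‖w y‖ ^ 2) +
      l * (mulB2 L y * (U1 y - u) + mulB1 L y * U2 y) * U y *
        inner ℝ (gee U U1 p q y) (psi U p y) +
      l * α ^ 2 * mulB1 L y * U y * inner ℝ (p y) (gee U U1 p q y) -
      l * mulB L y * U2 y * inner ℝ (p y) (w y) := by
  obtain ⟨f0, -, -, -, -, -, -, f7, f8, f9⟩ := S.facts
  have hM := F.M_pos
  have hM1 := F.one_le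
  have hU := F.pos hy
  have J0 : 0 < J := zero_lt_one.trans_le S.J1
  have σ0 := S.σ0
  have τ0 := S.τ0
  have α0 := S.α0
  have hL0 : 0 < L := by rw [hL]; positivity
  have hLτ : L ≤ τ := by rw [hL]; exact f9
  have hL1 : L ≤ 1 := hLτ.trans S.τ1
  have hu := F.u_pos
  have hl' : l = u⁻¹ := by field_simp; exact hl
  have l0 : 0 < l := by rw [hl']; positivity
  have hlM : |l| ≤ M := by rw [abs_of_pos l0, hl']; exact F.inv_u_le
  have hlow : 1 / M ≤ l := by
    rw [hl', ← one_div]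
    exact one_div_le_one_div_of_le hu F.u_le
  have hlM' : l ≤ M := (le_abs_self l).trans hlM
  have hb := mulB_nonneg hL0 hy
  have c1 := main_coefficient F hl hlM hL0 hy
  have t2 : -(M ^ 2 * τ) * (α * ‖p y‖) ^ 2 ≤
      l * mulB1 L y * (U1 y - u) * α ^ 2 * ‖p y‖ ^ 2 := by
    have h1 : |l * mulB1 L y * (U1 y - u)| ≤ M ^ 2 * τ := by
      rw [abs_mul, abs_mul]
      calc |l| * |mulB1 L y| * |U1 y - u| ≤ M * |mulB1 L y| * (M * y) := by
            have := F.bu y hy.le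
            gcongr
        _ = M ^ 2 * (|mulB1 L y| * y) := by ring
        _ ≤ M ^ 2 * τ := by
            gcongr
            exact (mulB1_mul_le hL0 hy).trans (by linarith)
    have h2 := mul_le_mul_of_nonneg_right (neg_le_of_abs_le h1)
      (by positivity : 0 ≤ α ^ 2 * ‖p y‖ ^ 2)
    linarith
  have t1 : (3 / 8 - 3 * M ^ 2 * τ) * ‖gee U U1 p q y‖ ^ 2 ≤
      (1 + l * mulB1 L y * (U1 y - u) - l / 2 * mulB1 L y * U1 y + l / 2 * mulB2 L y * U y) *
        ‖gee U U1 p q y‖ ^ 2 := by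
    refine mul_le_mul_of_nonneg_right (le_trans ?_ c1) (sq_nonneg _)
    have : M ^ 2 * L ≤ M ^ 2 * τ := by gcongr
    linarith
  have t3 : -(19 * M ^ 3 * τ * (‖gee U U1 p q y‖ * (σ * (1 / (1 + y) ^ 2 * ‖psi U p y‖)))) ≤
      l * (mulB2 L y * (U1 y - u) + mulB1 L y * U2 y) * U y *
        inner ℝ (gee U U1 p q y) (psi U p y) := by
    refine neg_le_of_abs_le ?_
    rw [abs_mul, abs_mul, abs_mul, abs_of_pos hU]
    have h1 := shear_correction_le F hL0 hy
    have h2 := abs_real_inner_le_norm (gee U U1 p q y) (psi U p y)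
    have h3 : L ≤ τ * σ := by
      rw [hL]; nlinarith
    calc |l| * |mulB2 L y * (U1 y - u) + mulB1 L y * U2 y| * U y *
          |inner ℝ (gee U U1 p q y) (psi U p y)|
        = |l| * (|mulB2 L y * (U1 y - u) + mulB1 L y * U2 y| * U y) *
          |inner ℝ (gee U U1 p q y) (psi U p y)| := by ring
      _ ≤ M * (19 * M ^ 2 * L * (1 / (1 + y) ^ 2)) * (‖gee U U1 p q y‖ * ‖psi U p y‖) := by gcongr
      _ ≤ M * (19 * M ^ 2 * (τ * σ) * (1 / (1 + y) ^ 2)) * (‖gee U U1 p q y‖ * ‖psi U p y‖) := by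
          gcongr
      _ = _ := by ring
  have t4 : -(M ^ 2 * τ * (α * ‖p y‖ * ‖gee U U1 p q y‖)) ≤
      l * α ^ 2 * mulB1 L y * U y * inner ℝ (p y) (gee U U1 p q y) := by
    refine neg_le_of_abs_le ?_
    rw [abs_mul, abs_mul, abs_mul, abs_mul, abs_of_pos hU, abs_of_nonneg (sq_nonneg α)]
    have h2 := abs_real_inner_le_norm (p y) (gee U U1 p q y)
    have h3 : L * α ≤ τ := by rw [hL]; linarith [S.h3]
    calc |l| * α ^ 2 * |mulB1 L y| * U y * |inner ℝ (p y) (gee U U1 p q y)|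
        ≤ M * α ^ 2 * |mulB1 L y| * (M * y) * (‖p y‖ * ‖gee U U1 p q y‖) := by
          have := F.le_mul y hy.le
          gcongr
      _ = M ^ 2 * (α * (|mulB1 L y| * y)) * (α * ‖p y‖ * ‖gee U U1 p q y‖) := by ring
      _ ≤ M ^ 2 * τ * (α * ‖p y‖ * ‖gee U U1 p q y‖) := by
          gcongr
          have := mul_le_mul_of_nonneg_left (mulB1_mul_le hL0 hy) α0.le
          nlinarith
  have t5 : l * mulB L y * U2 y * inner ℝ (p y) (w y) ≤
      1 / 4 * (l * (mulB L y * U y * ‖w y‖ ^ 2)) +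
        M ^ 4 * τ * (σ * (1 / (1 + y) ^ 2 * ‖psi U p y‖)) ^ 2 := by
    have h1 : ‖U2 y • psi U p y‖ ≤ M * (1 / (1 + y) ^ 2 * ‖psi U p y‖) :=
      psi_decay U p hy (F.b2 y hy.le)
    set d := M * (1 / (1 + y) ^ 2 * ‖psi U p y‖) with hd
    have h2 : inner ℝ (U2 y • psi U p y) (w y) ≤ d * ‖w y‖ := inner_le_mul h1 le_rfl
    have h3 : l * mulB L y * U2 y * inner ℝ (p y) (w y) =
        l * (mulB L y * U y) * inner ℝ (U2 y • psi U p y) (w y) := by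
      have ep : inner ℝ (p y) (w y) = U y * inner ℝ (psi U p y) (w y) := by
        rw [← real_inner_smul_left, smul_psi F p hy]
      rw [ep, real_inner_smul_left]
      ring
    have h4 : l * (mulB L y * U y) * (d ^ 2) ≤ M ^ 4 * τ * (σ * (1 / (1 + y) ^ 2 * ‖psi U p y‖)) ^ 2 := by
      have h5 : L ^ 2 ≤ τ * σ ^ 2 := by
        rw [hL]
        calc (J ^ 2 * σ ^ 2) ^ 2 = (J ^ 4 * σ ^ 2) * σ ^ 2 := by ring
          _ ≤ τ * σ ^ 2 := by gcongr
      calc l * (mulB L y * U y) * (d ^ 2) ≤ M * (M * L ^ 2) * d ^ 2 := by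
            have := mulB_mul_U_le F hL0 hy
            gcongr
        _ ≤ M * (M * (τ * σ ^ 2)) * d ^ 2 := by gcongr
        _ = _ := by rw [hd]; ring
    rw [h3]
    have h6 := mul_le_mul_of_nonneg_left h2 (by positivity : 0 ≤ l * (mulB L y * U y))
    have h7 : 0 ≤ l * (mulB L y * U y) * (‖w y‖ / 2 - d) ^ 2 := by positivity
    linarith
  linarith

/-- The two viscous contributions are treated together: the one from moving the derivative onto ζ,
where `energyRest` suffices, and the zeroth-order one with α², in which the bw part of the test
function has already dropped out. -/
theorem density_viscous (F : Flow U U1 U2 u M) (S : Small σ J τ α) (hl : l * u = 1)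
    (hy : 0 < y) (hL : L = J ^ 2 * σ ^ 2) (p q w : ℝ → ℂ) :
    -(112 * M ^ 3 * τ * ((σ ^ 2 * ‖w y‖) ^ 2 + (α * ‖p y‖) ^ 2 +
        (σ * (1 / (1 + y) ^ 2 * ‖psi U p y‖)) ^ 2 + ‖gee U U1 p q y‖ ^ 2 +
        (L ^ 2 / (L + y) ^ 2 * ‖psi U p y‖ / J) ^ 2)) ≤
    -((σ ^ 2) ^ 3 * inner ℝ (Complex.I * w y)
      (energyZeta' l u α U U1 U2 (mulB1 L) (mulB2 L) (mulB3 L) p q w y)) +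
    (σ ^ 2) ^ 3 * α ^ 2 * inner ℝ (Complex.I * w y)
      ((1 - mulB1 L y) • psi U p y + l • (mulB1 L y • q y)) := by
  obtain ⟨f0, -, -, -, -, -, -, f7, f8, f9⟩ := S.facts
  have hM := F.M_pos
  have hM1 := F.one_le
  have hU := F.pos hy
  have J0 : 0 < J := zero_lt_one.trans_le S.J1
  have σ0 := S.σ0
  have τ0 := S.τ0
  have α0 := S.α0
  have hL0 : 0 < L := by rw [hL]; positivity
  have hLτ : L ≤ τ := by rw [hL]; exact f9
  have hL1 : L ≤ 1 := hLτ.trans S.τ1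
  have hu := F.u_pos
  have hl' : l = u⁻¹ := by field_simp; exact hl
  have l0 : 0 < l := by rw [hl']; positivity
  have hlM : |l| ≤ M := by rw [abs_of_pos l0, hl']; exact F.inv_u_le
  have hlow : 1 / M ≤ l := by
    rw [hl', ← one_div]
    exact one_div_le_one_div_of_le hu F.u_le
  have hlM' : l ≤ M := (le_abs_self l).trans hlM
  have hb := mulB_nonneg hL0 hy
  have hz := norm_energyRest_le (α := α) F hlM hL0 hL1 p q hy
  have he : ‖(1 - mulB1 L y) • psi U p y + l • (mulB1 L y • q y)‖ ≤
      5 * M / L * ‖p y‖ + M * (‖gee U U1 p q y‖ +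
        M * (2 * (L ^ 2 / (L + y) ^ 2 * ‖psi U p y‖))) := by
    refine (norm_add_le _ _).trans (add_le_add ?_ ?_)
    · rw [psi, smul_smul]
      refine norm_smul_le_of ?_ le_rfl
      rw [abs_of_nonneg (quot_nonneg F hL0 hy)]
      exact quot_le F hL0 hL1 hy
    · refine norm_smul_le_of hlM ?_
      have e : mulB1 L y • q y = mulB1 L y • gee U U1 p q y + U1 y • (mulB1 L y • psi U p y) := by
        rw [gee]; module
      rw [e]
      refine (norm_add_le _ _).trans (add_le_add
        ((norm_smul_le_of (mulB1_le_one hL0 y) le_rfl).trans (one_mul _).le)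
        ((norm_smul_le_of (F.b1' hy.le) (norm_smul_le_of (mulB1_le_weight hL0 hy) le_rfl)).trans
          (le_of_eq (by ring))))
  rw [hL] at hz he
  have V := viscous_aux S hM1 (norm_nonneg _) (by positivity) (by positivity) (norm_nonneg _)
    (norm_nonneg (w y)) hz he
  rw [← hL] at V he hz
  have v1 : inner ℝ (Complex.I * w y)
      (energyZeta' l u α U U1 U2 (mulB1 L) (mulB2 L) (mulB3 L) p q w y) ≤
      ‖w y‖ * ‖energyRest l u α U U1 U2 (mulB1 L) (mulB2 L) (mulB3 L) p q y‖ := by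
    rw [inner_I_energyZeta' hl]
    exact inner_le_mul (by rw [norm_mul, Complex.norm_I, one_mul]) le_rfl
  have v2 : -inner ℝ (Complex.I * w y) ((1 - mulB1 L y) • psi U p y + l • (mulB1 L y • q y)) ≤
      ‖w y‖ * ‖(1 - mulB1 L y) • psi U p y + l • (mulB1 L y • q y)‖ :=
    neg_inner_le_mul (by rw [norm_mul, Complex.norm_I, one_mul]) le_rfl
  have v1' := mul_le_mul_of_nonneg_left v1 (by positivity : 0 ≤ (σ ^ 2) ^ 3)
  have v2' := mul_le_mul_of_nonneg_left v2 (by positivity : 0 ≤ (σ ^ 2) ^ 3 * α ^ 2)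
  linarith

/-- Using l·u = 1 the test function is ψ + lβg + lβ(U' - u)ψ - lbw, and only the corrections are
estimated. The pairing with ψ itself is kept intact, because its treatment depends on whether α ≥ 1
or α ≤ 1. -/
theorem density_data (F : Flow U U1 U2 u M) (S : Small σ J τ α) (hl : l * u = 1)
    (hy : 0 < y) (hL : L = J ^ 2 * σ ^ 2) (p q w f : ℝ → ℂ) :
    inner ℝ (f y) (psi U p y) - (τ * ‖gee U U1 p q y‖ ^ 2 +
      τ * (L ^ 2 / (L + y) ^ 2 * ‖psi U p y‖ / J) ^ 2 +
      1 / (8 * M) * (mulB L y * U y * ‖w y‖ ^ 2) + 9 * M ^ 4 * J ^ 2 / τ * ‖f y‖ ^ 2) ≤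
    inner ℝ (f y) (energyTest l U (mulB L) (mulB1 L) p q w y) := by
  obtain ⟨f0, -, -, -, -, -, -, f7, f8, f9⟩ := S.facts
  have hM := F.M_pos
  have hM1 := F.one_le
  have hU := F.pos hy
  have J0 : 0 < J := zero_lt_one.trans_le S.J1
  have σ0 := S.σ0
  have τ0 := S.τ0
  have α0 := S.α0
  have hL0 : 0 < L := by rw [hL]; positivity
  have hLτ : L ≤ τ := by rw [hL]; exact f9
  have hL1 : L ≤ 1 := hLτ.trans S.τ1
  have hu := F.u_pos
  have hl' : l = u⁻¹ := by field_simp; exact hl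
  have l0 : 0 < l := by rw [hl']; positivity
  have hlM : |l| ≤ M := by rw [abs_of_pos l0, hl']; exact F.inv_u_le
  have hlow : 1 / M ≤ l := by
    rw [hl', ← one_div]
    exact one_div_le_one_div_of_le hu F.u_le
  have hlM' : l ≤ M := (le_abs_self l).trans hlM
  have hb := mulB_nonneg hL0 hy
  have d1 : inner ℝ (f y) (psi U p y) - ‖f y‖ * (M * ‖gee U U1 p q y‖ +
      M * (4 * M * (L ^ 2 / (L + y) ^ 2 * ‖psi U p y‖)) + M * (mulB L y * ‖w y‖)) ≤
      inner ℝ (f y) (energyTest l U (mulB L) (mulB1 L) p q w y) := by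
    have e : energyTest l U (mulB L) (mulB1 L) p q w y = psi U p y +
        (l • (mulB1 L y • gee U U1 p q y) + l • ((mulB1 L y * (U1 y - u)) • psi U p y) -
          l • (mulB L y • w y)) := by
      have e0 : mulB1 L y • psi U p y = (l * u * mulB1 L y) • psi U p y := by rw [hl, one_mul]
      have e1 : q y = gee U U1 p q y + U1 y • psi U p y := by rw [gee, sub_add_cancel]
      rw [energyTest, sub_smul, e0]
      conv_lhs => rw [e1]
      module
    rw [e, inner_add_right]
    have h1 : ‖l • (mulB1 L y • gee U U1 p q y) + l • ((mulB1 L y * (U1 y - u)) • psi U p y) -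
          l • (mulB L y • w y)‖ ≤ M * ‖gee U U1 p q y‖ +
      M * (4 * M * (L ^ 2 / (L + y) ^ 2 * ‖psi U p y‖)) + M * (mulB L y * ‖w y‖) := by
      refine (norm_sub_le _ _).trans (add_le_add ((norm_add_le _ _).trans (add_le_add ?_ ?_)) ?_)
      · exact norm_smul_le_of hlM ((norm_smul_le_of (mulB1_le_one hL0 y) le_rfl).trans
          (one_mul _).le)
      · refine norm_smul_le_of hlM ((norm_smul_le_of (C := 2 * (L ^ 2 / (L + y) ^ 2) * (2 * M))
          ?_ le_rfl).trans (le_of_eq (by ring)))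
        rw [abs_mul]
        exact mul_le_mul (mulB1_le_weight hL0 hy) (F.abs_U1_sub_le hy.le) (abs_nonneg _)
          (by positivity)
      · refine norm_smul_le_of hlM (norm_smul_le_of ?_ le_rfl)
        rw [abs_of_nonneg hb]
    have h2 := neg_inner_le_mul (x := f y) le_rfl h1
    linarith
  have d2 := data_aux S hM1 (φ := ‖f y‖) (G := ‖gee U U1 p q y‖)
    (hL := L ^ 2 / (L + y) ^ 2 * ‖psi U p y‖) (n := ‖w y‖) hb
    (mulB_le F hL0 hL1 hy)
  linarith

theorem energyDensity_lower (F : Flow U U1 U2 u M) (S : Small σ J τ α) (hl : l * u = 1)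
    (hy : 0 < y) (hL : L = J ^ 2 * σ ^ 2) (p q w f : ℝ → ℂ) :
    3 / 8 * ‖gee U U1 p q y‖ ^ 2 + α ^ 2 * ‖p y‖ ^ 2 +
      5 / (8 * M) * (L ^ 2 * y / (L ^ 2 + y ^ 2) * U y * ‖w y‖ ^ 2) + inner ℝ (f y) (psi U p y) -
      150 * M ^ 4 * τ * ((σ ^ 2 * ‖w y‖) ^ 2 + (α * ‖p y‖) ^ 2 +
        (σ * ‖((1 : ℝ) ^ 2 / (1 + y) ^ 2) • psi U p y‖) ^ 2 + ‖gee U U1 p q y‖ ^ 2 +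
        (‖(L ^ 2 / (L + y) ^ 2) • psi U p y‖ / J) ^ 2) - 9 * M ^ 4 * J ^ 2 / τ * ‖f y‖ ^ 2 ≤
    energyDensity l u ((σ ^ 2) ^ 3) α U U1 U2 (mulB L) (mulB1 L) (mulB2 L) (mulB3 L) p q w f y := by
  obtain ⟨f0, -, -, -, -, -, -, f7, f8, f9⟩ := S.facts
  have hM := F.M_pos
  have hM1 := F.one_le
  have hU := F.pos hy
  have J0 : 0 < J := zero_lt_one.trans_le S.J1
  have σ0 := S.σ0
  have τ0 := S.τ0
  have α0 := S.α0
  have hL0 : 0 < L := by rw [hL]; positivity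
  have hLτ : L ≤ τ := by rw [hL]; exact f9
  have hL1 : L ≤ 1 := hLτ.trans S.τ1
  have hu := F.u_pos
  have hl' : l = u⁻¹ := by field_simp; exact hl
  have l0 : 0 < l := by rw [hl']; positivity
  have hlM : |l| ≤ M := by rw [abs_of_pos l0, hl']; exact F.inv_u_le
  have hlow : 1 / M ≤ l := by
    rw [hl', ← one_div]
    exact one_div_le_one_div_of_le hu F.u_le
  have hlM' : l ≤ M := (le_abs_self l).trans hlM
  have hb := mulB_nonneg hL0 hy
  have n1 : ‖((1 : ℝ) ^ 2 / (1 + y) ^ 2) • psi U p y‖ = 1 / (1 + y) ^ 2 * ‖psi U p y‖ := by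
    rw [norm_smul, Real.norm_of_nonneg (by positivity), one_pow]
  have n2 : ‖(L ^ 2 / (L + y) ^ 2) • psi U p y‖ = L ^ 2 / (L + y) ^ 2 * ‖psi U p y‖ := by
    rw [norm_smul, Real.norm_of_nonneg (by positivity)]
  rw [n1, n2]
  have A1 := density_shear F S hl hy hL p q w
  have A2 := density_viscous F S hl hy hL p q w
  have A3 := density_data F S hl hy hL p q w f
  have b1 : 3 / 4 * (1 / M * (mulB L y * U y * ‖w y‖ ^ 2)) ≤
      3 / 4 * (l * (mulB L y * U y * ‖w y‖ ^ 2)) := by gcongr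
  -- Of the 3/4 left by `density_shear`, an eighth pays for the data term and 5/8 remains.
  have b2 : 3 / 4 * (1 / M * (mulB L y * U y * ‖w y‖ ^ 2)) =
      5 / (8 * M) * (mulB L y * U y * ‖w y‖ ^ 2) + 1 / (8 * M) * (mulB L y * U y * ‖w y‖ ^ 2) := by
    field_simp; ring
  have eb : L ^ 2 * y / (L ^ 2 + y ^ 2) = mulB L y := rfl
  rw [energyDensity, eb]
  set G := ‖gee U U1 p q y‖
  set h := σ * (1 / (1 + y) ^ 2 * ‖psi U p y‖)
  set hΛ := L ^ 2 / (L + y) ^ 2 * ‖psi U p y‖ / J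
  have m3 : M ^ 3 ≤ M ^ 4 := pow_le_pow_right₀ hM1 (by norm_num)
  have m2 : M ^ 2 ≤ M ^ 4 := pow_le_pow_right₀ hM1 (by norm_num)
  have m0 : 1 ≤ M ^ 4 := one_le_pow₀ hM1
  have q1 : 19 * M ^ 3 * τ * (G * h) ≤ 10 * M ^ 4 * τ * (G ^ 2 + h ^ 2) := by
    have x := two_mul_le_add_sq G h
    calc 19 * M ^ 3 * τ * (G * h) = 19 / 2 * M ^ 3 * τ * (2 * G * h) := by ring
      _ ≤ 10 * M ^ 4 * τ * (G ^ 2 + h ^ 2) := by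
          gcongr
          norm_num
  have q2 : M ^ 2 * τ * (α * ‖p y‖ * G) ≤ M ^ 4 * τ * (1 / 2 * ((α * ‖p y‖) ^ 2 + G ^ 2)) := by
    have x := two_mul_le_add_sq (α * ‖p y‖) G
    have x' : α * ‖p y‖ * G ≤ 1 / 2 * ((α * ‖p y‖) ^ 2 + G ^ 2) := by linarith
    exact mul_le_mul (mul_le_mul_of_nonneg_right m2 τ0.le) x' (by positivity) (by positivity)
  have q3 : 112 * M ^ 3 * τ * ((σ ^ 2 * ‖w y‖) ^ 2 + (α * ‖p y‖) ^ 2 + h ^ 2 + G ^ 2 + hΛ ^ 2) ≤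
      112 * M ^ 4 * τ * ((σ ^ 2 * ‖w y‖) ^ 2 + (α * ‖p y‖) ^ 2 + h ^ 2 + G ^ 2 + hΛ ^ 2) := by
    gcongr
  have q4 : M ^ 2 * τ * G ^ 2 ≤ M ^ 4 * τ * G ^ 2 := by gcongr
  have q5 : M ^ 2 * τ * (α * ‖p y‖) ^ 2 ≤ M ^ 4 * τ * (α * ‖p y‖) ^ 2 := by gcongr
  have q6 : τ * G ^ 2 ≤ M ^ 4 * τ * G ^ 2 := by
    rw [mul_assoc]; exact le_mul_of_one_le_left (by positivity) m0
  have q7 : τ * hΛ ^ 2 ≤ M ^ 4 * τ * hΛ ^ 2 := by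
    rw [mul_assoc]; exact le_mul_of_one_le_left (by positivity) m0
  have z1 : 0 ≤ M ^ 4 * τ * G ^ 2 := by positivity
  have z2 : 0 ≤ M ^ 4 * τ * (α * ‖p y‖) ^ 2 := by positivity
  have z3 : 0 ≤ M ^ 4 * τ * h ^ 2 := by positivity
  have z4 : 0 ≤ M ^ 4 * τ * hΛ ^ 2 := by positivity
  have z5 : 0 ≤ M ^ 4 * τ * (σ ^ 2 * ‖w y‖) ^ 2 := by positivity
  linarith

end OrrSommerfeld

/-! ### The basic energy estimate -/

namespace OrrSommerfeld

/-- The absorption argument. S collects all quantities multiplied by the small c1 and costs at most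
an eighth of the good terms, with weight 1/M. This bounds G, F2 and the shear term, and the
vorticity bound then adds X and a2. -/
theorem energy_arith {M c1 c2 C0 G F2 X a2 Bw D I S : ℝ} (hM : 1 ≤ M) (hC0 : 1 ≤ C0)
    (c20 : 0 ≤ c2) (hG0 : 0 ≤ G) (F0 : 0 ≤ F2) (hf0 : 0 ≤ D) (hB0 : 0 ≤ Bw)
    (hv : X + a2 ≤ C0 * (Bw + D + F2 + G)) (z4 : c1 * S ≤ 1 / (8 * M) * (Bw + D + F2 + G))
    (key : 3 / 8 * G + F2 + 5 / (8 * M) * Bw + I - c1 * S - c2 * D ≤ 0) :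
    G + F2 + X + a2 ≤ 4 * M * (1 + C0) * (c2 + 2) * (|I| + D) := by
  have hM0 : 0 < M := by linarith
  have m1 : 1 / M ≤ 1 := by rw [div_le_one hM0]; exact hM
  have z6 : 5 / (8 * M) * Bw = 5 / 8 * (1 / M * Bw) := by field_simp
  have z7 : 1 / (8 * M) * (Bw + D + F2 + G) =
    1 / 8 * (1 / M * Bw) + 1 / 8 * (1 / M * D) + 1 / 8 * (1 / M * F2) + 1 / 8 * (1 / M * G) := by
    field_simp
  rw [z7] at z4
  rw [z6] at key
  have y1 : 1 / M * D ≤ D := mul_le_of_le_one_left hf0 m1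
  have y2 : 1 / M * F2 ≤ F2 := mul_le_of_le_one_left F0 m1
  have y3 : 1 / M * G ≤ G := mul_le_of_le_one_left hG0 m1
  have y4 : 0 ≤ 1 / M * Bw := by positivity
  have hI := neg_abs_le I
  have z8 : 1 / M * (1 / 4 * (G + F2 + Bw)) ≤ |I| + (c2 + 1) * D := by
    have : 1 / M * (1 / 4 * (G + F2 + Bw)) = 1 / 4 * (1 / M * G) + 1 / 4 * (1 / M * F2) +
      1 / 4 * (1 / M * Bw) := by ring
    rw [this]
    linarith
  have z9 : G + F2 + Bw ≤ 4 * M * (|I| + (c2 + 1) * D) := by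
    have := mul_le_mul_of_nonneg_left z8 (by positivity : 0 ≤ 4 * M)
    refine le_trans (le_of_eq ?_) this
    field_simp
  have hI0 := abs_nonneg I
  have z13 : C0 * D ≤ 4 * M * (1 + C0) * D := by
    gcongr
    nlinarith
  calc G + F2 + X + a2 ≤ (1 + C0) * (G + F2 + Bw) + C0 * D := by linarith
    _ ≤ (1 + C0) * (4 * M * (|I| + (c2 + 1) * D)) + 4 * M * (1 + C0) * D := by gcongr
    _ = 4 * M * (1 + C0) * (|I| + (c2 + 2) * D) := by ring
    _ ≤ 4 * M * (1 + C0) * ((c2 + 2) * |I| + (c2 + 2) * D) := by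
        gcongr
        exact le_mul_of_one_le_left hI0 (by linarith)
    _ = _ := by ring

/-- The basic energy estimate: all the energies are controlled by the work of the force against
`psi` and by the norm of the force. -/
theorem energy_bound {M : ℝ} (hM : 1 ≤ M) : ∃ C, 1 ≤ C ∧ ∃ δ, 0 < δ ∧ δ ≤ 1 ∧
    ∀ {U U1 U2 : ℝ → ℝ} {u σ α : ℝ} {p q w w1 w2 f : ℝ → ℂ},
    Sol U U1 U2 u M (σ ^ 2) α p q w w1 w2 f → 0 < σ → σ ≤ δ → σ ^ 2 * α ≤ δ →
    sqInt (gee U U1 p q) + α ^ 2 * sqInt p + (σ ^ 2) ^ 2 * sqInt w +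
      σ ^ 2 * ‖psi U p (σ ^ 2)‖ ^ 2 ≤
      C * (|∫ y in Ioi (0 : ℝ), inner ℝ (f y) (psi U p y)| + sqInt f) := by
  obtain ⟨C0, hC0, hvort⟩ := vorticity_bound hM
  have hM0 : 0 < M := by linarith
  -- τ solves 150M⁴τ·41M²(1 + C0) = 1/(8M): 150M⁴ is the constant of `energyDensity_lower`, and 41 =
  -- 2·20 + 1 counts the two weighted bounds of ψ, at scales 1 and L, and the energies themselves.
  obtain ⟨τ, hτ⟩ : ∃ τ, τ = 1 / (49200 * M ^ 7 * (1 + C0)) := ⟨_, rfl⟩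
  have τ0 : 0 < τ := by rw [hτ]; positivity
  have τ1 : τ ≤ 1 := by
    rw [hτ, div_le_one (by positivity)]
    have : 1 ≤ M ^ 7 := one_le_pow₀ hM
    nlinarith
  -- With J = 1/τ and threshold δ = τ⁵ one gets τJ⁴ = τ⁻³ ≥ 1, J⁴σ ≤ τ and J²σ²α ≤ τ³ ≤ τ, the three
  -- conditions of `Small`.
  obtain ⟨J, hJ⟩ : ∃ J, J = 1 / τ := ⟨_, rfl⟩
  have J1 : 1 ≤ J := by rw [hJ, le_div_iff₀ τ0]; linarith
  have J0 : 0 < J := by linarith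
  obtain ⟨c2, hc2⟩ : ∃ c2, c2 = 9 * M ^ 4 * J ^ 2 / τ := ⟨_, rfl⟩
  have c20 : 0 ≤ c2 := by rw [hc2]; positivity
  refine ⟨4 * M * (1 + C0) * (c2 + 2), by nlinarith [mul_nonneg hM0.le c20], τ ^ 5, by positivity,
    pow_le_one₀ τ0.le τ1, fun {U U1 U2 u σ α p q w w1 w2 f} S σ0 hσ hσα => ?_⟩
  have F := S.F
  have W := S.W
  have sm : Small σ J τ α := by
    refine ⟨σ0, J1, τ0, τ1, S.a0, ?_, ?_, ?_⟩
    · have : τ * J ^ 4 = 1 / τ ^ 3 := by rw [hJ]; field_simp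
      rw [this, le_div_iff₀ (by positivity), one_mul]
      exact pow_le_one₀ τ0.le τ1
    · calc J ^ 4 * σ ≤ J ^ 4 * τ ^ 5 := by gcongr
        _ = τ := by rw [hJ]; field_simp
    · calc J ^ 2 * (σ ^ 2 * α) ≤ J ^ 2 * τ ^ 5 := by gcongr
        _ = τ ^ 3 := by rw [hJ]; field_simp
        _ ≤ τ := pow_le_of_le_one τ0.le τ1 (by norm_num)
  obtain ⟨L, hL⟩ : ∃ L, L = J ^ 2 * σ ^ 2 := ⟨_, rfl⟩
  have hL0 : 0 < L := by rw [hL]; positivity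
  have hL1 : L ≤ 1 := by
    rw [hL]; obtain ⟨-, -, -, -, -, -, -, -, -, h⟩ := sm.facts; exact h.trans τ1
  have hkL : σ ^ 2 ≤ L := by
    rw [hL]; exact le_mul_of_one_le_left (by positivity) (one_le_pow₀ J1)
  have hl : u⁻¹ * u = 1 := inv_mul_cancel₀ F.u_pos.ne'
  obtain ⟨B, T⟩ := multiplier_mulB F hL0 hL1
  obtain ⟨iD, hD⟩ := energy_identity F W S.E S.mf T hl
  have mg := memLp_gee F W
  have ig : IntegrableOn (fun y => ‖gee U U1 p q y‖ ^ 2) (Ioi 0) := integrable_norm_sq_of_memLp mg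
  have ip : IntegrableOn (fun y => ‖p y‖ ^ 2) (Ioi 0) := integrable_norm_sq_of_memLp W.m0
  have iw : IntegrableOn (fun y => ‖w y‖ ^ 2) (Ioi 0) := integrable_norm_sq_of_memLp W.m2
  have iff : IntegrableOn (fun y => ‖f y‖ ^ 2) (Ioi 0) := integrable_norm_sq_of_memLp S.mf
  have ib := integrableOn_shear F hL0 W.m2
  have ifψ : IntegrableOn (fun y => inner ℝ (f y) (psi U p y)) (Ioi 0) :=
    integrable_inner_of_memLp S.mf (memLp_psi F W)
  have i1 : IntegrableOn (fun y => ‖((1 : ℝ) ^ 2 / (1 + y) ^ 2) • psi U p y‖ ^ 2) (Ioi 0) :=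
    integrable_norm_sq_of_memLp (memLp_weight_psi F W one_pos)
  have i2 : IntegrableOn (fun y => ‖(L ^ 2 / (L + y) ^ 2) • psi U p y‖ ^ 2) (Ioi 0) :=
    integrable_norm_sq_of_memLp (memLp_weight_psi F W hL0)
  obtain ⟨c1, hc1⟩ : ∃ c1, c1 = 150 * M ^ 4 * τ := ⟨_, rfl⟩
  have j1 := integrableOn_add (ig.const_mul (3 / 8 - c1)) (ip.const_mul ((1 - c1) * α ^ 2))
  have j2 := integrableOn_add j1 (ib.const_mul (5 / (8 * M)))
  have j3 := integrableOn_add j2 ifψ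
  have j4 := integrableOn_sub j3 (iw.const_mul (c1 * (σ ^ 2) ^ 2))
  have j5 := integrableOn_sub j4 (i1.const_mul (c1 * σ ^ 2))
  have j6 := integrableOn_sub j5 (i2.const_mul (c1 / J ^ 2))
  have j7 := integrableOn_sub j6 (iff.const_mul c2)
  have key := setIntegral_mono_on j7 iD measurableSet_Ioi fun y hy => by
    refine le_trans (le_of_eq ?_) (energyDensity_lower F sm hl hy hL p q w f)
    rw [hc1, hc2]
    ring
  rw [hD, integral_sub j6 (iff.const_mul c2), integral_sub j5 (i2.const_mul _),
    integral_sub j4 (i1.const_mul _), integral_sub j3 (iw.const_mul _), integral_add j2 ifψ,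
    integral_add j1 (ib.const_mul _), integral_add (ig.const_mul _) (ip.const_mul _)] at key
  simp only [integral_const_mul] at key
  have w1' := weighted_psi F W S.k0 S.k1 le_rfl
  have w2' := weighted_psi F W S.k0 hkL hL1
  have hv := hvort S hkL
  have hG0 := sqInt_nonneg (gee U U1 p q)
  have hp0 := sqInt_nonneg p
  have hw0 := sqInt_nonneg w
  have hf0 := sqInt_nonneg f
  have hB0 := shearInt_nonneg F hL0 w
  change (3 / 8 - c1) * sqInt (gee U U1 p q) + (1 - c1) * α ^ 2 * sqInt p +
    5 / (8 * M) * shearInt L U w + _ - c1 * (σ ^ 2) ^ 2 * sqInt w - c1 * σ ^ 2 * _ -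
    c1 / J ^ 2 * _ - c2 * sqInt f ≤ 0 at key
  change _ ≤ 20 * M ^ 2 * (1 / σ ^ 2) * (σ ^ 2 * ‖psi U p (σ ^ 2)‖ ^ 2 + sqInt (gee U U1 p q)) at w1'
  change _ ≤ 20 * M ^ 2 * (L / σ ^ 2) * (σ ^ 2 * ‖psi U p (σ ^ 2)‖ ^ 2 + sqInt (gee U U1 p q)) at w2'
  set I := ∫ y in Ioi (0 : ℝ), inner ℝ (f y) (psi U p y)
  set G := sqInt (gee U U1 p q)
  set Bw := shearInt L U w
  set D := sqInt f
  set I1 := ∫ y in Ioi (0 : ℝ), ‖((1 : ℝ) ^ 2 / (1 + y) ^ 2) • psi U p y‖ ^ 2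
  set I2 := ∫ y in Ioi (0 : ℝ), ‖(L ^ 2 / (L + y) ^ 2) • psi U p y‖ ^ 2
  obtain ⟨a2, ha2⟩ : ∃ a2, a2 = σ ^ 2 * ‖psi U p (σ ^ 2)‖ ^ 2 := ⟨_, rfl⟩
  obtain ⟨X, hX⟩ : ∃ X, X = (σ ^ 2) ^ 2 * sqInt w := ⟨_, rfl⟩
  obtain ⟨F2, hF2⟩ : ∃ F2, F2 = α ^ 2 * sqInt p := ⟨_, rfl⟩
  have a20 : 0 ≤ a2 := by rw [ha2]; positivity
  have X0 : 0 ≤ X := by rw [hX]; positivity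
  have F0 : 0 ≤ F2 := by rw [hF2]; positivity
  rw [← ha2] at w1' w2' hv ⊢
  rw [← hX, ← hF2] at hv ⊢
  rw [mul_assoc (1 - c1), ← hF2, mul_assoc c1 ((σ ^ 2) ^ 2), ← hX] at key
  have z1 : σ ^ 2 * I1 ≤ 20 * M ^ 2 * (a2 + G) := by
    refine (mul_le_mul_of_nonneg_left w1' (by positivity)).trans (le_of_eq ?_)
    field_simp
  have z2 : I2 / J ^ 2 ≤ 20 * M ^ 2 * (a2 + G) := by
    rw [div_le_iff₀ (by positivity)]
    refine w2'.trans (le_of_eq ?_)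
    rw [hL]
    field_simp
  have hM2 : 1 ≤ M ^ 2 := one_le_pow₀ hM
  have z3 : X + F2 + σ ^ 2 * I1 + G + I2 / J ^ 2 ≤ 41 * M ^ 2 * ((1 + C0) * (Bw + D + F2 + G)) := by
    have : X + F2 + G ≤ M ^ 2 * (X + F2 + G) := le_mul_of_one_le_left (by positivity) hM2
    have h4 : X + a2 + F2 + G ≤ (1 + C0) * (Bw + D + F2 + G) := by linarith
    have h5 := mul_le_mul_of_nonneg_left h4 (by positivity : 0 ≤ 41 * M ^ 2)
    have h6 : 0 ≤ M ^ 2 * (X + F2) := by positivity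
    have h7 : 0 ≤ M ^ 2 * a2 := by positivity
    linarith
  have c10 : 0 ≤ c1 := by rw [hc1]; positivity
  have z4 : c1 * (X + F2 + σ ^ 2 * I1 + G + I2 / J ^ 2) ≤ 1 / (8 * M) * (Bw + D + F2 + G) := by
    refine (mul_le_mul_of_nonneg_left z3 c10).trans (le_of_eq ?_)
    rw [hc1, hτ]
    field_simp
    ring
  refine energy_arith hM hC0 c20 hG0 F0 hf0 hB0 (S := X + F2 + σ ^ 2 * I1 + G + I2 / J ^ 2)
    hv z4 ?_
  have z5 : c1 / J ^ 2 * I2 = c1 * (I2 / J ^ 2) := by ring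
  linarith

end OrrSommerfeld

/-! ### Bounds of ψ by the energies, and wave numbers α ≥ 1 -/

namespace OrrSommerfeld

variable {U U1 U2 : ℝ → ℝ} {u M k α σ : ℝ} {p q w w1 w2 f g : ℝ → ℂ}

theorem l2norm_eq (f : ℝ → ℂ) : l2norm f = Real.sqrt (sqInt f) := rfl

theorem l2norm_nonneg (f : ℝ → ℂ) : 0 ≤ l2norm f := Real.sqrt_nonneg _

theorem l2norm_sq (f : ℝ → ℂ) : l2norm f ^ 2 = sqInt f := Real.sq_sqrt (sqInt_nonneg f)

theorem integral_norm_mul_le (hf : MemLp f 2 halfLine) (hg : MemLp g 2 halfLine) :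
    ∫ y in Ioi (0 : ℝ), ‖f y‖ * ‖g y‖ ≤ l2norm f * l2norm g := by
  refine le_of_sq_le_sq' ?_ (mul_nonneg (l2norm_nonneg _) (l2norm_nonneg _))
  rw [mul_pow, l2norm_sq, l2norm_sq]
  exact sq_integral_norm_mul_le hf hg
where
  le_of_sq_le_sq' {x y : ℝ} (h : x ^ 2 ≤ y ^ 2) (hy : 0 ≤ y) : x ≤ y := by
    by_contra hc
    nlinarith

theorem abs_integral_le_of_le {h k : ℝ → ℝ} (hk : IntegrableOn k (Ioi 0))
    (hle : ∀ y, 0 < y → |h y| ≤ k y) :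
    |∫ y in Ioi (0 : ℝ), h y| ≤ ∫ y in Ioi (0 : ℝ), k y := by
  have := norm_integral_le_of_norm_le (f := h) (g := k) (μ := halfLine) hk
    ((ae_restrict_iff' measurableSet_Ioi).2 (Eventually.of_forall fun y hy => hle y hy))
  simpa using this

theorem integrableOn_norm_mul (hf : MemLp f 2 halfLine) (hg : MemLp g 2 halfLine) :
    IntegrableOn (fun y => ‖f y‖ * ‖g y‖) (Ioi 0) := hf.norm.integrable_mul hg.norm

theorem abs_integral_inner_le (hf : MemLp f 2 halfLine) (hg : MemLp g 2 halfLine) :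
    |∫ y in Ioi (0 : ℝ), inner ℝ (f y) (g y)| ≤ l2norm f * l2norm g :=
  (abs_integral_le_of_le (integrableOn_norm_mul hf hg)
    fun _ _ => abs_real_inner_le_norm _ _).trans (integral_norm_mul_le hf hg)

theorem le_of_sq_le_quadratic {x n C : ℝ} (hn : 0 ≤ n) (hC : 1 ≤ C)
    (h : x ^ 2 ≤ C * (x * n + n ^ 2)) : x ≤ 2 * C * n := by
  by_contra hc
  push Not at hc
  have hx : 0 < x := lt_of_le_of_lt (by positivity) hc
  nlinarith [mul_nonneg hn hx.le, mul_nonneg (sub_nonneg.2 hC) hn]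

theorem l2norm_le_of {f : ℝ → ℂ} {C : ℝ} (hC : 0 ≤ C) (h : sqInt f ≤ C ^ 2) : l2norm f ≤ C := by
  rw [l2norm_eq]
  exact Real.sqrt_le_iff.2 ⟨hC, h⟩

theorem l2norm_mono (hg : MemLp g 2 halfLine) {C : ℝ} (hC : 0 ≤ C)
    (h : ∀ y, 0 < y → ‖f y‖ ≤ C * ‖g y‖) : l2norm f ≤ C * l2norm g := by
  refine l2norm_le_of (mul_nonneg hC (l2norm_nonneg _)) ?_
  rw [mul_pow, l2norm_sq, sqInt, sqInt, ← integral_const_mul]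
  refine setIntegral_le_of_le ((integrable_norm_sq_of_memLp hg).const_mul _)
    (fun y _ => by positivity) fun y hy => ?_
  rw [← mul_pow]
  exact pow_le_pow_left₀ (norm_nonneg _) (h y hy) 2

theorem l2norm_add_le (hf : MemLp f 2 halfLine) (hg : MemLp g 2 halfLine) :
    l2norm (fun y => f y + g y) ≤ l2norm f + l2norm g := by
  refine l2norm_le_of (add_nonneg (l2norm_nonneg _) (l2norm_nonneg _)) ?_
  have h1 := integral_norm_mul_le hf hg
  have i1 : IntegrableOn (fun y => ‖f y‖ ^ 2) (Ioi 0) := integrable_norm_sq_of_memLp hf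
  have i2 : IntegrableOn (fun y => ‖g y‖ ^ 2) (Ioi 0) := integrable_norm_sq_of_memLp hg
  have i3 := (integrableOn_norm_mul hf hg).const_mul 2
  have h2 : sqInt (fun y => f y + g y) ≤
      ∫ y in Ioi (0 : ℝ), (‖f y‖ ^ 2 + ‖g y‖ ^ 2 + 2 * (‖f y‖ * ‖g y‖)) := by
    refine setIntegral_le_of_le ((i1.add i2).add i3) (fun y _ => by positivity) fun y _ => ?_
    have := pow_le_pow_left₀ (norm_nonneg _) (norm_add_le (f y) (g y)) 2
    linarith
  rw [integral_add (integrableOn_add i1 i2) i3, integral_add i1 i2, integral_const_mul] at h2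
  have e1 := l2norm_sq f
  have e2 := l2norm_sq g
  simp only [sqInt] at e1 e2
  rw [← e1, ← e2] at h2
  linarith

theorem sq_norm_add_le (a b : ℂ) : ‖a + b‖ ^ 2 ≤ 2 * ‖a‖ ^ 2 + 2 * ‖b‖ ^ 2 := by
  have := pow_le_pow_left₀ (norm_nonneg _) (norm_add_le a b) 2
  nlinarith [sq_nonneg (‖a‖ - ‖b‖)]

/-! ### Bounds for `psi` away from the wall -/

theorem norm_psi_le_of_one_le (F : Flow U U1 U2 u M) (p : ℝ → ℂ) {y : ℝ} (hy : 1 ≤ y) :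
    ‖psi U p y‖ ≤ 2 * M * ‖p y‖ := by
  have hM := F.M_pos
  have hy0 : 0 < y := by linarith
  refine (norm_psi_le F p hy0).trans (mul_le_mul_of_nonneg_right ?_ (norm_nonneg _))
  rw [div_le_iff₀ hy0]
  nlinarith

theorem integral_psi_Ioi_one_le (F : Flow U U1 U2 u M) (W : Wave α p q w w1 w2) :
    ∫ y in Ioi (1 : ℝ), ‖psi U p y‖ ^ 2 ≤ 4 * M ^ 2 * sqInt p := by
  have hsub : Ioi (1 : ℝ) ⊆ Ioi 0 := Ioi_subset_Ioi zero_le_one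
  have ip : IntegrableOn (fun y => 4 * M ^ 2 * ‖p y‖ ^ 2) (Ioi 0) :=
    (integrable_norm_sq_of_memLp W.m0).const_mul _
  have h1 : ∫ y in Ioi (1 : ℝ), ‖psi U p y‖ ^ 2 ≤ ∫ y in Ioi (1 : ℝ), 4 * M ^ 2 * ‖p y‖ ^ 2 := by
    refine setIntegral_mono_on (integrable_norm_sq_of_memLp (halfLine_mono (memLp_psi F W) hsub))
      (ip.mono_set hsub) measurableSet_Ioi fun y hy => ?_
    refine (pow_le_pow_left₀ (norm_nonneg _) (norm_psi_le_of_one_le F p (le_of_lt hy)) 2).trans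
      (le_of_eq (by ring))
  refine h1.trans ((setIntegral_mono_set ip (Eventually.of_forall fun y => ?_)
    hsub.eventuallyLE).trans (le_of_eq ?_))
  · simp only [Pi.zero_apply]; positivity
  · rw [integral_const_mul, sqInt]

/-- Average |ψ(1)|² ≤ 2|ψ(y)|² + 2|ψ(y) - ψ(1)|² over (1, 1 + l). The length l balances the two
energies: l = 1 is used for α ≥ 1 and l = 1/α for α ≤ 1. -/
theorem sq_norm_psi_one_le (F : Flow U U1 U2 u M) (W : Wave α p q w w1 w2) {l : ℝ} (hl : 0 < l) :
    ‖psi U p 1‖ ^ 2 ≤ 8 * M ^ 2 / l * sqInt p + 4 * M ^ 2 * (2 + l) * sqInt (gee U U1 p q) := by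
  have hG := sqInt_nonneg (gee U U1 p q)
  have hM := F.M_pos
  have hsub : Ioc (1 : ℝ) (1 + l) ⊆ Ioi 1 := fun x hx => hx.1
  have hsub0 : Ioi (1 : ℝ) ⊆ Ioi 0 := Ioi_subset_Ioi zero_le_one
  have iψ : IntegrableOn (fun y => ‖psi U p y‖ ^ 2) (Ioi 1) :=
    integrable_norm_sq_of_memLp (halfLine_mono (memLp_psi F W) hsub0)
  set c := 4 * M ^ 2 * (2 + l) * sqInt (gee U U1 p q) with hc
  have h1 : ∫ _ in Ioc (1 : ℝ) (1 + l), ‖psi U p 1‖ ^ 2 ≤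
      ∫ y in Ioc (1 : ℝ) (1 + l), (2 * ‖psi U p y‖ ^ 2 + c) := by
    refine setIntegral_mono_on (by simp) (((iψ.mono_set hsub).const_mul 2).add (by simp))
      measurableSet_Ioc fun y hy => ?_
    have h2 := sq_norm_psi_sub_le F W one_pos hy.1.le
    have h3 := sq_norm_add_le (psi U p y) (-(psi U p y - psi U p 1))
    rw [norm_neg, neg_sub, add_sub_cancel] at h3
    have h4 : 2 * M ^ 2 * (y + 1 / 1) * sqInt (gee U U1 p q) ≤
        2 * M ^ 2 * (2 + l) * sqInt (gee U U1 p q) :=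
      mul_le_mul_of_nonneg_right (mul_le_mul_of_nonneg_left (by linarith [hy.2]) (by positivity)) hG
    change _ ≤ 2 * M ^ 2 * (y + 1 / 1) * sqInt (gee U U1 p q) at h2
    rw [hc]
    linarith
  have i2 : IntegrableOn (fun y => 2 * ‖psi U p y‖ ^ 2) (Ioc 1 (1 + l)) :=
    (iψ.mono_set hsub).const_mul 2
  rw [integral_add i2 (by simp), integral_const_mul] at h1
  simp only [integral_const, measureReal_restrict_apply_univ, Real.volume_real_Ioc, smul_eq_mul] at h1
  have e : max (1 + l - 1) 0 = l := by rw [add_sub_cancel_left, max_eq_left hl.le]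
  rw [e] at h1
  have h5 : ∫ y in Ioc (1 : ℝ) (1 + l), ‖psi U p y‖ ^ 2 ≤ ∫ y in Ioi (1 : ℝ), ‖psi U p y‖ ^ 2 :=
    setIntegral_mono_set iψ (Eventually.of_forall fun _ => by positivity) hsub.eventuallyLE
  have h6 := integral_psi_Ioi_one_le F W
  refine le_of_mul_le_mul_left ?_ hl
  have e2 : l * (8 * M ^ 2 / l * sqInt p + c) = 8 * M ^ 2 * sqInt p + l * c := by field_simp
  rw [e2]
  linarith

theorem memLp_weight_psi_sub (F : Flow U U1 U2 u M) (W : Wave α p q w w1 w2) (c : ℂ) :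
    MemLp (fun y => ((1 : ℝ) ^ 2 / (1 + y) ^ 2) • (psi U p y - c)) 2 halfLine := by
  have h1 : MemLp (fun y : ℝ => ((1 : ℝ) ^ 2 / (1 + y) ^ 2) • c) 2 halfLine := by
    refine MemLp.of_le_mul (c := ‖c‖) memLp_inv_one_add
      (((continuousOn_weight one_pos).aestronglyMeasurable measurableSet_Ioi).smul_const c) ?_
    refine (ae_restrict_iff' measurableSet_Ioi).2 (Eventually.of_forall fun y hy => ?_)
    have hy0 : (0 : ℝ) < y := hy
    rw [norm_smul, mul_comm, Real.norm_of_nonneg (by positivity), Real.norm_of_nonneg (by positivity)]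
    refine mul_le_mul_of_nonneg_left ?_ (norm_nonneg _)
    rw [div_le_div_iff₀ (by positivity) (by positivity)]
    nlinarith
  refine ((memLp_weight_psi F W one_pos).sub h1).ae_eq (Eventually.of_forall fun y => ?_)
  simp only [Pi.sub_apply, smul_sub]

/-- After subtraction of ψ(1) only g is needed, without ‖p‖, which is what makes the bound uniform
as α → 0. Hardy's inequality applies on (0, 1]; beyond 1 the growth |ψ - ψ(1)|² ≲ (1 + y)‖g‖² meets
the squared weight (1 + y)⁻⁴. -/
theorem weighted_psi_sub_one (F : Flow U U1 U2 u M) (W : Wave α p q w w1 w2) :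
    sqInt (fun y => ((1 : ℝ) ^ 2 / (1 + y) ^ 2) • (psi U p y - psi U p 1)) ≤
      20 * M ^ 2 * sqInt (gee U U1 p q) := by
  have hM := F.M_pos
  have hG := sqInt_nonneg (gee U U1 p q)
  have hi := integrable_norm_sq_of_memLp (memLp_weight_psi_sub F W (psi U p 1))
  have hsub1 : Ioc (0 : ℝ) 1 ⊆ Ioi 0 := fun x hx => hx.1
  have hsub2 : Ioi (1 : ℝ) ⊆ Ioi 0 := Ioi_subset_Ioi zero_le_one
  rw [sqInt, ← Ioc_union_Ioi_eq_Ioi zero_le_one, setIntegral_union Ioc_disjoint_Ioi_same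
    measurableSet_Ioi (hi.mono_measure (Measure.restrict_mono hsub1 le_rfl))
    (hi.mono_measure (Measure.restrict_mono hsub2 le_rfl))]
  have e1 : ∫ y in Ioc (0 : ℝ) 1, ‖((1 : ℝ) ^ 2 / (1 + y) ^ 2) • (psi U p y - psi U p 1)‖ ^ 2 ≤
      16 * M ^ 2 * sqInt (gee U U1 p q) := by
    have h := hardy_psi F W (psi U p 1) one_pos le_rfl
    rw [sub_self, norm_zero] at h
    have h' : ∫ y in Ioc (0 : ℝ) 1, ‖psi U p y - psi U p 1‖ ^ 2 ≤
        16 * M ^ 2 * sqInt (gee U U1 p q) := by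
      simpa [sqInt] using h
    refine le_trans ?_ h'
    refine setIntegral_mono_on (hi.mono_measure (Measure.restrict_mono hsub1 le_rfl))
      (integrable_norm_sq_of_memLp ((halfLine_mono (memLp_psi F W) hsub1).sub (memLp_const _)))
      measurableSet_Ioc fun y hy => ?_
    have hy0 : 0 < y := hy.1
    rw [norm_smul, Real.norm_of_nonneg (by positivity)]
    exact pow_le_pow_left₀ (by positivity)
      (mul_le_of_le_one_left (norm_nonneg _) (weight_le_one one_pos hy0)) 2
  have i3 := integrableOn_inv_add_pow one_pos (n := 2) (by norm_num)
  have e2 : ∫ y in Ioi (1 : ℝ), ‖((1 : ℝ) ^ 2 / (1 + y) ^ 2) • (psi U p y - psi U p 1)‖ ^ 2 ≤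
      M ^ 2 * sqInt (gee U U1 p q) := by
    have i4 : IntegrableOn (fun y : ℝ => 2 * M ^ 2 * sqInt (gee U U1 p q) * (1 / (1 + y) ^ (2 + 1)))
        (Ioi 0) := i3.1.const_mul _
    have h1 : ∫ y in Ioi (1 : ℝ), ‖((1 : ℝ) ^ 2 / (1 + y) ^ 2) • (psi U p y - psi U p 1)‖ ^ 2 ≤
        ∫ y in Ioi (1 : ℝ), 2 * M ^ 2 * sqInt (gee U U1 p q) * (1 / (1 + y) ^ (2 + 1)) := by
      refine setIntegral_mono_on (hi.mono_measure (Measure.restrict_mono hsub2 le_rfl))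
        (i4.mono_set hsub2) measurableSet_Ioi fun y hy => ?_
      have hy1 : (1 : ℝ) < y := hy
      have hy0 : 0 < y := by linarith
      have h2 := sq_norm_psi_sub_le F W one_pos hy1.le
      change _ ≤ 2 * M ^ 2 * (y + 1 / 1) * sqInt (gee U U1 p q) at h2
      rw [norm_smul, Real.norm_of_nonneg (by positivity), mul_pow]
      calc ((1 : ℝ) ^ 2 / (1 + y) ^ 2) ^ 2 * ‖psi U p y - psi U p 1‖ ^ 2
          ≤ ((1 : ℝ) ^ 2 / (1 + y) ^ 2) ^ 2 * (2 * M ^ 2 * (y + 1 / 1) * sqInt (gee U U1 p q)) := by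
            gcongr
        _ = _ := by
            rw [show y + 1 / 1 = 1 + y by ring]
            field_simp
            ring
    refine h1.trans ((setIntegral_mono_set i4 ?_ hsub2.eventuallyLE).trans (le_of_eq ?_))
    · refine (ae_restrict_iff' measurableSet_Ioi).2 (Eventually.of_forall fun y hy => ?_)
      have hy0 : (0 : ℝ) < y := hy
      simp only [Pi.zero_apply]
      positivity
    · rw [integral_const_mul, i3.2]
      push_cast
      ring
  have : 0 ≤ M ^ 2 * sqInt (gee U U1 p q) := by positivity
  linarith

/-- Beyond 1, |ψ| ≲ |p|, and near the wall Hardy's inequality applies. The assumption α ≥ 1 enters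
only through ‖p‖² ≤ α²‖p‖², which brings ‖p‖ within reach of the energy. -/
theorem sqInt_psi_le (F : Flow U U1 U2 u M) (W : Wave α p q w w1 w2) (hα : 1 ≤ α) :
    sqInt (psi U p) ≤ 40 * M ^ 2 * (sqInt (gee U U1 p q) + α ^ 2 * sqInt p) := by
  have hM := F.M_pos
  have hG := sqInt_nonneg (gee U U1 p q)
  have hp := sqInt_nonneg p
  have hi := integrable_norm_sq_of_memLp (memLp_psi F W)
  have hsub1 : Ioc (0 : ℝ) 1 ⊆ Ioi 0 := fun x hx => hx.1
  have hsub2 : Ioi (1 : ℝ) ⊆ Ioi 0 := Ioi_subset_Ioi zero_le_one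
  have h1 := hardy_psi F W 0 one_pos le_rfl
  have h2 := sq_norm_psi_one_le F W one_pos
  have h3 := integral_psi_Ioi_one_le F W
  simp only [sub_zero] at h1
  have h4 : sqInt p ≤ α ^ 2 * sqInt p := le_mul_of_one_le_left hp (one_le_pow₀ hα)
  have h5 := mul_le_mul_of_nonneg_left h4 (sq_nonneg M)
  rw [sqInt, ← Ioc_union_Ioi_eq_Ioi zero_le_one, setIntegral_union Ioc_disjoint_Ioi_same
    measurableSet_Ioi (hi.mono_measure (Measure.restrict_mono hsub1 le_rfl))
    (hi.mono_measure (Measure.restrict_mono hsub2 le_rfl))]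
  change _ ≤ 2 * 1 * ‖psi U p 1‖ ^ 2 + 16 * M ^ 2 * sqInt (gee U U1 p q) at h1
  have h6 := mul_nonneg (sq_nonneg M) hp
  linarith

/-- The sum of the energies. -/
noncomputable def energy (U U1 : ℝ → ℝ) (k α : ℝ) (p q w : ℝ → ℂ) : ℝ :=
  sqInt (gee U U1 p q) + α ^ 2 * sqInt p + k ^ 2 * sqInt w + k * ‖psi U p k‖ ^ 2

theorem energy_parts (hk : 0 ≤ k) (U U1 : ℝ → ℝ) (α : ℝ) (p q w : ℝ → ℂ) :
    0 ≤ energy U U1 k α p q w ∧ sqInt (gee U U1 p q) ≤ energy U U1 k α p q w ∧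
    α ^ 2 * sqInt p ≤ energy U U1 k α p q w ∧ k ^ 2 * sqInt w ≤ energy U U1 k α p q w ∧
    k * ‖psi U p k‖ ^ 2 ≤ energy U U1 k α p q w := by
  have h1 := sqInt_nonneg (gee U U1 p q)
  have h2 := mul_nonneg (sq_nonneg α) (sqInt_nonneg p)
  have h3 := mul_nonneg (sq_nonneg k) (sqInt_nonneg w)
  have h4 := mul_nonneg hk (sq_nonneg ‖psi U p k‖)
  unfold energy
  refine ⟨?_, ?_, ?_, ?_, ?_⟩ <;> linarith

/-- The energy estimate for wave numbers `α ≥ 1`. -/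
theorem energy_bound_large {M : ℝ} (hM : 1 ≤ M) : ∃ C, 1 ≤ C ∧ ∃ δ, 0 < δ ∧ δ ≤ 1 ∧
    ∀ {U U1 U2 : ℝ → ℝ} {u σ α : ℝ} {p q w w1 w2 f : ℝ → ℂ},
    Sol U U1 U2 u M (σ ^ 2) α p q w w1 w2 f → 0 < σ → σ ≤ δ → σ ^ 2 * α ≤ δ → 1 ≤ α →
    Real.sqrt (energy U U1 (σ ^ 2) α p q w) ≤ C * l2norm f ∧ l2norm q ≤ C * l2norm f := by
  obtain ⟨C, hC, δ, δ0, δ1, h⟩ := energy_bound hM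
  have hM0 : 0 < M := by linarith
  have c1 : 1 ≤ 7 * M * C := by nlinarith
  refine ⟨14 * M * C + 7 * M ^ 2 * (14 * M * C) + 14 * M * C, ?_, δ, δ0, δ1,
    fun {U U1 U2 u σ α p q w w1 w2 f} S σ0 hσ hσα hα => ?_⟩
  · have : 0 ≤ 7 * M ^ 2 * (14 * M * C) := by positivity
    linarith
  have h1 := h S σ0 hσ hσα
  change energy U U1 (σ ^ 2) α p q w ≤ _ at h1
  obtain ⟨hE, e1, e2, -, -⟩ := energy_parts (sq_nonneg σ) U U1 α p q w
  set E := energy U U1 (σ ^ 2) α p q w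
  set Q := Real.sqrt E with hQ
  have hQ2 : Q ^ 2 = E := Real.sq_sqrt hE
  have hQ0 : 0 ≤ Q := Real.sqrt_nonneg _
  have hf := l2norm_nonneg f
  have hψ : l2norm (psi U p) ≤ 7 * M * Q := by
    -- `40 = 20 + 20` with one half for each of the two energies
    have h2 := sqInt_psi_le S.F S.W hα
    have h3 : sqInt (gee U U1 p q) + α ^ 2 * sqInt p ≤ E := by
      have h4 := mul_nonneg (sq_nonneg (σ ^ 2)) (sqInt_nonneg w)
      have h5 := mul_nonneg (sq_nonneg σ) (sq_nonneg ‖psi U p (σ ^ 2)‖)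
      simp only [E, energy]
      linarith
    refine l2norm_le_of (by positivity) (h2.trans ?_)
    have hs : 0 ≤ sqInt (gee U U1 p q) + α ^ 2 * sqInt p :=
      add_nonneg (sqInt_nonneg _) (mul_nonneg (sq_nonneg _) (sqInt_nonneg _))
    calc 40 * M ^ 2 * (sqInt (gee U U1 p q) + α ^ 2 * sqInt p) ≤ 49 * M ^ 2 * E :=
          mul_le_mul (by linarith [sq_nonneg M]) h3 hs (by positivity)
      _ = _ := by rw [← hQ2]; ring
  have h2 := abs_integral_inner_le S.mf (memLp_psi S.F S.W)
  -- With ‖ψ‖ ≲ Q the energy bound becomes a quadratic inequality for Q, which yields Q ≲ ‖f‖.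
  have h3 : Q ^ 2 ≤ 7 * M * C * (Q * l2norm f + l2norm f ^ 2) := by
    rw [hQ2]
    refine h1.trans ?_
    rw [← l2norm_sq]
    have h4 : l2norm f * l2norm (psi U p) ≤ l2norm f * (7 * M * Q) := by gcongr
    have h5 : l2norm f ^ 2 ≤ 7 * M * l2norm f ^ 2 :=
      le_mul_of_one_le_left (sq_nonneg _) (by linarith)
    calc C * (|∫ y in Ioi (0 : ℝ), inner ℝ (f y) (psi U p y)| + l2norm f ^ 2)
        ≤ C * (l2norm f * (7 * M * Q) + 7 * M * l2norm f ^ 2) := by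
          gcongr
          linarith
      _ = _ := by ring
  have h4 := le_of_sq_le_quadratic hf c1 h3
  have h5 : Q ≤ 14 * M * C * l2norm f := by linarith
  have h6 : l2norm q ≤ Q + M * (7 * M * Q) := by
    have e : q = fun y => gee U U1 p q y + U1 y • psi U p y := by
      funext y; rw [gee, sub_add_cancel]
    have mU := memLp_U1_smul S.F (memLp_psi S.F S.W)
    have h7 := l2norm_add_le (memLp_gee S.F S.W) mU
    rw [← e] at h7
    have h8 : l2norm (gee U U1 p q) ≤ Q := l2norm_le_of hQ0 (by rw [hQ2]; exact e1)
    have h9 : l2norm (fun y => U1 y • psi U p y) ≤ M * l2norm (psi U p) :=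
      l2norm_mono (memLp_psi S.F S.W) hM0.le fun y hy => norm_smul_le_of (S.F.b1' hy.le) le_rfl
    have h10 : M * l2norm (psi U p) ≤ M * (7 * M * Q) := by gcongr
    linarith
  have r1 : 0 ≤ 7 * M ^ 2 * (14 * M * C) * l2norm f := by positivity
  have r2 : 0 ≤ 14 * M * C * l2norm f := by positivity
  have r3 := mul_le_mul_of_nonneg_left h5 (by positivity : 0 ≤ 7 * M ^ 2)
  constructor <;> linarith

end OrrSommerfeld

/-! ### Wave numbers α ≤ 1: the pairing of decaying data with ψ -/

namespace OrrSommerfeld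

variable {U U1 U2 : ℝ → ℝ} {u M k α σ N : ℝ} {p q w w1 w2 f g : ℝ → ℂ}

theorem continuousOn_inv_one_add_sq : ContinuousOn (fun y : ℝ => 1 / (1 + y) ^ 2) (Ioi 0) :=
  continuousOn_const.div (by fun_prop) fun y hy => by
    have : (0 : ℝ) < y := hy
    positivity

theorem abs_inv_one_add_sq_le (y : ℝ) (hy : 0 < y) : |1 / (1 + y) ^ 2| ≤ 1 / (1 + y) := by
  rw [abs_of_nonneg (by positivity)]
  exact one_div_le_one_div_of_le (by linarith) (by nlinarith)

theorem memLp_inv_one_add_sq : MemLp (fun y : ℝ => 1 / (1 + y) ^ 2) 2 halfLine := by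
  refine memLp_inv_one_add.mono (continuousOn_inv_one_add_sq.aestronglyMeasurable measurableSet_Ioi)
    ((ae_restrict_iff' measurableSet_Ioi).2 (Eventually.of_forall fun y hy => ?_))
  have : (0 : ℝ) < y := hy
  rw [Real.norm_eq_abs, Real.norm_of_nonneg (by positivity)]
  exact abs_inv_one_add_sq_le y hy

theorem inv_smul_weight (f : ℝ → ℂ) {y : ℝ} (hy : 0 < y) :
    (1 / (1 + y) ^ 2) • (((1 + y) ^ 2) • f y) = f y := by
  rw [smul_smul, one_div_mul_cancel (by positivity), one_smul]

theorem integrableOn_of_weight (mf : MemLp f 2 halfLine)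
    (mh : MemLp (fun y => ((1 + y) ^ 2) • f y) 2 halfLine) : IntegrableOn f (Ioi 0) := by
  have h1 : IntegrableOn (fun y => 1 / (1 + y) ^ 2 * ‖((1 + y) ^ 2) • f y‖) (Ioi 0) :=
    memLp_inv_one_add_sq.integrable_mul mh.norm
  refine Integrable.mono h1 mf.1
    ((ae_restrict_iff' measurableSet_Ioi).2 (Eventually.of_forall fun y hy => ?_))
  have hy0 : (0 : ℝ) < y := hy
  have e := congrArg norm (inv_smul_weight f hy0)
  rw [norm_smul, Real.norm_of_nonneg (by positivity)] at e
  rw [e, norm_norm]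

theorem l2norm_le_weight (mh : MemLp (fun y => ((1 + y) ^ 2) • f y) 2 halfLine) :
    l2norm f ≤ l2norm (fun y => ((1 + y) ^ 2) • f y) := by
  have h := l2norm_mono (f := f) mh zero_le_one fun y hy => ?_
  · rwa [one_mul] at h
  · rw [one_mul, norm_smul, Real.norm_of_nonneg (by positivity)]
    exact le_mul_of_one_le_left (norm_nonneg _) (one_le_pow₀ (by linarith))

theorem integral_inner_const_right (hf : IntegrableOn f (Ioi 0)) (c : ℂ) :
    ∫ y in Ioi (0 : ℝ), inner ℝ (f y) c = inner ℝ (∫ y in Ioi (0 : ℝ), f y) c := by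
  rw [real_inner_comm, ← integral_inner hf c]
  exact integral_congr_ae (Eventually.of_forall fun y => real_inner_comm _ _)

/-- Averaging over the length 1/α gives |ψ(1)|² ≲ α‖p‖² + α⁻¹‖g‖². Multiplication by α² leaves
quantities bounded by the energy. This is the origin of the factor 1/α in front of ∫f in N(f). -/
theorem norm_psi_one_le (F : Flow U U1 U2 u M) (W : Wave α p q w w1 w2) (hα : 0 < α)
    (hα1 : α ≤ 1) {Q : ℝ} (hQ : 0 ≤ Q) (hg : sqInt (gee U U1 p q) ≤ Q ^ 2)
    (hp : α ^ 2 * sqInt p ≤ Q ^ 2) : α * ‖psi U p 1‖ ≤ 5 * M * Q := by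
  have hM := F.M_pos
  have h1 := sq_norm_psi_one_le F W (l := 1 / α) (by positivity)
  have e : 8 * M ^ 2 / (1 / α) * sqInt p = 8 * M ^ 2 * (α * sqInt p) := by field_simp
  rw [e] at h1
  have hG := sqInt_nonneg (gee U U1 p q)
  have h2 : α ^ 2 * (8 * M ^ 2 * (α * sqInt p) + 4 * M ^ 2 * (2 + 1 / α) * sqInt (gee U U1 p q)) =
      8 * M ^ 2 * α * (α ^ 2 * sqInt p) + 4 * M ^ 2 * (2 * α ^ 2 + α) * sqInt (gee U U1 p q) := by
    field_simp
  have h3 : 8 * M ^ 2 * α * (α ^ 2 * sqInt p) ≤ 8 * M ^ 2 * 1 * Q ^ 2 := by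
    have : 0 ≤ α ^ 2 * sqInt p := mul_nonneg (sq_nonneg _) (sqInt_nonneg _)
    gcongr
  have h4 : 4 * M ^ 2 * (2 * α ^ 2 + α) * sqInt (gee U U1 p q) ≤ 4 * M ^ 2 * (2 * 1 + 1) * Q ^ 2 := by
    have : α ^ 2 ≤ 1 := pow_le_one₀ hα.le hα1
    gcongr
  have h5 := mul_le_mul_of_nonneg_left h1 (sq_nonneg α)
  refine le_of_sq_le_sq' ?_ (by positivity)
  have : 0 ≤ M ^ 2 * Q ^ 2 := by positivity
  rw [mul_pow, mul_pow, mul_pow]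
  linarith
where
  le_of_sq_le_sq' {x y : ℝ} (h : x ^ 2 ≤ y ^ 2) (hy : 0 ≤ y) : x ≤ y := by
    by_contra hc
    nlinarith

/-- The pairing of a forcing with fast decay and `psi`. -/
theorem abs_integral_inner_psi_le (F : Flow U U1 U2 u M) (W : Wave α p q w w1 w2) (hα : 0 < α)
    (hα1 : α ≤ 1) {Q : ℝ} (hQ : 0 ≤ Q) (hg : sqInt (gee U U1 p q) ≤ Q ^ 2)
    (hp : α ^ 2 * sqInt p ≤ Q ^ 2) (mf : MemLp f 2 halfLine)
    (mh : MemLp (fun y => ((1 + y) ^ 2) • f y) 2 halfLine)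
    (hN : l2norm (fun y => ((1 + y) ^ 2) • f y) ≤ N) (hI : ‖∫ y in Ioi (0 : ℝ), f y‖ ≤ α * N) :
    |∫ y in Ioi (0 : ℝ), inner ℝ (f y) (psi U p y)| ≤ 10 * M * (Q * N) := by
  have hM := F.M_pos
  have hN0 : 0 ≤ N := (l2norm_nonneg _).trans hN
  have fi := integrableOn_of_weight mf mh
  have mw := memLp_weight_psi_sub F W (psi U p 1)
  -- The constant ψ(1) sees only the mean of f. The remainder ψ - ψ(1) takes the weight (1 + y)⁻²,
  -- leaving (1 + y)² to f.
  have e : ∀ y ∈ Ioi (0 : ℝ), inner ℝ (f y) (psi U p y) = inner ℝ (f y) (psi U p 1) +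
      inner ℝ (((1 + y) ^ 2) • f y) (((1 : ℝ) ^ 2 / (1 + y) ^ 2) • (psi U p y - psi U p 1)) := by
    intro y hy
    have hy0 : (0 : ℝ) < y := hy
    rw [real_inner_smul_left, real_inner_smul_right, ← mul_assoc, inner_sub_right]
    field_simp
    ring
  have i1 : IntegrableOn (fun y => inner ℝ (f y) (psi U p 1)) (Ioi 0) := fi.inner_const _
  rw [setIntegral_congr_fun measurableSet_Ioi e,
    integral_add i1 (integrable_inner_of_memLp mh mw), integral_inner_const_right fi]
  have h1 := abs_integral_inner_le mh mw
  have h2 : l2norm (fun y => ((1 : ℝ) ^ 2 / (1 + y) ^ 2) • (psi U p y - psi U p 1)) ≤ 5 * M * Q := by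
    refine l2norm_le_of (by positivity) ((weighted_psi_sub_one F W).trans ?_)
    have : 20 * M ^ 2 * sqInt (gee U U1 p q) ≤ 20 * M ^ 2 * Q ^ 2 := by gcongr
    have : 0 ≤ M ^ 2 * Q ^ 2 := by positivity
    rw [mul_pow, mul_pow]
    linarith
  have h3 := norm_psi_one_le F W hα hα1 hQ hg hp
  have h4 : |inner ℝ (∫ y in Ioi (0 : ℝ), f y) (psi U p 1)| ≤ N * (5 * M * Q) := by
    refine (abs_real_inner_le_norm _ _).trans ?_
    calc ‖∫ y in Ioi (0 : ℝ), f y‖ * ‖psi U p 1‖ ≤ α * N * ‖psi U p 1‖ := by gcongr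
      _ = N * (α * ‖psi U p 1‖) := by ring
      _ ≤ _ := by gcongr
  have h5 := mul_le_mul hN h2 (l2norm_nonneg _) hN0
  have h6 := abs_add_le (inner ℝ (∫ y in Ioi (0 : ℝ), f y) (psi U p 1))
    (∫ y in Ioi (0 : ℝ), inner ℝ (((1 + y) ^ 2) • f y)
      (((1 : ℝ) ^ 2 / (1 + y) ^ 2) • (psi U p y - psi U p 1)))
  linarith

/-- The energy estimate for wave numbers `α ≤ 1`. -/
theorem energy_bound_small {M : ℝ} (hM : 1 ≤ M) : ∃ C, 1 ≤ C ∧ ∃ δ, 0 < δ ∧ δ ≤ 1 ∧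
    ∀ {U U1 U2 : ℝ → ℝ} {u σ α N : ℝ} {p q w w1 w2 f : ℝ → ℂ},
    Sol U U1 U2 u M (σ ^ 2) α p q w w1 w2 f → 0 < σ → σ ≤ δ → σ ^ 2 * α ≤ δ → α ≤ 1 →
    MemLp (fun y => ((1 + y) ^ 2) • f y) 2 halfLine →
    l2norm (fun y => ((1 + y) ^ 2) • f y) ≤ N → ‖∫ y in Ioi (0 : ℝ), f y‖ ≤ α * N →
    Real.sqrt (energy U U1 (σ ^ 2) α p q w) ≤ C * N := by
  obtain ⟨C, hC, δ, δ0, δ1, h⟩ := energy_bound hM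
  have c1 : 1 ≤ 10 * M * C := by nlinarith
  refine ⟨2 * (10 * M * C), by linarith, δ, δ0, δ1,
    fun {U U1 U2 u σ α N p q w w1 w2 f} S σ0 hσ hσα hα mh hN hI => ?_⟩
  have h1 := h S σ0 hσ hσα
  change energy U U1 (σ ^ 2) α p q w ≤ _ at h1
  obtain ⟨hE, e1, e2, -, -⟩ := energy_parts (sq_nonneg σ) U U1 α p q w
  rw [← Real.sq_sqrt hE] at h1 e1 e2
  set Q := Real.sqrt (energy U U1 (σ ^ 2) α p q w)
  have hQ : 0 ≤ Q := Real.sqrt_nonneg _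
  have h2 := abs_integral_inner_psi_le S.F S.W S.a0 hα hQ e1 e2 S.mf mh hN hI
  have hN0 : 0 ≤ N := (l2norm_nonneg _).trans hN
  refine le_of_sq_le_quadratic hN0 c1 (h1.trans ?_)
  have h3 : sqInt f ≤ N ^ 2 := by
    rw [← l2norm_sq]
    exact pow_le_pow_left₀ (l2norm_nonneg _) ((l2norm_le_weight mh).trans hN) 2
  have h4 : C * (|∫ y in Ioi (0 : ℝ), inner ℝ (f y) (psi U p y)| + sqInt f) ≤
      C * (10 * M * (Q * N) + 10 * M * N ^ 2) := by
    have : N ^ 2 ≤ 10 * M * N ^ 2 := le_mul_of_one_le_left (sq_nonneg _) (by linarith)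
    exact mul_le_mul_of_nonneg_left (by linarith) (by linarith)
  linarith

end OrrSommerfeld

/-! ### Bounds for the tangential velocity when α ≤ 1 -/

namespace OrrSommerfeld

variable {U U1 U2 : ℝ → ℝ} {u M k α σ N Q : ℝ} {p q w w1 w2 f g : ℝ → ℂ}

/-- Agmon's inequality on a half-line. -/
theorem norm_pow_four_le {h h' : ℝ → ℂ} {a : ℝ} (hd : ∀ y ∈ Ici a, HasDerivAt h (h' y) y)
    (mh : MemLp h 2 (volume.restrict (Ioi a))) (mh' : MemLp h' 2 (volume.restrict (Ioi a))) :
    (‖h a‖ ^ 2) ^ 2 ≤ 4 * ((∫ y in Ioi a, ‖h y‖ ^ 2) * ∫ y in Ioi a, ‖h' y‖ ^ 2) := by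
  have hd2 : ∀ y ∈ Ici a, HasDerivAt (fun y => ‖h y‖ ^ 2) (2 * inner ℝ (h y) (h' y)) y :=
    fun y hy => (hd y hy).norm_sq
  have i1 : IntegrableOn (fun y => 2 * inner ℝ (h y) (h' y)) (Ioi a) :=
    (integrable_inner_of_memLp mh mh').const_mul 2
  have ht := tendsto_zero_of_hasDerivAt_of_integrableOn_Ioi
    (fun y hy => hd2 y (Ioi_subset_Ici_self hy)) i1 (integrable_norm_sq_of_memLp mh)
  have h1 := integral_Ioi_of_hasDerivAt_of_tendsto' hd2 i1 ht
  have i2 : IntegrableOn (fun y => ‖h y‖ * ‖h' y‖) (Ioi a) := mh.norm.integrable_mul mh'.norm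
  have h2 : ‖h a‖ ^ 2 ≤ 2 * ∫ y in Ioi a, ‖h y‖ * ‖h' y‖ := by
    have h3 : ‖∫ y in Ioi a, 2 * inner ℝ (h y) (h' y)‖ ≤ ∫ y in Ioi a, 2 * (‖h y‖ * ‖h' y‖) := by
      refine norm_integral_le_of_norm_le (i2.const_mul 2) (Eventually.of_forall fun y => ?_)
      rw [norm_mul, Real.norm_of_nonneg zero_le_two]
      exact mul_le_mul_of_nonneg_left (norm_inner_le_norm _ _) zero_le_two
    rw [h1, zero_sub, norm_neg, Real.norm_of_nonneg (by positivity), integral_const_mul] at h3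
    exact h3
  have h3 := sq_integral_norm_mul_le mh mh'
  have h4 := pow_le_pow_left₀ (by positivity) h2 2
  rw [mul_pow] at h4
  linarith

theorem memLp_smul_const {c : ℝ → ℝ} (hc : MemLp c 2 halfLine) (z : ℂ) :
    MemLp (fun y => c y • z) 2 halfLine :=
  MemLp.of_le_mul (c := ‖z‖) hc (hc.1.smul_const z)
    (Eventually.of_forall fun y => by rw [norm_smul, mul_comm])

theorem abs_U1_div_le (F : Flow U U1 U2 u M) {y : ℝ} (hk : 0 < k) (hy : k ≤ y) :
    |U1 y * (U y)⁻¹| ≤ M ^ 2 / k := by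
  have hy0 : 0 < y := hk.trans_le hy
  have hM := F.M_pos
  have h1 := F.b1 y hy0.le
  have h2 := F.inv_le hy0
  rw [abs_mul, abs_of_nonneg (inv_nonneg.2 (F.pos hy0).le)]
  have h3 : 1 + y ≤ (1 + y) ^ 3 := le_self_pow₀ (by linarith) (by norm_num)
  calc |U1 y| * (U y)⁻¹ ≤ |U1 y| * (M * (1 + y) / y) := by gcongr
    _ = M / y * (|U1 y| * (1 + y)) := by ring
    _ ≤ M / y * (|U1 y| * (1 + y) ^ 3) := by gcongr
    _ ≤ M / y * M := by gcongr
    _ = M ^ 2 / y := by ring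
    _ ≤ M ^ 2 / k := by gcongr

theorem mul_cube_le {t y M s : ℝ} (hy : 0 < y) (h : |t| * (1 + y) ^ 3 ≤ M) (hs : 0 ≤ s) :
    |t| * s ≤ M * ((1 : ℝ) ^ 2 / (1 + y) ^ 2 * s) := by
  have h1 : |t| ≤ M * ((1 : ℝ) ^ 2 / (1 + y) ^ 2) := by
    rw [one_pow, mul_one_div, le_div_iff₀ (by positivity)]
    refine le_trans ?_ h
    exact mul_le_mul_of_nonneg_left (pow_le_pow_right₀ (by linarith) (by norm_num)) (abs_nonneg _)
  calc |t| * s ≤ M * ((1 : ℝ) ^ 2 / (1 + y) ^ 2) * s := by gcongr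
    _ = _ := by ring

theorem norm_dgee_le (F : Flow U U1 U2 u M) (p q w : ℝ → ℂ) {y : ℝ} (hk : 0 < k) (hy : k ≤ y) :
    ‖dgee α U U1 U2 p q w y‖ ≤ ‖w y‖ + α ^ 2 * ‖p y‖ +
      M * ‖((1 : ℝ) ^ 2 / (1 + y) ^ 2) • psi U p y‖ + M ^ 2 / k * ‖gee U U1 p q y‖ := by
  have hy0 : 0 < y := hk.trans_le hy
  rw [dgee]
  refine (norm_sub_le _ _).trans (add_le_add ((norm_sub_le _ _).trans (add_le_add
    ((norm_add_le _ _).trans (add_le_add le_rfl ?_)) ?_)) ?_)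
  · rw [norm_smul, Real.norm_of_nonneg (by positivity)]
  · rw [norm_smul, norm_smul, Real.norm_eq_abs, Real.norm_of_nonneg (by positivity)]
    exact mul_cube_le hy0 (F.b2 y hy0.le) (norm_nonneg _)
  · rw [norm_smul, Real.norm_eq_abs]
    exact mul_le_mul_of_nonneg_right (abs_U1_div_le F hk hy) (norm_nonneg _)

theorem sq_add_four_le {a b c d x : ℝ} (hx : 0 ≤ x) (h : x ≤ a + b + c + d) :
    x ^ 2 ≤ 4 * a ^ 2 + 4 * b ^ 2 + 4 * c ^ 2 + 4 * d ^ 2 := by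
  have := pow_le_pow_left₀ hx h 2
  nlinarith [sq_nonneg (a - b), sq_nonneg (a - c), sq_nonneg (a - d), sq_nonneg (b - c),
    sq_nonneg (b - d), sq_nonneg (c - d)]

/-- Outside the layer |U'/U| ≲ 1/k, so k‖g'‖ is bounded by the energies. The contributions of w, p,
ψ and g give 172 = 4 + 4 + 160 + 4, the 160 coming from the weighted bound of ψ at scale 1. -/
theorem integral_dgee_le (F : Flow U U1 U2 u M) (W : Wave α p q w w1 w2) (hk : 0 < k) (hk1 : k ≤ 1)
    (ha : 0 ≤ α) (hα1 : α ≤ 1) (hE : energy U U1 k α p q w ≤ Q ^ 2) :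
    k ^ 2 * ∫ y in Ioi k, ‖dgee α U U1 U2 p q w y‖ ^ 2 ≤ 172 * M ^ 4 * Q ^ 2 := by
  have hM := F.one_le
  have hM0 := F.M_pos
  obtain ⟨-, e1, e2, e3, e4⟩ := energy_parts hk.le U U1 α p q w
  have hψ := weighted_psi F W hk hk1 le_rfl
  change _ ≤ 20 * M ^ 2 * (1 / k) * (k * ‖psi U p k‖ ^ 2 + sqInt (gee U U1 p q)) at hψ
  have mψ := memLp_weight_psi F W one_pos
  have i1 : IntegrableOn (fun y => 4 * ‖w y‖ ^ 2) (Ioi 0) :=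
    (integrable_norm_sq_of_memLp W.m2).const_mul _
  have i2 : IntegrableOn (fun y => 4 * (α ^ 2) ^ 2 * ‖p y‖ ^ 2) (Ioi 0) :=
    (integrable_norm_sq_of_memLp W.m0).const_mul _
  have i3 : IntegrableOn (fun y => 4 * M ^ 2 * ‖((1 : ℝ) ^ 2 / (1 + y) ^ 2) • psi U p y‖ ^ 2)
    (Ioi 0) := (integrable_norm_sq_of_memLp mψ).const_mul _
  have i4 : IntegrableOn (fun y => 4 * (M ^ 2 / k) ^ 2 * ‖gee U U1 p q y‖ ^ 2) (Ioi 0) :=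
    (integrable_norm_sq_of_memLp (memLp_gee F W)).const_mul _
  have i12 := integrableOn_add i1 i2
  have i123 := integrableOn_add i12 i3
  have it := integrableOn_add i123 i4
  have hsub : Ioi k ⊆ Ioi 0 := Ioi_subset_Ioi hk.le
  have h1 : ∫ y in Ioi k, ‖dgee α U U1 U2 p q w y‖ ^ 2 ≤
      ∫ y in Ioi k, (4 * ‖w y‖ ^ 2 + 4 * (α ^ 2) ^ 2 * ‖p y‖ ^ 2 +
        4 * M ^ 2 * ‖((1 : ℝ) ^ 2 / (1 + y) ^ 2) • psi U p y‖ ^ 2 +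
        4 * (M ^ 2 / k) ^ 2 * ‖gee U U1 p q y‖ ^ 2) := by
    refine setIntegral_mono_on (integrable_norm_sq_of_memLp (halfLine_mono (memLp_dgee F W) hsub))
      (it.mono_set hsub) measurableSet_Ioi fun y hy => ?_
    have h := sq_add_four_le (norm_nonneg _) (norm_dgee_le (α := α) F p q w hk (le_of_lt hy))
    rw [mul_pow, mul_pow, mul_pow] at h
    linarith
  have h2 := h1.trans (setIntegral_mono_set it (Eventually.of_forall fun y => by
    simp only [Pi.zero_apply]; positivity) hsub.eventuallyLE)
  rw [integral_add i123 i4, integral_add i12 i3, integral_add i1 i2, integral_const_mul,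
    integral_const_mul, integral_const_mul, integral_const_mul] at h2
  change _ ≤ 4 * sqInt w + 4 * (α ^ 2) ^ 2 * sqInt p + 4 * M ^ 2 * _ +
    4 * (M ^ 2 / k) ^ 2 * sqInt (gee U U1 p q) at h2
  have h3 := mul_le_mul_of_nonneg_left h2 (sq_nonneg k)
  have hp := sqInt_nonneg p
  have hG := sqInt_nonneg (gee U U1 p q)
  have M4 : 1 ≤ M ^ 4 := one_le_pow₀ hM
  have Q0 := sq_nonneg Q
  have hk2 : k ^ 2 ≤ 1 := pow_le_one₀ hk.le hk1
  have t2 : k ^ 2 * (4 * (α ^ 2) ^ 2 * sqInt p) ≤ 4 * (M ^ 4 * Q ^ 2) := by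
    have a2 : α ^ 2 ≤ 1 := pow_le_one₀ ha hα1
    have : k ^ 2 * α ^ 2 ≤ 1 := mul_le_one₀ hk2 (sq_nonneg _) a2
    calc k ^ 2 * (4 * (α ^ 2) ^ 2 * sqInt p) = 4 * (k ^ 2 * α ^ 2 * (α ^ 2 * sqInt p)) := by ring
      _ ≤ 4 * (1 * (α ^ 2 * sqInt p)) := by
          have : 0 ≤ α ^ 2 * sqInt p := mul_nonneg (sq_nonneg _) hp
          gcongr
      _ ≤ 4 * (M ^ 4 * Q ^ 2) := by
          have : Q ^ 2 ≤ M ^ 4 * Q ^ 2 := le_mul_of_one_le_left Q0 M4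
          linarith
  have t3 : k ^ 2 * (4 * M ^ 2 * ∫ y in Ioi (0 : ℝ), ‖((1 : ℝ) ^ 2 / (1 + y) ^ 2) • psi U p y‖ ^ 2)
      ≤ 160 * (M ^ 4 * Q ^ 2) := by
    calc _ ≤ k ^ 2 * (4 * M ^ 2 * (20 * M ^ 2 * (1 / k) *
          (k * ‖psi U p k‖ ^ 2 + sqInt (gee U U1 p q)))) := by gcongr
      _ ≤ k ^ 2 * (4 * M ^ 2 * (20 * M ^ 2 * (1 / k) * (2 * Q ^ 2))) := by gcongr; linarith
      _ = 160 * (M ^ 4 * Q ^ 2) * k := by field_simp; ring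
      _ ≤ _ := mul_le_of_le_one_right (by positivity) hk1
  have t4 : k ^ 2 * (4 * (M ^ 2 / k) ^ 2 * sqInt (gee U U1 p q)) ≤ 4 * (M ^ 4 * Q ^ 2) := by
    have : k ^ 2 * (4 * (M ^ 2 / k) ^ 2 * sqInt (gee U U1 p q)) =
      4 * (M ^ 4 * sqInt (gee U U1 p q)) := by field_simp
    rw [this]
    have := mul_le_mul_of_nonneg_left (e1.trans hE) (by positivity : 0 ≤ M ^ 4)
    linarith
  have t1 : Q ^ 2 ≤ M ^ 4 * Q ^ 2 := le_mul_of_one_le_left Q0 M4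
  linarith

theorem sq_norm_psi_le (F : Flow U U1 U2 u M) (W : Wave α p q w w1 w2) (hk : 0 < k) (hk1 : k ≤ 1)
    (hE : energy U U1 k α p q w ≤ Q ^ 2) {y : ℝ} (hy : k ≤ y) :
    k * ‖psi U p y‖ ^ 2 ≤ 6 * M ^ 2 * (1 + y) * Q ^ 2 := by
  have hM := F.one_le
  have hM0 := F.M_pos
  have hy0 : 0 < y := hk.trans_le hy
  obtain ⟨-, e1, e2, e3, e4⟩ := energy_parts hk.le U U1 α p q w
  have h1 := sq_norm_psi_sub_le F W hk hy
  change _ ≤ 2 * M ^ 2 * (y + 1 / k) * sqInt (gee U U1 p q) at h1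
  have h2 := sq_norm_add_le (psi U p k) (psi U p y - psi U p k)
  rw [add_sub_cancel] at h2
  have h3 : k * (2 * M ^ 2 * (y + 1 / k) * sqInt (gee U U1 p q)) ≤ 2 * M ^ 2 * (1 + y) * Q ^ 2 := by
    calc _ = 2 * M ^ 2 * (k * y + 1) * sqInt (gee U U1 p q) := by field_simp
      _ ≤ 2 * M ^ 2 * (1 + y) * Q ^ 2 := by
          have : k * y + 1 ≤ 1 + y := by nlinarith
          have := sqInt_nonneg (gee U U1 p q)
          have := e1.trans hE
          gcongr
  have h4 := mul_le_mul_of_nonneg_left h1 hk.le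
  have h5 := mul_le_mul_of_nonneg_left h2 hk.le
  have h6 : Q ^ 2 ≤ M ^ 2 * (1 + y) * Q ^ 2 :=
    le_mul_of_one_le_left (sq_nonneg _) (by nlinarith)
  linarith

/-- The sup bound of the tangential velocity for `α ≤ 1`. -/
theorem norm_q_sup_le (F : Flow U U1 U2 u M) (W : Wave α p q w w1 w2) (hk : 0 < k) (hk1 : k ≤ 1)
    (ha : 0 ≤ α) (hα1 : α ≤ 1) (hE : energy U U1 k α p q w ≤ Q ^ 2) {y : ℝ} (hy : 0 < y) :
    k * ‖q y‖ ^ 2 ≤ 100 * M ^ 4 * Q ^ 2 := by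
  have hM := F.one_le
  have hM0 := F.M_pos
  have Q0 := sq_nonneg Q
  have M4 : 1 ≤ M ^ 4 := one_le_pow₀ hM
  obtain ⟨-, e1, e2, e3, e4⟩ := energy_parts hk.le U U1 α p q w
  rcases le_total y k with hyk | hyk
  -- Inside the layer q is the integral of w + α²p from the wall over a length at most k, and
  -- Cauchy–Schwarz suffices.
  · have mh : MemLp (fun y => w y + (α ^ 2) • p y) 2 halfLine :=
      W.m2.add (W.m0.const_smul (α ^ 2))
    have ch : Continuous (fun y => w y + (α ^ 2) • p y) := W.c2.add (W.c0.const_smul (α ^ 2))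
    have e : q y = ∫ t in (0 : ℝ)..y, (w t + (α ^ 2) • p t) := by
      rw [intervalIntegral.integral_eq_sub_of_hasDerivAt (fun x _ => W.d1 x)
        (ch.intervalIntegrable _ _), W.z1, sub_zero]
    have hsub : Ioc 0 y ⊆ Ioi 0 := fun x hx => hx.1
    have h1 : ‖q y‖ ≤ ∫ t in Ioc 0 y, ‖(1 : ℂ)‖ * ‖w t + (α ^ 2) • p t‖ := by
      rw [e]
      refine (intervalIntegral.norm_integral_le_integral_norm hy.le).trans ?_
      simp only [norm_one, one_mul]
      rw [intervalIntegral.integral_of_le hy.le]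
    have h2 := sq_integral_norm_mul_le (μ := volume.restrict (Ioc 0 y)) (f := fun _ => (1 : ℂ))
      (memLp_const _) (halfLine_mono mh hsub)
    have h3 : ∫ _ in Ioc 0 y, ‖(1 : ℂ)‖ ^ 2 = y := by simp [hy.le]
    rw [h3] at h2
    have iw : IntegrableOn (fun y => 2 * ‖w y‖ ^ 2) (Ioi 0) :=
      (integrable_norm_sq_of_memLp W.m2).const_mul _
    have ip : IntegrableOn (fun y => 2 * (α ^ 2) ^ 2 * ‖p y‖ ^ 2) (Ioi 0) :=
      (integrable_norm_sq_of_memLp W.m0).const_mul _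
    have h4 : sqInt (fun y => w y + (α ^ 2) • p y) ≤ 2 * sqInt w + 2 * (α ^ 2) ^ 2 * sqInt p := by
      rw [sqInt, sqInt, sqInt, ← integral_const_mul, ← integral_const_mul, ← integral_add iw ip]
      refine setIntegral_le_of_le (integrableOn_add iw ip) (fun y _ => by positivity) fun y _ => ?_
      have := sq_norm_add_le (w y) ((α ^ 2) • p y)
      rw [norm_smul, Real.norm_of_nonneg (sq_nonneg α), mul_pow] at this
      linarith
    have h5 : ‖q y‖ ^ 2 ≤ k * sqInt (fun y => w y + (α ^ 2) • p y) :=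
      (pow_le_pow_left₀ (norm_nonneg _) h1 2).trans (h2.trans
        (mul_le_mul hyk (setIntegral_norm_sq_le mh hsub) (integral_nonneg fun _ => by positivity)
          hk.le))
    have hp := sqInt_nonneg p
    have a2 : α ^ 2 ≤ 1 := pow_le_one₀ ha hα1
    have hk2 : k ^ 2 ≤ 1 := pow_le_one₀ hk.le hk1
    have h6 : k ^ 2 * (2 * (α ^ 2) ^ 2 * sqInt p) ≤ 2 * Q ^ 2 := by
      calc k ^ 2 * (2 * (α ^ 2) ^ 2 * sqInt p) = 2 * (k ^ 2 * α ^ 2 * (α ^ 2 * sqInt p)) := by ring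
        _ ≤ 2 * (1 * (α ^ 2 * sqInt p)) := by
            have : 0 ≤ α ^ 2 * sqInt p := mul_nonneg (sq_nonneg _) hp
            have : k ^ 2 * α ^ 2 ≤ 1 := mul_le_one₀ hk2 (sq_nonneg _) a2
            gcongr
        _ ≤ _ := by linarith
    have h7 := mul_le_mul_of_nonneg_left h4 (sq_nonneg k)
    have h8 : k * ‖q y‖ ^ 2 ≤ k * (k * sqInt (fun y => w y + (α ^ 2) • p y)) := by gcongr
    have h9 : Q ^ 2 ≤ M ^ 4 * Q ^ 2 := le_mul_of_one_le_left Q0 M4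
    linarith
  -- Outside the layer q = g + U'ψ. Agmon's inequality with ‖g‖ ≤ Q and k‖g'‖ ≲ Q gives k|g|² ≲ Q²,
  -- and the decay of U'² beats the linear growth of |ψ|².
  · have hsub : Ioi y ⊆ Ioi 0 := Ioi_subset_Ioi hy.le
    have h1 := norm_pow_four_le (a := y)
      (fun z hz => hasDerivAt_gee F W (hy.trans_le hz)) (halfLine_mono (memLp_gee F W) hsub)
      (halfLine_mono (memLp_dgee F W) hsub)
    have h2 : ∫ z in Ioi y, ‖gee U U1 p q z‖ ^ 2 ≤ Q ^ 2 :=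
      (setIntegral_norm_sq_le (memLp_gee F W) hsub).trans (e1.trans hE)
    have h3 : ∫ z in Ioi y, ‖dgee α U U1 U2 p q w z‖ ^ 2 ≤
        ∫ z in Ioi k, ‖dgee α U U1 U2 p q w z‖ ^ 2 :=
      setIntegral_mono_set (integrable_norm_sq_of_memLp
        (halfLine_mono (memLp_dgee F W) (Ioi_subset_Ioi hk.le)))
        (Eventually.of_forall fun _ => by positivity) (Ioi_subset_Ioi hyk).eventuallyLE
    have h4 := integral_dgee_le F W hk hk1 ha hα1 hE
    have h5 : (k * ‖gee U U1 p q y‖ ^ 2) ^ 2 ≤ (28 * M ^ 2 * Q ^ 2) ^ 2 := by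
      have hI : 0 ≤ ∫ z in Ioi y, ‖gee U U1 p q z‖ ^ 2 := integral_nonneg fun _ => by positivity
      have hJ : 0 ≤ ∫ z in Ioi y, ‖dgee α U U1 U2 p q w z‖ ^ 2 :=
        integral_nonneg fun _ => by positivity
      calc (k * ‖gee U U1 p q y‖ ^ 2) ^ 2 = k ^ 2 * (‖gee U U1 p q y‖ ^ 2) ^ 2 := by ring
        _ ≤ k ^ 2 * (4 * ((∫ z in Ioi y, ‖gee U U1 p q z‖ ^ 2) *
            ∫ z in Ioi y, ‖dgee α U U1 U2 p q w z‖ ^ 2)) := by gcongr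
        _ ≤ k ^ 2 * (4 * (Q ^ 2 * ∫ z in Ioi k, ‖dgee α U U1 U2 p q w z‖ ^ 2)) := by gcongr
        _ = 4 * Q ^ 2 * (k ^ 2 * ∫ z in Ioi k, ‖dgee α U U1 U2 p q w z‖ ^ 2) := by ring
        _ ≤ 4 * Q ^ 2 * (172 * M ^ 4 * Q ^ 2) := by gcongr
        _ ≤ (28 * M ^ 2 * Q ^ 2) ^ 2 := by
            have : 0 ≤ M ^ 4 * Q ^ 4 := by positivity
            linarith
    have h6 : k * ‖gee U U1 p q y‖ ^ 2 ≤ 28 * M ^ 2 * Q ^ 2 :=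
      (pow_le_pow_iff_left₀ (by positivity) (by positivity) two_ne_zero).1 h5
    have h7 := sq_norm_psi_le F W hk hk1 hE hyk
    have h8 : k * ‖U1 y • psi U p y‖ ^ 2 ≤ 6 * M ^ 4 * Q ^ 2 := by
      have b := F.b1 y hy.le
      have b2 : U1 y ^ 2 * (1 + y) ≤ M ^ 2 := by
        calc U1 y ^ 2 * (1 + y) ≤ U1 y ^ 2 * (1 + y) ^ 6 := by
              gcongr
              exact le_self_pow₀ (by linarith) (by norm_num)
          _ = (|U1 y| * (1 + y) ^ 3) ^ 2 := by rw [mul_pow, sq_abs]; ring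
          _ ≤ M ^ 2 := by gcongr
      rw [norm_smul, mul_pow, Real.norm_eq_abs, sq_abs]
      calc k * (U1 y ^ 2 * ‖psi U p y‖ ^ 2) = U1 y ^ 2 * (k * ‖psi U p y‖ ^ 2) := by ring
        _ ≤ U1 y ^ 2 * (6 * M ^ 2 * (1 + y) * Q ^ 2) := by gcongr
        _ = 6 * M ^ 2 * Q ^ 2 * (U1 y ^ 2 * (1 + y)) := by ring
        _ ≤ 6 * M ^ 2 * Q ^ 2 * M ^ 2 := by gcongr
        _ = _ := by ring
    have h9 := sq_norm_add_le (gee U U1 p q y) (U1 y • psi U p y)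
    rw [gee, sub_add_cancel] at h9
    have h10 := mul_le_mul_of_nonneg_left h9 hk.le
    have h11 : M ^ 2 * Q ^ 2 ≤ M ^ 4 * Q ^ 2 := by
      gcongr
      norm_num
    rw [gee] at h6
    linarith [mul_nonneg (by positivity : 0 ≤ M ^ 4) Q0]

/-- From q = g + U'ψ, with the decay of U' supplying the weight for ψ - ψ(1). The value ψ(1) is kept
apart because it alone can be larger than the energy, and it is responsible for the factor (α +
ε^{1/6})/(α + ε^{1/3}). -/
theorem l2norm_q_le (F : Flow U U1 U2 u M) (W : Wave α p q w w1 w2) (hQ : 0 ≤ Q)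
    (hg : sqInt (gee U U1 p q) ≤ Q ^ 2) : l2norm q ≤ 6 * M ^ 2 * Q + M * ‖psi U p 1‖ := by
  have hM := F.one_le
  have hM0 := F.M_pos
  have mw := memLp_weight_psi_sub F W (psi U p 1)
  have mc := memLp_smul_const memLp_inv_one_add_sq (psi U p 1)
  have h1 : l2norm q ≤ l2norm (gee U U1 p q) + l2norm (fun y => U1 y • psi U p y) := by
    have e : q = fun y => gee U U1 p q y + U1 y • psi U p y := by
      funext y; rw [gee, sub_add_cancel]
    have h := l2norm_add_le (memLp_gee F W) (memLp_U1_smul F (memLp_psi F W))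
    rwa [← e] at h
  have h2 : l2norm (gee U U1 p q) ≤ Q := l2norm_le_of hQ hg
  have h3 : l2norm (fun y => U1 y • psi U p y) ≤
      M * l2norm (fun y => ((1 : ℝ) ^ 2 / (1 + y) ^ 2) • (psi U p y - psi U p 1) +
        (1 / (1 + y) ^ 2) • psi U p 1) := by
    refine l2norm_mono (mw.add mc) hM0.le fun y hy => ?_
    have e : ((1 : ℝ) ^ 2 / (1 + y) ^ 2) • (psi U p y - psi U p 1) + (1 / (1 + y) ^ 2) • psi U p 1 =
        ((1 : ℝ) ^ 2 / (1 + y) ^ 2) • psi U p y := by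
      rw [one_pow, smul_sub, sub_add_cancel]
    change _ ≤ M * ‖((1 : ℝ) ^ 2 / (1 + y) ^ 2) • (psi U p y - psi U p 1) +
      (1 / (1 + y) ^ 2) • psi U p 1‖
    rw [e, norm_smul, norm_smul, Real.norm_eq_abs, Real.norm_of_nonneg (by positivity)]
    exact mul_cube_le hy (F.b1 y hy.le) (norm_nonneg _)
  have h4 := l2norm_add_le mw mc
  have h5 : l2norm (fun y => ((1 : ℝ) ^ 2 / (1 + y) ^ 2) • (psi U p y - psi U p 1)) ≤ 5 * M * Q := by
    refine l2norm_le_of (by positivity) ((weighted_psi_sub_one F W).trans ?_)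
    have : 20 * M ^ 2 * sqInt (gee U U1 p q) ≤ 20 * M ^ 2 * Q ^ 2 := by gcongr
    have : 0 ≤ M ^ 2 * Q ^ 2 := by positivity
    rw [mul_pow, mul_pow]
    linarith
  have h6 : l2norm (fun y : ℝ => (1 / (1 + y) ^ 2) • psi U p 1) ≤ ‖psi U p 1‖ := by
    refine l2norm_le_of (norm_nonneg _) ?_
    have i3 := integrableOn_inv_add_pow one_pos (n := 3) (by norm_num)
    have e : sqInt (fun y : ℝ => (1 / (1 + y) ^ 2) • psi U p 1) =
        (∫ y in Ioi (0 : ℝ), 1 / (1 + y) ^ (3 + 1)) * ‖psi U p 1‖ ^ 2 := by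
      rw [sqInt, ← integral_mul_const]
      refine setIntegral_congr_fun measurableSet_Ioi fun y hy => ?_
      simp only [norm_smul, mul_pow, Real.norm_eq_abs, sq_abs, one_div_pow, ← pow_mul]
    rw [e, i3.2]
    refine mul_le_of_le_one_left (sq_nonneg _) ?_
    norm_num
  have h7 : M * l2norm (fun y => ((1 : ℝ) ^ 2 / (1 + y) ^ 2) • (psi U p y - psi U p 1) +
        (1 / (1 + y) ^ 2) • psi U p 1) ≤ M * (5 * M * Q + ‖psi U p 1‖) := by
    gcongr
    linarith
  have h8 : Q ≤ M ^ 2 * Q := le_mul_of_one_le_left hQ (one_le_pow₀ hM)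
  linarith

end OrrSommerfeld

namespace OrrSommerfeld

variable {U U1 U2 : ℝ → ℝ} {u M k α σ N Q : ℝ} {p q w w1 w2 f g : ℝ → ℂ}

/-! ### The ramp `y² / (k² + y²)` -/

/-- A ramp vanishing quadratically at the wall. -/
noncomputable def ramp (k y : ℝ) : ℝ := y ^ 2 / (k ^ 2 + y ^ 2)

/-- The derivative of `ramp`. -/
noncomputable def dramp (k y : ℝ) : ℝ := 2 * k ^ 2 * y / (k ^ 2 + y ^ 2) ^ 2

/-- The second derivative of `ramp`. -/
noncomputable def ddramp (k y : ℝ) : ℝ := 2 * k ^ 2 * (k ^ 2 - 3 * y ^ 2) / (k ^ 2 + y ^ 2) ^ 3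

/-- The complement of `ramp`. -/
noncomputable def hump (k y : ℝ) : ℝ := k ^ 2 / (k ^ 2 + y ^ 2)

theorem hasDerivAt_ramp (hk : 0 < k) (y : ℝ) : HasDerivAt (ramp k) (dramp k y) y := by
  have hP : k ^ 2 + y ^ 2 ≠ 0 := by positivity
  have h2 := ((hasDerivAt_id y).pow 2).div (((hasDerivAt_id y).pow 2).const_add (k ^ 2)) hP
  refine h2.congr_deriv ?_
  simp only [id, Pi.pow_apply, dramp]
  field_simp
  push_cast
  ring

theorem hasDerivAt_dramp (hk : 0 < k) (y : ℝ) : HasDerivAt (dramp k) (ddramp k y) y := by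
  have hP : (k ^ 2 + y ^ 2) ^ 2 ≠ 0 := by positivity
  have h2 := ((hasDerivAt_id y).const_mul (2 * k ^ 2)).div
    ((((hasDerivAt_id y).pow 2).const_add (k ^ 2)).pow 2) hP
  refine h2.congr_deriv ?_
  simp only [id, Pi.pow_apply, ddramp]
  field_simp
  push_cast
  ring

theorem ramp_nonneg (k y : ℝ) : 0 ≤ ramp k y := by unfold ramp; positivity

theorem hump_nonneg (k y : ℝ) : 0 ≤ hump k y := by unfold hump; positivity

theorem ramp_add_hump (hk : 0 < k) (y : ℝ) : ramp k y + hump k y = 1 := by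
  unfold ramp hump
  have hP : k ^ 2 + y ^ 2 ≠ 0 := by positivity
  field_simp
  ring

theorem ramp_le_one (hk : 0 < k) (y : ℝ) : ramp k y ≤ 1 := by
  linarith [ramp_add_hump hk y, hump_nonneg k y]

theorem hump_le_one (hk : 0 < k) (y : ℝ) : hump k y ≤ 1 := by
  linarith [ramp_add_hump hk y, ramp_nonneg k y]

theorem dramp_nonneg {y : ℝ} (hy : 0 ≤ y) : 0 ≤ dramp k y := by unfold dramp; positivity

theorem dramp_mul_le {y : ℝ} (hk : 0 < k) : dramp k y * y ≤ 2 * hump k y := by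
  have e : dramp k y * y = 2 * (hump k y * ramp k y) := by
    unfold dramp hump ramp
    field_simp
  rw [e]
  exact mul_le_mul_of_nonneg_left (mul_le_of_le_one_right (hump_nonneg k y) (ramp_le_one hk y))
    zero_le_two

theorem mul_dramp_le {y : ℝ} (hk : 0 < k) : k * dramp k y ≤ hump k y := by
  unfold dramp hump
  rw [mul_div_assoc', div_le_div_iff₀ (by positivity) (by positivity)]
  have : 2 * (k * y) ≤ k ^ 2 + y ^ 2 := by nlinarith [sq_nonneg (k - y)]
  have h2 : 0 ≤ k ^ 2 * (k ^ 2 + y ^ 2) := by positivity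
  nlinarith

theorem sq_mul_abs_ddramp_le {y : ℝ} (hk : 0 < k) : k ^ 2 * |ddramp k y| ≤ 6 * hump k y := by
  have h0 : |k ^ 2 - 3 * y ^ 2| ≤ 3 * (k ^ 2 + y ^ 2) := by
    rw [abs_le]; constructor <;> nlinarith [sq_nonneg k, sq_nonneg y]
  have e : k ^ 2 * |ddramp k y| =
      2 * hump k y * (k ^ 2 / (k ^ 2 + y ^ 2) ^ 2 * |k ^ 2 - 3 * y ^ 2|) := by
    unfold ddramp hump
    rw [abs_div, abs_mul, abs_of_nonneg (by positivity : 0 ≤ 2 * k ^ 2),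
      abs_of_nonneg (by positivity : 0 ≤ (k ^ 2 + y ^ 2) ^ 3)]
    field_simp
  have h1 : k ^ 2 / (k ^ 2 + y ^ 2) ^ 2 * |k ^ 2 - 3 * y ^ 2| ≤ 3 := by
    calc _ ≤ k ^ 2 / (k ^ 2 + y ^ 2) ^ 2 * (3 * (k ^ 2 + y ^ 2)) := by gcongr
      _ = 3 * hump k y := by unfold hump; field_simp
      _ ≤ 3 := by linarith [hump_le_one hk y]
  rw [e]
  have := mul_le_mul_of_nonneg_left h1 (mul_nonneg zero_le_two (hump_nonneg k y))
  linarith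

theorem continuous_ramp (hk : 0 < k) : Continuous (ramp k) :=
  continuous_iff_continuousAt.2 fun y => (hasDerivAt_ramp hk y).continuousAt

theorem continuous_dramp (hk : 0 < k) : Continuous (dramp k) :=
  continuous_iff_continuousAt.2 fun y => (hasDerivAt_dramp hk y).continuousAt

theorem continuous_ddramp (hk : 0 < k) : Continuous (ddramp k) :=
  Continuous.div (by fun_prop) (by fun_prop) fun y => by positivity

theorem continuous_hump (hk : 0 < k) : Continuous (hump k) :=
  Continuous.div (by fun_prop) (by fun_prop) fun y => by positivity

theorem hump_sq_le {y : ℝ} (hk : 0 < k) (hy : 0 < y) :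
    hump k y ^ 2 ≤ 4 * k ^ 4 * (1 / (k + y) ^ (3 + 1)) := by
  have h : hump k y ≤ 2 * k ^ 2 * (1 / (k + y) ^ 2) := by
    unfold hump
    rw [mul_one_div, div_le_div_iff₀ (by positivity) (by positivity)]
    have := mul_nonneg (sq_nonneg k) (sq_nonneg (k - y))
    nlinarith
  refine (pow_le_pow_left₀ (hump_nonneg k y) h 2).trans (le_of_eq ?_)
  rw [mul_pow, one_div_pow, ← pow_mul]
  ring

theorem memLp_hump (hk : 0 < k) : MemLp (hump k) 2 halfLine ∧
    ∫ y in Ioi (0 : ℝ), hump k y ^ 2 ≤ 2 * k := by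
  have h3 := integrableOn_inv_add_pow hk (n := 3) (by norm_num)
  have i : IntegrableOn (fun y : ℝ => 4 * k ^ 4 * (1 / (k + y) ^ (3 + 1))) (Ioi 0) :=
    h3.1.const_mul _
  have hm : AEStronglyMeasurable (hump k) halfLine := (continuous_hump hk).aestronglyMeasurable
  refine ⟨?_, ?_⟩
  · rw [memLp_two_iff_integrable_sq hm]
    refine Integrable.mono i (hm.pow 2)
      ((ae_restrict_iff' measurableSet_Ioi).2 (Eventually.of_forall fun y hy => ?_))
    have hy0 : (0 : ℝ) < y := hy
    rw [Real.norm_of_nonneg (by positivity), Real.norm_of_nonneg (by positivity)]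
    exact hump_sq_le hk hy0
  · refine (setIntegral_le_of_le i (fun y hy => by positivity) fun y hy =>
      hump_sq_le hk hy).trans ?_
    rw [integral_const_mul, h3.2]
    push_cast
    have : 4 * k ^ 4 * (1 / (3 * k ^ 3)) = 4 / 3 * k := by field_simp
    rw [this]
    linarith

/-! ### Testing with `e^{-α y} ramp` -/

theorem hasDerivAt_exp_mul {b : ℝ → ℝ} {b' : ℝ} {y : ℝ} (α : ℝ) (hb : HasDerivAt b b' y) :
    HasDerivAt (fun y => Real.exp (-α * y) * b y) (Real.exp (-α * y) * (b' - α * b y)) y := by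
  have h1 : HasDerivAt (fun y => Real.exp (-α * y)) (Real.exp (-α * y) * (-α)) y := by
    have := ((hasDerivAt_id y).const_mul (-α)).exp
    simpa using this
  refine (h1.mul hb).congr_deriv ?_
  ring

theorem memLp_exp (hα : 0 < α) : MemLp (fun y => Real.exp (-α * y)) 2 halfLine := by
  have hm : AEStronglyMeasurable (fun y => Real.exp (-α * y)) halfLine :=
    Continuous.aestronglyMeasurable (by fun_prop)
  rw [memLp_two_iff_integrable_sq hm]
  refine (exp_neg_integrableOn_Ioi 0 (b := 2 * α) (by linarith)).congr
    (Eventually.of_forall fun y => ?_)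
  simp only
  rw [← Real.exp_nat_mul]
  congr 1
  push_cast
  ring

theorem exp_le_one {y : ℝ} (hα : 0 < α) (hy : 0 < y) : Real.exp (-α * y) ≤ 1 :=
  Real.exp_le_one_iff.2 (by nlinarith)

theorem memLp_exp_mul_smul (hα : 0 < α) {b : ℝ → ℝ} {B : ℝ} (hb : ContinuousOn b (Ioi 0))
    (hB : ∀ y, 0 < y → |b y| ≤ B) (c : ℂ) :
    MemLp (fun y => (Real.exp (-α * y) * b y) • c) 2 halfLine := by
  refine (memLp_smul_of_bound hb hB (memLp_smul_const (memLp_exp hα) c)).ae_eq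
    (Eventually.of_forall fun y => ?_)
  simp only [smul_smul, mul_comm]

theorem integrableOn_inner_exp (hα : 0 < α) {b : ℝ → ℝ} {B : ℝ} (hb : ContinuousOn b (Ioi 0))
    (hB : ∀ y, 0 < y → |b y| ≤ B) (c : ℂ) (hf : MemLp f 2 halfLine) :
    IntegrableOn (fun y => inner ℝ ((Real.exp (-α * y) * b y) • f y) c) (Ioi 0) := by
  refine (integrable_inner_of_memLp hf (memLp_exp_mul_smul hα hb hB c)).congr
    (Eventually.of_forall fun y => ?_)
  simp only [real_inner_smul_left, real_inner_smul_right]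

/-- The terms that survive when the equation is tested with `e^{-α y} ramp`. -/
noncomputable def rampForm (k α : ℝ) (U U1 : ℝ → ℝ) (p q w f : ℝ → ℂ) (y : ℝ) : ℂ :=
  (Real.exp (-α * y) * (dramp k y * U y)) • gee U U1 p q y +
    (Real.exp (-α * y) * (α * (dramp k y * U y ^ 2 + 2 * (ramp k y * (U y * U1 y))))) • psi U p y -
    (Real.exp (-α * y) * (k ^ 3 * (ddramp k y - 2 * α * dramp k y))) • (Complex.I * w y) +
    (Real.exp (-α * y) * ramp k y) • f y

theorem dramp_le {y : ℝ} (hk : 0 < k) : dramp k y ≤ 1 / k := by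
  rw [le_div_iff₀ hk, mul_comm]
  exact (mul_dramp_le hk).trans (hump_le_one hk y)

theorem abs_ddramp_le {y : ℝ} (hk : 0 < k) : |ddramp k y| ≤ 6 / k ^ 2 := by
  rw [le_div_iff₀ (by positivity), mul_comm]
  exact (sq_mul_abs_ddramp_le hk).trans (by linarith [hump_le_one hk y])

theorem abs_dramp_mul_U_le (F : Flow U U1 U2 u M) {y : ℝ} (hk : 0 < k) (hy : 0 < y) :
    |dramp k y * U y| ≤ 2 * M * hump k y := by
  have h1 := dramp_nonneg (k := k) hy.le
  rw [abs_of_nonneg (mul_nonneg h1 (F.pos hy).le)]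
  calc dramp k y * U y ≤ dramp k y * (M * y) := mul_le_mul_of_nonneg_left (F.le_mul y hy.le) h1
    _ = M * (dramp k y * y) := by ring
    _ ≤ M * (2 * hump k y) := mul_le_mul_of_nonneg_left (dramp_mul_le hk) F.M_pos.le
    _ = _ := by ring

/-- The quantity is the derivative of ramp·U². The decay is uniform in k because ramp'·U is bounded
near the wall and ramp' ≤ 2k²/y³ away from it. -/
theorem abs_deriv_ramp_mul_sq_le (F : Flow U U1 U2 u M) {y : ℝ} (hk : 0 < k) (hk1 : k ≤ 1)
    (hy : 0 < y) :
    |dramp k y * U y ^ 2 + 2 * (ramp k y * (U y * U1 y))| ≤ 18 * M ^ 2 * (1 / (1 + y) ^ 3) := by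
  have hM := F.M_pos
  have hU := F.pos hy
  have hd := dramp_nonneg (k := k) hy.le
  have h1 : dramp k y * U y ^ 2 ≤ 16 * M ^ 2 * (1 / (1 + y) ^ 3) := by
    rcases le_total y 1 with h | h
    · have e1 : dramp k y * U y ^ 2 ≤ 2 * M ^ 2 := by
        calc dramp k y * U y ^ 2 = |dramp k y * U y| * U y := by
              rw [abs_of_nonneg (mul_nonneg hd hU.le)]; ring
          _ ≤ 2 * M * hump k y * M :=
            mul_le_mul (abs_dramp_mul_U_le F hk hy) (F.le y hy.le) hU.le
              (mul_nonneg (by positivity) (hump_nonneg k y))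
          _ ≤ 2 * M * 1 * M := by gcongr; exact hump_le_one hk y
          _ = _ := by ring
      have e2 : 1 ≤ 8 * (1 / (1 + y) ^ 3) := by
        rw [mul_one_div, le_div_iff₀ (by positivity), one_mul]
        calc (1 + y) ^ 3 ≤ 2 ^ 3 := pow_le_pow_left₀ (by positivity) (by linarith) 3
          _ = 8 := by norm_num
      have := mul_le_mul_of_nonneg_left e2 (by positivity : 0 ≤ 2 * M ^ 2)
      linarith
    · have e1 : dramp k y ≤ 2 * (1 / y ^ 3) := by
        unfold dramp
        rw [mul_one_div, div_le_div_iff₀ (by positivity) (by positivity)]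
        have hk2 : k ^ 2 ≤ 1 := pow_le_one₀ hk.le hk1
        have : k ^ 2 * (y ^ 4) ≤ 1 * (k ^ 2 + y ^ 2) ^ 2 := by
          have : y ^ 4 ≤ (k ^ 2 + y ^ 2) ^ 2 := by nlinarith [sq_nonneg k, sq_nonneg y]
          exact mul_le_mul hk2 this (by positivity) zero_le_one
        linarith
      have e2 : 1 / y ^ 3 ≤ 8 * (1 / (1 + y) ^ 3) := by
        rw [mul_one_div, div_le_div_iff₀ (by positivity) (by positivity)]
        have := pow_le_pow_left₀ (by positivity) (by linarith : 1 + y ≤ 2 * y) 3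
        linarith
      calc dramp k y * U y ^ 2 ≤ 2 * (8 * (1 / (1 + y) ^ 3)) * M ^ 2 :=
            mul_le_mul (e1.trans (by linarith)) (pow_le_pow_left₀ hU.le (F.le y hy.le) 2)
              (sq_nonneg _) (by positivity)
        _ = _ := by ring
  have h2 : |2 * (ramp k y * (U y * U1 y))| ≤ 2 * M ^ 2 * (1 / (1 + y) ^ 3) := by
    have hb : |U1 y| ≤ M * (1 / (1 + y) ^ 3) := by
      rw [mul_one_div, le_div_iff₀ (by positivity)]
      exact F.b1 y hy.le
    rw [abs_mul, abs_mul, abs_mul, abs_of_nonneg (ramp_nonneg k y), abs_of_pos hU, abs_two]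
    calc 2 * (ramp k y * (U y * |U1 y|)) ≤ 2 * (1 * (M * (M * (1 / (1 + y) ^ 3)))) := by
          have := ramp_le_one hk y
          have := F.le y hy.le
          gcongr
      _ = _ := by ring
  refine (abs_add_le _ _).trans ?_
  rw [abs_of_nonneg (mul_nonneg hd (sq_nonneg (U y)))]
  linarith

/-- Since e^{-αy} is annihilated by ∂² - α², testing the inviscid operator with it leaves only
-2α∫U'φe^{-αy}, that is -α∫(U²)'ψe^{-αy}. The ramp makes the test function vanish to second order at
the wall, at the price of terms with ramp' and ramp'' localized in the layer. The constant c
converts the complex identity into a real one. -/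
theorem integral_rampForm (F : Flow U U1 U2 u M) (W : Wave α p q w w1 w2)
    (E : OSEq U U2 (k ^ 3) α p w w2 f) (mf : MemLp f 2 halfLine) (hk : 0 < k) (hα : 0 < α) (c : ℂ) :
    IntegrableOn (fun y => inner ℝ (rampForm k α U U1 p q w f y) c) (Ioi 0) ∧
      ∫ y in Ioi (0 : ℝ), inner ℝ (rampForm k α U U1 p q w f y) c = 0 := by
  have hM := F.M_pos
  have cR := continuous_ramp hk
  have cD := continuous_dramp hk
  have cDD := continuous_ddramp hk
  have cU := F.contU
  have cU1 := F.contU1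
  have bR : ∀ y, 0 < y → |ramp k y| ≤ 1 := fun y _ => by
    rw [abs_of_nonneg (ramp_nonneg k y)]; exact ramp_le_one hk y
  have bD : ∀ y, 0 < y → |dramp k y| ≤ 1 / k := fun y hy => by
    rw [abs_of_nonneg (dramp_nonneg hy.le)]; exact dramp_le hk
  have bU : ∀ y, 0 < y → |U y| ≤ M := fun y hy => by
    rw [abs_of_pos (F.pos hy)]; exact F.le y hy.le
  have bU1 : ∀ y, 0 < y → |U1 y| ≤ M := fun y hy => F.b1' hy.le
  have b1 : ∀ y, 0 < y → |dramp k y * U y| ≤ 1 / k * M := fun y hy => by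
    rw [abs_mul]; exact mul_le_mul (bD y hy) (bU y hy) (abs_nonneg _) (by positivity)
  have b2 : ∀ y, 0 < y → |α * (dramp k y * U y ^ 2 + 2 * (ramp k y * (U y * U1 y)))| ≤
      α * (1 / k * M ^ 2 + 2 * (1 * (M * M))) := fun y hy => by
    rw [abs_mul, abs_of_pos hα]
    refine mul_le_mul_of_nonneg_left ((abs_add_le _ _).trans (add_le_add ?_ ?_)) hα.le
    · rw [abs_mul, abs_pow]
      exact mul_le_mul (bD y hy) (pow_le_pow_left₀ (abs_nonneg _) (bU y hy) 2) (by positivity)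
        (by positivity)
    · rw [abs_mul, abs_mul, abs_mul, abs_two]
      exact mul_le_mul_of_nonneg_left (mul_le_mul (bR y hy) (mul_le_mul (bU y hy) (bU1 y hy)
        (abs_nonneg _) hM.le) (by positivity) zero_le_one) zero_le_two
  have b3 : ∀ y, 0 < y → |k ^ 3 * (ddramp k y - 2 * α * dramp k y)| ≤
      k ^ 3 * (6 / k ^ 2 + 2 * α * (1 / k)) := fun y hy => by
    rw [abs_mul, abs_of_pos (by positivity : 0 < k ^ 3)]
    refine mul_le_mul_of_nonneg_left ((abs_sub _ _).trans (add_le_add (abs_ddramp_le hk) ?_))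
      (by positivity)
    rw [abs_mul, abs_of_pos (by positivity : 0 < 2 * α)]
    exact mul_le_mul_of_nonneg_left (bD y hy) (by positivity)
  have mg := memLp_gee F W
  have mψ := memLp_psi F W
  have j1 := integrableOn_inner_exp hα (cD.mul cU).continuousOn b1 c mg
  have j2 := integrableOn_inner_exp hα (continuous_const.mul ((cD.mul (cU.pow 2)).add
    (continuous_const.mul (cR.mul (cU.mul cU1))))).continuousOn b2 c mψ
  have j3 := integrableOn_inner_exp hα (continuous_const.mul (cDD.sub
    (continuous_const.mul cD))).continuousOn b3 c (memLp_I_mul W.m2)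
  have j4 := integrableOn_inner_exp hα cR.continuousOn bR c mf
  have iD : IntegrableOn (fun y => inner ℝ (rampForm k α U U1 p q w f y) c) (Ioi 0) := by
    refine (((j1.add j2).sub j3).add j4).congr (Eventually.of_forall fun y => ?_)
    simp only [rampForm, inner_add_left, inner_sub_left, Pi.add_apply, Pi.sub_apply, Pi.mul_apply,
      Pi.pow_apply]
  refine ⟨iD, ?_⟩
  -- the test function
  have bV' : ∀ y, 0 < y → |dramp k y - α * ramp k y| ≤ 1 / k + α * 1 := fun y hy => by
    refine (abs_sub _ _).trans (add_le_add (bD y hy) ?_)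
    rw [abs_mul, abs_of_pos hα]
    exact mul_le_mul_of_nonneg_left (bR y hy) hα.le
  have cV' : Continuous fun y => dramp k y - α * ramp k y := cD.sub (continuous_const.mul cR)
  have hVd : ∀ y, HasDerivAt (fun y => (Real.exp (-α * y) * ramp k y) • c)
      ((Real.exp (-α * y) * (dramp k y - α * ramp k y)) • c) y := fun y =>
    (hasDerivAt_exp_mul α (hasDerivAt_ramp hk y)).smul_const c
  have R0 : ramp k 0 = 0 := by simp [ramp]
  have D0 : dramp k 0 = 0 := by simp [dramp]
  obtain ⟨iT, hT⟩ := integral_weakForm F W E mf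
    (V := fun y => (Real.exp (-α * y) * ramp k y) • c)
    (V' := fun y => (Real.exp (-α * y) * (dramp k y - α * ramp k y)) • c)
    (hVd 0).continuousAt.continuousWithinAt (by simp [R0]) (fun y _ => hVd y)
    (by fun_prop) (memLp_exp_mul_smul hα cR.continuousOn bR c)
    (memLp_exp_mul_smul hα cV'.continuousOn bV' c)
  -- the flux
  let Z : ℝ → ℂ := fun y => (Real.exp (-α * y) * (ramp k y * U y)) • gee U U1 p q y +
    (Real.exp (-α * y) * (α * (ramp k y * U y ^ 2))) • psi U p y -
    (Real.exp (-α * y) * (k ^ 3 * (dramp k y - α * ramp k y))) • (Complex.I * w y)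
  let T : ℝ → ℂ := fun y => (Real.exp (-α * y) * ramp k y) • (U y • w y - U2 y • p y) -
    (k ^ 3 * (Real.exp (-α * y) * (dramp k y - α * ramp k y))) • (Complex.I * w1 y) -
    (k ^ 3 * α ^ 2 * (Real.exp (-α * y) * ramp k y)) • (Complex.I * w y) -
    (Real.exp (-α * y) * ramp k y) • f y
  have hTT : ∀ y, weakForm U U2 (k ^ 3) α p w w1 f
      (fun y => (Real.exp (-α * y) * ramp k y) • c)
      (fun y => (Real.exp (-α * y) * (dramp k y - α * ramp k y)) • c) y = inner ℝ (T y) c := by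
    intro y
    simp only [weakForm, T, inner_sub_left, real_inner_smul_left, real_inner_smul_right]
    ring
  have hZ : ∀ y, 0 < y → HasDerivAt Z (T y + rampForm k α U U1 p q w f y) y := by
    intro y hy
    have hU := F.pos hy
    have d1 := (hasDerivAt_exp_mul α ((hasDerivAt_ramp hk y).mul (F.d0 y))).smul
      (hasDerivAt_gee F W hy)
    have d2 := (hasDerivAt_exp_mul α (((hasDerivAt_ramp hk y).mul ((F.d0 y).pow 2)).const_mul α)).smul
      (hasDerivAt_psi F W hy)
    have d3 := (hasDerivAt_exp_mul α (((hasDerivAt_dramp hk y).sub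
      ((hasDerivAt_ramp hk y).const_mul α)).const_mul (k ^ 3))).smul ((W.d2 y).const_mul Complex.I)
    refine ((d1.add d2).sub d3).congr_deriv ?_
    simp only [T, rampForm, Pi.mul_apply, Pi.sub_apply, Pi.pow_apply, dgee, mul_smul (U1 y) (U y)⁻¹]
    obtain ⟨G, hG⟩ : ∃ G, G = (U y)⁻¹ • gee U U1 p q y := ⟨_, rfl⟩
    have hg : gee U U1 p q y = U y • G := by
      rw [hG, smul_smul, mul_inv_cancel₀ hU.ne', one_smul]
    rw [← hG, hg, ← smul_psi F p hy]
    push_cast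
    module
  have hΦ : ∀ y, 0 < y → HasDerivAt (fun y => inner ℝ (Z y) c)
      (inner ℝ (T y) c + inner ℝ (rampForm k α U U1 p q w f y) c) y := fun y hy => by
    refine ((hZ y hy).inner ℝ (hasDerivAt_const y c)).congr_deriv ?_
    rw [inner_zero_right, zero_add, inner_add_left]
  have iT' : IntegrableOn (fun y => inner ℝ (T y) c) (Ioi 0) :=
    iT.congr (Eventually.of_forall hTT)
  have z1 := integrableOn_inner_exp hα (b := fun y => ramp k y * U y) (cR.mul cU).continuousOn
    (fun y hy => by
      rw [abs_mul]; exact mul_le_mul (bR y hy) (bU y hy) (abs_nonneg _) zero_le_one) c mg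
  have z2 := integrableOn_inner_exp hα (b := fun y => α * (ramp k y * U y ^ 2))
    (B := α * (1 * M ^ 2)) (continuous_const.mul (cR.mul (cU.pow 2))).continuousOn
    (fun y hy => by
      rw [abs_mul, abs_mul, abs_pow, abs_of_pos hα]
      exact mul_le_mul_of_nonneg_left (mul_le_mul (bR y hy)
        (pow_le_pow_left₀ (abs_nonneg _) (bU y hy) 2) (by positivity) zero_le_one) hα.le) c mψ
  have z3 := integrableOn_inner_exp hα (b := fun y => k ^ 3 * (dramp k y - α * ramp k y))
    (B := k ^ 3 * (1 / k + α * 1)) (continuous_const.mul cV').continuousOn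
    (fun y hy => by
      rw [abs_mul, abs_of_pos (by positivity : 0 < k ^ 3)]
      exact mul_le_mul_of_nonneg_left (bV' y hy) (by positivity)) c (memLp_I_mul W.m2)
  have iZ : IntegrableOn (fun y => inner ℝ (Z y) c) (Ioi 0) := by
    refine ((z1.add z2).sub z3).congr (Eventually.of_forall fun y => ?_)
    simp only [Z, inner_add_left, inner_sub_left, Pi.add_apply, Pi.sub_apply]
  have cZ : ContinuousWithinAt Z (Ioi 0) 0 := by
    have cE : Continuous fun y => Real.exp (-α * y) := by fun_prop
    exact (((cE.mul (cR.mul cU)).continuousWithinAt.smul (tendsto_gee_zero F W)).add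
      ((cE.mul (continuous_const.mul (cR.mul (cU.pow 2)))).continuousWithinAt.smul
        (tendsto_psi_zero F W))).sub
      ((cE.mul (continuous_const.mul cV')).continuousWithinAt.smul
        (continuous_const.mul W.c2).continuousWithinAt)
  have h := integral_Ioi_deriv_eq_neg (cZ.inner (𝕜 := ℝ) continuousWithinAt_const) hΦ iZ
    (integrableOn_add iT' iD)
  have Z0 : Z 0 = 0 := by simp [Z, R0, D0]
  rw [integral_add iT' iD, ← integral_congr_ae (Eventually.of_forall hTT), hT, Z0, inner_zero_left,
    neg_zero, zero_add] at h
  exact h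

end OrrSommerfeld

namespace OrrSommerfeld

variable {U U1 U2 : ℝ → ℝ} {u M k α σ N Q : ℝ} {p q w w1 w2 f g : ℝ → ℂ}

theorem integral_mul_norm_le {c : ℝ → ℝ} (hc : MemLp c 2 halfLine) (hg : MemLp g 2 halfLine)
    {A B : ℝ} (hA : 0 ≤ A) (hB : 0 ≤ B) (hcA : ∫ y in Ioi (0 : ℝ), c y ^ 2 ≤ A ^ 2)
    (hgB : l2norm g ≤ B) :
    IntegrableOn (fun y => c y * ‖g y‖) (Ioi 0) ∧ ∫ y in Ioi (0 : ℝ), c y * ‖g y‖ ≤ A * B := by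
  refine ⟨hc.integrable_mul hg.norm, ?_⟩
  have h1 := sq_integral_mul_le hc hg.norm
  have h2 : ∫ y in Ioi (0 : ℝ), ‖g y‖ ^ 2 ≤ B ^ 2 := by
    change sqInt g ≤ _
    rw [← l2norm_sq]
    exact pow_le_pow_left₀ (l2norm_nonneg _) hgB 2
  have h3 : (∫ y in Ioi (0 : ℝ), c y * ‖g y‖) ^ 2 ≤ (A * B) ^ 2 := by
    rw [mul_pow]
    exact h1.trans (mul_le_mul hcA h2 (integral_nonneg fun _ => by positivity) (sq_nonneg _))
  exact abs_le_of_sq_le_sq' h3 (mul_nonneg hA hB) |>.2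

/-- ψ is replaced by a constant and the test function in front of f by 1. Every error is then either
localized in the layer by `hump` or carries a factor α; for f this is |1 - e^{-αy}ramp| ≤ αy + hump.
-/
theorem norm_sub_rampForm_le (F : Flow U U1 U2 u M) {y : ℝ} (hk : 0 < k) (hk1 : k ≤ 1)
    (hα : 0 < α) (ka : k * α ≤ 1) (hy : 0 < y) (c : ℂ) :
    ‖(Real.exp (-α * y) * (α * (dramp k y * U y ^ 2 + 2 * (ramp k y * (U y * U1 y))))) • c + f y -
        rampForm k α U U1 p q w f y‖ ≤
      2 * M * (hump k y * ‖gee U U1 p q y‖) +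
      18 * M ^ 2 * α * (1 / (1 + y) * ‖((1 : ℝ) ^ 2 / (1 + y) ^ 2) • (psi U p y - c)‖) +
      8 * k * (hump k y * ‖w y‖) +
      (α * (1 / (1 + y) * ‖((1 + y) ^ 2) • f y‖) + hump k y * ‖((1 + y) ^ 2) • f y‖) := by
  have hM := F.M_pos
  have hE0 := (Real.exp_pos (-α * y)).le
  have hE1 := exp_le_one hα hy
  have hr := hump_nonneg k y
  set e := Real.exp (-α * y) with he
  have e1 : (e * (α * (dramp k y * U y ^ 2 + 2 * (ramp k y * (U y * U1 y))))) • c + f y -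
      rampForm k α U U1 p q w f y =
      -((e * (dramp k y * U y)) • gee U U1 p q y) -
      (e * (α * (dramp k y * U y ^ 2 + 2 * (ramp k y * (U y * U1 y))))) • (psi U p y - c) +
      (e * (k ^ 3 * (ddramp k y - 2 * α * dramp k y))) • (Complex.I * w y) +
      (1 - e * ramp k y) • f y := by
    rw [rampForm, ← he]
    module
  rw [e1]
  have hmul : ∀ {b B : ℝ}, |b| ≤ B → |e * b| ≤ B := fun {b B} hb => by
    rw [abs_mul, abs_of_nonneg hE0]
    exact (mul_le_of_le_one_left (abs_nonneg _) hE1).trans hb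
  refine (norm_add_le _ _).trans (add_le_add ((norm_add_le _ _).trans (add_le_add
    ((norm_sub_le _ _).trans (add_le_add ?_ ?_)) ?_)) ?_)
  · rw [norm_neg, norm_smul, Real.norm_eq_abs, ← mul_assoc (2 * M)]
    exact mul_le_mul_of_nonneg_right (hmul (abs_dramp_mul_U_le F hk hy))
      (norm_nonneg (gee U U1 p q y))
  · rw [norm_smul, norm_smul, Real.norm_eq_abs, Real.norm_of_nonneg (by positivity)]
    have h := abs_deriv_ramp_mul_sq_le F hk hk1 hy
    have h2 : |α * (dramp k y * U y ^ 2 + 2 * (ramp k y * (U y * U1 y)))| ≤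
        α * (18 * M ^ 2 * (1 / (1 + y) ^ 3)) := by
      rw [abs_mul, abs_of_pos hα]
      exact mul_le_mul_of_nonneg_left h hα.le
    refine (mul_le_mul_of_nonneg_right (hmul h2) (norm_nonneg _)).trans (le_of_eq ?_)
    field_simp
    try ring
  · rw [norm_smul, norm_mul Complex.I, Complex.norm_I, one_mul, Real.norm_eq_abs,
      ← mul_assoc (8 * k)]
    refine mul_le_mul_of_nonneg_right (hmul ?_) (norm_nonneg (w y))
    have h1 := sq_mul_abs_ddramp_le (k := k) (y := y) hk
    have h2 := mul_dramp_le (k := k) (y := y) hk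
    have h3 := dramp_nonneg (k := k) hy.le
    have h4 : |ddramp k y - 2 * α * dramp k y| ≤ |ddramp k y| + 2 * α * dramp k y := by
      refine (abs_sub _ _).trans (le_of_eq ?_)
      rw [abs_of_nonneg (by positivity : 0 ≤ 2 * α * dramp k y)]
    rw [abs_mul, abs_of_pos (by positivity : 0 < k ^ 3)]
    calc k ^ 3 * |ddramp k y - 2 * α * dramp k y|
        ≤ k ^ 3 * (|ddramp k y| + 2 * α * dramp k y) := by gcongr
      _ = k * (k ^ 2 * |ddramp k y|) + 2 * k * (k * α) * (k * dramp k y) := by ring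
      _ ≤ k * (6 * hump k y) + 2 * k * 1 * hump k y := by gcongr
      _ = _ := by ring
  · have h1 : ‖f y‖ ≤ ‖((1 + y) ^ 2) • f y‖ := by
      rw [norm_smul, Real.norm_of_nonneg (by positivity)]
      exact le_mul_of_one_le_left (norm_nonneg _) (one_le_pow₀ (by linarith))
    have h2 : y * ‖f y‖ ≤ 1 / (1 + y) * ‖((1 + y) ^ 2) • f y‖ := by
      rw [norm_smul, Real.norm_of_nonneg (by positivity)]
      have : 1 / (1 + y) * ((1 + y) ^ 2 * ‖f y‖) = (1 + y) * ‖f y‖ := by field_simp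
      rw [this]
      exact mul_le_mul_of_nonneg_right (by linarith) (norm_nonneg _)
    have h3 : |1 - e * ramp k y| ≤ α * y + hump k y := by
      have h4 : 1 - α * y ≤ e := by
        have := Real.add_one_le_exp (-α * y)
        linarith
      have h5 := ramp_add_hump hk y
      have h6 := ramp_nonneg k y
      have h7 : ramp k y = 1 - hump k y := by linarith
      have h8 : e * ramp k y ≤ 1 := mul_le_one₀ hE1 h6 (ramp_le_one hk y)
      have h9 : e * hump k y ≤ hump k y := mul_le_of_le_one_left hr hE1
      rw [abs_of_nonneg (by linarith), h7]
      linarith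
    rw [norm_smul, Real.norm_eq_abs]
    calc |1 - e * ramp k y| * ‖f y‖ ≤ (α * y + hump k y) * ‖f y‖ := by gcongr
      _ = α * (y * ‖f y‖) + hump k y * ‖f y‖ := by ring
      _ ≤ _ := by gcongr

/-- By parts the integral equals α∫e^{-αy}·ramp·U². On (1, ∞) one has ramp ≥ 1/2 and U ≥ 1/(2M), and
α∫₁^∞ e^{-αy} = e^{-α} ≥ e⁻¹ > 1/3. Hence the coefficient of αψ(1) does not degenerate as α or k
tends to zero. -/
theorem integral_exp_ramp (F : Flow U U1 U2 u M) (hk : 0 < k) (hk1 : k ≤ 1) (hα : 0 < α)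
    (hα1 : α ≤ 1) :
    IntegrableOn (fun y => Real.exp (-α * y) *
      (dramp k y * U y ^ 2 + 2 * (ramp k y * (U y * U1 y)))) (Ioi 0) ∧
    1 / (24 * M ^ 2) ≤ ∫ y in Ioi (0 : ℝ), Real.exp (-α * y) *
      (dramp k y * U y ^ 2 + 2 * (ramp k y * (U y * U1 y))) := by
  have hM := F.M_pos
  have iE : IntegrableOn (fun y => Real.exp (-α * y)) (Ioi 0) := exp_neg_integrableOn_Ioi 0 hα
  have cE : Continuous fun y => Real.exp (-α * y) := by fun_prop
  have cR := continuous_ramp hk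
  have cD := continuous_dramp hk
  have cU := F.contU
  have cU1 := F.contU1
  have b : ∀ y, 0 < y → |dramp k y * U y ^ 2 + 2 * (ramp k y * (U y * U1 y))| ≤ 18 * M ^ 2 :=
    fun y hy => (abs_deriv_ramp_mul_sq_le F hk hk1 hy).trans
      (mul_le_of_le_one_right (by positivity)
        (by rw [div_le_one (by positivity)]; exact one_le_pow₀ (by linarith)))
  have b2 : ∀ y, 0 < y → |ramp k y * U y ^ 2| ≤ 1 * M ^ 2 := fun y hy => by
    rw [abs_of_nonneg (mul_nonneg (ramp_nonneg k y) (sq_nonneg _))]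
    exact mul_le_mul (ramp_le_one hk y) (pow_le_pow_left₀ (F.pos hy).le (F.le y hy.le) 2)
      (sq_nonneg _) zero_le_one
  have key : ∀ {h : ℝ → ℝ} {B : ℝ}, Continuous h → (∀ y, 0 < y → |h y| ≤ B) →
      IntegrableOn (fun y => Real.exp (-α * y) * h y) (Ioi 0) := fun {h B} ch hB => by
    refine Integrable.mono (g := fun y => Real.exp (-α * y) * B) (iE.mul_const B)
      (cE.mul ch).aestronglyMeasurable
      ((ae_restrict_iff' measurableSet_Ioi).2 (Eventually.of_forall fun y hy => ?_))
    rw [norm_mul, norm_mul]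
    exact mul_le_mul_of_nonneg_left ((hB y hy).trans (le_abs_self _)) (norm_nonneg _)
  have i1 := key (h := fun y => dramp k y * U y ^ 2 + 2 * (ramp k y * (U y * U1 y))) (by fun_prop) b
  have i2 := key (h := fun y => ramp k y * U y ^ 2) (by fun_prop) b2
  refine ⟨i1, ?_⟩
  have hd : ∀ y, 0 < y → HasDerivAt (fun y => Real.exp (-α * y) * (ramp k y * U y ^ 2))
      (Real.exp (-α * y) * (dramp k y * U y ^ 2 + 2 * (ramp k y * (U y * U1 y))) -
        α * (Real.exp (-α * y) * (ramp k y * U y ^ 2))) y := fun y _ => by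
    refine (hasDerivAt_exp_mul α ((hasDerivAt_ramp hk y).mul ((F.d0 y).pow 2))).congr_deriv ?_
    simp only [Pi.mul_apply, Pi.pow_apply]
    push_cast
    ring
  have i3 : IntegrableOn (fun y => α * (Real.exp (-α * y) * (ramp k y * U y ^ 2))) (Ioi 0) :=
    i2.const_mul α
  have h := integral_Ioi_deriv_eq_neg
    (Continuous.continuousWithinAt (by fun_prop)) hd i2 (integrableOn_sub i1 i3)
  rw [integral_sub i1 i3, F.zero] at h
  have h1 : ∫ y in Ioi (0 : ℝ), Real.exp (-α * y) *
      (dramp k y * U y ^ 2 + 2 * (ramp k y * (U y * U1 y))) =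
      ∫ y in Ioi (0 : ℝ), α * (Real.exp (-α * y) * (ramp k y * U y ^ 2)) := by
    simp only [ne_eq, OfNat.ofNat_ne_zero, not_false_eq_true, zero_pow, mul_zero, neg_zero] at h
    linarith
  rw [h1]
  have hsub : Ioi (1 : ℝ) ⊆ Ioi 0 := Ioi_subset_Ioi zero_le_one
  have h2 : ∫ y in Ioi (1 : ℝ), α * (Real.exp (-α * y) * (ramp k y * U y ^ 2)) ≤
      ∫ y in Ioi (0 : ℝ), α * (Real.exp (-α * y) * (ramp k y * U y ^ 2)) :=
    setIntegral_mono_set i3 (Eventually.of_forall fun y =>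
      mul_nonneg hα.le (mul_nonneg (Real.exp_pos _).le
        (mul_nonneg (ramp_nonneg k y) (sq_nonneg _)))) hsub.eventuallyLE
  refine le_trans ?_ h2
  have h3 : ∫ y in Ioi (1 : ℝ), α / (8 * M ^ 2) * Real.exp (-α * y) ≤
      ∫ y in Ioi (1 : ℝ), α * (Real.exp (-α * y) * (ramp k y * U y ^ 2)) := by
    refine setIntegral_mono_on ((iE.mono_set hsub).const_mul _) (i3.mono_set hsub)
      measurableSet_Ioi fun y hy => ?_
    have hy1 : (1 : ℝ) < y := hy
    have r1 : 1 / 2 ≤ ramp k y := by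
      unfold ramp
      rw [div_le_div_iff₀ two_pos (by positivity)]
      nlinarith
    have r2 : 1 / (2 * M) ≤ U y := by
      have := F.ge y (by linarith)
      rw [div_le_iff₀ (by positivity)]
      have hU := F.pos (by linarith : 0 < y)
      have : 0 < M * U y := by positivity
      nlinarith
    have r3 : 1 / (4 * M ^ 2) ≤ U y ^ 2 := by
      have := pow_le_pow_left₀ (by positivity) r2 2
      rw [div_pow, mul_pow, one_pow] at this
      norm_num at this ⊢
      exact this
    have r4 : 1 / (8 * M ^ 2) ≤ ramp k y * U y ^ 2 := by
      calc 1 / (8 * M ^ 2) = 1 / 2 * (1 / (4 * M ^ 2)) := by field_simp; norm_num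
        _ ≤ _ := mul_le_mul r1 r3 (by positivity) (ramp_nonneg k y)
    calc α / (8 * M ^ 2) * Real.exp (-α * y) = α * (Real.exp (-α * y) * (1 / (8 * M ^ 2))) := by ring
      _ ≤ _ := by gcongr
  refine le_trans ?_ h3
  rw [integral_const_mul, integral_exp_mul_Ioi (by linarith)]
  have h4 : 1 / 3 ≤ Real.exp (-α * 1) := by
    have h5 : Real.exp (-1) ≤ Real.exp (-α * 1) := Real.exp_le_exp.2 (by linarith)
    have := Real.exp_neg_one_gt_d9
    linarith
  have e : α / (8 * M ^ 2) * (-Real.exp (-α * 1) / -α) = 1 / (8 * M ^ 2) * Real.exp (-α * 1) := by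
    field_simp
  rw [e]
  calc 1 / (24 * M ^ 2) = 1 / (8 * M ^ 2) * (1 / 3) := by field_simp; norm_num
    _ ≤ _ := by gcongr

/-- The bound of `psi` at a fixed point from testing with `e^{-α y} ramp`. -/
theorem Sol.mul_norm_psi_one_le (S : Sol U U1 U2 u M (σ ^ 2) α p q w w1 w2 f) (hσ : 0 < σ)
    (hα1 : α ≤ 1) (hQ : 0 ≤ Q) (hE : energy U U1 (σ ^ 2) α p q w ≤ Q ^ 2)
    (mh : MemLp (fun y => ((1 + y) ^ 2) • f y) 2 halfLine)
    (hN : l2norm (fun y => ((1 + y) ^ 2) • f y) ≤ N) (hI : ‖∫ y in Ioi (0 : ℝ), f y‖ ≤ α * N) :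
    α * ‖psi U p 1‖ ≤ 2688 * M ^ 5 * ((α + σ) * (Q + N)) := by
  have hk := S.k0
  have hα := S.a0
  have F := S.F
  have hM := F.one_le
  have hM0 := F.M_pos
  have hN0 : 0 ≤ N := (l2norm_nonneg _).trans hN
  obtain ⟨-, e1, e2, e3, e4⟩ := energy_parts hk.le U U1 α p q w
  obtain ⟨iD, hD⟩ := integral_rampForm F S.W S.E S.mf hk hα (psi U p 1)
  obtain ⟨im, hm⟩ := integral_exp_ramp F hk S.k1 hα hα1
  have fi := integrableOn_of_weight S.mf mh
  obtain ⟨mr, hr⟩ := memLp_hump hk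
  -- The layer has width of order σ², so Cauchy–Schwarz against `hump` yields a factor σ. This is
  -- where ε^{1/6} in the final ratio comes from.
  have hr2 : ∫ y in Ioi (0 : ℝ), hump (σ ^ 2) y ^ 2 ≤ (2 * σ) ^ 2 := by nlinarith
  have h11 : ∫ y in Ioi (0 : ℝ), (1 / (1 + y)) ^ 2 ≤ 1 ^ 2 := by
    have := (integrableOn_inv_add_pow (L := 1) one_pos (n := 1) le_rfl).2
    simp only [one_div_pow]
    rw [show (1 + 1 : ℕ) = 2 from rfl] at this
    rw [this]
    norm_num
  have hgQ : l2norm (gee U U1 p q) ≤ Q := l2norm_le_of hQ (e1.trans hE)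
  have hwQ : l2norm w ≤ Q / σ ^ 2 := by
    refine l2norm_le_of (by positivity) ?_
    rw [div_pow, le_div_iff₀ (by positivity), mul_comm]
    exact e3.trans hE
  have mw := memLp_weight_psi_sub F S.W (psi U p 1)
  have hψQ : l2norm (fun y => ((1 : ℝ) ^ 2 / (1 + y) ^ 2) • (psi U p y - psi U p 1)) ≤ 5 * M * Q := by
    refine l2norm_le_of (by positivity) ((weighted_psi_sub_one F S.W).trans ?_)
    have : 20 * M ^ 2 * sqInt (gee U U1 p q) ≤ 20 * M ^ 2 * Q ^ 2 := by
      have := e1.trans hE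
      gcongr
    have : 0 ≤ M ^ 2 * Q ^ 2 := by positivity
    rw [mul_pow, mul_pow]
    linarith
  obtain ⟨i1, t1⟩ := integral_mul_norm_le mr (memLp_gee F S.W) (by positivity) hQ hr2 hgQ
  obtain ⟨i2, t2⟩ := integral_mul_norm_le memLp_inv_one_add mw zero_le_one (by positivity) h11 hψQ
  obtain ⟨i3, t3⟩ := integral_mul_norm_le mr S.W.m2 (by positivity) (by positivity) hr2 hwQ
  obtain ⟨i4, t4⟩ := integral_mul_norm_le memLp_inv_one_add mh zero_le_one hN0 h11 hN
  obtain ⟨i5, t5⟩ := integral_mul_norm_le mr mh (by positivity) hN0 hr2 hN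
  have j1 := i1.const_mul (2 * M)
  have j2 := i2.const_mul (18 * M ^ 2 * α)
  have j3 := i3.const_mul (8 * σ ^ 2)
  have j4 := i4.const_mul α
  have j12 := integrableOn_add j1 j2
  have j123 := integrableOn_add j12 j3
  have j45 := integrableOn_add j4 i5
  have jt := integrableOn_add j123 j45
  set c := psi U p 1 with hc
  -- the pointwise inequality, integrated
  have iL1 : IntegrableOn (fun y => α * ‖c‖ ^ 2 * (Real.exp (-α * y) *
      (dramp (σ ^ 2) y * U y ^ 2 + 2 * (ramp (σ ^ 2) y * (U y * U1 y))))) (Ioi 0) := im.const_mul _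
  have iL2 : IntegrableOn (fun y => inner ℝ (f y) c) (Ioi 0) := fi.inner_const _
  have iL12 := integrableOn_add iL1 iL2
  have hint := setIntegral_mono_on (integrableOn_sub iL12 iD) (jt.const_mul ‖c‖) measurableSet_Ioi
    fun y hy => by
      have hy0 : (0 : ℝ) < y := hy
      have h := norm_sub_rampForm_le (f := f) (p := p) (q := q) (w := w) F hk S.k1 hα S.ka hy0 c
      have h2 := (real_inner_le_norm ((Real.exp (-α * y) * (α * (dramp (σ ^ 2) y * U y ^ 2 +
        2 * (ramp (σ ^ 2) y * (U y * U1 y))))) • c + f y - rampForm (σ ^ 2) α U U1 p q w f y) c).trans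
        (mul_le_mul_of_nonneg_right h (norm_nonneg c))
      rw [inner_sub_left, inner_add_left, real_inner_smul_left, real_inner_self_eq_norm_sq] at h2
      calc _ = _ := by ring
        _ ≤ _ := h2
        _ = _ := mul_comm _ _
  rw [integral_sub iL12 iD, hD, integral_add iL1 iL2, integral_const_mul, integral_const_mul,
    integral_inner_const_right fi, integral_add j123 j45, integral_add j12 j3, integral_add j1 j2,
    integral_add j4 i5, integral_const_mul, integral_const_mul, integral_const_mul,
    integral_const_mul] at hint
  have hI2 : -inner ℝ (∫ y in Ioi (0 : ℝ), f y) c ≤ α * N * ‖c‖ := neg_inner_le_mul hI le_rfl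
  set m := ∫ y in Ioi (0 : ℝ), Real.exp (-α * y) *
      (dramp (σ ^ 2) y * U y ^ 2 + 2 * (ramp (σ ^ 2) y * (U y * U1 y))) with hmdef
  set I1 := ∫ y in Ioi (0 : ℝ), hump (σ ^ 2) y * ‖gee U U1 p q y‖
  set I2 := ∫ y in Ioi (0 : ℝ), 1 / (1 + y) * ‖((1 : ℝ) ^ 2 / (1 + y) ^ 2) • (psi U p y - c)‖
  set I3 := ∫ y in Ioi (0 : ℝ), hump (σ ^ 2) y * ‖w y‖
  set I4 := ∫ y in Ioi (0 : ℝ), 1 / (1 + y) * ‖((1 + y) ^ 2) • f y‖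
  set I5 := ∫ y in Ioi (0 : ℝ), hump (σ ^ 2) y * ‖((1 + y) ^ 2) • f y‖
  have s3 : 8 * σ ^ 2 * I3 ≤ 16 * (σ * Q) := by
    calc 8 * σ ^ 2 * I3 ≤ 8 * σ ^ 2 * (2 * σ * (Q / σ ^ 2)) := by gcongr
      _ = _ := by field_simp; ring
  have M3 : 1 ≤ M ^ 3 := one_le_pow₀ hM
  have MM3 : M ≤ M ^ 3 := le_self_pow₀ hM (by norm_num)
  have s1 : 2 * M * I1 ≤ 4 * (M ^ 3 * (σ * Q)) := by
    calc 2 * M * I1 ≤ 2 * M * (2 * σ * Q) := by gcongr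
      _ = 4 * (M * (σ * Q)) := by ring
      _ ≤ _ := by gcongr
  have s2 : 18 * M ^ 2 * α * I2 ≤ 90 * (M ^ 3 * (α * Q)) := by
    calc 18 * M ^ 2 * α * I2 ≤ 18 * M ^ 2 * α * (1 * (5 * M * Q)) := by gcongr
      _ = _ := by ring
  have s4 : α * I4 ≤ α * N := by
    calc α * I4 ≤ α * (1 * N) := by gcongr
      _ = _ := by ring
  have g1 : 0 ≤ σ * Q := by positivity
  have g2 : 0 ≤ α * Q := by positivity
  have g3 : 0 ≤ σ * N := by positivity
  have g4 : 0 ≤ α * N := by positivity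
  have hsum : 2 * M * I1 + 18 * M ^ 2 * α * I2 + 8 * σ ^ 2 * I3 + (α * I4 + I5) + α * N ≤
      112 * (M ^ 3 * ((α + σ) * (Q + N))) := by
    have k1 := le_mul_of_one_le_left g1 M3
    have k2 := le_mul_of_one_le_left g2 M3
    have k3 := le_mul_of_one_le_left g3 M3
    have k4 := le_mul_of_one_le_left g4 M3
    have e : 112 * (M ^ 3 * ((α + σ) * (Q + N))) = 112 * (M ^ 3 * (σ * Q)) +
      112 * (M ^ 3 * (α * Q)) + 112 * (M ^ 3 * (σ * N)) + 112 * (M ^ 3 * (α * N)) := by ring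
    rw [e]
    linarith
  have hfin : α * ‖c‖ ^ 2 * m ≤ ‖c‖ * (112 * (M ^ 3 * ((α + σ) * (Q + N)))) := by
    have := mul_le_mul_of_nonneg_left hsum (norm_nonneg c)
    linarith
  rcases (norm_nonneg c).eq_or_lt with h0 | h0
  · rw [← h0, mul_zero]
    positivity
  · have h1 : α * ‖c‖ * m ≤ 112 * (M ^ 3 * ((α + σ) * (Q + N))) := by
      refine le_of_mul_le_mul_left ?_ h0
      linarith
    have h2 : α * ‖c‖ * (1 / (24 * M ^ 2)) ≤ α * ‖c‖ * m := by gcongr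
    -- 2688 = 112·24, the 24M² being the inverse of the lower bound in `integral_exp_ramp`.
    have h3 := mul_le_mul_of_nonneg_right (h2.trans h1) (by positivity : 0 ≤ 24 * M ^ 2)
    have e : α * ‖c‖ * (1 / (24 * M ^ 2)) * (24 * M ^ 2) = α * ‖c‖ := by field_simp
    rw [e] at h3
    linarith

/-- Adding σ times the first bound to the second gives (α + σ²)x ≲ (α + σ)Y. -/
theorem norm_psi_one_ratio_aux {α σ x C Y : ℝ} (hσ : 0 < σ) (hα : 0 < α)
    (hY : 0 ≤ Y) (hC : 1 ≤ C) (h1 : σ * x ≤ 3 * Y) (h2 : α * x ≤ C * ((α + σ) * Y)) :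
    x ≤ 6 * C * ((α + σ) / (α + σ ^ 2)) * Y := by
  have hP : 0 < α + σ ^ 2 := by positivity
  rw [mul_div_assoc', div_mul_eq_mul_div, le_div_iff₀ hP]
  have h3 : σ ^ 2 * x ≤ 3 * (σ * Y) := by
    have := mul_le_mul_of_nonneg_left h1 hσ.le
    linarith
  have hs : 0 ≤ σ * Y := by positivity
  have ha : 0 ≤ α * Y := by positivity
  have h4 := mul_nonneg (sub_nonneg.2 hC) hs
  have h5 := mul_nonneg (sub_nonneg.2 hC) ha
  nlinarith

/-- The estimates for `α ≤ 1`. -/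
theorem estimates_small {M : ℝ} (hM : 1 ≤ M) : ∃ C, 1 ≤ C ∧ ∃ δ, 0 < δ ∧ δ ≤ 1 ∧
    ∀ {U U1 U2 : ℝ → ℝ} {u σ α N : ℝ} {p q w w1 w2 f : ℝ → ℂ},
    Sol U U1 U2 u M (σ ^ 2) α p q w w1 w2 f → 0 < σ → σ ≤ δ → σ ^ 2 * α ≤ δ → α ≤ 1 →
    MemLp (fun y => ((1 + y) ^ 2) • f y) 2 halfLine →
    l2norm (fun y => ((1 + y) ^ 2) • f y) ≤ N → ‖∫ y in Ioi (0 : ℝ), f y‖ ≤ α * N →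
    l2norm q + α * l2norm p ≤ C * ((α + σ) / (α + σ ^ 2)) * N ∧
    (∀ y, 0 < y → ‖q y‖ ≤ C / σ * N) ∧ l2norm w ≤ C / σ ^ 2 * N := by
  obtain ⟨C, hC, δ, δ0, δ1, h⟩ := energy_bound_small hM
  have hM0 : 0 < M := by linarith
  have M1 : 1 ≤ M ^ 2 := one_le_pow₀ hM
  have M5 : 1 ≤ M ^ 5 := one_le_pow₀ hM
  refine ⟨7 * M ^ 2 * C + M * (6 * (2688 * M ^ 5) * (2 * M * (2 * C))) + 10 * M ^ 2 * C, ?_, δ, δ0,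
    δ1, fun {U U1 U2 u σ α N p q w w1 w2 f} S σ0 hσ hσα hα mh hN hI => ?_⟩
  · have : 0 ≤ M * (6 * (2688 * M ^ 5) * (2 * M * (2 * C))) := by positivity
    have : 1 ≤ M ^ 2 * C := one_le_mul_of_one_le_of_one_le M1 hC
    linarith
  have hQN := h S σ0 hσ hσα hα mh hN hI
  have hα0 := S.a0
  have hσ1 : σ ≤ 1 := hσ.trans δ1
  have hN0 : 0 ≤ N := (l2norm_nonneg _).trans hN
  obtain ⟨hE0, e1, e2, e3, e4⟩ := energy_parts S.k0.le U U1 α p q w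
  obtain ⟨Q, hQdef⟩ : ∃ Q, Q = C * N := ⟨_, rfl⟩
  have hQ : 0 ≤ Q := by rw [hQdef]; positivity
  have hE : energy U U1 (σ ^ 2) α p q w ≤ Q ^ 2 := by
    rw [← Real.sq_sqrt hE0, hQdef]
    exact pow_le_pow_left₀ (Real.sqrt_nonneg _) hQN 2
  have hNQ : N ≤ Q := by rw [hQdef]; exact le_mul_of_one_le_left hN0 hC
  have hp : α * l2norm p ≤ Q := by
    refine abs_le_of_sq_le_sq' (?_ : (α * l2norm p) ^ 2 ≤ Q ^ 2) hQ |>.2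
    rw [mul_pow, l2norm_sq]
    exact e2.trans hE
  have hw : σ ^ 2 * l2norm w ≤ Q := by
    refine abs_le_of_sq_le_sq' (?_ : (σ ^ 2 * l2norm w) ^ 2 ≤ Q ^ 2) hQ |>.2
    rw [mul_pow, l2norm_sq]
    exact e3.trans hE
  -- The bound starting from the trace at the edge of the layer. It loses 1/σ but no negative power
  -- of α, and complements the test with e^{-αy}.
  have hψ1 : σ * ‖psi U p 1‖ ≤ 3 * (2 * M * Q) := by
    have h1 := sq_norm_psi_le S.F S.W S.k0 S.k1 hE S.k1
    refine abs_le_of_sq_le_sq' (?_ : (σ * ‖psi U p 1‖) ^ 2 ≤ (3 * (2 * M * Q)) ^ 2)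
      (by positivity) |>.2
    have : 0 ≤ M ^ 2 * Q ^ 2 := by positivity
    rw [mul_pow]
    linarith
  have hψ2 := S.mul_norm_psi_one_le σ0 hα hQ hE mh hN hI
  have hψ3 : α * ‖psi U p 1‖ ≤ 2688 * M ^ 5 * ((α + σ) * (2 * M * Q)) := by
    refine hψ2.trans ?_
    have : Q + N ≤ 2 * M * Q := by nlinarith
    gcongr
  have hψ := norm_psi_one_ratio_aux σ0 hα0 (by positivity)
    (by linarith : 1 ≤ 2688 * M ^ 5) hψ1 hψ3
  obtain ⟨R, hR⟩ : ∃ R, R = (α + σ) / (α + σ ^ 2) := ⟨_, rfl⟩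
  have hR1 : 1 ≤ R := by
    rw [hR, one_le_div (by positivity)]
    nlinarith
  rw [← hR] at hψ ⊢
  have hq := l2norm_q_le S.F S.W hQ (e1.trans hE)
  have hMC : 0 ≤ M * (6 * (2688 * M ^ 5) * (2 * M * (2 * C))) := by positivity
  have hMC2 : 0 ≤ 7 * M ^ 2 * C := by positivity
  refine ⟨?_, fun y hy => ?_, ?_⟩
  · have h1 : M * ‖psi U p 1‖ ≤ M * (6 * (2688 * M ^ 5) * R * (2 * M * Q)) := by gcongr
    have h2 : Q ≤ M ^ 2 * Q := le_mul_of_one_le_left hQ M1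
    have h3 : 7 * M ^ 2 * Q ≤ 7 * M ^ 2 * C * R * N := by
      rw [hQdef]
      have : 0 ≤ 7 * M ^ 2 * C * N := by positivity
      have := le_mul_of_one_le_right this hR1
      linarith
    have h4 : M * (6 * (2688 * M ^ 5) * R * (2 * M * Q)) ≤
        M * (6 * (2688 * M ^ 5) * (2 * M * (2 * C))) * R * N := by
      rw [hQdef]
      have : 0 ≤ M * (6 * (2688 * M ^ 5) * (2 * M * C)) * R * N := by positivity
      linarith
    have h5 : 0 ≤ 10 * M ^ 2 * C * R * N := by positivity
    linarith
  · have h1 := norm_q_sup_le S.F S.W S.k0 S.k1 hα0.le hα hE hy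
    have h2 : σ * ‖q y‖ ≤ 10 * M ^ 2 * Q := by
      refine abs_le_of_sq_le_sq' (?_ : (σ * ‖q y‖) ^ 2 ≤ (10 * M ^ 2 * Q) ^ 2) (by positivity) |>.2
      rw [mul_pow]
      linarith
    rw [div_mul_eq_mul_div, le_div_iff₀ σ0, mul_comm]
    rw [hQdef] at h2
    have := mul_nonneg (add_nonneg hMC2 hMC) hN0
    linarith
  · rw [div_mul_eq_mul_div, le_div_iff₀ (by positivity), mul_comm]
    have h1 : 1 * (C * N) ≤ 7 * M ^ 2 * (C * N) := by
      have : 0 ≤ C * N := by positivity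
      gcongr
      linarith
    rw [hQdef] at hw
    have := mul_nonneg hMC hN0
    have : 0 ≤ 10 * M ^ 2 * C * N := by positivity
    linarith

end OrrSommerfeld

namespace OrrSommerfeld

/-! ### Weak derivatives and primitives -/

section primitive

variable {v V : ℝ → ℂ} {ζ ζ' : ℝ → ℝ} {R : ℝ}

theorem integral_deriv_mul_primitive {v : ℝ → ℝ} (hv : IntervalIntegrable v volume 0 R)
    (hζ : ∀ y, HasDerivAt ζ (ζ' y) y) (hζ' : Continuous ζ') :
    ∫ y in (0 : ℝ)..R, ζ' y * ∫ s in (0 : ℝ)..y, v s =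
      ζ R * (∫ s in (0 : ℝ)..R, v s) - ∫ y in (0 : ℝ)..R, ζ y * v y := by
  have hd : deriv ζ = ζ' := funext fun y => (hζ y).deriv
  have ac1 : AbsolutelyContinuousOnInterval ζ 0 R := by
    refine ContDiffOn.absolutelyContinuousOnInterval (ContDiff.contDiffOn ?_)
    rw [contDiff_one_iff_deriv, hd]
    exact ⟨fun y => (hζ y).differentiableAt, hζ'⟩
  have ac2 := hv.absolutelyContinuousOnInterval_intervalIntegral (c := 0) left_mem_uIcc
  have h := ac1.integral_mul_deriv_eq_deriv_mul ac2
  have e : ∫ y in (0 : ℝ)..R, ζ y * deriv (fun x => ∫ s in (0 : ℝ)..x, v s) y =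
      ∫ y in (0 : ℝ)..R, ζ y * v y := by
    apply intervalIntegral.integral_congr_ae
    filter_upwards [hv.ae_hasDerivAt_integral] with y h1 hy
    rw [(h1 (uIoc_subset_uIcc hy) 0 left_mem_uIcc).deriv]
  rw [e, hd, intervalIntegral.integral_same, mul_zero, sub_zero] at h
  linarith

theorem integral_deriv_smul_primitive (hv : IntervalIntegrable v volume 0 R)
    (hζ : ∀ y, HasDerivAt ζ (ζ' y) y) (hζ' : Continuous ζ') :
    ∫ y in (0 : ℝ)..R, ζ' y • ∫ s in (0 : ℝ)..y, v s =
      ζ R • (∫ s in (0 : ℝ)..R, v s) - ∫ y in (0 : ℝ)..R, ζ y • v y := by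
  have cζ : Continuous ζ := continuous_iff_continuousAt.2 fun y => (hζ y).continuousAt
  have i1 : IntervalIntegrable (fun y => ζ y • v y) volume 0 R :=
    hv.continuousOn_smul cζ.continuousOn
  have i2 : IntervalIntegrable (fun y => ζ' y • ∫ s in (0 : ℝ)..y, v s) volume 0 R := by
    refine ContinuousOn.intervalIntegrable (hζ'.continuousOn.smul ?_)
    exact intervalIntegral.continuousOn_primitive_interval' hv left_mem_uIcc
  have hsub : ∀ y ∈ uIcc 0 R, IntervalIntegrable v volume 0 y := fun y hy =>
    hv.mono_set (uIcc_subset_uIcc left_mem_uIcc hy)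
  have key : ∀ L : ℂ →L[ℝ] ℝ, L (∫ y in (0 : ℝ)..R, ζ' y • ∫ s in (0 : ℝ)..y, v s) =
      L (ζ R • (∫ s in (0 : ℝ)..R, v s) - ∫ y in (0 : ℝ)..R, ζ y • v y) := fun L => by
    have iL : IntervalIntegrable (fun y => L (v y)) volume 0 R :=
      ⟨L.integrable_comp hv.1, L.integrable_comp hv.2⟩
    have h := integral_deriv_mul_primitive iL hζ hζ'
    rw [map_sub, map_smul, smul_eq_mul, ← L.intervalIntegral_comp_comm i1,
      ← L.intervalIntegral_comp_comm i2, ← L.intervalIntegral_comp_comm hv]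
    simp only [map_smul, smul_eq_mul]
    rw [← h]
    refine intervalIntegral.integral_congr fun y hy => ?_
    simp only [L.intervalIntegral_comp_comm (hsub y hy)]
  exact Complex.ext (key Complex.reCLM) (key Complex.imCLM)

theorem setIntegral_eq_intervalIntegral {F : ℝ → ℂ} (hR : 0 ≤ R) (hF : ∀ y, R < y → F y = 0) :
    ∫ y in Ioi (0 : ℝ), F y = ∫ y in (0 : ℝ)..R, F y := by
  rw [intervalIntegral.integral_of_le hR]
  refine setIntegral_eq_of_subset_of_forall_sdiff_eq_zero measurableSet_Ioi
    (fun y hy => hy.1) fun y hy => hF y ?_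
  by_contra hc
  exact hy.2 ⟨hy.1, not_lt.1 hc⟩

/-- A smooth compactly supported function, its derivative and a bound of the support. -/
theorem exists_support_bound {η : ℝ → ℝ} (hη : ContDiff ℝ ∞ η) (hs : HasCompactSupport η) :
    (∀ y, HasDerivAt η (deriv η y) y) ∧ Continuous (deriv η) ∧
      ∃ R, 0 < R ∧ ∀ y, R ≤ y → η y = 0 ∧ deriv η y = 0 := by
  refine ⟨fun y => (hη.differentiable (by simp) y).hasDerivAt, hη.continuous_deriv (by simp), ?_⟩
  obtain ⟨R, hR⟩ := hs.isCompact.bddAbove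
  refine ⟨max R 0 + 1, by positivity, fun y hy => ?_⟩
  have hn : y ∉ tsupport η := fun h => by
    have := hR h
    have := le_max_left R 0
    linarith
  exact ⟨image_eq_zero_of_notMem_tsupport hn,
    image_eq_zero_of_notMem_tsupport fun h => hn (tsupport_deriv_subset h)⟩
where
  tsupport_deriv_subset {η : ℝ → ℝ} : tsupport (deriv η) ⊆ tsupport η :=
    closure_minimal (support_deriv_subset) (isClosed_tsupport η)

theorem integral_deriv_smul_primitive_Ioi {η : ℝ → ℝ} (hη : ContDiff ℝ ∞ η)
    (hs : HasCompactSupport η) (hv : ∀ R, 0 ≤ R → IntervalIntegrable v volume 0 R) :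
    ∫ y in Ioi (0 : ℝ), deriv η y • ∫ s in (0 : ℝ)..y, v s = -∫ y in Ioi (0 : ℝ), η y • v y := by
  obtain ⟨hd, hc, R, hR, h0⟩ := exists_support_bound hη hs
  rw [setIntegral_eq_intervalIntegral hR.le fun y hy => by rw [(h0 y hy.le).2, zero_smul],
    setIntegral_eq_intervalIntegral hR.le fun y hy => by rw [(h0 y hy.le).1, zero_smul],
    integral_deriv_smul_primitive (hv R hR.le) hd hc, (h0 R le_rfl).1, zero_smul, zero_sub]

theorem integral_deriv_Ioi {η : ℝ → ℝ} (hη : ContDiff ℝ ∞ η) (hs : HasCompactSupport η) (c : ℂ) :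
    ∫ y in Ioi (0 : ℝ), deriv η y • c = -(η 0 • c) := by
  obtain ⟨hd, hc, R, hR, h0⟩ := exists_support_bound hη hs
  rw [integral_smul_const]
  have h1 : ∫ y in Ioi (0 : ℝ), deriv η y = -η 0 := by
    have e : ∫ y in Ioi (0 : ℝ), deriv η y = ∫ y in (0 : ℝ)..R, deriv η y := by
      rw [intervalIntegral.integral_of_le hR.le]
      refine setIntegral_eq_of_subset_of_forall_sdiff_eq_zero measurableSet_Ioi
        (fun y hy => hy.1) fun y hy => (h0 y ?_).2
      by_contra hc
      exact hy.2 ⟨hy.1, (not_le.1 hc).le⟩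
    rw [e, intervalIntegral.integral_eq_sub_of_hasDerivAt (fun y _ => hd y)
      (hc.intervalIntegrable _ _), (h0 R le_rfl).1, zero_sub]
  rw [h1, neg_smul]

theorem locallyIntegrable_L2 (u : L2) : LocallyIntegrable (fun y => u y) halfLine :=
  (Lp.memLp u).locallyIntegrable (by norm_num)

theorem integrable_test_smul (u : L2) {η : ℝ → ℝ} (hη : Continuous η) (hs : HasCompactSupport η) :
    Integrable (fun y => η y • u y) halfLine :=
  (locallyIntegrable_L2 u).integrable_smul_left_of_hasCompactSupport hη hs

theorem continuousOn_primitive (hv : ∀ R, 0 ≤ R → IntervalIntegrable v volume 0 R) :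
    ContinuousOn (fun y => ∫ s in (0 : ℝ)..y, v s) (Ici 0) := by
  intro y hy
  have hy0 : (0 : ℝ) ≤ y := hy
  have h := intervalIntegral.continuousOn_primitive_interval' (hv (y + 1) (by linarith))
    left_mem_uIcc
  rw [uIcc_of_le (by linarith)] at h
  refine (h y ⟨hy0, by linarith⟩).mono_of_mem_nhdsWithin ?_
  rw [← Ici_inter_Iic]
  exact inter_mem self_mem_nhdsWithin (mem_nhdsWithin_of_mem_nhds (Iic_mem_nhds (by linarith)))

/-- A locally integrable function on `(0, ∞)` with weak derivative zero is constant. -/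
theorem ae_eq_const_of_integral_deriv_smul_eq_zero {W : ℝ → ℂ}
    (hW : LocallyIntegrableOn W (Ioi (0 : ℝ)) volume)
    (h : ∀ η : ℝ → ℝ, ContDiff ℝ ∞ η → HasCompactSupport η → tsupport η ⊆ Ioi (0 : ℝ) →
      ∫ y in Ioi (0 : ℝ), deriv η y • W y = 0) :
    ∃ c : ℂ, W =ᵐ[halfLine] fun _ => c := by
  let b : ContDiffBump (2 : ℝ) := ⟨1 / 2, 1, by norm_num, by norm_num⟩
  let θ : ℝ → ℝ := b.normed volume
  have θd : ContDiff ℝ ∞ θ := b.contDiff_normed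
  have θs : HasCompactSupport θ := b.hasCompactSupport_normed
  have θt : tsupport θ = Metric.closedBall 2 1 := b.tsupport_normed_eq
  have θi : ∫ y, θ y = 1 := b.integral_normed
  have hin : ∀ ξ : ℝ → ℝ, Continuous ξ → HasCompactSupport ξ → tsupport ξ ⊆ Ioi (0 : ℝ) →
      IntegrableOn (fun y => ξ y • W y) (Ioi 0) := fun ξ c1 c2 c3 => by
    have hK : IntegrableOn W (tsupport ξ) := hW.integrableOn_compact_subset c3 c2
    have h1 : IntegrableOn (fun y => ξ y • W y) (tsupport ξ) :=
      hK.continuousOn_smul c1.continuousOn c2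
    refine (h1.of_forall_sdiff_eq_zero measurableSet_Ioi fun y hy => ?_)
    rw [image_eq_zero_of_notMem_tsupport hy.2, zero_smul]
  have θt0 : tsupport θ ⊆ Ioi 0 := by
    rw [θt, Real.closedBall_eq_Icc]
    intro y hy
    have := hy.1
    norm_num at this
    exact mem_Ioi.2 (by linarith)
  have key : ∀ ξ : ℝ → ℝ, ContDiff ℝ ∞ ξ → HasCompactSupport ξ → tsupport ξ ⊆ Ioi (0 : ℝ) →
      ∫ y in Ioi (0 : ℝ), ξ y • W y = (∫ y, ξ y) • ∫ y in Ioi (0 : ℝ), θ y • W y := by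
    intro ξ c1 c2 c3
    -- Subtracting a multiple of a fixed normalized bump makes the mean zero, so z is itself the
    -- derivative of a test function supported in (0, ∞). The hypothesis then says that W acts on ξ
    -- like the constant ∫θW.
    let z : ℝ → ℝ := fun y => ξ y - (∫ t, ξ t) * θ y
    have zd : ContDiff ℝ ∞ z := c1.sub (contDiff_const.mul θd)
    have zi : ∫ y, z y = 0 := by
      have i1 : Integrable ξ := c1.continuous.integrable_of_hasCompactSupport c2
      have i2 : Integrable θ := θd.continuous.integrable_of_hasCompactSupport θs
      rw [integral_sub i1 (i2.const_mul _), integral_const_mul, θi, mul_one, sub_self]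
    obtain ⟨K, hK⟩ : ∃ K, K = tsupport ξ ∪ tsupport θ := ⟨_, rfl⟩
    have hKc : IsCompact K := hK ▸ c2.isCompact.union θs.isCompact
    have hKn : K.Nonempty := by
      refine ⟨2, ?_⟩
      rw [hK, θt]
      exact Or.inr (Metric.mem_closedBall_self zero_le_one)
    obtain ⟨a, haK, ha⟩ := hKc.exists_isLeast hKn
    obtain ⟨d, hdK, hd⟩ := hKc.exists_isGreatest hKn
    have ha0 : 0 < a := by
      have : K ⊆ Ioi 0 := hK ▸ union_subset c3 θt0
      exact this haK
    have z0 : ∀ y, y ∉ Icc a d → z y = 0 := fun y hy => by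
      have hn : y ∉ K := fun h => hy ⟨ha h, hd h⟩
      rw [hK] at hn
      simp only [z]
      rw [image_eq_zero_of_notMem_tsupport fun h => hn (Or.inl h),
        image_eq_zero_of_notMem_tsupport fun h => hn (Or.inr h), mul_zero, sub_zero]
    let η : ℝ → ℝ := fun y => ∫ s in (0 : ℝ)..y, z s
    have ηd : ∀ y, HasDerivAt η (z y) y := fun y =>
      intervalIntegral.integral_hasDerivAt_right (zd.continuous.intervalIntegrable _ _)
        (zd.continuous.stronglyMeasurableAtFilter _ _) zd.continuous.continuousAt
    have ηd' : deriv η = z := funext fun y => (ηd y).deriv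
    have ηc : ContDiff ℝ ∞ η := by
      rw [contDiff_infty_iff_deriv, ηd']
      exact ⟨fun y => (ηd y).differentiableAt, zd⟩
    have η0 : ∀ y, y ∉ Icc a d → η y = 0 := fun y hy => by
      rcases lt_or_ge y a with h1 | h1
      · refine intervalIntegral.integral_zero_ae (Eventually.of_forall fun s hs => z0 s fun hc => ?_)
        have := (hs.2.trans (max_le ha0.le h1.le))
        rcases le_or_gt 0 y with h2 | h2
        · have := hs.2
          rw [max_eq_right h2] at this
          linarith [hc.1]
        · have := hs.2
          rw [max_eq_left h2.le] at this
          linarith [hc.1]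
      · have h2 : d < y := by
          by_contra hc
          exact hy ⟨h1, not_lt.1 hc⟩
        have e : ∫ s in (0 : ℝ)..y, z s = ∫ s, z s := by
          rw [intervalIntegral.integral_of_le (ha0.le.trans h1)]
          refine setIntegral_eq_integral_of_forall_compl_eq_zero fun s hs => z0 s fun hc => hs ?_
          exact ⟨ha0.trans_le hc.1, hc.2.trans h2.le⟩
        change ∫ s in (0 : ℝ)..y, z s = 0
        rw [e, zi]
    have hsub : tsupport η ⊆ Icc a d := closure_minimal
      (fun y hy => by
        by_contra hc
        exact hy (η0 y hc)) isClosed_Icc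
    have h1 := h η ηc (HasCompactSupport.intro isCompact_Icc η0)
      (hsub.trans fun y hy => ha0.trans_le hy.1)
    rw [ηd'] at h1
    have e : ∀ y, z y • W y = ξ y • W y - (∫ t, ξ t) • (θ y • W y) := fun y => by
      simp only [z, sub_smul, mul_smul]
    simp only [e] at h1
    have j1 := hin ξ c1.continuous c2 c3
    have j2 := hin θ θd.continuous θs θt0
    have j3 : IntegrableOn (fun y => (∫ t, ξ t) • (θ y • W y)) (Ioi 0) :=
      Integrable.smul (∫ t, ξ t) j2
    rw [integral_sub j1 j3, integral_smul, sub_eq_zero] at h1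
    exact h1
  obtain ⟨c, hc⟩ : ∃ c, c = ∫ y in Ioi (0 : ℝ), θ y • W y := ⟨_, rfl⟩
  refine ⟨c, ?_⟩
  have h2 := isOpen_Ioi.ae_eq_zero_of_integral_contDiff_smul_eq_zero
    (μ := volume) (f := fun y => W y - c) (hW.sub (continuousOn_const.locallyIntegrableOn
      measurableSet_Ioi)) (by
      intro ξ c1 c2 c3
      have i1 : Integrable ξ := c1.continuous.integrable_of_hasCompactSupport c2
      have hset : ∫ y, ξ y • (W y - c) = ∫ y in Ioi (0 : ℝ), ξ y • (W y - c) := by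
        refine (setIntegral_eq_integral_of_forall_compl_eq_zero fun y hy => ?_).symm
        rw [image_eq_zero_of_notMem_tsupport fun h => hy (c3 h), zero_smul]
      have hset2 : ∫ y, ξ y = ∫ y in Ioi (0 : ℝ), ξ y := by
        refine (setIntegral_eq_integral_of_forall_compl_eq_zero fun y hy => ?_).symm
        exact image_eq_zero_of_notMem_tsupport fun h => hy (c3 h)
      rw [hset]
      simp only [smul_sub]
      rw [integral_sub (hin ξ c1.continuous c2 c3) (i1.integrableOn.smul_const c),
        integral_smul_const, key ξ c1 c2 c3, ← hc, hset2, sub_self])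
  refine (ae_restrict_iff' measurableSet_Ioi).2 ?_
  filter_upwards [h2] with y hy hmem
  exact sub_eq_zero.1 (hy hmem)

/-- A function with a weak derivative is a primitive of it. -/
theorem IsWeakDeriv.ae_eq_primitive {u v : L2} (h : IsWeakDeriv u v) (hV : ⇑v =ᵐ[halfLine] V) :
    ∃ c : ℂ, ⇑u =ᵐ[halfLine] fun y => c + ∫ s in (0 : ℝ)..y, V s := by
  have mV : MemLp V 2 halfLine := (memLp_congr_ae hV).1 (Lp.memLp v)
  have hi : ∀ R, 0 ≤ R → IntervalIntegrable V volume 0 R := fun R hR =>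
    intervalIntegrable_of_memLp_halfLine mV le_rfl hR
  have hc := (continuousOn_primitive hi).mono Ioi_subset_Ici_self
  have hu : LocallyIntegrableOn (fun y => u y) (Ioi (0 : ℝ)) volume :=
    locallyIntegrableOn_of_locallyIntegrable_restrict (locallyIntegrable_L2 u)
  have hp := hc.locallyIntegrableOn (μ := volume) measurableSet_Ioi
  obtain ⟨c, hcc⟩ := ae_eq_const_of_integral_deriv_smul_eq_zero (hu.sub hp) fun η h1 h2 h3 => by
    have e1 := h η h1 h2 h3
    have e2 := integral_deriv_smul_primitive_Ioi h1 h2 hi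
    have e3 : ∫ y in Ioi (0 : ℝ), η y • v y = ∫ y in Ioi (0 : ℝ), η y • V y := by
      refine integral_congr_ae ?_
      filter_upwards [hV] with y hy
      rw [hy]
    have c' : Continuous (deriv η) := h1.continuous_deriv (by simp)
    have i1 := integrable_test_smul u c' h2.deriv
    have i2 : IntegrableOn (fun y => deriv η y • ∫ s in (0 : ℝ)..y, V s) (Ioi 0) := by
      have hK : IntegrableOn (fun y => ∫ s in (0 : ℝ)..y, V s) (tsupport η) :=
        hp.integrableOn_compact_subset h3 h2
      refine IntegrableOn.of_forall_sdiff_eq_zero (hK.continuousOn_smul c'.continuousOn h2)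
        measurableSet_Ioi fun y hy => ?_
      have : deriv η y = 0 := by
        by_contra hne
        exact hy.2 (support_deriv_subset hne)
      rw [this, zero_smul]
    have e4 : ∀ y, deriv η y • ((fun y => u y) - fun y => ∫ s in (0 : ℝ)..y, V s) y =
        deriv η y • u y - deriv η y • ∫ s in (0 : ℝ)..y, V s := fun y => smul_sub _ _ _
    simp only [e4]
    rw [integral_sub i1 i2, e1, e2, e3, sub_self]
  refine ⟨c, ?_⟩
  filter_upwards [hcc] with y hy
  rw [Pi.sub_apply] at hy
  rw [← hy, sub_add_cancel]

/-- Primitives have weak derivatives. -/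
theorem isWeakDeriv_of_ae_eq_primitive {u v : L2} {c : ℂ} (hV : ⇑v =ᵐ[halfLine] V)
    (hu : ⇑u =ᵐ[halfLine] fun y => c + ∫ s in (0 : ℝ)..y, V s) {η : ℝ → ℝ} (hη : ContDiff ℝ ∞ η)
    (hs : HasCompactSupport η) :
    ∫ y in Ioi (0 : ℝ), deriv η y • u y = -(η 0 • c) - ∫ y in Ioi (0 : ℝ), η y • v y := by
  have mV : MemLp V 2 halfLine := (memLp_congr_ae hV).1 (Lp.memLp v)
  have hi : ∀ R, 0 ≤ R → IntervalIntegrable V volume 0 R := fun R hR =>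
    intervalIntegrable_of_memLp_halfLine mV le_rfl hR
  have c' : Continuous (deriv η) := hη.continuous_deriv (by simp)
  have i0 := integrable_test_smul u c' hs.deriv
  have i1 : IntegrableOn (fun y => deriv η y • c) (Ioi 0) :=
    (c'.integrable_of_hasCompactSupport hs.deriv).integrableOn.smul_const c
  have e1 : (fun y => deriv η y • u y) =ᵐ[halfLine]
      fun y => deriv η y • c + deriv η y • ∫ s in (0 : ℝ)..y, V s := by
    filter_upwards [hu] with y hy
    rw [hy, smul_add]
  have i2 : IntegrableOn (fun y => deriv η y • ∫ s in (0 : ℝ)..y, V s) (Ioi 0) := by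
    refine ((i0.congr e1).sub i1).congr (Eventually.of_forall fun y => ?_)
    simp only [Pi.sub_apply, add_sub_cancel_left]
  have e3 : ∫ y in Ioi (0 : ℝ), η y • v y = ∫ y in Ioi (0 : ℝ), η y • V y := by
    refine integral_congr_ae ?_
    filter_upwards [hV] with y hy
    rw [hy]
  rw [integral_congr_ae e1, integral_add i1 i2, integral_deriv_Ioi hη hs,
    integral_deriv_smul_primitive_Ioi hη hs hi, e3, sub_eq_add_neg]

theorem image_zero_of_tsupport {η : ℝ → ℝ} (h : tsupport η ⊆ Ioi (0 : ℝ)) : η 0 = 0 :=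
  image_eq_zero_of_notMem_tsupport fun h0 => lt_irrefl (0 : ℝ) (h h0)

/-- Integration by parts against test functions that need not vanish at the wall characterizes a
zero trace. -/
theorem hasZeroTrace_of_integral {u v : L2} (h : ∀ η : ℝ → ℝ, ContDiff ℝ ∞ η →
    HasCompactSupport η → ∫ y in Ioi (0 : ℝ), deriv η y • u y = -∫ y in Ioi (0 : ℝ), η y • v y) :
    IsWeakDeriv u v ∧ HasZeroTrace u := by
  have hw : IsWeakDeriv u v := fun η h1 h2 _ => h η h1 h2
  refine ⟨hw, ?_⟩
  obtain ⟨c, hc⟩ := hw.ae_eq_primitive (ae_eq_refl v)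
  have hi : ∀ R, 0 ≤ R → IntervalIntegrable (fun y => v y) volume 0 R := fun R hR =>
    intervalIntegrable_of_memLp_halfLine (Lp.memLp v) le_rfl hR
  refine ⟨_, continuousOn_const.add (continuousOn_primitive hi), hc, ?_⟩
  -- A test function equal to 1 at the wall reads off the boundary value c of the primitive, which
  -- the assumed formula forces to vanish.
  let b : ContDiffBump (0 : ℝ) := ⟨1, 2, by norm_num, by norm_num⟩
  have h1 := isWeakDeriv_of_ae_eq_primitive (ae_eq_refl v) hc (η := b) b.contDiff
    b.hasCompactSupport
  have h2 := h b b.contDiff b.hasCompactSupport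
  have b1 : b 0 = 1 := b.one_of_mem_closedBall (Metric.mem_closedBall_self b.rIn_pos.le)
  rw [h2, b1, one_smul] at h1
  have h3 : c = 0 := by
    have h4 := congrArg (fun x => x + ∫ y in Ioi (0 : ℝ), (b : ℝ → ℝ) y • v y) h1
    simpa using h4.symm
  simp [h3]

theorem IsWeakDeriv.add {u u' v v' : L2} (h : IsWeakDeriv u v) (h' : IsWeakDeriv u' v') :
    IsWeakDeriv (u + u') (v + v') := fun η h1 h2 h3 => by
  have c' : Continuous (deriv η) := h1.continuous_deriv (by simp)
  have e1 : ∫ y in Ioi (0 : ℝ), deriv η y • (u + u') y =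
      ∫ y in Ioi (0 : ℝ), (deriv η y • u y + deriv η y • u' y) := by
    refine integral_congr_ae ?_
    filter_upwards [Lp.coeFn_add u u'] with y hy
    rw [hy, Pi.add_apply, smul_add]
  have e2 : ∫ y in Ioi (0 : ℝ), η y • (v + v') y =
      ∫ y in Ioi (0 : ℝ), (η y • v y + η y • v' y) := by
    refine integral_congr_ae ?_
    filter_upwards [Lp.coeFn_add v v'] with y hy
    rw [hy, Pi.add_apply, smul_add]
  rw [e1, e2, integral_add (integrable_test_smul u c' h2.deriv)
    (integrable_test_smul u' c' h2.deriv), integral_add (integrable_test_smul v h1.continuous h2)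
    (integrable_test_smul v' h1.continuous h2), h η h1 h2 h3, h' η h1 h2 h3, neg_add]

theorem IsWeakDeriv.const_smul {u v : L2} (h : IsWeakDeriv u v) (a : ℂ) :
    IsWeakDeriv (a • u) (a • v) := fun η h1 h2 h3 => by
  have e : ∀ (g : ℝ → ℝ) (z : L2), ∫ y in Ioi (0 : ℝ), g y • (a • z) y =
      a • ∫ y in Ioi (0 : ℝ), g y • z y := fun g z => by
    rw [← integral_smul]
    refine integral_congr_ae ?_
    filter_upwards [Lp.coeFn_smul a z] with y hy
    rw [hy, Pi.smul_apply, smul_comm]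
  rw [e, e, h η h1 h2 h3, smul_neg]

end primitive

end OrrSommerfeld

namespace OrrSommerfeld

/-! ### The shear profile as a `Flow` -/

theorem exists_primitive {g : ℝ → ℝ} (hg : Continuous g) (c : ℝ) :
    ∃ G : ℝ → ℝ, (∀ y, HasDerivAt G (g y) y) ∧ G 0 = c ∧
      ∀ C y : ℝ, 0 ≤ y → (∀ t, 0 ≤ t → t ≤ y → |g t| ≤ C) → |G y - c| ≤ C * y := by
  refine ⟨fun y => c + ∫ s in (0 : ℝ)..y, g s, fun y => ?_, by simp, fun C y hy hC => ?_⟩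
  · exact (intervalIntegral.integral_hasDerivAt_right (hg.intervalIntegrable _ _)
      (hg.stronglyMeasurableAtFilter _ _) hg.continuousAt).const_add c
  · rw [add_sub_cancel_left]
    have h := intervalIntegral.norm_integral_le_of_norm_le_const (a := 0) (b := y) (f := g) (C := C)
      fun t ht => by
        rw [uIoc_of_le hy] at ht
        exact hC t ht.1.le ht.2
    rwa [sub_zero, abs_of_nonneg hy] at h

theorem eqOn_of_hasDerivAt {f g h : ℝ → ℝ} (hf : ∀ y, HasDerivAt f (h y) y)
    (hg : ∀ y, 0 ≤ y → HasDerivWithinAt g (h y) (Ici 0) y) (h0 : f 0 = g 0) {y : ℝ} (hy : 0 ≤ y) :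
    f y = g y := by
  have h1 : ∀ x ∈ Icc 0 y, (f - g) x = (f - g) 0 :=
    constant_of_has_deriv_right_zero
      (fun x hx => ((hf x).continuousAt.continuousWithinAt.sub
        ((hg x hx.1).continuousWithinAt.mono Icc_subset_Ici_self)))
      (fun x hx => by
        have := (hf x).hasDerivWithinAt.sub ((hg x hx.1).mono (Ici_subset_Ici.2 hx.1))
        rwa [sub_self] at this)
  have h2 := h1 y ⟨hy, le_rfl⟩
  simp only [Pi.sub_apply, h0, sub_self] at h2
  exact sub_eq_zero.1 h2

/-- Only y ≤ M(1 + y)U requires an argument, in three regions: up to a the positive slope at the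
wall dominates the quadratic error, beyond b the positive limit is close, and in between U has a
positive minimum by compactness. -/
theorem flow_bounds {U U1 U2 : ℝ → ℝ} {UE M1 M2 : ℝ} (d0 : ∀ y, HasDerivAt U (U1 y) y)
    (d1 : ∀ y, HasDerivAt U1 (U2 y) y) (c2 : Continuous U2) (z : U 0 = 0) (pos : ∀ y, 0 < y → 0 < U y)
    (slope : 0 < U1 0) (hUE : 0 < UE) (lim : Tendsto U atTop (𝓝 UE))
    (b1 : ∀ y, 0 ≤ y → |U1 y| * (1 + y) ^ 3 ≤ M1) (b2 : ∀ y, 0 ≤ y → |U2 y| * (1 + y) ^ 3 ≤ M2)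
    (b1' : ∀ y, 0 ≤ y → U y ≤ M1 * y) (bu : ∀ y, 0 ≤ y → |U1 y - U1 0| ≤ M2 * y)
    (bl : ∀ y, 0 ≤ y → |U y - U1 0 * y| ≤ M2 * y * y) : ∃ M, Flow U U1 U2 (U1 0) M := by
  have hM1 : 0 ≤ M1 := le_trans (by positivity) (b1 0 le_rfl)
  have hM2 : 0 ≤ M2 := le_trans (by positivity) (b2 0 le_rfl)
  have hcU : Continuous U := continuous_iff_continuousAt.2 fun y => (d0 y).continuousAt
  obtain ⟨b, hb⟩ := eventually_atTop.1 ((lim.eventually_const_le (by linarith : UE / 2 < UE)).and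
    (lim.eventually_le_const (by linarith : UE < UE + 1)))
  obtain ⟨u, hu⟩ : ∃ u, u = U1 0 := ⟨_, rfl⟩
  rw [← hu] at slope bu bl ⊢
  obtain ⟨a, ha⟩ : ∃ a, a = u / (2 * (M2 + 1)) := ⟨_, rfl⟩
  have ha0 : 0 < a := by rw [ha]; positivity
  obtain ⟨x, hx, hmin⟩ := (isCompact_Icc (a := a) (b := max a b)).exists_isMinOn
    ⟨a, le_rfl, le_max_left _ _⟩ hcU.continuousOn
  have hm : 0 < U x := pos x (ha0.trans_le hx.1)
  have p1 : 0 < 2 / u := by positivity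
  have p2 : 0 < 2 / UE := by positivity
  have p3 : 0 < 1 / U x := by positivity
  have p4 : 0 ≤ M1 * |b| := by positivity
  obtain ⟨M, hM⟩ : ∃ M, M = 1 + M1 + M2 + 2 / u + (UE + 1) + M1 * |b| + 1 / U x + 2 / UE := ⟨_, rfl⟩
  have hM0 : 0 < M := by linarith
  have hMy : ∀ y, 0 ≤ y → M1 * y ≤ M * y := fun y hy =>
    mul_le_mul_of_nonneg_right (by linarith) hy
  refine ⟨M, d0, d1, c2, z, by linarith, ?_, fun y hy => (b1' y hy).trans (hMy y hy), fun y hy => ?_,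
    fun y hy => ?_, fun y hy => (b1 y hy).trans (by linarith),
    fun y hy => (b2 y hy).trans (by linarith), fun y hy => (bu y hy).trans ?_⟩
  · have h : 2 / u * u = 2 := by field_simp
    have : 2 / u * u ≤ M * u := mul_le_mul_of_nonneg_right (by linarith) slope.le
    linarith
  · rcases le_total b y with h | h
    · exact (hb y h).2.trans (by linarith)
    · refine (b1' y hy).trans ?_
      have : M1 * y ≤ M1 * |b| := mul_le_mul_of_nonneg_left (h.trans (le_abs_self b)) hM1
      linarith
  · have one : 1 ≤ M * U y → y ≤ M * (1 + y) * U y := fun h => by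
      have := mul_le_mul_of_nonneg_right h (by linarith : 0 ≤ 1 + y)
      linarith
    rcases le_total y a with h | h
    · have h1 : u * y / 2 ≤ U y := by
        have h2 := (abs_le.1 (bl y hy)).1
        have h3 : M2 * y ≤ u / 2 := by
          calc M2 * y ≤ (M2 + 1) * a := mul_le_mul (by linarith) h hy (by positivity)
            _ = u / 2 := by rw [ha]; field_simp
        have := mul_le_mul_of_nonneg_right h3 hy
        linarith
      have h2 : y ≤ M * U y := by
        calc y = 2 / u * (u * y / 2) := by field_simp
          _ ≤ M * U y := mul_le_mul (by linarith) h1 (by positivity) hM0.le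
      have hU : 0 ≤ U y := le_trans (by positivity) h1
      have : 0 ≤ M * U y * y := by positivity
      linarith
    · rcases le_total b y with hby | hby
      · refine one ?_
        calc 1 = 2 / UE * (UE / 2) := by field_simp
          _ ≤ M * U y := mul_le_mul (by linarith) (hb y hby).1 (by positivity) hM0.le
      · refine one ?_
        have h1 : U x ≤ U y := hmin ⟨h, hby.trans (le_max_right _ _)⟩
        calc 1 = 1 / U x * U x := by field_simp
          _ ≤ M * U y := mul_le_mul (by linarith) h1 hm.le hM0.le
  · exact mul_le_mul_of_nonneg_right (by linarith) hy

/-- A shear profile extends to a flow on `ℝ`. -/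
theorem IsShearProfile.exists_flow {U : ℝ → ℝ} (hU : IsShearProfile U) :
    ∃ (V V1 V2 : ℝ → ℝ) (u M UE : ℝ), Flow V V1 V2 u M ∧ Tendsto V atTop (𝓝 UE) ∧
      (∀ y, 0 ≤ y → V y = U y) ∧ ∀ y, 0 ≤ y → V2 y = iteratedDerivWithin 2 U (Ici (0 : ℝ)) y := by
  have hs : UniqueDiffOn ℝ (Ici (0 : ℝ)) := uniqueDiffOn_Ici 0
  obtain ⟨D1, hD1⟩ : ∃ D1, D1 = iteratedDerivWithin 1 U (Ici (0 : ℝ)) := ⟨_, rfl⟩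
  obtain ⟨D2, hD2⟩ : ∃ D2, D2 = iteratedDerivWithin 2 U (Ici (0 : ℝ)) := ⟨_, rfl⟩
  have dU : ∀ y, 0 ≤ y → HasDerivWithinAt U (D1 y) (Ici 0) y := fun y hy => by
    rw [hD1, iteratedDerivWithin_one]
    exact (hU.contDiffOn.differentiableOn (by norm_num) y hy).hasDerivWithinAt
  have dD : ∀ y, 0 ≤ y → HasDerivWithinAt D1 (D2 y) (Ici 0) y := fun y hy => by
    have e : D2 y = derivWithin D1 (Ici 0) y := by rw [hD2, hD1, ← iteratedDerivWithin_succ]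
    rw [e, hD1]
    exact (hU.contDiffOn.differentiableOn_iteratedDerivWithin (m := 1) (by norm_cast) hs y
      hy).hasDerivWithinAt
  have cD2 : ContinuousOn D2 (Ici 0) := by
    rw [hD2]
    exact hU.contDiffOn.continuousOn_iteratedDerivWithin (by norm_cast) hs
  -- U'' is continued by its wall value to the left and integrated twice. This gives two-sided
  -- derivatives on ℝ without changing anything on [0, ∞).
  have cV2 : Continuous fun y => D2 (max y 0) :=
    cD2.comp_continuous (by fun_prop) fun y => le_max_right y 0
  have eV2 : ∀ y, 0 ≤ y → D2 (max y 0) = D2 y := fun y hy => by rw [max_eq_left hy]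
  obtain ⟨V1, dV1, V10, bV1⟩ := exists_primitive cV2 (D1 0)
  have cV1 : Continuous V1 := continuous_iff_continuousAt.2 fun y => (dV1 y).continuousAt
  obtain ⟨V, dV, V0, bV⟩ := exists_primitive cV1 0
  have eV1 : ∀ y, 0 ≤ y → V1 y = D1 y := fun y hy =>
    eqOn_of_hasDerivAt dV1 (fun y hy => by rw [eV2 y hy]; exact dD y hy) V10 hy
  have eV : ∀ y, 0 ≤ y → V y = U y := fun y hy =>
    eqOn_of_hasDerivAt dV (fun y hy => by rw [eV1 y hy]; exact dU y hy) (by rw [V0, hU.zero]) hy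
  obtain ⟨M1, hM1⟩ := hU.decay 1 (Or.inl rfl)
  obtain ⟨M2, hM2⟩ := hU.decay 2 (Or.inr rfl)
  rw [← hD1] at hM1
  rw [← hD2] at hM2
  obtain ⟨UE, hUE, lim⟩ := hU.lim
  have limV : Tendsto V atTop (𝓝 UE) :=
    lim.congr' ((eventually_ge_atTop 0).mono fun y hy => (eV y hy).symm)
  have b1 : ∀ y, 0 ≤ y → |V1 y| * (1 + y) ^ 3 ≤ M1 := fun y hy => by
    rw [eV1 y hy, mul_comm]; exact hM1 y hy
  have b2 : ∀ y, 0 ≤ y → |D2 (max y 0)| * (1 + y) ^ 3 ≤ M2 := fun y hy => by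
    rw [eV2 y hy, mul_comm]; exact hM2 y hy
  have b1' : ∀ y, 0 ≤ y → |V1 y| ≤ M1 := fun y hy =>
    (le_mul_of_one_le_right (abs_nonneg _) (one_le_pow₀ (by linarith))).trans (b1 y hy)
  have b2' : ∀ y, 0 ≤ y → |D2 (max y 0)| ≤ M2 := fun y hy =>
    (le_mul_of_one_le_right (abs_nonneg _) (one_le_pow₀ (by linarith))).trans (b2 y hy)
  have hM2 : 0 ≤ M2 := (abs_nonneg _).trans (b2' 0 le_rfl)
  have bu : ∀ y, 0 ≤ y → |V1 y - V1 0| ≤ M2 * y := fun y hy => by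
    rw [V10]; exact bV1 M2 y hy fun t ht _ => b2' t ht
  have bl : ∀ y, 0 ≤ y → |V y - V1 0 * y| ≤ M2 * y * y := fun y hy => by
    have hd : ∀ t, HasDerivAt (fun t => V t - V1 0 * t) (V1 t - V1 0) t := fun t => by
      exact ((dV t).sub ((hasDerivAt_id t).const_mul (V1 0))).congr_deriv (by simp)
    have h := (convex_Icc 0 y).norm_image_sub_le_of_norm_hasDerivWithin_le (C := M2 * y)
      (fun t _ => (hd t).hasDerivWithinAt)
      (fun t ht => (bu t ht.1).trans (mul_le_mul_of_nonneg_left ht.2 hM2))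
      (left_mem_Icc.2 hy) (right_mem_Icc.2 hy)
    simpa [V0, abs_of_nonneg hy] using h
  obtain ⟨M, hF⟩ := flow_bounds dV dV1 cV2 V0 (fun y hy => by rw [eV y hy.le]; exact hU.pos y hy)
    (by rw [V10, hD1]; exact hU.deriv_pos) hUE limV b1 b2
    (fun y hy => by
      have := bV M1 y hy fun t ht _ => b1' t ht
      rw [sub_zero] at this
      exact (le_abs_self _).trans this) bu bl
  exact ⟨V, V1, _, _, M, UE, hF, limV, eV, fun y hy => by rw [eV2 y hy, hD2]⟩

/-! ### Classical representatives of solutions -/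

section representative

variable {α : ℝ}

theorem hasDerivAt_primitive {g : ℝ → ℂ} (hg : Continuous g) (c : ℂ) (y : ℝ) :
    HasDerivAt (fun y => c + ∫ s in (0 : ℝ)..y, g s) (g y) y :=
  (intervalIntegral.integral_hasDerivAt_right (hg.intervalIntegrable _ _)
    (hg.stronglyMeasurableAtFilter _ _) hg.continuousAt).const_add c

theorem HasZeroTrace.eq_zero {u : L2} (h : HasZeroTrace u) {g : ℝ → ℂ} (hg : Continuous g)
    (hu : ⇑u =ᵐ[halfLine] g) : g 0 = 0 := by
  obtain ⟨w, hw, hu', h0⟩ := h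
  have e : g =ᵐ[volume.restrict (Ici (0 : ℝ))] w := by
    rw [Measure.restrict_congr_set Ioi_ae_eq_Ici.symm]
    exact hu.symm.trans hu'
  have := Measure.eqOn_of_ae_eq e hg.continuousOn hw (by
    rw [interior_Ici, closure_Ioi])
  rw [this self_mem_Ici, h0]

theorem IsWeakDeriv.helmholtz_eq {φ φ1 φ2 : L2} (h1 : IsWeakDeriv φ φ1) (h2 : IsWeakDeriv φ1 φ2) :
    helmholtz α φ = φ2 - ((α ^ 2 : ℝ) : ℂ) • φ := by
  rw [helmholtz, h1.weakDeriv_eq, h2.weakDeriv_eq]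
  congr 1

theorem IsWeakDeriv.sub_smul {u u' v v' : L2} (h : IsWeakDeriv u v) (h' : IsWeakDeriv u' v')
    (a : ℂ) : IsWeakDeriv (u - a • u') (v - a • v') := by
  rw [sub_eq_add_neg, sub_eq_add_neg, ← neg_smul, ← neg_smul]
  exact h.add (h'.const_smul _)

theorem coeFn_sub_smul (u v : L2) (a : ℝ) :
    ⇑(u - (a : ℂ) • v) =ᵐ[halfLine] fun y => u y - a • v y := by
  filter_upwards [Lp.coeFn_sub u ((a : ℂ) • v), Lp.coeFn_smul (a : ℂ) v] with y h1 h2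
  rw [h1, Pi.sub_apply, h2, Pi.smul_apply, Complex.coe_smul]

/-- Solutions have classical representatives. -/
theorem IsOSSolution.exists_wave {U V V2 : ℝ → ℝ} {ε : ℝ} {f : ℝ → ℂ} {φ : L2}
    (h : IsOSSolution U ε α f φ) (eV : ∀ y, 0 ≤ y → V y = U y)
    (eV2 : ∀ y, 0 ≤ y → V2 y = iteratedDerivWithin 2 U (Ici (0 : ℝ)) y) :
    ∃ p q w w1 w2 : ℝ → ℂ, Wave α p q w w1 w2 ∧ OSEq V V2 ε α p w w2 f ∧
      ⇑φ =ᵐ[halfLine] p ∧ ⇑(weakDeriv φ) =ᵐ[halfLine] q ∧ ⇑(helmholtz α φ) =ᵐ[halfLine] w := by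
  obtain ⟨⟨φ1, h1, φ2, h2, φ3, h3, φ4, h4, -⟩, ⟨-, t0, t1⟩, heq⟩ := h
  rw [h1.weakDeriv_eq] at t1
  have e0 := h1.helmholtz_eq (α := α) h2
  have e1 : helmholtz α (helmholtz α φ) =
      (φ4 - ((α ^ 2 : ℝ) : ℂ) • φ2) - ((α ^ 2 : ℝ) : ℂ) • (φ2 - ((α ^ 2 : ℝ) : ℂ) • φ) := by
    rw [e0]
    exact (h3.sub_smul h1 _).helmholtz_eq (h4.sub_smul h2 _)
  obtain ⟨c3, hc3⟩ := h4.ae_eq_primitive (ae_eq_refl φ4)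
  have i4 : ∀ R, 0 ≤ R → IntervalIntegrable (fun y => φ4 y) volume 0 R := fun R hR =>
    intervalIntegrable_of_memLp_halfLine (Lp.memLp φ4) le_rfl hR
  -- The fourth derivative is only in L², so the third is continuous but no better; this is why
  -- `Wave` states its last relation in integral form. Using max y 0 makes the representative
  -- constant on the left.
  obtain ⟨P3, hP3⟩ : ∃ P3, P3 = fun y : ℝ => c3 + ∫ s in (0 : ℝ)..max y 0, φ4 s := ⟨_, rfl⟩
  have cP3 : Continuous P3 := by
    rw [hP3]
    exact continuous_const.add ((continuousOn_primitive i4).comp_continuous (by fun_prop)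
      fun y => le_max_right y 0)
  have a3 : ⇑φ3 =ᵐ[halfLine] P3 := by
    filter_upwards [hc3, ae_restrict_mem measurableSet_Ioi] with y hy hy0
    rw [hy, hP3]
    simp only [max_eq_left (mem_Ioi.1 hy0).le]
  obtain ⟨c2, a2⟩ := h3.ae_eq_primitive a3
  have dP2 := hasDerivAt_primitive cP3 c2
  obtain ⟨P2, hP2⟩ : ∃ P2, P2 = fun y : ℝ => c2 + ∫ s in (0 : ℝ)..y, P3 s := ⟨_, rfl⟩
  rw [← hP2] at a2 dP2
  have cP2 : Continuous P2 := continuous_iff_continuousAt.2 fun y => (dP2 y).continuousAt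
  obtain ⟨c1, a1⟩ := h2.ae_eq_primitive a2
  have dP1 := hasDerivAt_primitive cP2 c1
  obtain ⟨P1, hP1⟩ : ∃ P1, P1 = fun y : ℝ => c1 + ∫ s in (0 : ℝ)..y, P2 s := ⟨_, rfl⟩
  rw [← hP1] at a1 dP1
  have cP1 : Continuous P1 := continuous_iff_continuousAt.2 fun y => (dP1 y).continuousAt
  obtain ⟨c0, a0⟩ := h1.ae_eq_primitive a1
  have dP0 := hasDerivAt_primitive cP1 c0
  obtain ⟨P0, hP0⟩ : ∃ P0, P0 = fun y : ℝ => c0 + ∫ s in (0 : ℝ)..y, P1 s := ⟨_, rfl⟩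
  rw [← hP0] at a0 dP0
  have cP0 : Continuous P0 := continuous_iff_continuousAt.2 fun y => (dP0 y).continuousAt
  have m0 : MemLp P0 2 halfLine := (memLp_congr_ae a0).1 (Lp.memLp φ)
  have m1 : MemLp P1 2 halfLine := (memLp_congr_ae a1).1 (Lp.memLp φ1)
  have m2 : MemLp P2 2 halfLine := (memLp_congr_ae a2).1 (Lp.memLp φ2)
  have m3 : MemLp P3 2 halfLine := (memLp_congr_ae a3).1 (Lp.memLp φ3)
  have aw : ⇑(helmholtz α φ) =ᵐ[halfLine] fun y => P2 y - (α ^ 2) • P0 y := by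
    rw [e0]
    filter_upwards [coeFn_sub_smul φ2 φ (α ^ 2), a2, a0] with y hy e2 e0
    rw [hy, e2, e0]
  refine ⟨P0, P1, fun y => P2 y - (α ^ 2) • P0 y, fun y => P3 y - (α ^ 2) • P1 y,
    fun y => φ4 y - (α ^ 2) • P2 y, ⟨dP0, fun y => ?_, fun y => (dP2 y).sub ((dP0 y).const_smul (α ^ 2)),
      cP3.sub (cP1.const_smul (α ^ 2)), fun y hy => ?_, t0.eq_zero cP0 a0, t1.eq_zero cP1 a1, m0, m1,
      m2.sub (m0.const_smul (α ^ 2)), m3.sub (m1.const_smul (α ^ 2)),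
      (Lp.memLp φ4).sub (m2.const_smul (α ^ 2))⟩, ?_, a0, h1.weakDeriv_eq ▸ a1, aw⟩
  · simpa using dP1 y
  · have j2 : IntervalIntegrable (fun t => (α ^ 2) • P2 t) volume 0 y :=
      (cP2.const_smul (α ^ 2)).intervalIntegrable _ _
    rw [intervalIntegral.integral_sub (i4 y hy) j2, intervalIntegral.integral_smul,
      hP3, hP1]
    simp only [max_eq_left hy, max_self, intervalIntegral.integral_same, add_zero, smul_add]
    abel
  · unfold OSEq
    have ah := coeFn_sub_smul (φ4 - ((α ^ 2 : ℝ) : ℂ) • φ2) (φ2 - ((α ^ 2 : ℝ) : ℂ) • φ) (α ^ 2)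
    filter_upwards [heq, aw, a0, a2, ah, coeFn_sub_smul φ4 φ2 (α ^ 2),
      coeFn_sub_smul φ2 φ (α ^ 2), ae_restrict_mem measurableSet_Ioi] with y g1 g2 g3 g4 g5 g6 g7 hy
    rw [e1, g5, g6, g7, g2, g3, g4] at g1
    rw [← g1, eV y (mem_Ioi.1 hy).le, eV2 y (mem_Ioi.1 hy).le]
    simp only [Complex.real_smul]
    ring

end representative

end OrrSommerfeld

/-! ### Uniqueness and a priori estimates for solutions -/

namespace OrrSommerfeld

section apriori

variable {α k M u : ℝ} {U U1 U2 : ℝ → ℝ} {p q w w1 w2 p' q' w' w1' w2' f f' : ℝ → ℂ}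

theorem norm_eq_l2norm {φ : L2} (h : ⇑φ =ᵐ[halfLine] p) : ‖φ‖ = l2norm p := by
  have h1 : ‖φ‖ ^ 2 = sqInt p := by
    have h2 := inner_self_eq_norm_sq (𝕜 := ℂ) φ
    rw [← h2, L2.inner_def, sqInt, ← integral_re (L2.integrable_inner φ φ)]
    refine integral_congr_ae ?_
    filter_upwards [h] with y hy
    rw [inner_self_eq_norm_sq, hy]
  rw [l2norm_eq, ← h1, Real.sqrt_sq (norm_nonneg _)]

theorem Wave.sub (h : Wave α p q w w1 w2) (h' : Wave α p' q' w' w1' w2') :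
    Wave α (fun y => p y - p' y) (fun y => q y - q' y) (fun y => w y - w' y)
      (fun y => w1 y - w1' y) (fun y => w2 y - w2' y) where
  d0 y := (h.d0 y).sub (h'.d0 y)
  d1 y := ((h.d1 y).sub (h'.d1 y)).congr_deriv (by rw [smul_sub]; abel)
  d2 y := (h.d2 y).sub (h'.d2 y)
  c3 := h.c3.sub h'.c3
  i3 y hy := by
    rw [h.i3 y hy, h'.i3 y hy, intervalIntegral.integral_sub
      (intervalIntegrable_of_memLp_halfLine h.m4 le_rfl hy)
      (intervalIntegrable_of_memLp_halfLine h'.m4 le_rfl hy)]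
    abel
  z0 := by simp only [h.z0, h'.z0, sub_zero]
  z1 := by simp only [h.z1, h'.z1, sub_zero]
  m0 := h.m0.sub h'.m0
  m1 := h.m1.sub h'.m1
  m2 := h.m2.sub h'.m2
  m3 := h.m3.sub h'.m3
  m4 := h.m4.sub h'.m4

theorem OSEq.sub {ε : ℝ} (h : OSEq U U2 ε α p w w2 f) (h' : OSEq U U2 ε α p' w' w2' f) :
    OSEq U U2 ε α (fun y => p y - p' y) (fun y => w y - w' y) (fun y => w2 y - w2' y)
      (fun _ => 0) := by
  unfold OSEq at *
  filter_upwards [h, h'] with y e e'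
  have e0 : (0 : ℂ) = f y - f y := (sub_self _).symm
  rw [e0]
  nth_rewrite 1 [e]
  rw [e']
  simp only [Complex.real_smul]
  ring

/-- Estimates for wave numbers `α ≥ 1`. -/
theorem estimates_large {M : ℝ} (hM : 1 ≤ M) : ∃ C, 1 ≤ C ∧ ∃ δ, 0 < δ ∧ δ ≤ 1 ∧
    ∀ {U U1 U2 : ℝ → ℝ} {u σ α : ℝ} {p q w w1 w2 f : ℝ → ℂ},
    Sol U U1 U2 u M (σ ^ 2) α p q w w1 w2 f → 0 < σ → σ ≤ δ → σ ^ 2 * α ≤ δ → 1 ≤ α →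
    l2norm q + α * l2norm p ≤ C * l2norm f ∧ l2norm w ≤ C / σ ^ 2 * l2norm f := by
  obtain ⟨C, hC, δ, δ0, δ1, h⟩ := energy_bound_large hM
  refine ⟨2 * C, by linarith, δ, δ0, δ1, fun {U U1 U2 u σ α p q w w1 w2 f} S σ0 hσ hσα hα => ?_⟩
  obtain ⟨hE, hq⟩ := h S σ0 hσ hσα hα
  have hn := l2norm_nonneg f
  obtain ⟨e0, -, e2, e3, -⟩ := energy_parts (k := σ ^ 2) (by positivity) U U1 α p q w
  have hp : α * l2norm p ≤ C * l2norm f := by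
    refine le_trans (Real.le_sqrt_of_sq_le ?_) hE
    rwa [mul_pow, l2norm_sq]
  have hw : σ ^ 2 * l2norm w ≤ C * l2norm f := by
    refine le_trans (Real.le_sqrt_of_sq_le ?_) hE
    rwa [mul_pow, l2norm_sq]
  refine ⟨by linarith, ?_⟩
  rw [div_mul_eq_mul_div, le_div_iff₀ (by positivity), mul_comm]
  nlinarith [mul_nonneg (zero_le_one.trans hC) hn]

/-- Waves without forcing vanish. -/
theorem unique_of_energy {M : ℝ} (hM : 1 ≤ M) : ∃ δ, 0 < δ ∧ δ ≤ 1 ∧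
    ∀ {U U1 U2 : ℝ → ℝ} {u σ α : ℝ} {p q w w1 w2 : ℝ → ℂ},
    Sol U U1 U2 u M (σ ^ 2) α p q w w1 w2 (fun _ => 0) → 0 < σ → σ ≤ δ → σ ^ 2 * α ≤ δ →
    sqInt p = 0 := by
  obtain ⟨C, hC, δ, δ0, δ1, h⟩ := energy_bound hM
  refine ⟨δ, δ0, δ1, fun {U U1 U2 u σ α p q w w1 w2} S σ0 hσ hσα => ?_⟩
  have h1 := h S σ0 hσ hσα
  have hα := S.a0
  obtain ⟨-, -, e2, -, -⟩ := energy_parts (k := σ ^ 2) (by positivity) U U1 α p q w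
  rw [energy] at e2
  have h2 := e2.trans h1
  simp only [inner_zero_left, integral_zero, abs_zero, sqInt, norm_zero, zero_pow two_ne_zero,
    add_zero, mul_zero] at h2
  refine le_antisymm ?_ (sqInt_nonneg p)
  by_contra hc
  push Not at hc
  have : 0 < α ^ 2 * sqInt p := by positivity
  exact absurd h2 (not_le.2 this)

theorem rpow_sixth {ε : ℝ} (hε : 0 < ε) : ∃ σ, 0 < σ ∧ ε ^ (1 / 6 : ℝ) = σ ∧
    ε ^ (1 / 3 : ℝ) = σ ^ 2 ∧ ε = (σ ^ 2) ^ 3 := by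
  refine ⟨ε ^ (1 / 6 : ℝ), Real.rpow_pos_of_pos hε _, rfl, ?_, ?_⟩
  · rw [← Real.rpow_natCast, ← Real.rpow_mul hε.le]
    norm_num
  · rw [← pow_mul, ← Real.rpow_natCast, ← Real.rpow_mul hε.le]
    norm_num

theorem weight_memLp_one (mf : MemLp f 2 halfLine)
    (mh : MemLp (fun y : ℝ => ((1 + y : ℝ) : ℂ) ^ 2 * f y) 2 halfLine) :
    MemLp (fun y : ℝ => ((1 + y : ℝ) : ℂ) * f y) 2 halfLine := by
  refine mh.mono ?_ ((ae_restrict_iff' measurableSet_Ioi).2 (Eventually.of_forall fun y hy => ?_))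
  · exact (Continuous.aestronglyMeasurable (by fun_prop)).mul mf.1
  · have hy0 : (0 : ℝ) < y := hy
    rw [norm_mul, norm_mul, norm_pow, Complex.norm_of_nonneg (by positivity)]
    exact mul_le_mul_of_nonneg_right (by nlinarith) (norm_nonneg _)

/-- Uniqueness and a priori estimates. -/
theorem IsShearProfile.a_priori {U : ℝ → ℝ} (hU : IsShearProfile U) :
    ∃ δ₀ : ℝ, 0 < δ₀ ∧ ∃ ε₀ : ℝ, 0 < ε₀ ∧ ∃ C : ℝ, 0 < C ∧
      ∀ ε α : ℝ, 0 < ε → ε ≤ ε₀ → 0 < α → ε ^ (1 / 3 : ℝ) * α ≤ δ₀ →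
      ∀ f : ℝ → ℂ, MemLp f 2 halfLine →
        (∀ φ φ' : L2, IsOSSolution U ε α f φ → IsOSSolution U ε α f φ' → φ = φ') ∧
        (MemLp (fun Y : ℝ => ((1 + Y : ℝ) : ℂ) ^ 2 * f Y) 2 halfLine →
        ∀ φ : L2, IsOSSolution U ε α f φ →
          (1 ≤ α →
            ‖weakDeriv φ‖ + α * ‖φ‖
              ≤ C * l2norm (fun Y : ℝ => ((1 + Y : ℝ) : ℂ) * f Y) ∧
            ‖helmholtz α φ‖
              ≤ C / ε ^ (1 / 3 : ℝ) * l2norm (fun Y : ℝ => ((1 + Y : ℝ) : ℂ) * f Y)) ∧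
          (α ≤ 1 →
            ‖weakDeriv φ‖ + α * ‖φ‖
              ≤ C * ((α + ε ^ (1 / 6 : ℝ)) / (α + ε ^ (1 / 3 : ℝ))) *
                (l2norm (fun Y : ℝ => ((1 + Y : ℝ) : ℂ) ^ 2 * f Y)
                  + 1 / α * ‖∫ Y in Ioi (0 : ℝ), f Y‖) ∧
            eLpNorm (weakDeriv φ) ∞ halfLine
              ≤ ENNReal.ofReal (C / ε ^ (1 / 6 : ℝ) *
                (l2norm (fun Y : ℝ => ((1 + Y : ℝ) : ℂ) ^ 2 * f Y)
                  + 1 / α * ‖∫ Y in Ioi (0 : ℝ), f Y‖)) ∧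
            ‖helmholtz α φ‖
              ≤ C / ε ^ (1 / 3 : ℝ) *
                (l2norm (fun Y : ℝ => ((1 + Y : ℝ) : ℂ) ^ 2 * f Y)
                  + 1 / α * ‖∫ Y in Ioi (0 : ℝ), f Y‖))) := by
  obtain ⟨V, V1, V2, u, M, UE, F, -, eV, eV2⟩ := hU.exists_flow
  have hM := F.one_le
  obtain ⟨δ1, δ1p, δ1l, huniq⟩ := unique_of_energy hM
  obtain ⟨C2, hC2, δ2, δ2p, -, hlarge⟩ := estimates_large hM
  obtain ⟨C3, hC3, δ3, δ3p, -, hsmall⟩ := estimates_small hM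
  obtain ⟨δ, hδ⟩ : ∃ δ, δ = min δ1 (min δ2 δ3) := ⟨_, rfl⟩
  have δp : 0 < δ := by rw [hδ]; exact lt_min δ1p (lt_min δ2p δ3p)
  have le1 : δ ≤ δ1 := by rw [hδ]; exact min_le_left _ _
  have le2 : δ ≤ δ2 := by rw [hδ]; exact (min_le_right _ _).trans (min_le_left _ _)
  have le3 : δ ≤ δ3 := by rw [hδ]; exact (min_le_right _ _).trans (min_le_right _ _)
  have C20 : 0 < C2 := by linarith
  have C30 : 0 < C3 := by linarith
  -- The threshold δ⁶ for ε is exactly σ = ε^{1/6} ≤ δ, and σ²α = ε^{1/3}α ≤ δ is the hypothesis on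
  -- α.
  refine ⟨δ, δp, (δ ^ 2) ^ 3, by positivity, C2 + C3, by linarith,
    fun ε α hε hε0 hα hεα f mf => ?_⟩
  obtain ⟨σ, σ0, e6, e3, eε⟩ := rpow_sixth hε
  rw [e3] at hεα
  simp only [e6, e3]
  have hσ : σ ≤ δ := by
    rw [eε, ← pow_mul, ← pow_mul] at hε0
    exact (pow_le_pow_iff_left₀ σ0.le δp.le (by norm_num)).1 hε0
  have k1 : σ ^ 2 ≤ 1 := pow_le_one₀ σ0.le (by linarith)
  have mkSol : ∀ {p q w w1 w2 g : ℝ → ℂ}, Wave α p q w w1 w2 → OSEq V V2 ε α p w w2 g →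
      MemLp g 2 halfLine → Sol V V1 V2 u M (σ ^ 2) α p q w w1 w2 g :=
    fun W E mg => ⟨F, W, eε ▸ E, mg, by positivity, k1, hα, by linarith⟩
  refine ⟨fun φ φ' h h' => ?_, fun mh φ h => ?_⟩
  · obtain ⟨p, q, w, w1, w2, W, E, ep, -, -⟩ := h.exists_wave eV eV2
    obtain ⟨p', q', w', w1', w2', W', E', ep', -, -⟩ := h'.exists_wave eV eV2
    have h0 := huniq (mkSol (W.sub W') (E.sub E') MemLp.zero') σ0 (hσ.trans le1) (hεα.trans le1)
    have e : ⇑(φ - φ') =ᵐ[halfLine] fun y => p y - p' y := by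
      filter_upwards [Lp.coeFn_sub φ φ', ep, ep'] with y h1 h2 h3
      rw [h1, Pi.sub_apply, h2, h3]
    have h1 := norm_eq_l2norm e
    rw [l2norm_eq, h0, Real.sqrt_zero, norm_eq_zero] at h1
    exact sub_eq_zero.1 h1
  · obtain ⟨p, q, w, w1, w2, W, E, ep, eq, ew⟩ := h.exists_wave eV eV2
    have S := mkSol W E mf
    rw [norm_eq_l2norm ep, norm_eq_l2norm eq, norm_eq_l2norm ew]
    refine ⟨fun h1 => ?_, fun h1 => ?_⟩
    · have mh1 := weight_memLp_one mf mh
      obtain ⟨r1, r2⟩ := hlarge S σ0 (hσ.trans le2) (hεα.trans le2) h1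
      -- For α ≥ 1 the energy argument needs only ‖f‖, which is weaker than the weighted norm in the
      -- statement.
      have hle : l2norm f ≤ l2norm fun y : ℝ => ((1 + y : ℝ) : ℂ) * f y := by
        have h := l2norm_mono (f := f) mh1 zero_le_one fun y hy => ?_
        · rwa [one_mul] at h
        · rw [one_mul, norm_mul, Complex.norm_of_nonneg (by positivity)]
          exact le_mul_of_one_le_left (norm_nonneg _) (by linarith)
      refine ⟨r1.trans (mul_le_mul (by linarith) hle (l2norm_nonneg _) (by linarith)),
        r2.trans (mul_le_mul ?_ hle (l2norm_nonneg _) (by positivity))⟩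
      exact div_le_div_of_nonneg_right (by linarith) (by positivity)
    · have ew2 : (fun y : ℝ => ((1 + y : ℝ) : ℂ) ^ 2 * f y) = fun y => ((1 + y) ^ 2) • f y := by
        funext y
        rw [Complex.real_smul]
        push_cast
        rfl
      rw [ew2] at mh ⊢
      obtain ⟨N, hN⟩ : ∃ N, N = l2norm (fun y => ((1 + y) ^ 2) • f y) +
        1 / α * ‖∫ Y in Ioi (0 : ℝ), f Y‖ := ⟨_, rfl⟩
      have n1 := l2norm_nonneg fun y => ((1 + y) ^ 2) • f y
      have n2 : 0 ≤ 1 / α * ‖∫ Y in Ioi (0 : ℝ), f Y‖ := by positivity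
      have hI : ‖∫ y in Ioi (0 : ℝ), f y‖ ≤ α * N := by
        rw [hN, mul_add, ← mul_assoc, mul_one_div_cancel hα.ne', one_mul]
        exact le_add_of_nonneg_left (mul_nonneg hα.le n1)
      obtain ⟨r1, r2, r3⟩ := hsmall (N := N) S σ0 (hσ.trans le3) (hεα.trans le3) h1 mh
        (by linarith) hI
      rw [← hN]
      have hN0 : 0 ≤ N := by linarith
      refine ⟨r1.trans ?_, ?_, r3.trans ?_⟩
      · exact mul_le_mul_of_nonneg_right (mul_le_mul_of_nonneg_right (by linarith)
          (by positivity)) hN0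
      · rw [eLpNorm_exponent_top, eLpNormEssSup_congr_ae eq]
        refine eLpNormEssSup_le_of_ae_bound
          ((ae_restrict_iff' measurableSet_Ioi).2 (Eventually.of_forall fun y hy => ?_))
        refine (r2 y hy).trans (mul_le_mul_of_nonneg_right ?_ hN0)
        exact div_le_div_of_nonneg_right (by linarith) σ0.le
      · exact mul_le_mul_of_nonneg_right
          (div_le_div_of_nonneg_right (by linarith) (by positivity)) hN0

end apriori

end OrrSommerfeld

/-! ### Compact operators and the Fredholm alternative -/

namespace OrrSommerfeld

section hilbertSchmidt

variable {E : Type*} [NormedAddCommGroup E] [InnerProductSpace ℂ E]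

theorem isCompactOperator_smulRight (a b : E) :
    IsCompactOperator ((innerSL ℂ a).smulRight b : E →L[ℂ] E) := by
  have h : IsCompactOperator (innerSL ℂ a : E →L[ℂ] ℂ) :=
    isCompactOperator_of_locallyCompactSpace_dom (innerSL ℂ a)
  exact h.clm_comp (ContinuousLinearMap.toSpanSingleton ℂ b)

variable [CompleteSpace E]

/-- Hilbert–Schmidt operators are compact. -/
theorem isCompactOperator_of_sum_norm_sq_le (T : E →L[ℂ] E) (C : ℝ)
    (h : ∀ (S : Set E) (v : S → E), Orthonormal ℂ v → ∀ s : Finset S, ∑ i ∈ s, ‖T (v i)‖ ^ 2 ≤ C) :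
    IsCompactOperator T := by
  classical
  obtain ⟨S, b, -⟩ := exists_hilbertBasis ℂ E
  have hs : Summable fun i => ‖T (b i)‖ ^ 2 :=
    summable_of_sum_le (fun i => by positivity) (h S b b.orthonormal)
  -- Finite-rank truncations along a Hilbert basis. By Cauchy–Schwarz and Bessel the error in
  -- operator norm is at most the square root of a tail of Σ‖T bᵢ‖².
  let F : Finset S → E →L[ℂ] E := fun s => ∑ i ∈ s, (innerSL ℂ (b i)).smulRight (T (b i))
  have Fx : ∀ s x, F s x = ∑ i ∈ s, inner ℂ (b i) x • T (b i) := fun s x => by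
    simp [F]
  refine isCompactOperator_of_tendsto (l := atTop) (F := F) ?_ (Eventually.of_forall fun s => ?_)
  · rw [Metric.tendsto_nhds]
    intro η hη
    obtain ⟨s, hs⟩ := summable_iff_vanishing_norm.1 hs ((η / 2) ^ 2) (by positivity)
    filter_upwards [eventually_ge_atTop s] with s' hs'
    rw [dist_comm, dist_eq_norm]
    refine lt_of_le_of_lt (ContinuousLinearMap.opNorm_le_bound _ (by positivity) fun x => ?_)
      (half_lt_self hη)
    have hlim : Tendsto (fun t => ‖F t x - F s' x‖) atTop (𝓝 ‖(T - F s') x‖) := by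
      have h1 : HasSum (fun i => inner ℂ (b i) x • T (b i)) (T x) := by
        have := (b.hasSum_repr x).mapL T
        simpa only [map_smul, b.repr_apply_apply] using this
      have h2 : Tendsto (fun t => F t x) atTop (𝓝 (T x)) := by
        simp only [Fx]
        exact h1
      exact (h2.sub_const _).norm
    refine le_of_tendsto hlim ?_
    filter_upwards [eventually_ge_atTop s'] with t ht
    rw [Fx, Fx, ← Finset.sum_sdiff ht, add_sub_cancel_right]
    have d : Disjoint (t \ s') s := (Finset.sdiff_disjoint).mono_right hs'
    have h1 := hs _ d
    rw [Real.norm_of_nonneg (Finset.sum_nonneg fun i _ => by positivity)] at h1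
    have h2 := b.orthonormal.sum_inner_products_le (s := t \ s') x
    calc ‖∑ i ∈ t \ s', inner ℂ (b i) x • T (b i)‖
        ≤ ∑ i ∈ t \ s', ‖inner ℂ (b i) x‖ * ‖T (b i)‖ :=
          (norm_sum_le _ _).trans (Finset.sum_le_sum fun i _ => (norm_smul _ _).le)
      _ ≤ Real.sqrt (∑ i ∈ t \ s', ‖inner ℂ (b i) x‖ ^ 2) *
          Real.sqrt (∑ i ∈ t \ s', ‖T (b i)‖ ^ 2) := Real.sum_mul_le_sqrt_mul_sqrt _ _ _
      _ ≤ ‖x‖ * (η / 2) := by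
          refine mul_le_mul (Real.sqrt_le_iff.2 ⟨norm_nonneg _, h2⟩)
            (Real.sqrt_le_iff.2 ⟨by positivity, h1.le⟩) (Real.sqrt_nonneg _) (norm_nonneg _)
      _ = η / 2 * ‖x‖ := mul_comm _ _
  · induction s using Finset.induction_on with
    | empty => simpa [F] using isCompactOperator_zero
    | insert i s hi ih =>
      have : F (insert i s) = (innerSL ℂ (b i)).smulRight (T (b i)) + F s :=
        Finset.sum_insert hi
      rw [this]
      exact (isCompactOperator_smulRight _ _).add ih

/-- The Fredholm alternative for compact perturbations of invertible operators. -/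
theorem surjective_of_compact_perturbation (A K : E →L[ℂ] E) (hA : IsUnit A)
    (hK : IsCompactOperator K) (h : ∀ x, (A + K) x = 0 → x = 0) :
    Function.Surjective (A + K) := by
  obtain ⟨A, rfl⟩ := hA
  have hc : IsCompactOperator ((↑A⁻¹ : E →L[ℂ] E) * K) := hK.clm_comp (↑A⁻¹ : E →L[ℂ] E)
  have e1 : (↑A : E →L[ℂ] E) * ((↑A⁻¹ : E →L[ℂ] E) * K) = K := by
    rw [← mul_assoc, Units.mul_inv, one_mul]
  -- A + K = A(1 + A⁻¹K). For the compact operator A⁻¹K the number -1 is either an eigenvalue,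
  -- excluded by injectivity, or in the resolvent set, which makes 1 + A⁻¹K invertible.
  rcases hc.hasEigenvalue_or_mem_resolventSet (neg_ne_zero.2 one_ne_zero : (-1 : ℂ) ≠ 0) with h1 | h1
  · obtain ⟨x, hx⟩ := h1.exists_hasEigenvector
    refine absurd (h x ?_) hx.2
    have h2 : ((↑A⁻¹ : E →L[ℂ] E) * K) x = (-1 : ℂ) • x := hx.apply_eq_smul
    have h3 : K x = (↑A : E →L[ℂ] E) ((-1 : ℂ) • x) := by
      rw [← h2, ← mul_apply_eq_comp, e1]
    rw [add_apply, h3, neg_smul, one_smul, map_neg, add_neg_cancel]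
  · obtain ⟨B, hB⟩ := h1
    intro y
    refine ⟨-(((↑B⁻¹ : E →L[ℂ] E) * (↑A⁻¹ : E →L[ℂ] E)) y), ?_⟩
    have e2 : (↑A : E →L[ℂ] E) + K = -((↑A : E →L[ℂ] E) * (↑B : E →L[ℂ] E)) := by
      rw [hB, mul_sub, e1, map_neg, map_one, mul_neg, mul_one]
      abel
    rw [e2, map_neg, neg_apply, neg_neg, ← mul_apply_eq_comp]
    have e3 : (↑A : E →L[ℂ] E) * (↑B : E →L[ℂ] E) *
        ((↑B⁻¹ : E →L[ℂ] E) * (↑A⁻¹ : E →L[ℂ] E)) = 1 := by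
      rw [mul_assoc, ← mul_assoc (↑B : E →L[ℂ] E), Units.mul_inv, one_mul, Units.mul_inv]
    rw [e3, one_apply_eq_self]

/-- A self-adjoint operator times a projection, shifted off the real axis, is invertible. -/
theorem isUnit_smul_one_add (P G : E →L[ℂ] E) (hP : IsSelfAdjoint P) (hPP : P * P = P)
    (hG : IsSelfAdjoint G) {ε c : ℝ} (hε : 0 < ε) :
    IsUnit (((ε : ℂ) * Complex.I) • (1 : E →L[ℂ] E) + (c : ℂ) • (P * G)) := by
  have hz : -((ε : ℂ) * Complex.I) ≠ 0 := neg_ne_zero.2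
    (mul_ne_zero (Complex.ofReal_ne_zero.2 hε.ne') Complex.I_ne_zero)
  -- PG is not self-adjoint but PGP is. Since P·(PG) = PG and (PG)·P = PGP have the same nonzero
  -- spectrum, the nonzero spectrum of PG is real, and -iε avoids it.
  have hself : IsSelfAdjoint ((c : ℂ) • (P * G) * P) := by
    rw [isSelfAdjoint_iff, star_mul, star_smul, star_mul, hP.star_eq, hG.star_eq,
      smul_mul_assoc, mul_smul_comm, mul_assoc]
    congr 1
    exact Complex.conj_ofReal c
  have h1 : -((ε : ℂ) * Complex.I) ∉ spectrum ℂ ((c : ℂ) • (P * G) * P) := fun hm => by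
    have := hself.im_eq_zero_of_mem_spectrum hm
    simp at this
    exact hε.ne' this
  have h2 : -((ε : ℂ) * Complex.I) ∉ spectrum ℂ (P * ((c : ℂ) • (P * G))) := fun hm => by
    have h3 : -((ε : ℂ) * Complex.I) ∈ spectrum ℂ ((c : ℂ) • (P * G) * P) \ {0} := by
      rw [spectrum.nonzero_mul_comm]
      exact ⟨hm, hz⟩
    exact h1 h3.1
  rw [spectrum.notMem_iff, mul_smul_comm, ← mul_assoc, hPP, map_neg, Algebra.algebraMap_eq_smul_one,
    ← neg_add', IsUnit.neg_iff] at h2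
  exact h2

end hilbertSchmidt

/-! ### The Volterra operator inverting ∂ + α -/

section volterra

variable {α : ℝ} {h : ℝ → ℂ}

/-- Multiplication by a bounded continuous function. -/
theorem exists_mulOp {m : ℝ → ℝ} {B : ℝ} (hm : ContinuousOn m (Ioi 0))
    (hB : ∀ y, 0 < y → |m y| ≤ B) :
    ∃ T : L2 →L[ℂ] L2, ∀ u, ⇑(T u) =ᵐ[halfLine] fun y => m y • u y := by
  have hmem : ∀ u : L2, MemLp (fun y => m y • u y) 2 halfLine := fun u =>
    memLp_smul_of_bound hm hB (Lp.memLp u)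
  have hc : ∀ u : L2, ⇑((hmem u).toLp _) =ᵐ[halfLine] fun y => m y • u y := fun u =>
    (hmem u).coeFn_toLp
  refine ⟨LinearMap.mkContinuous ⟨⟨fun u => (hmem u).toLp _, fun u v => ?_⟩, fun a u => ?_⟩ B
    fun u => ?_, fun u => hc u⟩
  · refine Lp.ext ?_
    filter_upwards [hc (u + v), Lp.coeFn_add u v, Lp.coeFn_add ((hmem u).toLp _) ((hmem v).toLp _),
      hc u, hc v] with y h1 h2 h3 h4 h5
    rw [h1, h2, h3, Pi.add_apply, Pi.add_apply, h4, h5, smul_add]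
  · refine Lp.ext ?_
    filter_upwards [hc (a • u), Lp.coeFn_smul a u, Lp.coeFn_smul a ((hmem u).toLp _),
      hc u] with y h1 h2 h3 h4
    rw [RingHom.id_apply, h1, h2, h3, Pi.smul_apply, Pi.smul_apply, h4, smul_comm]
  · refine Lp.norm_le_mul_norm_of_ae_le_mul ?_
    filter_upwards [hc u, ae_restrict_mem measurableSet_Ioi] with y h1 hy
    change ‖((hmem u).toLp _ : ℝ → ℂ) y‖ ≤ _
    rw [h1, norm_smul, Real.norm_eq_abs]
    exact mul_le_mul_of_nonneg_right (hB y hy) (norm_nonneg _)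

/-- The primitive of `h` with respect to `∂ + α` that vanishes at the wall. -/
noncomputable def volterra (α : ℝ) (h : ℝ → ℂ) (y : ℝ) : ℂ :=
  Real.exp (-α * y) • ∫ s in (0 : ℝ)..y, Real.exp (α * s) • h s

theorem integral_exp_le (hα : 0 < α) (y : ℝ) :
    Real.exp (-α * y) * ∫ s in (0 : ℝ)..y, Real.exp (α * s) ≤ 1 / α := by
  have h1 : ∫ s in (0 : ℝ)..y, Real.exp (α * s) = Real.exp (α * y) / α - 1 / α := by
    rw [intervalIntegral.integral_eq_sub_of_hasDerivAt (f := fun s => Real.exp (α * s) / α)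
      (fun s _ => ?_) (Continuous.intervalIntegrable (by fun_prop) _ _)]
    · simp
    · have := ((hasDerivAt_id s).const_mul α).exp.div_const α
      refine this.congr_deriv ?_
      simp only [id]
      field_simp
  rw [h1, mul_sub, ← mul_div_assoc, ← Real.exp_add]
  have : -α * y + α * y = 0 := by ring
  rw [this, Real.exp_zero]
  have : 0 ≤ Real.exp (-α * y) * (1 / α) := by positivity
  linarith

/-- Schur's test: the kernel is split as e^{αs/2}·e^{αs/2}, and the factor without h integrates to
at most 1/α. -/
theorem sq_norm_volterra_le (hα : 0 < α) (hh : MemLp h 2 halfLine) {y : ℝ} (hy : 0 ≤ y) :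
    ‖volterra α h y‖ ^ 2 ≤
      1 / α * (Real.exp (-α * y) * ∫ s in (0 : ℝ)..y, Real.exp (α * s) * ‖h s‖ ^ 2) := by
  have hsub : Ioc 0 y ⊆ Ioi 0 := fun s hs => hs.1
  have hmem : MemLp h 2 (volume.restrict (Ioc 0 y)) := halfLine_mono hh hsub
  have hcE : Continuous fun s : ℝ => Real.exp (α * s / 2) := by fun_prop
  have mE : MemLp (fun s : ℝ => Real.exp (α * s / 2)) 2 (volume.restrict (Ioc 0 y)) := by
    rw [memLp_two_iff_integrable_sq hcE.aestronglyMeasurable]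
    exact ((hcE.pow 2).integrableOn_Icc).mono_set Ioc_subset_Icc_self
  have mEh : MemLp (fun s : ℝ => Real.exp (α * s / 2) * ‖h s‖) 2 (volume.restrict (Ioc 0 y)) := by
    refine MemLp.of_le_mul (c := Real.exp (α * y / 2)) hmem
      (hcE.aestronglyMeasurable.mul hmem.1.norm)
      ((ae_restrict_iff' measurableSet_Ioc).2 (Eventually.of_forall fun s hs => ?_))
    rw [norm_mul, norm_norm, Real.norm_of_nonneg (Real.exp_pos _).le]
    refine mul_le_mul_of_nonneg_right (Real.exp_le_exp.2 ?_) (norm_nonneg _)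
    have := mul_le_mul_of_nonneg_left hs.2 hα.le
    linarith
  have h1 := sq_integral_mul_le mE mEh
  have e1 : ∀ s : ℝ, Real.exp (α * s / 2) ^ 2 = Real.exp (α * s) := fun s => by
    rw [← Real.exp_nat_mul]
    congr 1
    push_cast
    ring
  have e2 : ∀ s : ℝ, Real.exp (α * s / 2) * (Real.exp (α * s / 2) * ‖h s‖) =
      Real.exp (α * s) * ‖h s‖ := fun s => by
    rw [← mul_assoc, ← sq, e1]
  simp only [mul_pow, e1, e2, ← intervalIntegral.integral_of_le hy] at h1
  have h2 : ‖∫ s in (0 : ℝ)..y, Real.exp (α * s) • h s‖ ≤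
      ∫ s in (0 : ℝ)..y, Real.exp (α * s) * ‖h s‖ := by
    refine (intervalIntegral.norm_integral_le_integral_norm hy).trans (le_of_eq ?_)
    simp only [norm_smul, Real.norm_of_nonneg (Real.exp_pos _).le]
  have h3 := pow_le_pow_left₀ (norm_nonneg _) h2 2
  have h4 := integral_exp_le hα y
  have h5 : 0 ≤ Real.exp (-α * y) * ∫ s in (0 : ℝ)..y, Real.exp (α * s) * ‖h s‖ ^ 2 :=
    mul_nonneg (Real.exp_pos _).le
      (intervalIntegral.integral_nonneg hy fun s _ => by positivity)
  rw [volterra, norm_smul, mul_pow, Real.norm_of_nonneg (Real.exp_pos _).le]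
  calc _ ≤ Real.exp (-α * y) ^ 2 * ((∫ s in (0 : ℝ)..y, Real.exp (α * s)) *
        ∫ s in (0 : ℝ)..y, Real.exp (α * s) * ‖h s‖ ^ 2) :=
        mul_le_mul_of_nonneg_left (h3.trans h1) (sq_nonneg _)
    _ = (Real.exp (-α * y) * ∫ s in (0 : ℝ)..y, Real.exp (α * s)) *
        (Real.exp (-α * y) * ∫ s in (0 : ℝ)..y, Real.exp (α * s) * ‖h s‖ ^ 2) := by ring
    _ ≤ _ := mul_le_mul_of_nonneg_right h4 h5

theorem intervalIntegrable_exp_smul (hh : MemLp h 2 halfLine) {R : ℝ} (hR : 0 ≤ R) :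
    IntervalIntegrable (fun s => Real.exp (α * s) • h s) volume 0 R :=
  (intervalIntegrable_of_memLp_halfLine hh le_rfl hR).continuousOn_smul
    (Continuous.continuousOn (by fun_prop))

theorem continuousOn_volterra (hh : MemLp h 2 halfLine) :
    ContinuousOn (volterra α h) (Ici 0) :=
  (Continuous.continuousOn (f := fun y => Real.exp (-α * y)) (by fun_prop)).smul
    (continuousOn_primitive fun _ hR => intervalIntegrable_exp_smul hh hR)

/-- The pointwise bound is integrated over [0, R]. Integration by parts against -e^{-αy}/α replaces
Fubini and supplies the second factor 1/α; the boundary term at R has a good sign. -/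
theorem memLp_volterra (hα : 0 < α) (hh : MemLp h 2 halfLine) :
    MemLp (volterra α h) 2 halfLine ∧ l2norm (volterra α h) ≤ 1 / α * l2norm h := by
  have hc := continuousOn_volterra (α := α) hh
  have hm : AEStronglyMeasurable (volterra α h) halfLine :=
    (hc.mono Ioi_subset_Ici_self).aestronglyMeasurable measurableSet_Ioi
  have ih : IntegrableOn (fun y => ‖h y‖ ^ 2) (Ioi 0) := integrable_norm_sq_of_memLp hh
  have hv : ∀ R, 0 ≤ R → IntervalIntegrable (fun s => Real.exp (α * s) * ‖h s‖ ^ 2) volume 0 R :=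
    fun R hR => ((intervalIntegrable_iff_integrableOn_Ioc_of_le hR).2
      (ih.mono_set fun s hs => hs.1)).continuousOn_mul (Continuous.continuousOn (by fun_prop))
  have hii : ∀ R, 0 ≤ R → IntervalIntegrable (fun y => ‖volterra α h y‖ ^ 2) volume 0 R :=
    fun R hR => ContinuousOn.intervalIntegrable (by
      rw [uIcc_of_le hR]
      exact (hc.mono Icc_subset_Ici_self).norm.pow 2)
  have key : ∀ R, 0 ≤ R → ∫ y in (0 : ℝ)..R, ‖volterra α h y‖ ^ 2 ≤ (1 / α) ^ 2 * sqInt h := by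
    intro R hR
    have h1 : ∫ y in (0 : ℝ)..R, ‖volterra α h y‖ ^ 2 ≤ ∫ y in (0 : ℝ)..R,
        1 / α * (Real.exp (-α * y) * ∫ s in (0 : ℝ)..y, Real.exp (α * s) * ‖h s‖ ^ 2) := by
      refine intervalIntegral.integral_mono_on hR (hii R hR) ?_
        fun y hy => sq_norm_volterra_le hα hh hy.1
      refine ContinuousOn.intervalIntegrable ?_
      refine continuousOn_const.mul (ContinuousOn.mul (Continuous.continuousOn (by fun_prop)) ?_)
      exact intervalIntegral.continuousOn_primitive_interval' (hv R hR) left_mem_uIcc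
    have hd : ∀ y, HasDerivAt (fun y => -(Real.exp (-α * y) / α)) (Real.exp (-α * y)) y := fun y => by
      have := (((hasDerivAt_id y).const_mul (-α)).exp.div_const α).neg
      refine this.congr_deriv ?_
      simp only [id]
      field_simp
    rw [intervalIntegral.integral_const_mul,
      integral_deriv_mul_primitive (hv R hR) hd (by fun_prop)] at h1
    have e : ∫ y in (0 : ℝ)..R, -(Real.exp (-α * y) / α) * (Real.exp (α * y) * ‖h y‖ ^ 2) =
        -(1 / α * ∫ y in (0 : ℝ)..R, ‖h y‖ ^ 2) := by
      rw [← intervalIntegral.integral_const_mul, ← intervalIntegral.integral_neg]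
      refine intervalIntegral.integral_congr fun y _ => ?_
      have e0 : Real.exp (-α * y) * Real.exp (α * y) = 1 := by
        rw [← Real.exp_add]
        simp
      linear_combination (-(1 / α) * ‖h y‖ ^ 2) * e0
    have h2 : 0 ≤ Real.exp (-α * R) / α * ∫ s in (0 : ℝ)..R, Real.exp (α * s) * ‖h s‖ ^ 2 :=
      mul_nonneg (by positivity) (intervalIntegral.integral_nonneg hR fun s _ => by positivity)
    have h3 : ∫ y in (0 : ℝ)..R, ‖h y‖ ^ 2 ≤ sqInt h := by
      rw [intervalIntegral.integral_of_le hR]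
      exact setIntegral_mono_set ih (Eventually.of_forall fun y => by positivity)
        (Eventually.of_forall fun s hs => hs.1)
    rw [e] at h1
    have h4 : (1 / α) ^ 2 * ∫ y in (0 : ℝ)..R, ‖h y‖ ^ 2 ≤ (1 / α) ^ 2 * sqInt h :=
      mul_le_mul_of_nonneg_left h3 (by positivity)
    have h5 : 0 ≤ 1 / α * (Real.exp (-α * R) / α *
      ∫ s in (0 : ℝ)..R, Real.exp (α * s) * ‖h s‖ ^ 2) := mul_nonneg (by positivity) h2
    linarith
  have hint : IntegrableOn (fun y => ‖volterra α h y‖ ^ 2) (Ioi 0) := by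
    refine integrableOn_Ioi_of_intervalIntegral_norm_bounded ((1 / α) ^ 2 * sqInt h) 0
      (b := fun R : ℝ => max R 0) (l := atTop)
      (fun R => (intervalIntegrable_iff_integrableOn_Ioc_of_le (le_max_right _ _)).1
        (hii _ (le_max_right _ _))) (tendsto_atTop_mono (fun R => le_max_left R 0) tendsto_id)
      (Eventually.of_forall fun R => ?_)
    have e : ∀ y, ‖‖volterra α h y‖ ^ 2‖ = ‖volterra α h y‖ ^ 2 := fun y =>
      Real.norm_of_nonneg (by positivity)
    change ∫ y in (0 : ℝ)..max R 0, ‖‖volterra α h y‖ ^ 2‖ ≤ _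
    simp only [e]
    exact key _ (le_max_right _ _)
  have mV : MemLp (volterra α h) 2 halfLine := (memLp_two_iff_integrable_sq_norm hm).2 hint
  refine ⟨mV, l2norm_le_of (mul_nonneg (by positivity) (l2norm_nonneg _)) ?_⟩
  rw [mul_pow, l2norm_sq]
  refine le_of_tendsto (intervalIntegral_tendsto_integral_Ioi 0 hint tendsto_id) ?_
  filter_upwards [eventually_ge_atTop 0] with R hR
  exact key R hR

end volterra

end OrrSommerfeld

/-! ### Boundary traces and the Green operator -/

namespace OrrSommerfeld

section green

variable {α : ℝ} {u v u' v' e : L2} {c c' : ℂ} {S : L2 →L[ℂ] L2} {η : ℝ → ℝ}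

/-- `u` has the weak derivative `v` and the boundary value `c`. -/
def HasTrace (u v : L2) (c : ℂ) : Prop :=
  ∀ η : ℝ → ℝ, ContDiff ℝ ∞ η → HasCompactSupport η →
    ∫ y in Ioi (0 : ℝ), deriv η y • u y = -(η 0 • c) - ∫ y in Ioi (0 : ℝ), η y • v y

theorem memLp_test (hη : Continuous η) (hs : HasCompactSupport η) :
    MemLp (fun y => (η y : ℂ)) 2 halfLine :=
  (hη.memLp_of_hasCompactSupport (μ := volume) hs).ofReal.restrict _

theorem integral_test_eq_inner {t : L2} (ht : ⇑t =ᵐ[halfLine] fun y => (η y : ℂ)) (u : L2) :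
    ∫ y in Ioi (0 : ℝ), η y • u y = inner ℂ t u := by
  rw [L2.inner_def]
  refine integral_congr_ae ?_
  filter_upwards [ht] with y hy
  rw [hy, RCLike.inner_apply, Complex.conj_ofReal, Complex.real_smul, mul_comm]

theorem exists_test (hη : ContDiff ℝ ∞ η) (hs : HasCompactSupport η) :
    ∃ t t' : L2, (⇑t =ᵐ[halfLine] fun y => (η y : ℂ)) ∧
      ⇑t' =ᵐ[halfLine] fun y => ((deriv η y : ℝ) : ℂ) :=
  ⟨(memLp_test hη.continuous hs).toLp _,
    (memLp_test (hη.continuous_deriv (by simp)) hs.deriv).toLp _, MemLp.coeFn_toLp _,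
    MemLp.coeFn_toLp _⟩

theorem HasTrace.add (h : HasTrace u v c) (h' : HasTrace u' v' c') :
    HasTrace (u + u') (v + v') (c + c') := fun η h1 h2 => by
  obtain ⟨t, t', ht, ht'⟩ := exists_test h1 h2
  have a := h η h1 h2
  have b := h' η h1 h2
  rw [integral_test_eq_inner ht, integral_test_eq_inner ht'] at *
  rw [inner_add_right, inner_add_right, a, b, smul_add]
  abel

theorem HasTrace.smul (h : HasTrace u v c) (a : ℂ) : HasTrace (a • u) (a • v) (a • c) :=
  fun η h1 h2 => by
  obtain ⟨t, t', ht, ht'⟩ := exists_test h1 h2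
  have b := h η h1 h2
  rw [integral_test_eq_inner ht, integral_test_eq_inner ht'] at *
  rw [inner_smul_right, inner_smul_right, b]
  simp only [Complex.real_smul, smul_eq_mul]
  ring

theorem HasTrace.isWeakDeriv (h : HasTrace u v c) : IsWeakDeriv u v := fun η h1 h2 h3 => by
  rw [h η h1 h2, image_zero_of_tsupport h3, zero_smul, neg_zero, zero_sub]

theorem HasTrace.hasZeroTrace (h : HasTrace u v 0) : HasZeroTrace u :=
  (hasZeroTrace_of_integral (v := v) fun η h1 h2 => by
    rw [h η h1 h2, smul_zero, neg_zero, zero_sub]).2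

theorem hasTrace_exp (he : ⇑e =ᵐ[halfLine] fun y => ((Real.exp (-α * y) : ℝ) : ℂ)) :
    HasTrace e ((-α : ℂ) • e) 1 := fun η h1 h2 => by
  have hd : ∀ y : ℝ, HasDerivAt (fun y => ((Real.exp (-α * y) : ℝ) : ℂ))
      ((-α : ℂ) • ((Real.exp (-α * y) : ℝ) : ℂ)) y := fun y => by
    have := ((hasDerivAt_id y).const_mul (-α)).exp.ofReal_comp
    refine this.congr_deriv ?_
    simp only [id, smul_eq_mul]
    push_cast
    ring
  refine isWeakDeriv_of_ae_eq_primitive (V := fun y => (-α : ℂ) • ((Real.exp (-α * y) : ℝ) : ℂ))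
    ?_ ?_ h1 h2
  · filter_upwards [Lp.coeFn_smul (-α : ℂ) e, he] with y h1 h2
    rw [h1, Pi.smul_apply, h2]
  · filter_upwards [he] with y hy
    rw [hy, intervalIntegral.integral_eq_sub_of_hasDerivAt (fun s _ => hd s)
      (Continuous.intervalIntegrable (by fun_prop) _ _)]
    simp

theorem volterra_congr {g g' : ℝ → ℂ} (hg : g =ᵐ[halfLine] g') {y : ℝ} (hy : 0 < y) :
    volterra α g y = volterra α g' y := by
  rw [volterra, volterra]
  congr 1
  rw [intervalIntegral.integral_of_le hy.le, intervalIntegral.integral_of_le hy.le]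
  have hg' : g =ᵐ[volume.restrict (Ioc 0 y)] g' :=
    ae_restrict_of_ae_restrict_of_subset (fun s hs => hs.1) hg
  refine integral_congr_ae ?_
  filter_upwards [hg'] with s hs
  rw [hs]

theorem exists_volterraOp (hα : 0 < α) :
    ∃ S : L2 →L[ℂ] L2, ∀ h, ⇑(S h) =ᵐ[halfLine] volterra α h := by
  have hmem : ∀ u : L2, MemLp (volterra α u) 2 halfLine := fun u =>
    (memLp_volterra hα (Lp.memLp u)).1
  have hc : ∀ u : L2, ⇑((hmem u).toLp _) =ᵐ[halfLine] volterra α u := fun u =>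
    (hmem u).coeFn_toLp
  refine ⟨LinearMap.mkContinuous ⟨⟨fun u => (hmem u).toLp _, fun u v => ?_⟩, fun a u => ?_⟩ (1 / α)
    fun u => ?_, fun u => hc u⟩
  · refine Lp.ext ?_
    filter_upwards [hc (u + v), Lp.coeFn_add ((hmem u).toLp _) ((hmem v).toLp _),
      hc u, hc v, ae_restrict_mem measurableSet_Ioi] with y h1 h3 h4 h5 hy
    rw [h1, h3, Pi.add_apply, h4, h5, volterra_congr (Lp.coeFn_add u v) hy, volterra, volterra, volterra,
      ← smul_add, ← intervalIntegral.integral_add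
        (intervalIntegrable_exp_smul (Lp.memLp u) (mem_Ioi.1 hy).le)
        (intervalIntegrable_exp_smul (Lp.memLp v) (mem_Ioi.1 hy).le)]
    simp only [Pi.add_apply, smul_add]
  · refine Lp.ext ?_
    filter_upwards [hc (a • u), Lp.coeFn_smul a ((hmem u).toLp _),
      hc u, ae_restrict_mem measurableSet_Ioi] with y h1 h3 h4 hy
    rw [RingHom.id_apply, h1, h3, Pi.smul_apply, h4, volterra_congr (Lp.coeFn_smul a u) hy, volterra,
      volterra]
    simp only [Pi.smul_apply, smul_comm _ a]
    rw [intervalIntegral.integral_smul, smul_comm]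
  · have h1 := (memLp_volterra hα (Lp.memLp u)).2
    rw [← norm_eq_l2norm (hc u), ← norm_eq_l2norm (ae_eq_refl u)] at h1
    exact h1

/-- Testing the primitive of e^{αs}h with e^{-αy}η expresses that v = Sh solves v' + αv = h with
v(0) = 0, for test functions η that need not vanish at the wall. -/
theorem hasTrace_volterra (hS : ∀ h, ⇑(S h) =ᵐ[halfLine] volterra α h) (h : L2) :
    HasTrace (S h) (h + (-α : ℂ) • S h) 0 := fun η h1 h2 => by
  obtain ⟨t, t', ht, ht'⟩ := exists_test h1 h2
  have hE : ContDiff ℝ ∞ fun y : ℝ => Real.exp (-α * y) := by fun_prop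
  have hd : ∀ y, deriv (fun y => Real.exp (-α * y) * η y) y =
      Real.exp (-α * y) * (deriv η y - α * η y) := fun y => by
    have := (((hasDerivAt_id y).const_mul (-α)).exp.mul
      ((h1.differentiable (by simp) y).hasDerivAt)).deriv
    refine Eq.trans this ?_
    simp only [id]
    ring
  have key := integral_deriv_smul_primitive_Ioi (hE.mul h1) h2.mul_left
    (fun R hR => intervalIntegrable_exp_smul (α := α) (Lp.memLp h) hR)
  have i1 : ∫ y in Ioi (0 : ℝ), deriv (fun y => Real.exp (-α * y) * η y) y •
      ∫ s in (0 : ℝ)..y, Real.exp (α * s) • h s =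
      inner ℂ t' (S h) - (α : ℂ) * inner ℂ t (S h) := by
    rw [← inner_smul_left_eq_mul, ← inner_sub_left, L2.inner_def]
    refine integral_congr_ae ?_
    filter_upwards [hS h, ht, ht', Lp.coeFn_sub t' ((α : ℂ) • t), Lp.coeFn_smul (α : ℂ) t]
      with y g1 g2 g3 g4 g5
    rw [hd, RCLike.inner_apply, g4, Pi.sub_apply, g5, Pi.smul_apply, g1, g2, g3, volterra]
    simp only [Complex.real_smul, smul_eq_mul, map_sub, map_mul, Complex.conj_ofReal]
    push_cast
    ring
  have i2 : ∫ y in Ioi (0 : ℝ), (Real.exp (-α * y) * η y) • Real.exp (α * y) • h y =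
      inner ℂ t h := by
    rw [← integral_test_eq_inner ht]
    refine integral_congr_ae (Eventually.of_forall fun y => ?_)
    have e0 : Real.exp (-α * y) * Real.exp (α * y) = 1 := by
      rw [← Real.exp_add]
      simp
    simp only [smul_smul]
    congr 1
    linear_combination (η y) * e0
  have key' : inner ℂ t' (S h) - (α : ℂ) * inner ℂ t (S h) = -inner ℂ t h :=
    i1.symm.trans (key.trans (congrArg Neg.neg i2))
  rw [integral_test_eq_inner ht, integral_test_eq_inner ht', inner_add_right, inner_smul_right,
    smul_zero]
  linear_combination key'
where
  inner_smul_left_eq_mul (a b : L2) : inner ℂ ((α : ℂ) • a) b = (α : ℂ) * inner ℂ a b := by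
    rw [inner_smul_left, Complex.conj_ofReal]

theorem volterra_deriv (hη : ContDiff ℝ ∞ η) (y : ℝ) :
    volterra α (fun y => ((deriv η y : ℝ) : ℂ)) y =
      (η y : ℂ) - (η 0 : ℂ) * ((Real.exp (-α * y) : ℝ) : ℂ) -
        (α : ℂ) * volterra α (fun y => (η y : ℂ)) y := by
  have hd : ∀ s : ℝ, HasDerivAt (fun s => ((Real.exp (α * s) * η s : ℝ) : ℂ))
      (Real.exp (α * s) • ((deriv η s : ℝ) : ℂ) + (α : ℂ) * Real.exp (α * s) • (η s : ℂ)) s := fun s => by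
    have := ((((hasDerivAt_id s).const_mul α).exp.mul
      ((hη.differentiable (by simp) s).hasDerivAt))).ofReal_comp
    refine this.congr_deriv ?_
    simp only [id, Complex.real_smul]
    push_cast
    ring
  have c0 := hη.continuous
  have c1 : Continuous (deriv η) := hη.continuous_deriv (by simp)
  have j1 : IntervalIntegrable (fun s => Real.exp (α * s) • ((deriv η s : ℝ) : ℂ)) volume 0 y :=
    Continuous.intervalIntegrable (by fun_prop) _ _
  have j2 : IntervalIntegrable (fun s => (α : ℂ) * Real.exp (α * s) • (η s : ℂ)) volume 0 y :=
    Continuous.intervalIntegrable (by fun_prop) _ _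
  have h1 := intervalIntegral.integral_eq_sub_of_hasDerivAt (a := 0) (b := y)
    (fun s _ => hd s) (j1.add j2)
  rw [intervalIntegral.integral_add j1 j2, intervalIntegral.integral_const_mul] at h1
  have e0 : ((Real.exp (-α * y) : ℝ) : ℂ) * ((Real.exp (α * y) : ℝ) : ℂ) = 1 := by
    rw [← Complex.ofReal_mul, ← Real.exp_add]
    simp
  rw [volterra, volterra]
  simp only [mul_zero, Real.exp_zero, one_mul, Complex.ofReal_mul] at h1
  rw [Complex.real_smul, Complex.real_smul]
  linear_combination ((Real.exp (-α * y) : ℝ) : ℂ) * h1 + (η y : ℂ) * e0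

/-- Obtained by duality: `volterra_deriv` computes S on η', where the value η(0) appears multiplied
by e^{-αy}. Transposition turns this term into the boundary value ⟨e, h⟩ of the adjoint. -/
theorem hasTrace_adjoint (hS : ∀ h, ⇑(S h) =ᵐ[halfLine] volterra α h)
    (he : ⇑e =ᵐ[halfLine] fun y => ((Real.exp (-α * y) : ℝ) : ℂ)) (h : L2) :
    HasTrace (star S h) ((α : ℂ) • star S h + (-1 : ℂ) • h) (inner ℂ e h) := fun η h1 h2 => by
  obtain ⟨t, t', ht, ht'⟩ := exists_test h1 h2
  have key : S t' = t - (η 0 : ℂ) • e - (α : ℂ) • S t := by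
    refine Lp.ext ?_
    filter_upwards [hS t', hS t, ht, he, Lp.coeFn_sub (t - (η 0 : ℂ) • e) ((α : ℂ) • S t),
      Lp.coeFn_sub t ((η 0 : ℂ) • e), Lp.coeFn_smul (η 0 : ℂ) e, Lp.coeFn_smul (α : ℂ) (S t),
      ae_restrict_mem measurableSet_Ioi] with y g1 g2 g3 g4 g5 g6 g7 g8 hy
    rw [g1, g5, Pi.sub_apply, g6, Pi.sub_apply, g7, g8, Pi.smul_apply, Pi.smul_apply, g2, g3, g4,
      volterra_congr ht' hy, volterra_congr ht hy, volterra_deriv h1, smul_eq_mul, smul_eq_mul]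
  rw [integral_test_eq_inner ht, integral_test_eq_inner ht', ContinuousLinearMap.star_eq_adjoint,
    ContinuousLinearMap.adjoint_inner_right, key, inner_sub_left, inner_sub_left, inner_smul_left,
    inner_smul_left, inner_add_right, inner_smul_right, inner_smul_right,
    ContinuousLinearMap.adjoint_inner_right, Complex.conj_ofReal, Complex.conj_ofReal,
    Complex.real_smul]
  ring

end green

end OrrSommerfeld

/-! ### Existence of solutions -/

namespace OrrSommerfeld

section existence

variable {α ε M u UE : ℝ} {U V V1 V2 m : ℝ → ℝ} {e : L2} {S T : L2 →L[ℂ] L2} {f : ℝ → ℂ}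

/-- Point evaluation of Sh at y is the pairing with e^{-α(y - s)} on (0, y], whose squared norm is
at most 1/(2α) uniformly in y. This row bound drives the Hilbert–Schmidt estimate. -/
theorem exists_volterra_kernel (hα : 0 < α) {y : ℝ} (hy : 0 < y) :
    ∃ k : L2, ‖k‖ ^ 2 ≤ 1 / (2 * α) ∧ ∀ h : L2, volterra α h y = inner ℂ k h := by
  obtain ⟨κ, hκ⟩ : ∃ κ : ℝ → ℂ, κ = (Ioc 0 y).indicator
    fun s => ((Real.exp (-α * y) * Real.exp (α * s) : ℝ) : ℂ) := ⟨_, rfl⟩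
  have hsub : Ioc 0 y ⊆ Ioi 0 := fun s hs => hs.1
  have hc : Continuous fun s : ℝ => ((Real.exp (-α * y) * Real.exp (α * s) : ℝ) : ℂ) := by fun_prop
  have hsq : ∀ s : ℝ, (Real.exp (-α * y) * Real.exp (α * s)) ^ 2 =
      Real.exp (-(2 * α) * y) * Real.exp (2 * α * s) := fun s => by
    rw [mul_pow, ← Real.exp_nat_mul, ← Real.exp_nat_mul]
    congr 2 <;> push_cast <;> ring
  have mκ : MemLp κ 2 halfLine := by
    rw [hκ, memLp_indicator_iff_restrict measurableSet_Ioc,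
      Measure.restrict_restrict measurableSet_Ioc, inter_eq_left.2 hsub,
      memLp_two_iff_integrable_sq_norm hc.aestronglyMeasurable]
    exact (hc.norm.pow 2).integrableOn_Icc.mono_set Ioc_subset_Icc_self
  have hind : ∀ G : ℝ → ℂ, ∫ s in Ioi (0 : ℝ), (Ioc 0 y).indicator G s = ∫ s in (0 : ℝ)..y, G s :=
    fun G => by
    rw [setIntegral_indicator measurableSet_Ioc, inter_eq_right.2 hsub,
      intervalIntegral.integral_of_le hy.le]
  refine ⟨mκ.toLp κ, ?_, fun h => ?_⟩
  · rw [norm_eq_l2norm mκ.coeFn_toLp, l2norm_sq, sqInt]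
    have e1 : ∀ s, ‖κ s‖ ^ 2 = (Ioc 0 y).indicator
        (fun s => Real.exp (-(2 * α) * y) * Real.exp (2 * α * s)) s := fun s => by
      rw [hκ]
      by_cases hs : s ∈ Ioc 0 y
      · rw [indicator_of_mem hs, indicator_of_mem hs, Complex.norm_of_nonneg (by positivity), hsq]
      · rw [indicator_of_notMem hs, indicator_of_notMem hs, norm_zero, zero_pow two_ne_zero]
    simp only [e1]
    rw [setIntegral_indicator measurableSet_Ioc, inter_eq_right.2 hsub,
      ← intervalIntegral.integral_of_le hy.le, intervalIntegral.integral_const_mul]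
    exact integral_exp_le (by linarith) y
  · rw [L2.inner_def]
    have e1 : ∫ s in Ioi (0 : ℝ), inner ℂ ((mκ.toLp κ) s) (h s) =
        ∫ s in Ioi (0 : ℝ), (Ioc 0 y).indicator
          (fun s => Real.exp (-α * y) • Real.exp (α * s) • h s) s := by
      refine integral_congr_ae ?_
      filter_upwards [mκ.coeFn_toLp] with s hs
      rw [hs, hκ]
      by_cases hs : s ∈ Ioc 0 y
      · rw [indicator_of_mem hs, indicator_of_mem hs, RCLike.inner_apply, Complex.conj_ofReal,
          smul_smul, Complex.real_smul, mul_comm]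
      · rw [indicator_of_notMem hs, indicator_of_notMem hs, inner_zero_left]
    rw [e1, hind, intervalIntegral.integral_smul, volterra]

/-- For an orthonormal family, Bessel's inequality at each y gives Σ|m(y)(Svᵢ)(y)|² ≤ m(y)²/(2α),
which is integrable. Hence the operator is Hilbert–Schmidt, although S alone need not be. -/
theorem isCompactOperator_mul_volterra (hα : 0 < α) (hS : ∀ h, ⇑(S h) =ᵐ[halfLine] volterra α h)
    (hT : ∀ u, ⇑(T u) =ᵐ[halfLine] fun y => m y • u y) (mm : MemLp m 2 halfLine) :
    IsCompactOperator (T * S) := by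
  have hTS : ∀ h, ⇑((T * S) h) =ᵐ[halfLine] fun y => m y • volterra α h y := fun h => by
    rw [mul_apply_eq_comp]
    filter_upwards [hT (S h), hS h] with y h1 h2
    rw [h1, h2]
  have im : IntegrableOn (fun y => 1 / (2 * α) * m y ^ 2) (Ioi 0) :=
    ((memLp_two_iff_integrable_sq mm.1).1 mm).const_mul _
  refine isCompactOperator_of_sum_norm_sq_le _ (∫ y in Ioi (0 : ℝ), 1 / (2 * α) * m y ^ 2)
    fun A v hv s => ?_
  have e1 : ∀ i, ‖(T * S) (v i)‖ ^ 2 = ∫ y in Ioi (0 : ℝ), ‖m y • volterra α (v i) y‖ ^ 2 := fun i => by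
    rw [norm_eq_l2norm (hTS (v i)), l2norm_sq, sqInt]
  have i1 : ∀ i ∈ s, Integrable (fun y => ‖m y • volterra α (v i) y‖ ^ 2) halfLine := fun i _ =>
    integrable_norm_sq_of_memLp ((memLp_congr_ae (hTS (v i))).1 (Lp.memLp _))
  simp only [e1]
  rw [← integral_finsetSum s i1]
  refine setIntegral_mono_on (integrable_finsetSum s i1) im measurableSet_Ioi fun y hy => ?_
  obtain ⟨k, hk, hin⟩ := exists_volterra_kernel hα (mem_Ioi.1 hy)
  have h1 := hv.sum_inner_products_le (s := s) k
  have h2 : ∑ i ∈ s, ‖m y • volterra α (v i) y‖ ^ 2 = m y ^ 2 * ∑ i ∈ s, ‖inner ℂ (v i) k‖ ^ 2 := by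
    rw [Finset.mul_sum]
    refine Finset.sum_congr rfl fun i _ => ?_
    rw [hin, norm_smul, mul_pow, norm_inner_symm, Real.norm_eq_abs, sq_abs]
  rw [h2, mul_comm]
  exact mul_le_mul_of_nonneg_right (h1.trans hk) (sq_nonneg _)

/-- The derivative of M/(1 + y)² is -2M/(1 + y)³, larger in size than |V'|, so ±V - M/(1 + y)² is
monotone and can be compared with its limit. In particular V - U_E is square integrable, as
compactness requires. -/
theorem Flow.abs_sub_limit_le (F : Flow V V1 V2 u M) (hlim : Tendsto V atTop (𝓝 UE)) {y : ℝ}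
    (hy : 0 < y) : |V y - UE| ≤ M * (1 / (1 + y) ^ 2) := by
  have hM := F.M_pos
  have hd : ∀ y : ℝ, 0 ≤ y → HasDerivAt (fun y => M * (1 / (1 + y) ^ 2))
      (M * (-2 / (1 + y) ^ 3)) y := fun y hy => by
    have hp : (1 + y) ≠ 0 := by positivity
    have := ((((hasDerivAt_id y).const_add 1).pow 2).inv (pow_ne_zero 2 hp)).const_mul M
    refine (this.congr_deriv ?_).congr_of_eventuallyEq (Eventually.of_forall fun y => ?_)
    · simp only [id, Pi.pow_apply]
      field_simp
      simp [mul_comm]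
    · simp [one_div]
  have hb : ∀ y : ℝ, 0 ≤ y → |V1 y| ≤ M * (1 / (1 + y) ^ 3) := fun y hy => by
    rw [mul_one_div, le_div_iff₀ (by positivity)]
    exact F.b1 y hy
  have h0 : Tendsto (fun y : ℝ => M * (1 / (1 + y) ^ 2)) atTop (𝓝 0) := by
    have h1 : Tendsto (fun y : ℝ => (1 + y) ^ 2) atTop atTop :=
      (tendsto_pow_atTop two_ne_zero).comp (tendsto_atTop_add_const_left _ 1 tendsto_id)
    simpa [one_div] using h1.inv_tendsto_atTop.const_mul M
  have key : ∀ σ : ℝ, |σ| = 1 → σ * (V y - UE) ≤ M * (1 / (1 + y) ^ 2) := fun σ hσ => by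
    have hmono : MonotoneOn (fun y => σ * V y - M * (1 / (1 + y) ^ 2)) (Ici 0) := by
      refine monotoneOn_of_hasDerivWithinAt_nonneg (convex_Ici 0)
        (f' := fun y => σ * V1 y - M * (-2 / (1 + y) ^ 3))
        (fun y hy => (((F.d0 y).const_mul σ).sub (hd y hy)).continuousAt.continuousWithinAt)
        (fun y hy => ?_) fun y hy => ?_
      · rw [interior_Ici] at hy
        exact (((F.d0 y).const_mul σ).sub (hd y (mem_Ioi.1 hy).le)).hasDerivWithinAt
      · rw [interior_Ici] at hy
        have hy0 : 0 < y := hy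
        have h1 := neg_abs_le (σ * V1 y)
        rw [abs_mul, hσ, one_mul] at h1
        have h2 := hb y hy0.le
        have h3 : 0 ≤ M * (1 / (1 + y) ^ 3) := by positivity
        have h4 : M * (-2 / (1 + y) ^ 3) = -2 * (M * (1 / (1 + y) ^ 3)) := by ring
        rw [h4]
        linarith
    have hl : Tendsto (fun y => σ * V y - M * (1 / (1 + y) ^ 2)) atTop (𝓝 (σ * UE - 0)) :=
      (hlim.const_mul σ).sub h0
    have := ge_of_tendsto hl (b := σ * V y - M * (1 / (1 + y) ^ 2)) (by
      filter_upwards [eventually_ge_atTop y] with z hz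
      exact hmono hy.le (hy.le.trans hz) hz)
    linarith
  refine abs_le.2 ⟨?_, ?_⟩
  · have := key (-1) (by simp)
    linarith
  · have := key 1 (by simp)
    linarith

/-- The Green operator `(∂² - α²)⁻¹` with Dirichlet condition. -/
theorem green_hasTrace (hS : ∀ h, ⇑(S h) =ᵐ[halfLine] volterra α h)
    (he : ⇑e =ᵐ[halfLine] fun y => ((Real.exp (-α * y) : ℝ) : ℂ)) (h : L2) :
    ∃ g : L2, HasTrace ((-(S * star S)) h) g 0 ∧
      HasTrace g (h + ((α ^ 2 : ℝ) : ℂ) • (-(S * star S)) h) (-inner ℂ e h) := by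
  have h1 := (hasTrace_volterra hS (star S h)).smul (-1)
  have h2 := hasTrace_adjoint hS he h
  have e1 : (-(S * star S)) h = (-1 : ℂ) • S (star S h) := by
    rw [neg_smul, one_smul, neg_apply, mul_apply_eq_comp]
  rw [smul_zero] at h1
  rw [e1]
  refine ⟨_, h1, ?_⟩
  have h3 := (h2.smul (-1)).add (h1.smul (-α : ℂ))
  convert h3 using 1
  · module
  · push_cast
    module
  · simp

/-- Existence of solutions follows from uniqueness. -/
theorem Flow.exists_solution (F : Flow V V1 V2 u M) (hlim : Tendsto V atTop (𝓝 UE))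
    (eV : ∀ y, 0 ≤ y → V y = U y)
    (eV2 : ∀ y, 0 ≤ y → V2 y = iteratedDerivWithin 2 U (Ici (0 : ℝ)) y) (hα : 0 < α) (hε : 0 < ε)
    (huniq : ∀ φ φ' : L2, IsOSSolution U ε α (fun _ => 0) φ →
      IsOSSolution U ε α (fun _ => 0) φ' → φ = φ') (mf : MemLp f 2 halfLine) :
    ∃ φ, IsOSSolution U ε α f φ := by
  have hM := F.M_pos
  obtain ⟨S, hS⟩ := exists_volterraOp hα
  obtain ⟨e, he⟩ : ∃ e : L2, ⇑e =ᵐ[halfLine] fun y => ((Real.exp (-α * y) : ℝ) : ℂ) :=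
    ⟨(memLp_exp hα).ofReal.toLp _, MemLp.coeFn_toLp _⟩
  have cV : Continuous V := continuous_iff_continuousAt.2 fun y => (F.d0 y).continuousAt
  have bD : ∀ y, 0 < y → |V y - UE| ≤ M * (1 / (1 + y) ^ 2) := fun y hy =>
    F.abs_sub_limit_le hlim hy
  have b2 : ∀ y, 0 < y → |V2 y| ≤ M * (1 / (1 + y) ^ 2) := fun y hy => by
    rw [mul_one_div, le_div_iff₀ (by positivity)]
    refine le_trans (mul_le_mul_of_nonneg_left ?_ (abs_nonneg _)) (F.b2 y hy.le)
    exact pow_le_pow_right₀ (by linarith) (by norm_num)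
  have bw : ∀ y : ℝ, 0 < y → M * (1 / (1 + y) ^ 2) ≤ M := fun y hy => by
    refine mul_le_of_le_one_right hM.le ?_
    rw [div_le_one (by positivity)]
    exact one_le_pow₀ (by linarith)
  have memW : ∀ {m : ℝ → ℝ}, Continuous m → (∀ y, 0 < y → |m y| ≤ M * (1 / (1 + y) ^ 2)) →
      MemLp m 2 halfLine := fun {m} hm hb => by
    refine MemLp.of_le_mul (c := M) memLp_inv_one_add_sq hm.aestronglyMeasurable
      ((ae_restrict_iff' measurableSet_Ioi).2 (Eventually.of_forall fun y hy => ?_))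
    have hy0 : (0 : ℝ) < y := hy
    rw [Real.norm_eq_abs, Real.norm_of_nonneg (by positivity)]
    exact hb y hy
  obtain ⟨T0, hT0⟩ := exists_mulOp (m := fun y => V y - UE) (B := M) (by fun_prop)
    fun y hy => (bD y hy).trans (bw y hy)
  obtain ⟨T2, hT2⟩ := exists_mulOp (m := V2) (B := M) F.c2.continuousOn
    fun y hy => (b2 y hy).trans (bw y hy)
  have k0 := isCompactOperator_mul_volterra hα hS hT0 (memW (by fun_prop) bD)
  have k2 := isCompactOperator_mul_volterra hα hS hT2 (memW F.c2 b2)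
  -- The unknown is x = (∂² - α²)²φ. The function w = PGx differs from Gx by a multiple of e, which
  -- ∂² - α² annihilates, so (∂² - α²)w = x. The Neumann trace of Gw is -⟨e, w⟩, so orthogonality to
  -- e is exactly the second boundary condition for φ = Gw.
  obtain ⟨G, hG⟩ : ∃ G : L2 →L[ℂ] L2, G = -(S * star S) := ⟨_, rfl⟩
  obtain ⟨Q, hQ⟩ : ∃ Q : L2 →L[ℂ] L2, Q = (ℂ ∙ e).starProjection := ⟨_, rfl⟩
  obtain ⟨P, hP⟩ : ∃ P : L2 →L[ℂ] L2, P = 1 - Q := ⟨_, rfl⟩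
  have sG : IsSelfAdjoint G := by
    rw [hG, isSelfAdjoint_iff, star_neg, star_mul, star_star]
  have sQ : IsSelfAdjoint Q := hQ ▸ isSelfAdjoint_starProjection _
  have QQ : Q * Q = Q := by
    rw [hQ]
    exact (Submodule.isIdempotentElem_starProjection (K := ℂ ∙ e))
  have sP : IsSelfAdjoint P := by
    rw [hP]
    exact (IsSelfAdjoint.one _).sub sQ
  have PP : P * P = P := by
    rw [hP]
    noncomm_ring
    rw [QQ]
    abel
  have Qform : ∀ x, ∃ c : ℂ, Q x = c • e := fun x => by
    have : Q x ∈ ℂ ∙ e := by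
      rw [hQ]
      exact Submodule.starProjection_apply_mem _ _
    obtain ⟨c, hc⟩ := Submodule.mem_span_singleton.1 this
    exact ⟨c, hc.symm⟩
  have orth : ∀ x, inner ℂ e (P x) = 0 := fun x => by
    have h1 := Submodule.sub_starProjection_mem_orthogonal (K := ℂ ∙ e) x
    rw [Submodule.mem_orthogonal_singleton_iff_inner_right] at h1
    rwa [hP, hQ]
  have kQ : IsCompactOperator Q := by
    rw [hQ]
    have h1 : IsCompactOperator (Submodule.subtypeL (ℂ ∙ e)) :=
      isCompactOperator_of_locallyCompactSpace_rng _
    exact h1.comp_clm (ℂ ∙ e).orthogonalProjectionOnto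
  -- the solution generated by a source
  have gen : ∀ x : L2, MemSobolev 4 (G (P (G x))) ∧ MemH20 (G (P (G x))) ∧
      helmholtz α (G (P (G x))) = P (G x) ∧ helmholtz α (P (G x)) = x := fun x => by
    obtain ⟨g, hg1, hg2⟩ := green_hasTrace hS he x
    rw [← hG] at hg1 hg2
    obtain ⟨c, hc⟩ := Qform (G x)
    have ew : P (G x) = G x + (-c) • e := by
      rw [hP, sub_apply, one_apply_eq_self, hc]
      module
    have hE := hasTrace_exp he
    have w1 := (hg1.add (hE.smul (-c))).isWeakDeriv
    have w2 := (hg2.add ((hE.smul (-α : ℂ)).smul (-c))).isWeakDeriv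
    rw [← ew] at w1
    have e2 : x + ((α ^ 2 : ℝ) : ℂ) • G x + -c • (-α : ℂ) • (-α : ℂ) • e =
        x + ((α ^ 2 : ℝ) : ℂ) • P (G x) := by
      rw [ew]
      push_cast
      module
    rw [e2] at w2
    obtain ⟨p, hp1, hp2⟩ := green_hasTrace hS he (P (G x))
    rw [← hG] at hp1 hp2
    rw [orth, neg_zero] at hp2
    have v3 := w1.add (hp1.isWeakDeriv.const_smul ((α ^ 2 : ℝ) : ℂ))
    have v4 := w2.add (hp2.isWeakDeriv.const_smul ((α ^ 2 : ℝ) : ℂ))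
    refine ⟨⟨_, hp1.isWeakDeriv, _, hp2.isWeakDeriv, _, v3, _, v4, trivial⟩,
      ⟨⟨_, hp1.isWeakDeriv, _, hp2.isWeakDeriv, trivial⟩, hp1.hasZeroTrace, ?_⟩, ?_, ?_⟩
    · rw [hp1.isWeakDeriv.weakDeriv_eq]
      exact hp2.hasZeroTrace
    · rw [hp1.isWeakDeriv.helmholtz_eq hp2.isWeakDeriv, add_sub_cancel_right]
    · rw [w1.helmholtz_eq w2, add_sub_cancel_right]
  -- In terms of x the equation reads (A + K)x = f: A has the profile frozen at its limit U_E, and K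
  -- contains the decaying coefficients V - U_E and V''.
  obtain ⟨A, hA⟩ : ∃ A : L2 →L[ℂ] L2,
    A = ((ε : ℂ) * Complex.I) • (1 : L2 →L[ℂ] L2) + (UE : ℂ) • (P * G) := ⟨_, rfl⟩
  obtain ⟨K, hK⟩ : ∃ K : L2 →L[ℂ] L2, K = T0 * (P * G) - T2 * (G * (P * G)) := ⟨_, rfl⟩
  have hAu : IsUnit A := hA ▸ isUnit_smul_one_add P G sP PP sG hε
  have hKc : IsCompactOperator K := by
    -- Expanding G = -SS* and P = 1 - Q exhibits each summand as a bounded operator composed with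
    -- one of the compact operators T0·S, T2·S or the rank-at-most-one projection Q.
    have e1 : K = -((T0 * S) * star S) - T0 * (Q * G) + (T2 * S) * (star S * (P * G)) := by
      rw [hK, hP, hG]
      noncomm_ring
    rw [e1]
    exact ((k0.comp_clm (star S)).neg.sub ((kQ.comp_clm G).clm_comp T0)).add
      (k2.comp_clm (star S * (P * G)))
  have act : ∀ x, ⇑((A + K) x) =ᵐ[halfLine] fun y =>
      (U y : ℂ) * P (G x) y - ((iteratedDerivWithin 2 U (Ici (0 : ℝ)) y : ℝ) : ℂ) * G (P (G x)) y
        + Complex.I * (ε : ℂ) * x y := fun x => by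
    have e1 : (A + K) x = (((ε : ℂ) * Complex.I) • x + (UE : ℂ) • P (G x)) +
        (T0 (P (G x)) - T2 (G (P (G x)))) := by
      rw [hA, hK]
      rfl
    rw [e1]
    filter_upwards [Lp.coeFn_add (((ε : ℂ) * Complex.I) • x + (UE : ℂ) • P (G x))
        (T0 (P (G x)) - T2 (G (P (G x)))),
      Lp.coeFn_add (((ε : ℂ) * Complex.I) • x) ((UE : ℂ) • P (G x)),
      Lp.coeFn_sub (T0 (P (G x))) (T2 (G (P (G x)))), Lp.coeFn_smul ((ε : ℂ) * Complex.I) x,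
      Lp.coeFn_smul (UE : ℂ) (P (G x)), hT0 (P (G x)), hT2 (G (P (G x))),
      ae_restrict_mem measurableSet_Ioi] with y g1 g2 g3 g4 g5 g6 g7 hy
    rw [g1, Pi.add_apply, g2, g3, Pi.add_apply, Pi.sub_apply, g4, g5, g6, g7,
      ← eV y (mem_Ioi.1 hy).le, ← eV2 y (mem_Ioi.1 hy).le]
    simp only [Pi.smul_apply, smul_eq_mul, Complex.real_smul]
    push_cast
    ring
  have sol : ∀ {x : L2} {g : ℝ → ℂ}, (⇑((A + K) x) =ᵐ[halfLine] g) →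
      IsOSSolution U ε α g (G (P (G x))) := fun {x g} hg => by
    obtain ⟨s1, s2, s3, s4⟩ := gen x
    refine ⟨s1, s2, ?_⟩
    rw [s3, s4]
    filter_upwards [act x, hg] with y h1 h2
    rw [← h1, h2]
  have zero_sol : ∀ {x : L2}, (A + K) x = 0 → IsOSSolution U ε α (fun _ => 0) (G (P (G x))) :=
    fun {x} hx => sol (by
      rw [hx]
      exact Lp.coeFn_zero ℂ 2 halfLine)
  -- Uniqueness gives φ = 0, and x is recovered from φ by applying ∂² - α² twice.
  have inj : ∀ x, (A + K) x = 0 → x = 0 := fun x hx => by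
    have h1 := huniq _ _ (zero_sol hx) (zero_sol (x := 0) (map_zero _))
    obtain ⟨-, -, s3, s4⟩ := gen x
    obtain ⟨-, -, r3, r4⟩ := gen 0
    rw [← s4, ← s3, h1, r3, r4]
  obtain ⟨x, hx⟩ := surjective_of_compact_perturbation A K hAu hKc inj (mf.toLp f)
  exact ⟨_, sol (hx ▸ mf.coeFn_toLp)⟩

end existence

end OrrSommerfeld

theorem theorem6p1 (U : ℝ → ℝ) (hU : IsShearProfile U) :
    ∃ δ₀ : ℝ, 0 < δ₀ ∧ ∃ ε₀ : ℝ, 0 < ε₀ ∧ ∃ C : ℝ, 0 < C ∧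
      ∀ ε α : ℝ, 0 < ε → ε ≤ ε₀ → 0 < α → ε ^ (1 / 3 : ℝ) * α ≤ δ₀ →
      ∀ f : ℝ → ℂ, MemLp f 2 halfLine →
        MemLp (fun Y : ℝ => ((1 + Y : ℝ) : ℂ) ^ 2 * f Y) 2 halfLine →
        (∃! φ : L2, IsOSSolution U ε α f φ) ∧
        ∀ φ : L2, IsOSSolution U ε α f φ →
          (1 ≤ α →
            ‖weakDeriv φ‖ + α * ‖φ‖
              ≤ C * l2norm (fun Y : ℝ => ((1 + Y : ℝ) : ℂ) * f Y) ∧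
            ‖helmholtz α φ‖
              ≤ C / ε ^ (1 / 3 : ℝ) * l2norm (fun Y : ℝ => ((1 + Y : ℝ) : ℂ) * f Y)) ∧
          (α ≤ 1 →
            ‖weakDeriv φ‖ + α * ‖φ‖
              ≤ C * ((α + ε ^ (1 / 6 : ℝ)) / (α + ε ^ (1 / 3 : ℝ))) *
                (l2norm (fun Y : ℝ => ((1 + Y : ℝ) : ℂ) ^ 2 * f Y)
                  + 1 / α * ‖∫ Y in Ioi (0 : ℝ), f Y‖) ∧
            eLpNorm (weakDeriv φ) ∞ halfLine
              ≤ ENNReal.ofReal (C / ε ^ (1 / 6 : ℝ) *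
                (l2norm (fun Y : ℝ => ((1 + Y : ℝ) : ℂ) ^ 2 * f Y)
                  + 1 / α * ‖∫ Y in Ioi (0 : ℝ), f Y‖)) ∧
            ‖helmholtz α φ‖
              ≤ C / ε ^ (1 / 3 : ℝ) *
                (l2norm (fun Y : ℝ => ((1 + Y : ℝ) : ℂ) ^ 2 * f Y)
                  + 1 / α * ‖∫ Y in Ioi (0 : ℝ), f Y‖)) := by
  obtain ⟨δ₀, hδ, ε₀, hε₀, C, hC, h⟩ := hU.a_priori
  obtain ⟨V, V1, V2, u, M, UE, F, hlim, eV, eV2⟩ := hU.exists_flow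
  refine ⟨δ₀, hδ, ε₀, hε₀, C, hC, fun ε α hε hε1 hα hεα f mf mh => ?_⟩
  obtain ⟨hu, he⟩ := h ε α hε hε1 hα hεα f mf
  obtain ⟨φ, hφ⟩ := F.exists_solution hlim eV eV2 hα hε
    (h ε α hε hε1 hα hεα (fun _ => 0) MemLp.zero').1 mf
  exact ⟨⟨φ, hφ, fun φ' hφ' => hu _ _ hφ' hφ⟩, he mh⟩
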